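/- Let $\mathbb{Q}_2^{\mathrm{unr}}$ be the maximal unramified extension of $\mathbb{Q}_2$ in a fixed algebraic closure $\overline{\mathbb{Q}}_2$, and let $I_2\subset \mathrm{Gal}(\overline{\mathbb{Q}}_2/\mathbb{Q}_2)$ be the inertia subgroup. For an elliptic curve $E/\mathbb{Q}_2$ with potentially good reduction, the inertial field of $E$ is $L=\mathbb{Q}_2^{\mathrm{unr}}(E[q])$ for a prime $q\ge 3$; it does not depend on $q$. For elliptic curves $E,E'$ over $\mathbb{Q}_2$ and a prime $p\geq 3$, an isomorphism $\phi\colon E[p]\to E'[p]$ of $I_2$-modules is called symplectic if there is a square $r\in(\mathbb{F}_p^\times)^2$ with $e_{E',p}(\phi(P),\phi(Q))=e_{E,p}(P,Q)^{r}$ for all $P,Q\in E[p]$, where $e_{E,p}$, $e_{E',p}$ are the Weil pairings; $E[p]$ and $E'[p]$ are symplectically isomorphic $I_2$-modules if such a $\phi$ exists. Theorem. Let $p\ge 3$ be a prime. Let $E$ and $E'$ be elliptic curves over $\mathbb{Q}_2$ with potentially good reduction. Suppose that they have the same inertial field $L$ (computed with any prime $q\ge 3$, not necessarily equal to $p$)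 and that $I=\mathrm{Gal}(L/\mathbb{Q}_2^{\mathrm{unr}})$ is isomorphic to the quaternion group $H_8$ of order $8$. Then $E[p]$ and $E'[p]$ are isomorphic as $I_2$-modules. Moreover: 1. if $\left(\frac{2}{p}\right)=1$, then $E[p]$ and $E'[p]$ are symplectically isomorphic $I_2$-modules; 2. if $\left(\frac{2}{p}\right)=-1$, then $E[p]$ and $E'[p]$ are symplectically isomorphic $I_2$-modules if and only if $E[3]$ and $E'[3]$ are symplectically isomorphic $I_2$-modules. -/

import Mathlib

open Polynomial

noncomputable section

/-! ### Local fields: the ring of integers, inertia, the maximal unramified extension -/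

namespace LocalInertia

variable (ℓ : ℕ) [Fact ℓ.Prime]

/-- An element of the algebraic closure of `ℚ_ℓ` is integral over `ℤ_ℓ` iff its norm is at most
one. -/
theorem isIntegral_iff_norm_le_one (x : PadicAlgCl ℓ) : IsIntegral ℤ_[ℓ] x ↔ ‖x‖ ≤ 1 := by
  have hx : IsIntegral ℚ_[ℓ] x := Algebra.IsIntegral.isIntegral x
  have key : ‖x‖ ≤ 1 ↔ ∀ n : ℕ, ‖(minpoly ℚ_[ℓ] x).coeff n‖ ≤ 1 := by
    rw [← PadicAlgCl.spectralNorm_eq, spectralNorm, spectralValue_le_one_iff (minpoly.monic hx)]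
  rw [key]
  constructor
  · intro h n
    rw [minpoly.isIntegrallyClosed_eq_field_fractions' ℚ_[ℓ] h, coeff_map]
    exact ((minpoly ℤ_[ℓ] x).coeff n).2
  · intro h
    have hl : minpoly ℚ_[ℓ] x ∈ Polynomial.lifts (algebraMap ℤ_[ℓ] ℚ_[ℓ]) := by
      rw [Polynomial.lifts_iff_coeff_lifts]
      exact fun n => ⟨⟨_, h n⟩, rfl⟩
    obtain ⟨q, hq, -, hm⟩ := Polynomial.lifts_and_degree_eq_and_monic hl (minpoly.monic hx)
    refine ⟨q, hm, ?_⟩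
    have := minpoly.aeval ℚ_[ℓ] x
    rw [← hq, aeval_map_algebraMap] at this
    exact this

variable {ℓ} in
/-- The ring of integers of an extension `F` of `ℚ_ℓ` inside the algebraic closure. -/
abbrev integers (F : IntermediateField ℚ_[ℓ] (PadicAlgCl ℓ)) : Subalgebra ℤ_[ℓ] F :=
  integralClosure ℤ_[ℓ] F

variable {ℓ} in
instance (F : IntermediateField ℚ_[ℓ] (PadicAlgCl ℓ)) [FiniteDimensional ℚ_[ℓ] F] :
    IsFractionRing (integers F) F :=
  integralClosure.isFractionRing_of_finite_extension ℚ_[ℓ] F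

variable {ℓ} in
theorem mem_integers_iff (F : IntermediateField ℚ_[ℓ] (PadicAlgCl ℓ)) (x : F) :
    x ∈ integers F ↔ ‖(x : PadicAlgCl ℓ)‖ ≤ 1 := by
  rw [← isIntegral_iff_norm_le_one, mem_integralClosure_iff]
  exact (isIntegral_algHom_iff (F.val.restrictScalars ℤ_[ℓ]) F.val.injective).symm

variable {ℓ} in
theorem isUnit_integers_iff (F : IntermediateField ℚ_[ℓ] (PadicAlgCl ℓ)) (x : integers F) :
    IsUnit x ↔ ‖((x : F) : PadicAlgCl ℓ)‖ = 1 := by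
  constructor
  · intro h
    obtain ⟨y, hy⟩ := h.exists_right_inv
    have h1 := (mem_integers_iff F _).1 x.2
    have h2 := (mem_integers_iff F _).1 y.2
    have h3 : ‖((x : F) : PadicAlgCl ℓ)‖ * ‖((y : F) : PadicAlgCl ℓ)‖ = 1 := by
      rw [← norm_mul]
      have : ((x : F) : PadicAlgCl ℓ) * ((y : F) : PadicAlgCl ℓ) = 1 := by exact_mod_cast hy
      rw [this, norm_one]
    nlinarith [norm_nonneg ((x : F) : PadicAlgCl ℓ), norm_nonneg ((y : F) : PadicAlgCl ℓ)]
  · intro h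
    have hx0 : (x : F) ≠ 0 := by
      intro h0
      rw [h0] at h
      simp at h
    have hinv : (x : F)⁻¹ ∈ integers F := by
      rw [mem_integers_iff]
      simp [h]
    exact IsUnit.of_mul_eq_one ⟨_, hinv⟩ (Subtype.ext (mul_inv_cancel₀ hx0))

variable {ℓ} in
/-- The ring of integers of a finite extension of `ℚ_ℓ` is a discrete valuation ring. -/
instance (F : IntermediateField ℚ_[ℓ] (PadicAlgCl ℓ)) [FiniteDimensional ℚ_[ℓ] F] :
    IsDiscreteValuationRing (integers F) := by
  have hd : IsDedekindDomain (integers F) := integralClosure.isDedekindDomain ℤ_[ℓ] ℚ_[ℓ] F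
  have : IsLocalRing (integers F) := by
    refine IsLocalRing.of_nonunits_add fun a b ha hb => ?_
    rw [mem_nonunits_iff, isUnit_integers_iff] at *
    have ha' := lt_of_le_of_ne ((mem_integers_iff F _).1 a.2) ha
    have hb' := lt_of_le_of_ne ((mem_integers_iff F _).1 b.2) hb
    exact ((PadicAlgCl.isNonarchimedean ℓ _ _).trans_lt (max_lt ha' hb')).ne
  have hnf : ¬ IsField (integers F) := by
    intro h
    have hp : ((ℓ : integers F)) ≠ 0 := by
      exact_mod_cast (Fact.out : ℓ.Prime).ne_zero
    obtain ⟨y, hy⟩ := h.mul_inv_cancel hp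
    have hu := (isUnit_integers_iff F (ℓ : integers F)).1 (IsUnit.of_mul_eq_one y hy)
    have hn : ‖((ℓ : ℚ_[ℓ]) : PadicAlgCl ℓ)‖ = 1 := by simpa using hu
    rw [PadicAlgCl.norm_extends] at hn
    exact (Padic.norm_p_lt_one (p := ℓ)).ne hn
  exact ((IsDiscreteValuationRing.TFAE (integers F) hnf).out 0 2).2 hd

/-- The inertia subgroup `I_ℓ` of the absolute Galois group of `ℚ_ℓ`: the automorphisms of the
algebraic closure that act trivially on the residue field of its valuation ring. -/
def inertia : Subgroup Gal(PadicAlgCl ℓ/ℚ_[ℓ]) :=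
  ((PadicAlgCl.valued ℓ).v.valuationSubring.inertiaSubgroup ℚ_[ℓ]).map (Subgroup.subtype _)

/-- The maximal unramified extension `ℚ_ℓ^unr` of `ℚ_ℓ`: the fixed field of inertia. -/
def unramified : IntermediateField ℚ_[ℓ] (PadicAlgCl ℓ) :=
  IntermediateField.fixedField (inertia ℓ)

end LocalInertia

/-! ### The Weil pairing -/

namespace WeilPairing

open scoped Classical

variable {F : Type*} [Field F] (W : WeierstrassCurve.Affine F)

/-- The ideal of the affine coordinate ring of the functions that vanish at a point; the unit ideal
for the point at infinity. -/
def pointIdeal : W.Point → Ideal W.CoordinateRing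
  | .zero => ⊤
  | .some x y _ => WeierstrassCurve.Affine.CoordinateRing.XYIdeal W x (C y)

/-- The value at a point of a function that is regular on the affine curve; the placeholder `0` at
infinity, a value that is never used below. -/
def evalAt (f : W.CoordinateRing) : W.Point → F
  | .zero => 0
  | .some _ _ h => AdjoinRoot.evalEval h.1 f

/-- The function `f` has divisor `n (P) - n (O)`: it is regular on the affine curve, with divisor
`n (P)` there (for `P = O`, it is a nonzero constant). -/
def HasTorsionDivisor (n : ℕ) (P : W.Point) (f : W.CoordinateRing) : Prop :=
  Ideal.span {f} = pointIdeal W P ^ n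

/-- `z` is the value of the Weil pairing `e_n (P, Q)`, for `n`-torsion points `P` and `Q`:
if `div f = n (P) - n (O)` and `div g = n (Q) - n (O)`, and `S` is any point outside
`{O, P, -Q, P - Q}`, then
`e_n (P, Q) = (f (Q + S) / f (S)) / (g (P - S) / g (-S))`. -/
def IsValue (n : ℕ) (P Q : W.Point) (z : F) : Prop :=
  ∃ (f g : W.CoordinateRing) (S : W.Point),
    HasTorsionDivisor W n P f ∧ HasTorsionDivisor W n Q g ∧
    S ≠ 0 ∧ S ≠ P ∧ S ≠ -Q ∧ S ≠ P - Q ∧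
    z = (evalAt W f (Q + S) / evalAt W f S) / (evalAt W g (P - S) / evalAt W g (-S))

/-- The Weil pairing `e_n (P, Q)` of two `n`-torsion points (over an algebraically closed field of
characteristic prime to `n`; the value does not depend on the choices of `f`, `g` and `S`). -/
def weilPairing (n : ℕ) (P Q : W.Point) : F :=
  if h : ∃ z, IsValue W n P Q z then h.choose else 1

end WeilPairing

/-! ### Elliptic curves over `ℚ_ℓ` -/

namespace EllipticLocal

open scoped Classical
open LocalInertia

variable {ℓ : ℕ} [Fact ℓ.Prime]

/-- An elliptic curve over `ℚ_ℓ` has potentially good reduction if over some finite extension `F`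
of `ℚ_ℓ` it is isomorphic to a minimal Weierstrass curve with good reduction. -/
def PotentiallyGoodReduction (E : WeierstrassCurve ℚ_[ℓ]) : Prop :=
  ∃ (F : IntermediateField ℚ_[ℓ] (PadicAlgCl ℓ)) (_ : FiniteDimensional ℚ_[ℓ] F)
    (C : WeierstrassCurve.VariableChange F),
    WeierstrassCurve.HasGoodReduction (integers F) (C • E.baseChange F)

/-- The curve over the algebraic closure. -/
abbrev geom (E : WeierstrassCurve ℚ_[ℓ]) : WeierstrassCurve.Affine (PadicAlgCl ℓ) :=
  E.baseChange (PadicAlgCl ℓ)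

/-- The group `E[n]` of `n`-torsion points over the algebraic closure. -/
abbrev Torsion (E : WeierstrassCurve ℚ_[ℓ]) (n : ℕ) : AddSubgroup (geom E).Point :=
  AddSubgroup.torsionBy (geom E).Point (n : ℤ)

/-- The action of a Galois automorphism on the geometric points, through the coordinates. -/
def galPoint (E : WeierstrassCurve ℚ_[ℓ]) (σ : Gal(PadicAlgCl ℓ/ℚ_[ℓ])) :
    (geom E).Point →+ (geom E).Point :=
  WeierstrassCurve.Affine.Point.map (W' := E)
    (σ : PadicAlgCl ℓ →ₐ[ℚ_[ℓ]] PadicAlgCl ℓ)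

/-- The action of a Galois automorphism on `E[n]`. -/
def galTorsion (E : WeierstrassCurve ℚ_[ℓ]) (n : ℕ) (σ : Gal(PadicAlgCl ℓ/ℚ_[ℓ])) :
    Torsion E n →+ Torsion E n :=
  ((galPoint E σ).comp (Torsion E n).subtype).codRestrict (Torsion E n) fun P => by
    rw [AddSubgroup.torsionBy.nsmul_iff]
    change n • galPoint E σ (P : (geom E).Point) = 0
    rw [← map_nsmul, AddSubgroup.torsionBy.nsmul_iff.1 P.2, map_zero]

/-- The field `ℚ_ℓ^unr(E[q])`. When `E` has potentially good reduction it is the same for all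
primes `q ≥ 3` with `q ≠ ℓ`, and it is called the inertial field of `E`. -/
def inertialField (E : WeierstrassCurve ℚ_[ℓ]) (q : ℕ) :
    IntermediateField (unramified ℓ) (PadicAlgCl ℓ) :=
  IntermediateField.adjoin (unramified ℓ)
    {z | ∃ (x y : PadicAlgCl ℓ) (h : (geom E).Nonsingular x y),
      .some x y h ∈ Torsion E q ∧ (z = x ∨ z = y)}

/-- An isomorphism `E[n] ≃ E'[n]` of `I_ℓ`-modules: an additive bijection that commutes with the
action of inertia. -/
def IsInertiaEquivariant {E E' : WeierstrassCurve ℚ_[ℓ]} {n : ℕ}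
    (φ : Torsion E n ≃+ Torsion E' n) : Prop :=
  ∀ σ ∈ inertia ℓ, ∀ P : Torsion E n, φ (galTorsion E n σ P) = galTorsion E' n σ (φ P)

/-- `φ` multiplies the Weil pairing by a square: for some square `r` in `F_p^×`,
`e(φ P, φ Q) = e(P, Q) ^ r` for all `P` and `Q` in `E[p]`. -/
def IsSymplectic {E E' : WeierstrassCurve ℚ_[ℓ]} {p : ℕ}
    (φ : Torsion E p ≃+ Torsion E' p) : Prop :=
  ∃ r : (ZMod p)ˣ, IsSquare r ∧ ∀ P Q : Torsion E p,
    WeilPairing.weilPairing (geom E') p (φ P) (φ Q) =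
      WeilPairing.weilPairing (geom E) p P Q ^ (r : ZMod p).val

/-- `E[p]` and `E'[p]` are isomorphic `I_ℓ`-modules. -/
def InertiaIsomorphic (E E' : WeierstrassCurve ℚ_[ℓ]) (p : ℕ) : Prop :=
  ∃ φ : Torsion E p ≃+ Torsion E' p, IsInertiaEquivariant φ

/-- `E[p]` and `E'[p]` are symplectically isomorphic `I_ℓ`-modules. -/
def InertiaSymplecticallyIsomorphic (E E' : WeierstrassCurve ℚ_[ℓ]) (p : ℕ) : Prop :=
  ∃ φ : Torsion E p ≃+ Torsion E' p, IsInertiaEquivariant φ ∧ IsSymplectic φ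

end EllipticLocal

end

/-!
# Symplectic isomorphisms of torsion modules with quaternion inertia

*Reduction.* Let `k` be the residue field of `ℚ̄₂`, an algebraically closed field of characteristic
two. A curve `E` with potentially good reduction becomes, after a change of variables over `ℚ̄₂`, a
curve with a smooth reduction over `k`, and for odd `p` reduction identifies `E[p]` with the
`p`-torsion of the reduced curve (`exists_torsion_equiv`). Since inertia acts trivially on `k`, the
action of `σ` on the points of `E` is the composition of a map that reduces to the identity and a
change of variables, so that it reduces to an automorphism of the reduced curve that does not depend
on `p`; moreover reduction respects Weil pairings (`exists_hasModel`, `red_weilPairing`). An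
automorphism is determined by its action on the torsion of one odd prime level
(`eq_one_of_autHom_eq`), so the kernel of the action is that of the map from inertia to
`Gal(L/ℚ₂^unr)`, for any `q`. If this group is the quaternion group, then the reduced curve has more
than two automorphisms, and therefore it is the curve `y² + y = x³`
(`aut_eq_or_eq_of_a₁_ne_zero`, `exists_smul_eq_supersingular`). As a result, both `E[p]` and `E'[p]`
are the `p`-torsion of this curve, with inertia acting through embeddings `j` and `j'` of the same
quotient of inertia in its automorphism group (`exists_embedding`).

*Comparison.* Two embeddings of the quaternion group in the automorphism group of `y² + y = x³`
differ by a conjugation, up to composition with Frobenius (`semiconjBy_or_frob`). An automorphism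
preserves the Weil pairing, and Frobenius squares it (`SemilinearChange.weilPairing_hom`). Hence
there is an isomorphism `E[p] ≃ E'[p]` of inertia modules that preserves the pairing, for all odd `p`
at once, or one that squares it, for all odd `p` at once (`exists_equivariant_scalesPairing`). In
the first case `E[p]` and `E'[p]` are symplectically isomorphic for all `p`. In the second case,
Schur's lemma (`exists_eq_smul_of_commute`) shows that any other equivariant isomorphism differs by
a scalar `c`, and so it raises the pairing to the power `2 c²`; since the pairing is nondegenerate
(`exists_weilPairing_ne_one`), the modules are symplectically isomorphic precisely when `2` is a
square modulo `p`. As `2` is not a square modulo `3`, the level `3` tells the two cases apart.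

*The Weil pairing.* The theory of the pairing is developed here from its definition by functions
with divisor `n (P) - n (O)`. The coordinate ring of an elliptic curve is shown to be a Dedekind
domain, with the maximal ideals corresponding to the points. A map `X ↦ m X + Q` of the curve acts on
the function field, through the image of the generic point in the group law over the function field
(`mulAdd`), and it is unramified for `m ≠ 0` in characteristic zero (`unram_mul`). For a `p`-torsion
point `P` there is a function `g` such that `g ^ p` is the pull-back under multiplication by `p` of a
function with divisor `p (P) - p (O)`, up to a constant, and the translate of `g` by `Q` is
`e (P, Q) g` (`IsRootFun.translate_eq`). This gives bilinearity. For nondegeneracy, a function that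
is invariant under all translations by `p`-torsion points is a pull-back under multiplication by `p`
(`exists_eq_mulAdd_of_invariant`). The number of torsion points comes from coprime polynomials
`Φ`, `Ψ` with `x (n T) = Φ (x T) / Ψ (x T)` (`exists_isMulPair`).
-/

/-! ### Multiplication by `n` on `x`-coordinates and the number of torsion points -/

noncomputable section
namespace TorsionCount
open scoped Classical
open WeierstrassCurve WeierstrassCurve.Affine

section Forms
variable {R : Type*} [CommRing R] (W : WeierstrassCurve R)

/-- The first of three forms in the coordinates of `x (P) = X₁ / Z₁` and `x (Q) = X₂ / Z₂`. Together
they are, up to a common factor, the coefficients of the quadratic form with the roots `x (P + Q)`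
and `x (P - Q)`: `formA : formB : formC` is `x (P + Q) x (P - Q) : x (P + Q) + x (P - Q) : 1`. -/
def formA (X₁ Z₁ X₂ Z₂ : R) : R :=
  (X₁ * X₂) ^ 2 - W.b₄ * (X₁ * X₂) * (Z₁ * Z₂) - W.b₆ * (X₁ * Z₂ + Z₁ * X₂) * (Z₁ * Z₂)
    - W.b₈ * (Z₁ * Z₂) ^ 2

/-- The form of the sum `x (P + Q) + x (P - Q)`; see `formA`. -/
def formB (X₁ Z₁ X₂ Z₂ : R) : R :=
  2 * (X₁ * Z₂ + Z₁ * X₂) * (X₁ * X₂) + W.b₂ * (X₁ * X₂) * (Z₁ * Z₂)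
    + W.b₄ * (X₁ * Z₂ + Z₁ * X₂) * (Z₁ * Z₂) + W.b₆ * (Z₁ * Z₂) ^ 2

/-- The common denominator of `x (P + Q)` and `x (P - Q)`; see `formA`. -/
def formC (X₁ Z₁ X₂ Z₂ : R) : R := (X₁ * Z₂ - Z₁ * X₂) ^ 2

end Forms

variable {F : Type*} [Field F] (W : Affine F)

/-- On an elliptic curve, the three forms have no common zero, because they are essentially the
forms for which `addSubMap_ne_zero` is known. -/
lemma forms_ne_zero [W.IsElliptic] {X₁ Z₁ X₂ Z₂ : F} (h₁ : X₁ ≠ 0 ∨ Z₁ ≠ 0) (h₂ : X₂ ≠ 0 ∨ Z₂ ≠ 0)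
    (hA : formA W X₁ Z₁ X₂ Z₂ = 0) (hB : formB W X₁ Z₁ X₂ Z₂ = 0)
    (hC : formC X₁ Z₁ X₂ Z₂ = 0) : False := by
  have hx : ![X₁ * X₂, X₁ * Z₂ + Z₁ * X₂, Z₁ * Z₂] ≠ 0 := by
    intro h
    have e0 := congrFun h 0
    have e1 := congrFun h 1
    have e2 := congrFun h 2
    simp at e0 e1 e2
    grind
  apply addSubMap_ne_zero W hx
  ext i
  fin_cases i
  · simp [addSubMap]; simp [formA] at hA; linear_combination hA
  · simp [addSubMap]; simp [formB] at hB; linear_combination hB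
  · simp only [formC] at hC; simp [addSubMap]; linear_combination hC

lemma forms_of_X_ne {x₁ y₁ x₂ y₂ : F} (h₁ : W.Equation x₁ y₁) (h₂ : W.Equation x₂ y₂)
    (hx : x₁ ≠ x₂) :
    let p := W.addX x₁ x₂ (W.slope x₁ x₂ y₁ y₂)
    let m := W.addX x₁ x₂ (W.slope x₁ x₂ y₁ (W.negY x₂ y₂))
    formA W x₁ 1 x₂ 1 = (x₁ - x₂) ^ 2 * (p * m) ∧
    formB W x₁ 1 x₂ 1 = (x₁ - x₂) ^ 2 * (p + m) := by
  intro p m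
  have hd : x₁ - x₂ ≠ 0 := sub_ne_zero.2 hx
  simp only [p, m]
  rw [slope_of_X_ne hx, slope_of_X_ne hx]
  simp only [addX, negY, formA, formB, b₂, b₄, b₆, b₈]
  rw [equation_iff] at h₁ h₂
  constructor
  · field_simp
    grind
  · field_simp
    grind

lemma forms_double {x y : F} (h : W.Equation x y) (hy : y ≠ W.negY x y) :
    formA W x 1 x 1 = (y - W.negY x y) ^ 2 * W.addX x x (W.slope x x y y) ∧
    formB W x 1 x 1 = (y - W.negY x y) ^ 2 := by
  have hd : y - W.negY x y ≠ 0 := sub_ne_zero.2 hy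
  rw [slope_of_Y_ne rfl hy]
  rw [equation_iff] at h
  constructor
  · simp only [addX]
    field_simp
    simp only [negY, formA, b₄, b₆, b₈]
    grind
  · simp only [negY, formB, b₂, b₄, b₆]
    grind

lemma forms_two_torsion {x y : F} (h : W.Equation x y) (hy : y = W.negY x y) :
    formB W x 1 x 1 = 0 := by
  rw [equation_iff] at h
  simp only [negY, formB, b₂, b₄, b₆] at *
  grind

/-- The three forms are proportional to the symmetric functions of `x (P + Q)` and `x (P - Q)`, in
homogeneous coordinates; a point at infinity is allowed everywhere. -/
lemma add_sub_forms [W.IsElliptic] (P Q : W.Point) :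
    ∃ c : F, c ≠ 0 ∧
      formA W (P.xRep 0) (P.xRep 1) (Q.xRep 0) (Q.xRep 1) =
        c * ((P + Q).xRep 0 * (P - Q).xRep 0) ∧
      formB W (P.xRep 0) (P.xRep 1) (Q.xRep 0) (Q.xRep 1) =
        c * ((P + Q).xRep 0 * (P - Q).xRep 1 + (P + Q).xRep 1 * (P - Q).xRep 0) ∧
      formC (P.xRep 0) (P.xRep 1) (Q.xRep 0) (Q.xRep 1) =
        c * ((P + Q).xRep 1 * (P - Q).xRep 1) := by
  have key : ∀ {x y : F} (h : W.Nonsingular x y), ∃ c : F, c ≠ 0 ∧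
      formA W x 1 x 1 = c * (Point.some x y h + Point.some x y h).xRep 0 ∧
      formB W x 1 x 1 = c * (Point.some x y h + Point.some x y h).xRep 1 := by
    intro x y h
    by_cases hy : y = W.negY x y
    · rw [Point.add_self_of_Y_eq hy]
      refine ⟨formA W x 1 x 1, ?_, by simp, by simp [forms_two_torsion W h.1 hy]⟩
      intro h0
      exact forms_ne_zero W (Or.inr one_ne_zero) (Or.inr one_ne_zero) h0
        (forms_two_torsion W h.1 hy) (by simp [formC])
    · rw [Point.add_self_of_Y_ne hy]
      obtain ⟨h1, h2⟩ := forms_double W h.1 hy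
      exact ⟨_, pow_ne_zero 2 (sub_ne_zero.2 hy), by simpa using h1, by simpa using h2⟩
  rcases P with _ | ⟨x₁, y₁, h₁⟩ <;> rcases Q with _ | ⟨x₂, y₂, h₂⟩
  · exact ⟨1, one_ne_zero, by simp [← Point.zero_def, formA, formB, formC]⟩
  · refine ⟨1, one_ne_zero, ?_⟩
    simp [← Point.zero_def, formA, formB, formC, -Point.neg_some]
    refine ⟨by ring, by ring⟩
  · refine ⟨1, one_ne_zero, ?_⟩
    simp [← Point.zero_def, formA, formB, formC]
    refine ⟨by ring, by ring⟩
  · by_cases hx : x₁ = x₂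
    · subst hx
      obtain ⟨c, hc, hA, hB⟩ := key h₁
      refine ⟨c, hc, ?_⟩
      rcases (Point.X_eq_iff (h₁ := h₂) (h₂ := h₁)).1 rfl with he | he
      · rw [he, sub_self]
        simp [formC, hA, hB]
      · rw [he, add_neg_cancel, sub_neg_eq_add]
        simp only [Point.xRep_neg]
        simp [formC, hA, hB]
    · obtain ⟨hA, hB⟩ := forms_of_X_ne W h₁.1 h₂.1 hx
      refine ⟨(x₁ - x₂) ^ 2, pow_ne_zero 2 (sub_ne_zero.2 hx), ?_⟩
      rw [sub_eq_add_neg (Point.some _ _ _), Point.neg_some, Point.add_of_X_ne hx, Point.add_of_X_ne hx]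
      simp only [Point.xRep_some, Matrix.cons_val_zero, Matrix.cons_val_one, hA, hB]
      refine ⟨trivial, by ring, by simp [formC]⟩

/-- Division of a quadratic form over a polynomial ring by a primitive linear form. -/
lemma exists_div_linear {R : Type*} [CommRing R] [IsDomain R] {Φ Ψ A B C : R}
    (hco : IsCoprime Φ Ψ) (h : A * Ψ ^ 2 - B * (Φ * Ψ) + C * Φ ^ 2 = 0) :
    ∃ A' C' : R, A = Φ * A' ∧ C = Ψ * C' ∧ B = A' * Ψ + C' * Φ := by
  by_cases hΦ : Φ = 0
  · subst hΦ
    obtain ⟨u, hu⟩ := isCoprime_zero_left.1 hco |>.exists_left_inv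
    have hA : A = 0 := by
      have : A * Ψ ^ 2 = 0 := by simpa using h
      linear_combination u ^ 2 * this - A * (u * Ψ + 1) * hu
    exact ⟨B * u, C * u, by simp [hA], by linear_combination (-C) * hu,
      by linear_combination (-B) * hu⟩
  by_cases hΨ : Ψ = 0
  · subst hΨ
    obtain ⟨u, hu⟩ := isCoprime_zero_right.1 hco |>.exists_left_inv
    have hC : C = 0 := by
      have : C * Φ ^ 2 = 0 := by simpa using h
      linear_combination u ^ 2 * this - C * (u * Φ + 1) * hu
    exact ⟨A * u, B * u, by linear_combination (-A) * hu, by simp [hC],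
      by linear_combination (-B) * hu⟩
  have h1 : Φ ∣ A := by
    have : Φ ∣ A * Ψ ^ 2 := ⟨B * Ψ - C * Φ, by linear_combination h⟩
    exact (hco.pow_right (n := 2)).dvd_of_dvd_mul_right this
  have h2 : Ψ ∣ C := by
    have : Ψ ∣ C * Φ ^ 2 := ⟨B * Φ - A * Ψ, by linear_combination h⟩
    exact (hco.symm.pow_right (n := 2)).dvd_of_dvd_mul_right this
  obtain ⟨A', rfl⟩ := h1
  obtain ⟨C', rfl⟩ := h2
  refine ⟨A', C', rfl, rfl, ?_⟩
  apply mul_left_cancel₀ (mul_ne_zero hΦ hΨ)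
  linear_combination -h

/-- Unique factorization for binary quadratic forms: if the products of a nonzero linear form `a`
with the linear forms `b` and `c` are proportional, then so are `b` and `c`. -/
lemma proportional_of_mul {a₀ a₁ b₀ b₁ c₀ c₁ u v : F} (ha : a₀ ≠ 0 ∨ a₁ ≠ 0)
    (hu : u ≠ 0) (h0 : u * (a₀ * b₀) = v * (a₀ * c₀))
    (h1 : u * (a₀ * b₁ + a₁ * b₀) = v * (a₀ * c₁ + a₁ * c₀)) (h2 : u * (a₁ * b₁) = v * (a₁ * c₁)) :
    b₀ * c₁ = b₁ * c₀ := by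
  have e : u * b₀ = v * c₀ ∧ u * b₁ = v * c₁ := by
    rcases ha with ha | ha
    · have e0 : u * b₀ = v * c₀ := mul_left_cancel₀ ha (by linear_combination h0)
      exact ⟨e0, mul_left_cancel₀ ha (by linear_combination h1 - a₁ * e0)⟩
    · have e0 : u * b₁ = v * c₁ := mul_left_cancel₀ ha (by linear_combination h2)
      exact ⟨mul_left_cancel₀ ha (by linear_combination h1 - a₀ * e0), e0⟩
  apply mul_left_cancel₀ hu
  linear_combination c₁ * e.1 - c₀ * e.2

lemma exists_scalar {a b c d : F} (h₁ : a ≠ 0 ∨ b ≠ 0) (h₂ : c ≠ 0 ∨ d ≠ 0)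
    (h : a * d = b * c) : ∃ e : F, e ≠ 0 ∧ a = e * c ∧ b = e * d := by
  rcases h₂ with h₂ | h₂
  · refine ⟨a / c, ?_, by field_simp, by field_simp; linear_combination -h⟩
    intro h0
    have ha : a = 0 := by simpa [h₂] using h0
    have : b * c = 0 := by rw [← h, ha, zero_mul]
    grind
  · refine ⟨b / d, ?_, by field_simp; linear_combination h, by field_simp⟩
    intro h0
    have hb : b = 0 := by simpa [h₂] using h0
    have : a * d = 0 := by rw [h, hb, zero_mul]
    grind

lemma xRep_ne (P : W.Point) : P.xRep 0 ≠ 0 ∨ P.xRep 1 ≠ 0 := by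
  rcases P with _ | ⟨x, y, h⟩
  · left; simp [← Point.zero_def]
  · right; simp

lemma eval_ne_of_isCoprime {Φ Ψ : F[X]} (h : IsCoprime Φ Ψ) (x : F) :
    Φ.eval x ≠ 0 ∨ Ψ.eval x ≠ 0 := by
  obtain ⟨u, v, huv⟩ := h
  by_contra! hc
  have := congrArg (eval x) huv
  simp [hc.1, hc.2] at this

lemma exists_point [IsAlgClosed F] [W.IsElliptic] (x : F) : ∃ y, W.Nonsingular x y := by
  have hdeg : (W.polynomial.map (evalRingHom x)).degree ≠ 0 := by
    rw [monic_polynomial.degree_map, degree_polynomial]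
    exact two_ne_zero
  obtain ⟨y, hy⟩ := IsAlgClosed.exists_root _ hdeg
  refine ⟨y, equation_iff_nonsingular.1 ?_⟩
  rw [IsRoot, map_evalRingHom_eval] at hy
  exact hy

/-- Multiplication by `n` on `x`-coordinates: `x (n T) = Φ (x T) / Ψ (x T)`, where `xRep` holds the
homogeneous coordinates of `x (n T)`. The coefficient `n ^ 2` of `Ψ` vanishes in characteristic
dividing `n`. -/
structure IsMulPair (n : ℕ) (Φ Ψ : F[X]) : Prop where
  coprime : IsCoprime Φ Ψ
  monic : Φ.Monic
  natDegree_eq : Φ.natDegree = n ^ 2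
  degree_lt : Ψ.degree < (n ^ 2 : ℕ)
  coeff_eq : Ψ.coeff (n ^ 2 - 1) = (n : F) ^ 2
  spec : ∀ {x y : F} (h : W.Nonsingular x y), Φ.eval x * (n • Point.some x y h).xRep 1 =
    Ψ.eval x * (n • Point.some x y h).xRep 0

lemma isMulPair_zero : IsMulPair W 0 1 0 where
  coprime := isCoprime_one_left
  monic := monic_one
  natDegree_eq := by simp
  degree_lt := by simp
  coeff_eq := by simp
  spec h := by simp

lemma isMulPair_one : IsMulPair W 1 X 1 where
  coprime := isCoprime_one_right
  monic := monic_X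
  natDegree_eq := by simp
  degree_lt := by simp
  coeff_eq := by simp
  spec h := by simp

end TorsionCount
end

noncomputable section
namespace TorsionCount
open scoped Classical
open WeierstrassCurve WeierstrassCurve.Affine
variable {F : Type*} [Field F] (W : Affine F)

lemma eval_formA (Φ Ψ : F[X]) (x : F) :
    (formA (W.map C) Φ Ψ X 1).eval x = formA W (Φ.eval x) (Ψ.eval x) x 1 := by
  simp [formA]

lemma eval_formB (Φ Ψ : F[X]) (x : F) :
    (formB (W.map C) Φ Ψ X 1).eval x = formB W (Φ.eval x) (Ψ.eval x) x 1 := by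
  simp [formB]

lemma eval_formC (Φ Ψ : F[X]) (x : F) :
    (formC Φ Ψ X 1).eval x = formC (Φ.eval x) (Ψ.eval x) x 1 := by
  simp [formC]

lemma IsMulPair.exists_scalar {W : Affine F} {n : ℕ} {Φ Ψ : F[X]} (h : IsMulPair W n Φ Ψ) {x y : F}
    (hT : W.Nonsingular x y) : ∃ e : F, e ≠ 0 ∧
      Φ.eval x = e * (n • Point.some x y hT).xRep 0 ∧
      Ψ.eval x = e * (n • Point.some x y hT).xRep 1 :=
  TorsionCount.exists_scalar (eval_ne_of_isCoprime h.coprime x) (xRep_ne W _) (h.spec hT)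

lemma natDegree_formA_sub_le {N : ℕ} {Φ Ψ : F[X]} (hN : 1 ≤ N) (hΦ : Φ.natDegree ≤ N)
    (hΨ : Ψ.natDegree ≤ N - 1) :
    (formA (W.map C) Φ Ψ X 1 - (Φ * X) ^ 2).natDegree ≤ 2 * N + 1 := by
  have e : formA (W.map C) Φ Ψ X 1 - (Φ * X) ^ 2 =
      -(C W.b₄ * X * Φ * Ψ + C W.b₆ * (Φ + Ψ * X) * Ψ + C W.b₈ * Ψ ^ 2) := by
    simp only [formA, map_b₄, map_b₆, map_b₈]; ring
  have hX : (X : F[X]).natDegree ≤ 1 := natDegree_X_le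
  have h1 : (C W.b₄ * X * Φ * Ψ).natDegree ≤ 0 + 1 + N + (N - 1) :=
    natDegree_mul_le_of_le (natDegree_mul_le_of_le (natDegree_mul_le_of_le (by simp) hX) hΦ) hΨ
  have h2 : (C W.b₆ * (Φ + Ψ * X) * Ψ).natDegree ≤ 0 + max N (N - 1 + 1) + (N - 1) :=
    natDegree_mul_le_of_le (natDegree_mul_le_of_le (by simp)
      (natDegree_add_le_of_le hΦ (natDegree_mul_le_of_le hΨ hX))) hΨ
  have h3 : (C W.b₈ * Ψ ^ 2).natDegree ≤ 0 + 2 * (N - 1) :=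
    natDegree_mul_le_of_le (by simp) (natDegree_pow_le_of_le 2 hΨ)
  rw [e, natDegree_neg]
  refine (natDegree_add_le_of_le (natDegree_add_le_of_le h1 h2) h3).trans ?_
  have : N - 1 + 1 = N := by omega
  rw [this]
  simp
  omega

lemma natDegree_formB_sub_le {N : ℕ} {Φ Ψ : F[X]} (hN : 1 ≤ N) (hΦ : Φ.natDegree ≤ N)
    (hΨ : Ψ.natDegree ≤ N - 1) :
    (formB (W.map C) Φ Ψ X 1 - 2 * (Φ + Ψ * X) * (Φ * X)).natDegree ≤ 2 * N := by
  have e : formB (W.map C) Φ Ψ X 1 - 2 * (Φ + Ψ * X) * (Φ * X) =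
      C W.b₂ * (X * Φ) * Ψ + C W.b₄ * (Φ + Ψ * X) * Ψ + C W.b₆ * Ψ ^ 2 := by
    simp only [formB, map_b₄, map_b₆, map_b₂]; ring
  have hX : (X : F[X]).natDegree ≤ 1 := natDegree_X_le
  have h1 : (C W.b₂ * (X * Φ) * Ψ).natDegree ≤ 0 + (1 + N) + (N - 1) :=
    natDegree_mul_le_of_le (natDegree_mul_le_of_le (by simp) (natDegree_mul_le_of_le hX hΦ)) hΨ
  have h2 : (C W.b₄ * (Φ + Ψ * X) * Ψ).natDegree ≤ 0 + max N (N - 1 + 1) + (N - 1) :=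
    natDegree_mul_le_of_le (natDegree_mul_le_of_le (by simp)
      (natDegree_add_le_of_le hΦ (natDegree_mul_le_of_le hΨ hX))) hΨ
  have h3 : (C W.b₆ * Ψ ^ 2).natDegree ≤ 0 + 2 * (N - 1) :=
    natDegree_mul_le_of_le (by simp) (natDegree_pow_le_of_le 2 hΨ)
  rw [e]
  refine (natDegree_add_le_of_le (natDegree_add_le_of_le h1 h2) h3).trans ?_
  have : N - 1 + 1 = N := by omega
  rw [this]
  simp
  omega

/-- The step of the construction. As `(n + 2) T` and `n T` are `(n + 1) T ± T`, the forms at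
`(n + 1) T` and `T` are the coefficients of a quadratic form with the known linear factor
`Ψ₀ X - Φ₀ Z`; the other factor gives the new pair. -/
lemma IsMulPair.step [IsAlgClosed F] [W.IsElliptic] {n : ℕ} {Φ₀ Ψ₀ Φ₁ Ψ₁ : F[X]}
    (h₀ : IsMulPair W n Φ₀ Ψ₀) (h₁ : IsMulPair W (n + 1) Φ₁ Ψ₁) :
    ∃ Φ Ψ, IsMulPair W (n + 2) Φ Ψ := by
  set A := formA (W.map C) Φ₁ Ψ₁ X 1 with hA
  set B := formB (W.map C) Φ₁ Ψ₁ X 1 with hB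
  set D := formC Φ₁ Ψ₁ X 1 with hD
  -- the values at a point
  have hval : ∀ {x y : F} (hT : W.Nonsingular x y), ∃ c : F, c ≠ 0 ∧
      A.eval x = c * (Φ₀.eval x * ((n + 2) • Point.some x y hT).xRep 0) ∧
      B.eval x = c * (Φ₀.eval x * ((n + 2) • Point.some x y hT).xRep 1 +
        Ψ₀.eval x * ((n + 2) • Point.some x y hT).xRep 0) ∧
      D.eval x = c * (Ψ₀.eval x * ((n + 2) • Point.some x y hT).xRep 1) := by
    intro x y hT
    obtain ⟨e₀, he₀, hΦ₀, hΨ₀⟩ := h₀.exists_scalar hT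
    obtain ⟨e₁, he₁, hΦ₁, hΨ₁⟩ := h₁.exists_scalar hT
    obtain ⟨c, hc, hcA, hcB, hcD⟩ := add_sub_forms W ((n + 1) • Point.some x y hT) (Point.some x y hT)
    have hp : (n + 1) • Point.some x y hT + Point.some x y hT = (n + 2) • Point.some x y hT := by
      rw [← succ_nsmul]
    have hm : (n + 1) • Point.some x y hT - Point.some x y hT = n • Point.some x y hT := by
      rw [succ_nsmul, add_sub_cancel_right]
    rw [hp, hm] at hcA hcB hcD
    simp only [Point.xRep_some, Matrix.cons_val_zero, Matrix.cons_val_one] at hcA hcB hcD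
    refine ⟨e₁ ^ 2 * c / e₀, by positivity, ?_, ?_, ?_⟩
    · rw [hA, eval_formA, hΦ₀, hΦ₁, hΨ₁]
      have : formA W (e₁ * ((n + 1) • Point.some x y hT).xRep 0)
        (e₁ * ((n + 1) • Point.some x y hT).xRep 1) x 1 = e₁ ^ 2 *
        formA W (((n + 1) • Point.some x y hT).xRep 0) (((n + 1) • Point.some x y hT).xRep 1) x 1 := by
        simp only [formA]; ring
      rw [this, hcA]; field_simp
    · rw [hB, eval_formB, hΦ₀, hΨ₀, hΦ₁, hΨ₁]
      have : formB W (e₁ * ((n + 1) • Point.some x y hT).xRep 0)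
        (e₁ * ((n + 1) • Point.some x y hT).xRep 1) x 1 = e₁ ^ 2 *
        formB W (((n + 1) • Point.some x y hT).xRep 0) (((n + 1) • Point.some x y hT).xRep 1) x 1 := by
        simp only [formB]; ring
      rw [this, hcB]; field_simp; ring
    · rw [hD, eval_formC, hΨ₀, hΦ₁, hΨ₁]
      have : formC (e₁ * ((n + 1) • Point.some x y hT).xRep 0)
        (e₁ * ((n + 1) • Point.some x y hT).xRep 1) x 1 = e₁ ^ 2 *
        formC (((n + 1) • Point.some x y hT).xRep 0) (((n + 1) • Point.some x y hT).xRep 1) x 1 := by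
        simp only [formC]; ring
      rw [this, hcD]; field_simp
  have hrel : A * Ψ₀ ^ 2 - B * (Φ₀ * Ψ₀) + D * Φ₀ ^ 2 = 0 := by
    apply Polynomial.funext
    intro x
    obtain ⟨y, hT⟩ := exists_point W x
    obtain ⟨c, -, e1, e2, e3⟩ := hval hT
    simp only [eval_add, eval_sub, eval_mul, eval_pow, e1, e2, e3, eval_zero]
    ring
  obtain ⟨Φ, Ψ, hAΦ, hDΨ, hBΦ⟩ := exists_div_linear h₀.coprime hrel
  -- degrees
  have hN : 1 ≤ (n + 1) ^ 2 := Nat.one_le_pow _ _ (by omega)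
  have hdΨ₁ : Ψ₁.natDegree ≤ (n + 1) ^ 2 - 1 := by
    have := h₁.degree_lt
    by_cases h0 : Ψ₁ = 0
    · simp [h0]
    · rw [degree_eq_natDegree h0] at this
      have := Nat.cast_lt.1 this
      omega
  have hAsub := natDegree_formA_sub_le W hN h₁.natDegree_eq.le hdΨ₁
  have hBsub := natDegree_formB_sub_le W hN h₁.natDegree_eq.le hdΨ₁
  rw [← hA] at hAsub
  rw [← hB] at hBsub
  have hmX : (Φ₁ * X).Monic := h₁.monic.mul monic_X
  have hdX : (Φ₁ * X).natDegree = (n + 1) ^ 2 + 1 := by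
    rw [natDegree_mul_X h₁.monic.ne_zero, h₁.natDegree_eq]
  have hd2 : ((Φ₁ * X) ^ 2).natDegree = 2 * (n + 1) ^ 2 + 2 := by
    rw [natDegree_pow, hdX]; ring
  have hA' : A = (A - (Φ₁ * X) ^ 2) + (Φ₁ * X) ^ 2 := by ring
  have hlt : (A - (Φ₁ * X) ^ 2).degree < ((Φ₁ * X) ^ 2).degree := by
    apply degree_lt_degree
    omega
  have hAm : A.Monic := by
    rw [hA']
    exact (hmX.pow 2).add_of_right hlt
  have hAd : A.natDegree = 2 * (n + 1) ^ 2 + 2 := by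
    rw [hA', natDegree_add_eq_right_of_degree_lt hlt, hd2]
  have hΦm : Φ.Monic := by
    apply h₀.monic.of_mul_monic_left
    rwa [← hAΦ]
  have hΦd : Φ.natDegree = (n + 2) ^ 2 := by
    have := h₀.monic.natDegree_mul hΦm
    rw [← hAΦ, hAd, h₀.natDegree_eq] at this
    nlinarith
  have hΨeq : Ψ * Φ₀ = B - Φ * Ψ₀ := by rw [hBΦ]; ring
  have hdΨ₀ : Ψ₀.natDegree ≤ n ^ 2 - 1 := by
    have := h₀.degree_lt
    by_cases h0 : Ψ₀ = 0
    · simp [h0]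
    · rw [degree_eq_natDegree h0] at this
      have := Nat.cast_lt.1 this
      omega
  have hXd : (X : F[X]).natDegree ≤ 1 := natDegree_X_le
  have hPd : (Φ₁ + Ψ₁ * X).natDegree ≤ (n + 1) ^ 2 := by
    refine (natDegree_add_le_of_le h₁.natDegree_eq.le (natDegree_mul_le_of_le hdΨ₁ hXd)).trans ?_
    simp
  have hQd : (2 * (Φ₁ + Ψ₁ * X) * (Φ₁ * X)).natDegree ≤ 2 * (n + 1) ^ 2 + 1 := by
    refine (natDegree_mul_le_of_le (natDegree_mul_le_of_le (m := 0) ?_ hPd) hdX.le).trans (by omega)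
    exact (natDegree_natCast 2).le
  have hBd : B.natDegree ≤ 2 * (n + 1) ^ 2 + 1 := by
    have : B = (B - 2 * (Φ₁ + Ψ₁ * X) * (Φ₁ * X)) + 2 * (Φ₁ + Ψ₁ * X) * (Φ₁ * X) := by ring
    rw [this]
    refine (natDegree_add_le_of_le hBsub hQd).trans ?_
    simp
  have hΦΨd : (Φ * Ψ₀).natDegree ≤ 2 * (n + 1) ^ 2 + 1 := by
    by_cases hn : n = 0
    · subst hn
      have : Ψ₀ = 0 := by
        simpa using h₀.degree_lt
      simp [this]
    · refine (natDegree_mul_le_of_le hΦd.le hdΨ₀).trans ?_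
      have : 1 ≤ n ^ 2 := Nat.one_le_pow _ _ (by omega)
      have : n ^ 2 - 1 + 1 = n ^ 2 := by omega
      nlinarith
  have hΨd' : (Ψ * Φ₀).natDegree ≤ 2 * (n + 1) ^ 2 + 1 := by
    rw [hΨeq]
    refine (natDegree_sub_le_of_le hBd hΦΨd).trans (by simp)
  have hΨd : Ψ.natDegree ≤ (n + 2) ^ 2 - 1 := by
    by_cases h0 : Ψ = 0
    · simp [h0]
    rw [natDegree_mul h0 h₀.monic.ne_zero, h₀.natDegree_eq] at hΨd'
    have : (n + 2) ^ 2 = 2 * (n + 1) ^ 2 + 2 - n ^ 2 := by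
      have : (n + 2) ^ 2 + n ^ 2 = 2 * (n + 1) ^ 2 + 2 := by ring
      omega
    omega
  have hco : Ψ.coeff ((n + 2) ^ 2 - 1) = ((n + 2 : ℕ) : F) ^ 2 := by
    have e1 : (Ψ * Φ₀).coeff ((n + 2) ^ 2 - 1 + n ^ 2) = Ψ.coeff ((n + 2) ^ 2 - 1) := by
      rw [coeff_mul_add_eq_of_natDegree_le hΨd h₀.natDegree_eq.le, ← h₀.natDegree_eq,
        h₀.monic.coeff_natDegree, mul_one]
    have e0 : (n + 2) ^ 2 - 1 + n ^ 2 = 2 * (n + 1) ^ 2 + 1 := by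
      have : (n + 2) ^ 2 + n ^ 2 = 2 * (n + 1) ^ 2 + 2 := by ring
      have : 1 ≤ (n + 2) ^ 2 := Nat.one_le_pow _ _ (by omega)
      omega
    have e2 : B.coeff (2 * (n + 1) ^ 2 + 1) = 2 * (1 + ((n + 1 : ℕ) : F) ^ 2) := by
      have : B = (B - 2 * (Φ₁ + Ψ₁ * X) * (Φ₁ * X)) + 2 * (Φ₁ + Ψ₁ * X) * (Φ₁ * X) := by ring
      rw [this, coeff_add, coeff_eq_zero_of_natDegree_lt (by omega), zero_add]
      have e3 : 2 * (n + 1) ^ 2 + 1 = (n + 1) ^ 2 + ((n + 1) ^ 2 + 1) := by ring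
      have e4 : (2 * (Φ₁ + Ψ₁ * X) * (Φ₁ * X)) = C 2 * ((Φ₁ + Ψ₁ * X) * (Φ₁ * X)) := by
        rw [map_ofNat]; ring
      rw [e4, coeff_C_mul, e3, coeff_mul_add_eq_of_natDegree_le hPd hdX.le, ← hdX, hmX.coeff_natDegree, mul_one,
        coeff_add]
      congr 2
      · rw [← h₁.natDegree_eq, h₁.monic.coeff_natDegree]
      · have : (n + 1) ^ 2 = ((n + 1) ^ 2 - 1) + 1 := by omega
        rw [this, coeff_mul_X, h₁.coeff_eq]
    have e5 : (Φ * Ψ₀).coeff (2 * (n + 1) ^ 2 + 1) = (n : F) ^ 2 := by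
      by_cases hn : n = 0
      · subst hn
        have : Ψ₀ = 0 := by
          simpa using h₀.degree_lt
        simp [this]
      · have : 1 ≤ n ^ 2 := Nat.one_le_pow _ _ (by omega)
        have e6 : 2 * (n + 1) ^ 2 + 1 = (n + 2) ^ 2 + (n ^ 2 - 1) := by
          have : (n + 2) ^ 2 + n ^ 2 = 2 * (n + 1) ^ 2 + 2 := by ring
          omega
        rw [e6, coeff_mul_add_eq_of_natDegree_le hΦd.le hdΨ₀, h₀.coeff_eq, ← hΦd, hΦm.coeff_natDegree,
          one_mul]
    rw [← e1, e0, hΨeq, coeff_sub, e2, e5]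
    push_cast
    ring
  -- values
  have hvanish : ∀ x, ¬ (Φ.eval x = 0 ∧ Ψ.eval x = 0) := by
    rintro x ⟨hx1, hx2⟩
    refine forms_ne_zero W (eval_ne_of_isCoprime h₁.coprime x) (Or.inr (one_ne_zero (α := F)))
      (X₂ := x) ?_ ?_ ?_
    · rw [← eval_formA, ← hA, hAΦ]; simp [hx1]
    · rw [← eval_formB, ← hB, hBΦ]; simp [hx1, hx2]
    · rw [← eval_formC, ← hD, hDΨ]; simp [hx2]
  refine ⟨Φ, Ψ, ?_, hΦm, hΦd, ?_, hco, ?_⟩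
  · rw [isCoprime_iff_aeval_ne_zero_of_isAlgClosed F F]
    intro x
    simpa only [coe_aeval_eq_eval, not_and_or] using hvanish x
  · rw [degree_lt_iff_coeff_zero]
    intro m hm
    apply coeff_eq_zero_of_natDegree_lt
    have : 1 ≤ (n + 2) ^ 2 := Nat.one_le_pow _ _ (by omega)
    omega
  · intro x y hT
    obtain ⟨c, hc, e1, e2, e3⟩ := hval hT
    refine proportional_of_mul (u := 1) (v := c) (eval_ne_of_isCoprime h₀.coprime x) one_ne_zero
      ?_ ?_ ?_
    · rw [one_mul, ← eval_mul, ← hAΦ, e1]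
    · rw [one_mul, ← e2, hBΦ]; simp; ring
    · rw [one_mul, ← eval_mul, ← hDΨ, e3]

end TorsionCount
end

noncomputable section
namespace TorsionCount
open scoped Classical
open WeierstrassCurve WeierstrassCurve.Affine
variable {F : Type*} [Field F] (W : Affine F)

/-- Multiplication by `n` on `x`-coordinates is given by coprime polynomials of degree `n ^ 2` and
less, by induction on `n` in steps of two. -/
theorem exists_isMulPair [IsAlgClosed F] [W.IsElliptic] (n : ℕ) : ∃ Φ Ψ, IsMulPair W n Φ Ψ := by
  have : (∃ Φ Ψ, IsMulPair W n Φ Ψ) ∧ ∃ Φ Ψ, IsMulPair W (n + 1) Φ Ψ := by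
    induction n with
    | zero => exact ⟨⟨_, _, isMulPair_zero W⟩, ⟨_, _, isMulPair_one W⟩⟩
    | succ n ih =>
      obtain ⟨⟨Φ₀, Ψ₀, h₀⟩, ⟨Φ₁, Ψ₁, h₁⟩⟩ := ih
      exact ⟨⟨_, _, h₁⟩, h₀.step W h₁⟩
  exact this.1

/-- A point with given `x`-coordinate. -/
def pointAt [IsAlgClosed F] [W.IsElliptic] (x : F) : W.Point :=
  .some x _ (exists_point W x).choose_spec

lemma eq_pointAt_or [IsAlgClosed F] [W.IsElliptic] {x y : F} (h : W.Nonsingular x y) :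
    Point.some x y h = pointAt W x ∨ Point.some x y h = -pointAt W x :=
  Point.X_eq_iff.1 rfl

lemma IsMulPair.eval_eq_zero {W : Affine F} {n : ℕ} {Φ Ψ : F[X]} (hm : IsMulPair W n Φ Ψ) {x y : F}
    {h : W.Nonsingular x y} (h0 : n • Point.some x y h = 0) : Ψ.eval x = 0 := by
  simpa [h0] using (hm.spec h).symm

lemma torsion_subset [IsAlgClosed F] [W.IsElliptic] {n : ℕ} {Φ Ψ : F[X]}
    (hm : IsMulPair W n Φ Ψ) (h0 : Ψ ≠ 0) :
    {P : W.Point | n • P = 0} ⊆ (insert 0 (Ψ.roots.toFinset.image (pointAt W) ∪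
      Ψ.roots.toFinset.image fun x => -pointAt W x) : Finset W.Point) := by
  rintro (_ | ⟨x, y, h⟩) hP
  · simp [← Point.zero_def]
  · have hx : Ψ.eval x = 0 := hm.eval_eq_zero hP
    have hx' : x ∈ Ψ.roots.toFinset := by simp [h0, hx]
    simp only [Finset.coe_insert, Finset.coe_union, Finset.coe_image, Set.mem_insert_iff,
      Set.mem_union, Set.mem_image, Finset.mem_coe]
    rcases eq_pointAt_or W h with he | he
    · exact Or.inr (Or.inl ⟨x, hx', he.symm⟩)
    · exact Or.inr (Or.inr ⟨x, hx', he.symm⟩)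

lemma IsMulPair.ne_zero {W : Affine F} {n : ℕ} {Φ Ψ : F[X]} (hm : IsMulPair W n Φ Ψ)
    (hn : (n : F) ≠ 0) : Ψ ≠ 0 := by
  rintro rfl
  have := hm.coeff_eq
  rw [coeff_zero] at this
  exact pow_ne_zero 2 hn this.symm

lemma finite_torsion [IsAlgClosed F] [W.IsElliptic] {n : ℕ} (hn : (n : F) ≠ 0) :
    {P : W.Point | n • P = 0}.Finite := by
  obtain ⟨Φ, Ψ, hm⟩ := exists_isMulPair W n
  exact (Finset.finite_toSet _).subset (torsion_subset W hm (hm.ne_zero hn))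

/-- Besides the point at infinity, the `n`-torsion points lie over the fewer than `n ^ 2` roots of
`Ψ`, at most two over each. -/
lemma ncard_torsion_lt [IsAlgClosed F] [W.IsElliptic] {n : ℕ} (hn : (n : F) ≠ 0) :
    {P : W.Point | n • P = 0}.ncard < 2 * n ^ 2 := by
  obtain ⟨Φ, Ψ, hm⟩ := exists_isMulPair W n
  have h0 := hm.ne_zero hn
  have hle := Set.ncard_le_ncard (torsion_subset W hm h0) (Finset.finite_toSet _)
  rw [Set.ncard_coe_finset] at hle
  have h1 := Finset.card_insert_le 0 (Ψ.roots.toFinset.image (pointAt W) ∪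
      Ψ.roots.toFinset.image fun x => -pointAt W x)
  have h2 := Finset.card_union_le (Ψ.roots.toFinset.image (pointAt W))
      (Ψ.roots.toFinset.image fun x => -pointAt W x)
  have h3 : (Ψ.roots.toFinset.image (pointAt W)).card ≤ Ψ.roots.toFinset.card := Finset.card_image_le
  have h4 : (Ψ.roots.toFinset.image fun x => -pointAt W x).card ≤ Ψ.roots.toFinset.card :=
    Finset.card_image_le
  have h5 : Ψ.roots.toFinset.card ≤ Ψ.natDegree :=
    (Multiset.toFinset_card_le _).trans (card_roots' _)
  have h6 : Ψ.natDegree < n ^ 2 := by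
    have := hm.degree_lt
    rw [degree_eq_natDegree h0] at this
    exact_mod_cast this
  omega

/-- If `Φ (x) = c Ψ (x)` for the `x`-coordinate of `T`, then `n T` has `x`-coordinate `c`. -/
lemma IsMulPair.nsmul_eq [IsAlgClosed F] [W.IsElliptic] {n : ℕ} {Φ Ψ : F[X]}
    (hm : IsMulPair W n Φ Ψ) {c x y d : F} (hx : (Φ - C c * Ψ).IsRoot x) (h : W.Nonsingular x y)
    (hd : W.Nonsingular c d) :
    n • Point.some x y h = .some c d hd ∨ n • Point.some x y h = -.some c d hd := by
  have hx' : Φ.eval x = c * Ψ.eval x := by simpa [sub_eq_zero] using hx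
  have hs := hm.spec h
  have hΨ : Ψ.eval x ≠ 0 := by
    intro h0
    rcases eval_ne_of_isCoprime hm.coprime x with h1 | h1
    · exact h1 (by rw [hx', h0, mul_zero])
    · exact h1 h0
  rw [hx', mul_comm c, mul_assoc] at hs
  have hs' := mul_left_cancel₀ hΨ hs
  rcases hP : n • Point.some x y h with _ | ⟨x', y', h'⟩
  · rw [hP, ← Point.zero_def] at hs'
    simp at hs'
  · rw [hP] at hs'
    simp at hs'
    subst hs'
    exact Point.X_eq_iff.1 rfl

lemma IsMulPair.degree_sub {W : Affine F} {n : ℕ} {Φ Ψ : F[X]} (hm : IsMulPair W n Φ Ψ) (c : F) :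
    (Φ - C c * Ψ).degree = (n ^ 2 : ℕ) := by
  have h1 : Φ.degree = (n ^ 2 : ℕ) := by
    rw [degree_eq_natDegree hm.monic.ne_zero, hm.natDegree_eq]
  rw [← h1]
  apply degree_sub_eq_left_of_degree_lt
  rw [h1]
  refine lt_of_le_of_lt ?_ hm.degree_lt
  rw [← smul_eq_C_mul]
  exact degree_smul_le _ _

theorem nsmul_surjective [IsAlgClosed F] [W.IsElliptic] {n : ℕ} (hn : n ≠ 0) (Q : W.Point) :
    ∃ T : W.Point, n • T = Q := by
  rcases Q with _ | ⟨c, d, hd⟩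
  · exact ⟨0, by simp [← Point.zero_def]⟩
  obtain ⟨Φ, Ψ, hm⟩ := exists_isMulPair W n
  have hdeg : (Φ - C c * Ψ).degree ≠ 0 := by
    rw [hm.degree_sub]
    exact_mod_cast pow_ne_zero 2 hn
  obtain ⟨x, hx⟩ := IsAlgClosed.exists_root _ hdeg
  obtain ⟨y, h⟩ := exists_point W x
  rcases hm.nsmul_eq W hx h hd with he | he
  · exact ⟨_, he⟩
  · exact ⟨-Point.some x y h, by rw [smul_neg, he, neg_neg]⟩

/-- In characteristic zero, almost all fibres of multiplication by `n` are separable. -/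
lemma IsMulPair.exists_separable [CharZero F] [IsAlgClosed F] {W : Affine F} {n : ℕ} {Φ Ψ : F[X]}
    (hm : IsMulPair W n Φ Ψ) (hn : n ≠ 0) (S : Finset F) :
    ∃ c ∉ S, ∀ x, (Φ - C c * Ψ).IsRoot x → (derivative (Φ - C c * Ψ)).eval x ≠ 0 := by
  -- The values `c` to be avoided are those of `Φ / Ψ` at the zeros of the numerator `D` of its
  -- derivative.
  set D := derivative Φ * Ψ - Φ * derivative Ψ with hD
  have hD0 : D ≠ 0 := by
    intro h0
    have h1 : Φ ∣ derivative Φ := by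
      apply hm.coprime.dvd_of_dvd_mul_right
      exact ⟨derivative Ψ, by linear_combination h0⟩
    have h2 : Φ.degree ≠ 0 := by
      rw [degree_eq_natDegree hm.monic.ne_zero, hm.natDegree_eq]
      exact_mod_cast pow_ne_zero 2 hn
    have h3 : derivative Φ = 0 := by
      by_contra h
      exact absurd (degree_le_of_dvd h1 h) (not_le.2 (degree_derivative_lt hm.monic.ne_zero))
    have h4 := natDegree_eq_zero_of_derivative_eq_zero h3
    rw [hm.natDegree_eq] at h4
    exact pow_ne_zero 2 hn h4
  obtain ⟨c, hc⟩ := Infinite.exists_notMem_finset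
    (S ∪ D.roots.toFinset.image fun x => Φ.eval x / Ψ.eval x)
  simp only [Finset.mem_union, Finset.mem_image, not_or, not_exists, not_and] at hc
  refine ⟨c, hc.1, fun x hx hx' => ?_⟩
  have e1 : Φ.eval x = c * Ψ.eval x := by simpa [sub_eq_zero] using hx
  have e2 : (derivative Φ).eval x = c * (derivative Ψ).eval x := by
    simpa [sub_eq_zero] using hx'
  have hΨ : Ψ.eval x ≠ 0 := by
    intro h0
    rcases eval_ne_of_isCoprime hm.coprime x with h1 | h1
    · exact h1 (by rw [e1, h0, mul_zero])
    · exact h1 h0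
  refine hc.2 x ?_ ?_
  · have : D.eval x = 0 := by simp [hD, e1, e2]; ring
    simp [hD0, this]
  · rw [e1]; field_simp

/-- A separable fibre of multiplication by `n` has at least `n ^ 2` points, one over each root of
`Φ - c Ψ`, and it is a translate of the `n`-torsion. -/
theorem le_ncard_torsion [CharZero F] [IsAlgClosed F] [W.IsElliptic] {n : ℕ} (hn : n ≠ 0) :
    n ^ 2 ≤ {P : W.Point | n • P = 0}.ncard := by
  obtain ⟨Φ, Ψ, hm⟩ := exists_isMulPair W n
  obtain ⟨c, -, hc⟩ := hm.exists_separable hn ∅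
  obtain ⟨d, hd⟩ := exists_point W c
  set f := Φ - C c * Ψ with hf
  have hf0 : f ≠ 0 := by
    intro h0
    have := hm.degree_sub c
    rw [← hf, h0, degree_zero] at this
    exact WithBot.natCast_ne_bot _ this.symm
  have hcard : f.roots.toFinset.card = n ^ 2 := by
    rw [Multiset.toFinset_card_of_nodup]
    · rw [IsAlgClosed.card_roots_eq_natDegree]
      exact natDegree_eq_of_degree_eq_some (hm.degree_sub c)
    · rw [Multiset.nodup_iff_count_le_one]
      intro x
      rw [count_roots]
      by_contra! h1
      have h2 := (one_lt_rootMultiplicity_iff_isRoot hf0).1 h1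
      exact hc x h2.1 h2.2
  have hT : ∀ x ∈ f.roots.toFinset, ∃ y, ∃ h : W.Nonsingular x y,
      n • Point.some x y h = .some c d hd := by
    intro x hx
    have hx : f.IsRoot x := by simpa [hf0] using hx
    obtain ⟨y, h⟩ := exists_point W x
    rcases hm.nsmul_eq W hx h hd with he | he
    · exact ⟨y, h, he⟩
    · refine ⟨W.negY x y, (nonsingular_neg ..).2 h, ?_⟩
      rw [← Point.neg_some h, smul_neg, he, neg_neg]
  choose! y hy hny using hT
  obtain ⟨T₀, hT₀⟩ := nsmul_surjective W hn (.some c d hd)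
  let g : F → W.Point := fun x => if h : x ∈ f.roots.toFinset then .some x (y x) (hy x h) - T₀ else 0
  rw [← hcard, ← Set.ncard_coe_finset]
  refine Set.ncard_le_ncard_of_injOn g ?_ ?_ (finite_torsion W (Nat.cast_ne_zero.2 hn))
  · intro x hx
    have hx : x ∈ f.roots.toFinset := hx
    simp only [g, dif_pos hx, Set.mem_ofPred_eq, smul_sub, hny x hx, hT₀, sub_self]
  · intro x hx x' hx' he
    have hx : x ∈ f.roots.toFinset := hx
    have hx' : x' ∈ f.roots.toFinset := hx'
    simp only [g, dif_pos hx, dif_pos hx', sub_left_inj, Point.some.injEq] at he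
    exact he.1

/-- There are `p ^ 2` points of `p`-torsion: their number is a power of `p`, at least `p ^ 2`, and
less than `2 p ^ 2 ≤ p ^ 3`. -/
theorem card_torsion [CharZero F] [IsAlgClosed F] [W.IsElliptic] (p : ℕ) [hp : Fact p.Prime] :
    Nat.card (AddSubgroup.torsionBy W.Point (p : ℤ)) = p ^ 2 := by
  have hset : ((AddSubgroup.torsionBy W.Point (p : ℤ) : AddSubgroup W.Point) : Set W.Point) =
      {P : W.Point | p • P = 0} := by
    ext P
    rw [SetLike.mem_coe, AddSubgroup.torsionBy.nsmul_iff, Set.mem_ofPred_eq]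
  have hp0 : (p : F) ≠ 0 := Nat.cast_ne_zero.2 hp.1.ne_zero
  have h1 : Nat.card (AddSubgroup.torsionBy W.Point (p : ℤ)) < 2 * p ^ 2 := by
    have := ncard_torsion_lt W hp0
    rwa [← hset] at this
  have h2 : p ^ 2 ≤ Nat.card (AddSubgroup.torsionBy W.Point (p : ℤ)) := by
    have := le_ncard_torsion W hp.1.ne_zero
    rwa [← hset] at this
  have hfin : Finite (AddSubgroup.torsionBy W.Point (p : ℤ)) :=
    Nat.finite_of_card_ne_zero (by have := pow_pos hp.1.pos 2; omega)
  have hpg : IsPGroup p (Multiplicative (AddSubgroup.torsionBy W.Point (p : ℤ))) := by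
    intro g
    refine ⟨1, ?_⟩
    rw [pow_one]
    have := AddSubgroup.torsionBy.nsmul (Multiplicative.toAdd g)
    exact congrArg Multiplicative.ofAdd this
  obtain ⟨m, hm⟩ := IsPGroup.iff_card.1 hpg
  have hm : Nat.card (AddSubgroup.torsionBy W.Point (p : ℤ)) = p ^ m := hm
  rw [hm] at h1 h2 ⊢
  have h3 : 2 ≤ m := (Nat.pow_le_pow_iff_right hp.1.one_lt).1 h2
  have h4 : m < 3 := by
    by_contra! h
    have h5 := Nat.pow_le_pow_right hp.1.pos h
    have h6 := hp.1.two_le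
    nlinarith [pow_pos hp.1.pos 2]
  have : m = 2 := by omega
  rw [this]
end TorsionCount
end

/-! ### Places and the reduction of points -/

noncomputable section
/-- A place of the field `F` with values in the field `κ`: a valuation ring of `F` together with a
local homomorphism to `κ`. -/
structure Place (F κ : Type*) [Field F] [Field κ] where
  ring : ValuationSubring F
  res : ring →+* κ
  isUnit_of_res_ne_zero : ∀ a : ring, res a ≠ 0 → IsUnit a

namespace Place
variable {F κ : Type*} [Field F] [Field κ] (v : Place F κ)

/-- The element `a` is regular at the place, with value `b`. -/
def Red (a : F) (b : κ) : Prop := ∃ h : a ∈ v.ring, v.res ⟨a, h⟩ = b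

variable {v} {a a' : F} {b b' : κ}

lemma Red.mem (h : v.Red a b) : a ∈ v.ring := h.1

lemma exists_red (h : a ∈ v.ring) : ∃ b, v.Red a b := ⟨_, h, rfl⟩

lemma Red.unique (h : v.Red a b) (h' : v.Red a b') : b = b' := h.2.symm.trans h'.2

lemma Red.add (h : v.Red a b) (h' : v.Red a' b') : v.Red (a + a') (b + b') := by
  obtain ⟨h1, rfl⟩ := h
  obtain ⟨h2, rfl⟩ := h'
  exact ⟨add_mem h1 h2, map_add v.res ⟨a, h1⟩ ⟨a', h2⟩⟩

lemma Red.mul (h : v.Red a b) (h' : v.Red a' b') : v.Red (a * a') (b * b') := by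
  obtain ⟨h1, rfl⟩ := h
  obtain ⟨h2, rfl⟩ := h'
  exact ⟨mul_mem h1 h2, map_mul v.res ⟨a, h1⟩ ⟨a', h2⟩⟩

lemma Red.neg (h : v.Red a b) : v.Red (-a) (-b) := by
  obtain ⟨h1, rfl⟩ := h
  exact ⟨neg_mem h1, map_neg v.res ⟨a, h1⟩⟩

lemma Red.sub (h : v.Red a b) (h' : v.Red a' b') : v.Red (a - a') (b - b') := by
  rw [sub_eq_add_neg, sub_eq_add_neg]
  exact h.add h'.neg

lemma red_one : v.Red 1 1 := ⟨one_mem _, map_one v.res⟩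

lemma red_zero : v.Red 0 0 := ⟨zero_mem _, map_zero v.res⟩

lemma red_natCast (n : ℕ) : v.Red n n := by
  induction n with
  | zero => simpa using red_zero
  | succ n ih => simpa using ih.add red_one

lemma red_ofNat (n : ℕ) [n.AtLeastTwo] : v.Red (OfNat.ofNat n) (OfNat.ofNat n) := by
  have := red_natCast (v := v) (OfNat.ofNat n)
  rwa [Nat.cast_ofNat, Nat.cast_ofNat] at this

lemma Red.pow (h : v.Red a b) (n : ℕ) : v.Red (a ^ n) (b ^ n) := by
  induction n with
  | zero => simpa using red_one
  | succ n ih => simpa [pow_succ] using ih.mul h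

lemma Red.ne_zero (h : v.Red a b) (hb : b ≠ 0) : a ≠ 0 := by
  rintro rfl
  exact hb (h.unique red_zero)

lemma Red.inv (h : v.Red a b) (hb : b ≠ 0) : v.Red a⁻¹ b⁻¹ := by
  have ha := h.ne_zero hb
  obtain ⟨h1, rfl⟩ := h
  obtain ⟨c, hc⟩ := (v.isUnit_of_res_ne_zero _ hb).exists_right_inv
  have hc' : a * (c : F) = 1 := congrArg Subtype.val hc
  have e : a⁻¹ = c := by field_simp; exact hc'.symm
  refine ⟨e ▸ c.2, ?_⟩
  apply mul_left_cancel₀ hb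
  rw [mul_inv_cancel₀ hb, ← map_mul, ← map_one v.res]
  congr 1
  apply Subtype.ext
  exact mul_inv_cancel₀ ha

lemma Red.div (h : v.Red a b) (h' : v.Red a' b') (hb : b' ≠ 0) : v.Red (a / a') (b / b') := by
  rw [div_eq_mul_inv, div_eq_mul_inv]
  exact h.mul (h'.inv hb)

/-- The inverse of an element that is not regular vanishes at the place. -/
lemma red_inv_of_notMem (h : a ∉ v.ring) : v.Red a⁻¹ 0 := by
  have h1 : a⁻¹ ∈ v.ring := (v.ring.mem_or_inv_mem a).resolve_left h
  refine ⟨h1, ?_⟩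
  by_contra h2
  have h3 := Red.inv (v := v) (a := a⁻¹) ⟨h1, rfl⟩ h2
  rw [inv_inv] at h3
  exact h h3.mem

/-- The valuation ring is integrally closed (quadratic equations). -/
lemma mem_of_quadratic {c d : F} (hc : c ∈ v.ring) (hd : d ∈ v.ring) (h : a ^ 2 + c * a = d) :
    a ∈ v.ring := by
  by_contra ha
  have h0 : a ≠ 0 := by rintro rfl; exact ha (zero_mem _)
  have hi := red_inv_of_notMem ha
  obtain ⟨c', hc'⟩ := exists_red hc
  obtain ⟨d', hd'⟩ := exists_red hd
  have h1 := (hd'.mul (hi.pow 2)).sub (hc'.mul hi)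
  have e : d * a⁻¹ ^ 2 - c * a⁻¹ = 1 := by
    rw [← h]; field_simp; ring
  rw [e] at h1
  simpa using red_one.unique h1

open WeierstrassCurve WeierstrassCurve.Affine

variable (v)

/-- The curve `W'` is the reduction of the curve `W` at the place. -/
structure RedCurve (W : Affine F) (W' : Affine κ) : Prop where
  a₁ : v.Red W.a₁ W'.a₁
  a₂ : v.Red W.a₂ W'.a₂
  a₃ : v.Red W.a₃ W'.a₃
  a₄ : v.Red W.a₄ W'.a₄
  a₆ : v.Red W.a₆ W'.a₆

/-- The point `P'` is the reduction of the point `P` at the place. -/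
inductive RedPt (W : Affine F) (W' : Affine κ) : W.Point → W'.Point → Prop
  | zero : RedPt W W' 0 0
  | pole {x y : F} (h : W.Nonsingular x y) (hx : x ∉ v.ring) : RedPt W W' (.some x y h) 0
  | some {x y : F} (h : W.Nonsingular x y) {x' y' : κ} (h' : W'.Nonsingular x' y')
      (hx : v.Red x x') (hy : v.Red y y') : RedPt W W' (.some x y h) (.some x' y' h')

variable {v} {W : Affine F} {W' : Affine κ}

lemma RedCurve.equation (hW : v.RedCurve W W') {x y : F} {x' y' : κ} (h : W.Equation x y)
    (hx : v.Red x x') (hy : v.Red y y') : W'.Equation x' y' := by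
  rw [equation_iff] at h ⊢
  refine Red.unique (v := v) (a := y ^ 2 + W.a₁ * x * y + W.a₃ * y) ?_ ?_
  · exact ((hy.pow 2).add ((hW.a₁.mul hx).mul hy)).add (hW.a₃.mul hy)
  · rw [h]
    exact (((hx.pow 3).add (hW.a₂.mul (hx.pow 2))).add (hW.a₄.mul hx)).add hW.a₆

lemma RedCurve.y_mem (hW : v.RedCurve W W') {x y : F} (h : W.Equation x y) (hx : x ∈ v.ring) :
    y ∈ v.ring := by
  rw [equation_iff] at h
  obtain ⟨x', hx⟩ := exists_red hx
  refine mem_of_quadratic (c := W.a₁ * x + W.a₃) (d := x ^ 3 + W.a₂ * x ^ 2 + W.a₄ * x + W.a₆)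
    ((hW.a₁.mul hx).add hW.a₃).mem ?_ ?_
  · exact ((((hx.pow 3).add (hW.a₂.mul (hx.pow 2))).add (hW.a₄.mul hx)).add hW.a₆).mem
  · rw [← h]; ring

lemma RedCurve.exists_redPt [W'.IsElliptic] (hW : v.RedCurve W W') (P : W.Point) :
    ∃ P', v.RedPt W W' P P' := by
  rcases P with _ | ⟨x, y, h⟩
  · exact ⟨0, .zero⟩
  · by_cases hx : x ∈ v.ring
    · obtain ⟨x', hx'⟩ := exists_red hx
      obtain ⟨y', hy'⟩ := exists_red (hW.y_mem h.1 hx)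
      exact ⟨_, .some h (equation_iff_nonsingular.1 (hW.equation h.1 hx' hy')) hx' hy'⟩
    · exact ⟨0, .pole h hx⟩

lemma RedPt.unique {P : W.Point} {P₁ P₂ : W'.Point} (h₁ : v.RedPt W W' P P₁)
    (h₂ : v.RedPt W W' P P₂) : P₁ = P₂ := by
  cases h₁ with
  | zero => cases h₂; rfl
  | pole h hx =>
    cases h₂ with
    | pole => rfl
    | some _ _ hx' _ => exact absurd hx'.mem hx
  | some h h' hx hy =>
    cases h₂ with
    | pole _ hx' => exact absurd hx.mem hx'
    | some _ _ hx' hy' =>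
      obtain rfl := hx.unique hx'
      obtain rfl := hy.unique hy'
      rfl

lemma RedCurve.negY (hW : v.RedCurve W W') {x y : F} {x' y' : κ}
    (hx : v.Red x x') (hy : v.Red y y') : v.Red (W.negY x y) (W'.negY x' y') :=
  (hy.neg.sub (hW.a₁.mul hx)).sub hW.a₃

end Place
end

noncomputable section
namespace Place
open scoped Classical
open WeierstrassCurve WeierstrassCurve.Affine
variable {F κ : Type*} [Field F] [Field κ] {v : Place F κ} {W : Affine F} {W' : Affine κ}

lemma RedCurve.addX (hW : v.RedCurve W W') {x₁ x₂ l : F} {x₁' x₂' l' : κ} (h₁ : v.Red x₁ x₁')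
    (h₂ : v.Red x₂ x₂') (hl : v.Red l l') : v.Red (W.addX x₁ x₂ l) (W'.addX x₁' x₂' l') :=
  ((((hl.pow 2).add (hW.a₁.mul hl)).sub hW.a₂).sub h₁).sub h₂

lemma RedCurve.addY (hW : v.RedCurve W W') {x₁ x₂ y₁ l : F} {x₁' x₂' y₁' l' : κ}
    (h₁ : v.Red x₁ x₁') (h₂ : v.Red x₂ x₂') (hy : v.Red y₁ y₁') (hl : v.Red l l') :
    v.Red (W.addY x₁ x₂ y₁ l) (W'.addY x₁' x₂' y₁' l') :=
  hW.negY (hW.addX h₁ h₂ hl) ((hl.mul ((hW.addX h₁ h₂ hl).sub h₁)).add hy)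

/-- The chord slope, in the form that stays regular when the reduced chord is a tangent. -/
lemma slope_mul_eq {x₁ y₁ x₂ y₂ : F} (h₁ : W.Equation x₁ y₁) (h₂ : W.Equation x₂ y₂)
    (hxy : ¬(x₁ = x₂ ∧ y₁ = W.negY x₂ y₂)) :
    W.slope x₁ x₂ y₁ y₂ * (y₁ - W.negY x₂ y₂) =
      x₁ ^ 2 + x₁ * x₂ + x₂ ^ 2 + W.a₂ * (x₁ + x₂) + W.a₄ - W.a₁ * y₁ ∧
    W.slope x₁ x₂ y₁ y₂ * (x₁ - x₂) = y₁ - y₂ := by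
  by_cases hx : x₁ = x₂
  · subst hx
    have hy : y₁ ≠ W.negY x₁ y₂ := fun h => hxy ⟨rfl, h⟩
    obtain rfl := Y_eq_of_Y_ne h₁ h₂ rfl hy
    have hd : y₁ - W.negY x₁ y₁ ≠ 0 := sub_ne_zero.2 hy
    rw [slope_of_Y_ne rfl hy]
    refine ⟨?_, by simp⟩
    rw [div_mul_cancel₀ _ hd]
    ring
  · have hd : x₁ - x₂ ≠ 0 := sub_ne_zero.2 hx
    rw [slope_of_X_ne hx]
    refine ⟨?_, div_mul_cancel₀ _ hd⟩
    rw [equation_iff] at h₁ h₂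
    apply mul_left_cancel₀ hd
    rw [WeierstrassCurve.Affine.negY]
    field_simp
    linear_combination h₁ - h₂

/-- Reduction respects the sum of two points with regular coordinates, also where the reduced points
are opposite. -/
lemma RedCurve.add_int (hW : v.RedCurve W W') {x₁ y₁ x₂ y₂ : F} {x₁' y₁' x₂' y₂' : κ}
    (h₁ : W.Nonsingular x₁ y₁) (h₂ : W.Nonsingular x₂ y₂) (h₁' : W'.Nonsingular x₁' y₁')
    (h₂' : W'.Nonsingular x₂' y₂') (hx₁ : v.Red x₁ x₁') (hy₁ : v.Red y₁ y₁') (hx₂ : v.Red x₂ x₂')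
    (hy₂ : v.Red y₂ y₂') :
    v.RedPt W W' (.some x₁ y₁ h₁ + .some x₂ y₂ h₂) (.some x₁' y₁' h₁' + .some x₂' y₂' h₂') := by
  have hn₂ := hW.negY hx₂ hy₂
  have hD := hy₁.sub hn₂
  have hN := ((((((hx₁.pow 2).add (hx₁.mul hx₂)).add (hx₂.pow 2)).add
    (hW.a₂.mul (hx₁.add hx₂))).add hW.a₄).sub (hW.a₁.mul hy₁))
  by_cases hxy' : x₁' = x₂' ∧ y₁' = W'.negY x₂' y₂'
  · rw [Point.add_of_Y_eq hxy'.1 hxy'.2]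
    by_cases hxy : x₁ = x₂ ∧ y₁ = W.negY x₂ y₂
    · rw [Point.add_of_Y_eq hxy.1 hxy.2]
      exact .zero
    -- If the sum of the points had regular coordinates, then the slope would be regular too, and the
    -- two equations for the slope would make the reduced point singular.
    rw [Point.add_some hxy]
    refine .pole _ fun hmem => ?_
    obtain ⟨e1, e2⟩ := slope_mul_eq h₁.1 h₂.1 hxy
    set l := W.slope x₁ x₂ y₁ y₂ with hl
    have hlm : l ∈ v.ring := by
      refine mem_of_quadratic (c := W.a₁) (d := W.addX x₁ x₂ l + W.a₂ + x₁ + x₂) hW.a₁.mem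
        (add_mem (add_mem (add_mem hmem hW.a₂.mem) hx₁.mem) hx₂.mem) ?_
      simp only [WeierstrassCurve.Affine.addX]
      ring
    obtain ⟨l', hl'⟩ := exists_red hlm
    have e1' := (hl'.mul hD).unique (e1 ▸ hN)
    have e2' := (hl'.mul (hx₁.sub hx₂)).unique (e2 ▸ (hy₁.sub hy₂))
    obtain ⟨hx', hy'⟩ := hxy'
    rw [hx', sub_self, mul_zero] at e2'
    have hyy : y₁' = y₂' := (sub_eq_zero.1 e2'.symm)
    rw [hy', sub_self, mul_zero] at e1'
    rw [nonsingular_iff] at h₁'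
    rcases h₁'.2 with h | h
    · apply h
      subst hx'
      linear_combination e1' + W'.a₁ * hy'
    · apply h
      subst hx'
      rw [← hyy] at hy'
      exact hy'
  · have hxy : ¬(x₁ = x₂ ∧ y₁ = W.negY x₂ y₂) := by
      rintro ⟨rfl, rfl⟩
      exact hxy' ⟨hx₁.unique hx₂, hy₁.unique hn₂⟩
    obtain ⟨e1, e2⟩ := slope_mul_eq h₁.1 h₂.1 hxy
    obtain ⟨e1', e2'⟩ := slope_mul_eq h₁'.1 h₂'.1 hxy'
    have hl : v.Red (W.slope x₁ x₂ y₁ y₂) (W'.slope x₁' x₂' y₁' y₂') := by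
      by_cases hx' : x₁' = x₂'
      · have hd' : y₁' - W'.negY x₂' y₂' ≠ 0 := sub_ne_zero.2 fun h => hxy' ⟨hx', h⟩
        rw [← eq_div_iff (hD.ne_zero hd')] at e1
        rw [← eq_div_iff hd'] at e1'
        rw [e1, e1']
        exact hN.div hD hd'
      · have hd' : x₁' - x₂' ≠ 0 := sub_ne_zero.2 hx'
        rw [← eq_div_iff ((hx₁.sub hx₂).ne_zero hd')] at e2
        rw [← eq_div_iff hd'] at e2'
        rw [e2, e2']
        exact (hy₁.sub hy₂).div (hx₁.sub hx₂) hd'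
    rw [Point.add_some hxy, Point.add_some hxy']
    exact .some _ _ (hW.addX hx₁ hx₂ hl) (hW.addY hx₁ hx₂ hy₁ hl)

/-- A point in the kernel of reduction, in terms of the parameter `t = x / y` at infinity. -/
lemma RedCurve.exists_param (hW : v.RedCurve W W') {x y : F} (h : W.Equation x y)
    (hx : x ∉ v.ring) : ∃ t α : F, t ≠ 0 ∧ v.Red t 0 ∧ v.Red α 1 ∧ x = α / t ^ 2 ∧ y = α / t ^ 3 := by
  rw [equation_iff] at h
  have hx0 : x ≠ 0 := by rintro rfl; exact hx (zero_mem _)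
  have hz := red_inv_of_notMem hx
  set z := x⁻¹ with hzdef
  have hxz : x * z = 1 := mul_inv_cancel₀ hx0
  set s := y * z with hs
  have hys : y = s * x := by rw [hs]; linear_combination (-y) * hxz
  have e : s ^ 2 + W.a₁ * s + W.a₃ * (s * z) = x + W.a₂ + W.a₄ * z + W.a₆ * z ^ 2 := by
    rw [hs]
    linear_combination z ^ 2 * h + (x ^ 2 * z - W.a₁ * y * z + x + W.a₂ * x * z + W.a₂ + W.a₄ * z) * hxz
  have hsm : s ∉ v.ring := by
    intro hsm
    apply hx
    obtain ⟨s', hs'⟩ := exists_red hsm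
    have e' : x = s ^ 2 + W.a₁ * s + W.a₃ * (s * z) - (W.a₂ + W.a₄ * z + W.a₆ * z ^ 2) := by
      linear_combination -e
    rw [e']
    exact ((((hs'.pow 2).add (hW.a₁.mul hs')).add (hW.a₃.mul (hs'.mul hz))).sub
      ((hW.a₂.add (hW.a₄.mul hz)).add (hW.a₆.mul (hz.pow 2)))).mem
  have ht := red_inv_of_notMem hsm
  have hs0 : s ≠ 0 := by intro h0; rw [h0] at hsm; exact hsm (zero_mem _)
  set t := s⁻¹ with htdef
  have hst : s * t = 1 := mul_inv_cancel₀ hs0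
  have ht0 : t ≠ 0 := inv_ne_zero hs0
  refine ⟨t, x * t ^ 2, ht0, ht, ?_, by field_simp, ?_⟩
  · have e' : x * t ^ 2 = 1 + W.a₁ * t + W.a₃ * (z * t) -
        (W.a₂ + W.a₄ * z + W.a₆ * z ^ 2) * t ^ 2 := by
      linear_combination (-t ^ 2) * e + (s * t + 1 + W.a₁ * t + W.a₃ * z * t) * hst
    rw [e']
    have := ((red_one.add (hW.a₁.mul ht)).add (hW.a₃.mul (hz.mul ht))).sub
      (((hW.a₂.add (hW.a₄.mul hz)).add (hW.a₆.mul (hz.pow 2))).mul (ht.pow 2))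
    simpa using this
  · rw [hys, eq_div_iff (pow_ne_zero 3 ht0)]
    linear_combination (x * t ^ 2) * hst

/-- The sum of a point in the kernel of reduction and a point with regular coordinates has regular
coordinates. -/
lemma RedCurve.add_pole_int (hW : v.RedCurve W W') {x₁ y₁ x₂ y₂ : F} {x₂' y₂' : κ}
    (h₁ : W.Nonsingular x₁ y₁) (h₂ : W.Nonsingular x₂ y₂) (hx₁ : x₁ ∉ v.ring)
    (hx₂ : v.Red x₂ x₂') (hy₂ : v.Red y₂ y₂') :
    ∃ x₃ y₃ h₃, x₃ ∈ v.ring ∧ Point.some x₁ y₁ h₁ + .some x₂ y₂ h₂ = .some x₃ y₃ h₃ := by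
  have hx : x₁ ≠ x₂ := by rintro rfl; exact hx₁ hx₂.mem
  rw [Point.add_of_X_ne hx]
  refine ⟨_, _, _, ?_, rfl⟩
  obtain ⟨t, α, ht0, ht, hα, rfl, rfl⟩ := hW.exists_param h₁.1 hx₁
  have hE := h₁.1
  rw [equation_iff] at hE
  field_simp at hE
  have hd := hα.sub (hx₂.mul (ht.pow 2))
  have hd0 : α - x₂ * t ^ 2 ≠ 0 := hd.ne_zero (by simp)
  set M := -W.a₃ * α * t + W.a₂ * α ^ 2 + W.a₄ * α * t ^ 2 + W.a₆ * t ^ 4 - 2 * α * y₂ * t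
    + y₂ ^ 2 * t ^ 4 - W.a₁ * α * x₂ * t - W.a₁ * α * y₂ * t ^ 2 + W.a₁ * x₂ * y₂ * t ^ 4
    - (W.a₂ + x₂) * (α - x₂ * t ^ 2) ^ 2 + 2 * α ^ 2 * x₂ - α * x₂ ^ 2 * t ^ 2 with hM
  have hMm : M ∈ v.ring := by
    have m1 := hW.a₁.mem
    have m2 := hW.a₂.mem
    have m3 := hW.a₃.mem
    have m4 := hW.a₄.mem
    have m6 := hW.a₆.mem
    have mα := hα.mem
    have mt := ht.mem
    have mx := hx₂.mem
    have my := hy₂.mem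
    have e2 : (2 : F) ∈ v.ring := (red_ofNat (v := v) 2).mem
    rw [hM]
    repeat' first
      | assumption
      | apply sub_mem
      | apply add_mem
      | apply mul_mem
      | apply pow_mem
      | apply neg_mem
  have key : W.addX (α / t ^ 2) x₂ (W.slope (α / t ^ 2) x₂ (α / t ^ 3) y₂) =
      M / (α - x₂ * t ^ 2) ^ 2 := by
    have hd' : α / t ^ 2 - x₂ ≠ 0 := sub_ne_zero.2 hx
    have hsl : W.slope (α / t ^ 2) x₂ (α / t ^ 3) y₂ = (α - y₂ * t ^ 3) / (t * (α - x₂ * t ^ 2)) := by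
      rw [slope_of_X_ne hx, div_eq_div_iff hd' (mul_ne_zero ht0 hd0)]
      field_simp
    rw [hsl, WeierstrassCurve.Affine.addX, eq_div_iff (pow_ne_zero 2 hd0)]
    have gen (A d : F) (hd : d ≠ 0) : (A / (t * d)) ^ 2 * d ^ 2 = A ^ 2 / t ^ 2 ∧
        A / (t * d) * d = A / t := by
      constructor <;> field_simp
    obtain ⟨e, e'⟩ := gen (α - y₂ * t ^ 3) _ hd0
    have e3 : ((α - y₂ * t ^ 3) / (t * (α - x₂ * t ^ 2))) ^ 2 * (α - x₂ * t ^ 2) ^ 2 +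
        W.a₁ * ((α - y₂ * t ^ 3) / (t * (α - x₂ * t ^ 2)) * (α - x₂ * t ^ 2)) * (α - x₂ * t ^ 2) -
        (W.a₂ + α / t ^ 2 + x₂) * (α - x₂ * t ^ 2) ^ 2 = M := by
      rw [e, e', hM]
      generalize W.a₁ = a₁ at *
      generalize W.a₂ = a₂ at *
      clear e e' hMm hsl hM hd' gen
      field_simp
      grind
    linear_combination e3
  rw [key]
  obtain ⟨M', hM'⟩ := exists_red hMm
  exact (hM'.div (hd.pow 2) (by simp)).mem

lemma RedCurve.add_pole_int' [W'.IsElliptic] (hW : v.RedCurve W W') {x₁ y₁ x₂ y₂ : F} {x₂' y₂' : κ}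
    (h₁ : W.Nonsingular x₁ y₁) (h₂ : W.Nonsingular x₂ y₂) (hx₁ : x₁ ∉ v.ring)
    (h₂' : W'.Nonsingular x₂' y₂') (hx₂ : v.Red x₂ x₂') (hy₂ : v.Red y₂ y₂') :
    v.RedPt W W' (.some x₁ y₁ h₁ + .some x₂ y₂ h₂) (.some x₂' y₂' h₂') := by
  obtain ⟨x₃, y₃, h₃, hx₃, e⟩ := hW.add_pole_int h₁ h₂ hx₁ hx₂ hy₂
  obtain ⟨x₃', hx₃'⟩ := exists_red hx₃
  obtain ⟨y₃', hy₃'⟩ := exists_red (hW.y_mem h₃.1 hx₃)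
  rw [e]
  have h₃' : W'.Equation x₃' y₃' := hW.equation h₃.1 hx₃' hy₃'
  have hs := equation_iff_nonsingular.1 h₃'
  -- the difference of the sum and the regular point has a pole, so the reductions agree
  have h := hW.add_int h₃ ((nonsingular_neg ..).2 h₂) hs ((nonsingular_neg ..).2 h₂') hx₃' hy₃' hx₂
    (hW.negY hx₂ hy₂)
  rw [← Point.neg_some h₂, ← Point.neg_some h₂', ← e, add_neg_cancel_right] at h
  have h0 := h.unique (.pole h₁ hx₁)
  rw [← sub_eq_add_neg, sub_eq_zero] at h0
  rw [← h0]
  exact .some _ _ hx₃' hy₃'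

lemma RedPt.add [W'.IsElliptic] (hW : v.RedCurve W W') {P Q : W.Point} {P' Q' : W'.Point}
    (hP : v.RedPt W W' P P') (hQ : v.RedPt W W' Q Q') : v.RedPt W W' (P + Q) (P' + Q') := by
  cases hP with
  | zero => simpa using hQ
  | some h₁ h₁' hx₁ hy₁ =>
    cases hQ with
    | zero => exact .some h₁ h₁' hx₁ hy₁
    | some h₂ h₂' hx₂ hy₂ => exact hW.add_int h₁ h₂ h₁' h₂' hx₁ hy₁ hx₂ hy₂
    | pole h₂ hx₂ =>
      rw [add_comm, add_zero]
      exact hW.add_pole_int' h₂ h₁ hx₂ h₁' hx₁ hy₁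
  | pole h₁ hx₁ =>
    cases hQ with
    | zero => exact .pole h₁ hx₁
    | some h₂ h₂' hx₂ hy₂ =>
      rw [zero_add]
      exact hW.add_pole_int' h₁ h₂ hx₁ h₂' hx₂ hy₂
    | pole h₂ hx₂ =>
      rw [add_zero]
      obtain ⟨R', hR⟩ := hW.exists_redPt (.some _ _ h₁ + .some _ _ h₂)
      generalize hR0 : Point.some _ _ h₁ + .some _ _ h₂ = R at hR
      cases hR with
      | zero => exact .zero
      | pole h hx => exact .pole h hx
      | some h h' hx hy =>
        -- a regular sum would make the second point regular
        have h3 := hW.add_pole_int' ((nonsingular_neg ..).2 h₁) h hx₁ h' hx hy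
        rw [← Point.neg_some h₁, ← hR0, neg_add_cancel_left] at h3
        exact absurd (h3.unique (.pole h₂ hx₂)) (Point.some_ne_zero h')

/-- The reduction homomorphism at a place, for a curve with smooth reduction. -/
def RedCurve.hom [W'.IsElliptic] (hW : v.RedCurve W W') : W.Point →+ W'.Point :=
  AddMonoidHom.mk' (fun P => (hW.exists_redPt P).choose) fun P Q =>
    (hW.exists_redPt (P + Q)).choose_spec.unique
      ((hW.exists_redPt P).choose_spec.add hW (hW.exists_redPt Q).choose_spec)

lemma RedCurve.redPt_hom [W'.IsElliptic] (hW : v.RedCurve W W') (P : W.Point) :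
    v.RedPt W W' P (hW.hom P) :=
  (hW.exists_redPt P).choose_spec

lemma RedCurve.hom_eq [W'.IsElliptic] (hW : v.RedCurve W W') {P : W.Point} {P' : W'.Point}
    (h : v.RedPt W W' P P') : hW.hom P = P' :=
  (hW.redPt_hom P).unique h

end Place
end

/-! ### The coordinate ring of an elliptic curve is a Dedekind domain -/

noncomputable section
namespace CurveRing
open scoped Classical
open WeierstrassCurve WeierstrassCurve.Affine WeierstrassCurve.Affine.CoordinateRing WeilPairing
variable {k : Type*} [Field k] {W : Affine k}

/-- The coordinate function `x` in the coordinate ring. -/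
def xR (W : Affine k) : W.CoordinateRing := mk W (C X)
/-- The coordinate function `y` in the coordinate ring. -/
def yR (W : Affine k) : W.CoordinateRing := mk W X

lemma algebraMap_eq_mk (c : k) : algebraMap k W.CoordinateRing c = mk W (C (C c)) := rfl

lemma algebraMap_poly_eq (p : k[X]) : algebraMap k[X] W.CoordinateRing p = aeval (xR W) p := by
  induction p using Polynomial.induction_on' with
  | add p q hp hq => rw [map_add, map_add, hp, hq]
  | monomial n a =>
    rw [aeval_monomial, ← C_mul_X_pow_eq_monomial, map_mul, map_pow]
    rfl

lemma exists_eq (f : W.CoordinateRing) :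
    ∃ p q : k[X], f = aeval (xR W) p + aeval (xR W) q * yR W := by
  obtain ⟨p, q, rfl⟩ := exists_smul_basis_eq f
  refine ⟨p, q, ?_⟩
  rw [Algebra.smul_def, Algebra.smul_def, algebraMap_poly_eq, algebraMap_poly_eq, mul_one]
  rfl

lemma equation_xR_yR : yR W ^ 2 + algebraMap k _ W.a₁ * xR W * yR W + algebraMap k _ W.a₃ * yR W =
    xR W ^ 3 + algebraMap k _ W.a₂ * xR W ^ 2 + algebraMap k _ W.a₄ * xR W + algebraMap k _ W.a₆ := by
  simp only [xR, yR, algebraMap_eq_mk, ← map_pow, ← map_mul, ← map_add]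
  rw [AdjoinRoot.mk_eq_mk]
  refine ⟨1, ?_⟩
  rw [polynomial]
  simp only [map_mul, map_add, map_pow]
  ring

section Lift
variable {A : Type*} [CommRing A] [Algebra k A]

lemma eval₂_polynomial {x y : A}
    (h : y ^ 2 + algebraMap k A W.a₁ * x * y + algebraMap k A W.a₃ * y =
      x ^ 3 + algebraMap k A W.a₂ * x ^ 2 + algebraMap k A W.a₄ * x + algebraMap k A W.a₆) :
    W.polynomial.eval₂ (aeval x : k[X] →ₐ[k] A).toRingHom y = 0 := by
  rw [polynomial]
  simp only [eval₂_add, eval₂_sub, eval₂_mul, eval₂_pow, eval₂_X, eval₂_C]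
  simp only [AlgHom.toRingHom_eq_coe, RingHom.coe_coe, map_add, map_mul, map_pow, aeval_X, aeval_C]
  linear_combination h

/-- The homomorphism from the coordinate ring to an algebra given by a point with coordinates in
the algebra. -/
def liftHom (W : Affine k) (x y : A)
    (h : y ^ 2 + algebraMap k A W.a₁ * x * y + algebraMap k A W.a₃ * y =
      x ^ 3 + algebraMap k A W.a₂ * x ^ 2 + algebraMap k A W.a₄ * x + algebraMap k A W.a₆) :
    W.CoordinateRing →ₐ[k] A where
  toRingHom := AdjoinRoot.lift (aeval x : k[X] →ₐ[k] A).toRingHom y (eval₂_polynomial h)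
  commutes' c := by
    have : algebraMap k W.CoordinateRing c = AdjoinRoot.of _ (C c) := rfl
    rw [this]
    simp

variable {x y : A}
    (h : y ^ 2 + algebraMap k A W.a₁ * x * y + algebraMap k A W.a₃ * y =
      x ^ 3 + algebraMap k A W.a₂ * x ^ 2 + algebraMap k A W.a₄ * x + algebraMap k A W.a₆)

@[simp] lemma liftHom_xR : liftHom W x y h (xR W) = x := by
  refine (AdjoinRoot.lift_mk (eval₂_polynomial h) _).trans ?_
  simp

@[simp] lemma liftHom_yR : liftHom W x y h (yR W) = y := by
  refine (AdjoinRoot.lift_mk (eval₂_polynomial h) _).trans ?_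
  simp

@[simp] lemma liftHom_aeval (p : k[X]) : liftHom W x y h (aeval (xR W) p) = aeval x p := by
  rw [← aeval_algHom_apply, liftHom_xR]

lemma algHom_ext {B : Type*} [CommRing B] [Algebra k B] {f g : W.CoordinateRing →ₐ[k] B}
    (hx : f (xR W) = g (xR W)) (hy : f (yR W) = g (yR W)) : f = g := by
  refine AlgHom.ext fun a => ?_
  obtain ⟨p, q, rfl⟩ := exists_eq a
  rw [map_add, map_add, map_mul, map_mul, hy, ← aeval_algHom_apply, ← aeval_algHom_apply,
    ← aeval_algHom_apply, ← aeval_algHom_apply, hx]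

end Lift

section Eval
variable {x y : k} (h : W.Nonsingular x y)

/-- Evaluation of regular functions at a point. -/
def evalHom (h : W.Equation x y) : W.CoordinateRing →ₐ[k] k :=
  liftHom W x y (by simpa using (equation_iff ..).1 h)

@[simp] lemma evalHom_xR (h : W.Equation x y) : evalHom h (xR W) = x := liftHom_xR _

@[simp] lemma evalHom_yR (h : W.Equation x y) : evalHom h (yR W) = y := liftHom_yR _

@[simp] lemma evalHom_aeval (h : W.Equation x y) (p : k[X]) :
    evalHom h (aeval (xR W) p) = p.eval x := liftHom_aeval _ p

lemma evalAt_some (f : W.CoordinateRing) : evalAt W f (.some x y h) = evalHom h.1 f := by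
  obtain ⟨f, rfl⟩ := AdjoinRoot.mk_surjective f
  rfl

lemma XClass_eq (x : k) : XClass W x = xR W - algebraMap k _ x := by
  rw [XClass, xR, algebraMap_eq_mk, ← map_sub, ← C_sub]

lemma YClass_eq (y : k) : YClass W (C y) = yR W - algebraMap k _ y := by
  rw [YClass, yR, algebraMap_eq_mk, ← map_sub]

lemma pointIdeal_some : pointIdeal W (.some x y h) =
    Ideal.span {xR W - algebraMap k _ x, yR W - algebraMap k _ y} := by
  rw [← XClass_eq, ← YClass_eq]; rfl

lemma sub_eval_mem (f : W.CoordinateRing) :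
    f - algebraMap k _ (evalHom h.1 f) ∈ pointIdeal W (.some x y h) := by
  obtain ⟨p, q, rfl⟩ := exists_eq f
  have hx : xR W - algebraMap k _ x ∈ pointIdeal W (.some x y h) := by
    rw [pointIdeal_some]; exact Ideal.subset_span (by simp)
  have hy : yR W - algebraMap k _ y ∈ pointIdeal W (.some x y h) := by
    rw [pointIdeal_some]; exact Ideal.subset_span (by simp)
  have hp (p : k[X]) : aeval (xR W) p - algebraMap k _ (p.eval x) ∈
      pointIdeal W (.some x y h) := by
    obtain ⟨r, hr⟩ := X_sub_C_dvd_sub_C_eval (a := x) (p := p)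
    have := congrArg (aeval (xR W)) hr
    simp only [map_sub, map_mul, aeval_X, aeval_C] at this
    rw [this]
    exact Ideal.mul_mem_right _ _ hx
  have e : aeval (xR W) p + aeval (xR W) q * yR W - algebraMap k _ (evalHom h.1
      (aeval (xR W) p + aeval (xR W) q * yR W)) = (aeval (xR W) p - algebraMap k _ (p.eval x)) +
      (yR W * (aeval (xR W) q - algebraMap k _ (q.eval x)) + algebraMap k _ (q.eval x) *
      (yR W - algebraMap k _ y)) := by
    simp
    ring
  rw [e]
  exact add_mem (hp p) (add_mem (Ideal.mul_mem_left _ _ (hp q)) (Ideal.mul_mem_left _ _ hy))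

lemma mem_pointIdeal_some {f : W.CoordinateRing} :
    f ∈ pointIdeal W (.some x y h) ↔ evalHom h.1 f = 0 := by
  constructor
  · intro hf
    have : pointIdeal W (.some x y h) ≤ RingHom.ker (evalHom h.1) := by
      rw [pointIdeal_some, Ideal.span_le]
      rintro _ (rfl | rfl) <;> simp [RingHom.mem_ker]
    exact this hf
  · intro hf
    have := sub_eval_mem h f
    rwa [hf, map_zero, sub_zero] at this

lemma mem_pointIdeal {P : W.Point} (hP : P ≠ 0) {f : W.CoordinateRing} :
    f ∈ pointIdeal W P ↔ evalAt W f P = 0 := by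
  rcases P with _ | ⟨x, y, h⟩
  · exact absurd rfl hP
  · rw [evalAt_some]; exact mem_pointIdeal_some h

lemma pointIdeal_zero : pointIdeal W 0 = ⊤ := rfl

lemma pointIdeal_some_eq_ker :
    pointIdeal W (.some x y h) = RingHom.ker (evalHom h.1) := by
  ext f
  exact mem_pointIdeal_some h

lemma isMaximal_pointIdeal {P : W.Point} (hP : P ≠ 0) : (pointIdeal W P).IsMaximal := by
  rcases P with _ | ⟨x, y, h⟩
  · exact absurd rfl hP
  · rw [pointIdeal_some_eq_ker]
    exact RingHom.ker_isMaximal_of_surjective _ fun c => ⟨_, (evalHom h.1).commutes c⟩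

lemma pointIdeal_ne_bot (P : W.Point) : pointIdeal W P ≠ ⊥ := by
  rcases P with _ | ⟨x, y, h⟩
  · exact top_ne_bot
  · intro h0
    have : XClass W x ∈ pointIdeal W (.some x y h) := Ideal.subset_span (by simp)
    rw [h0] at this
    exact XClass_ne_zero x this

lemma pointIdeal_injective : Function.Injective (pointIdeal W) := by
  intro P Q hPQ
  rcases P with _ | ⟨x, y, h⟩ <;> rcases Q with _ | ⟨x', y', h'⟩
  · rfl
  · exact absurd hPQ.symm (isMaximal_pointIdeal (Point.some_ne_zero h')).ne_top
  · exact absurd hPQ (isMaximal_pointIdeal (Point.some_ne_zero h)).ne_top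
  · have h1 : xR W - algebraMap k _ x ∈ pointIdeal W (.some x' y' h') := by
      rw [← hPQ, mem_pointIdeal_some]; simp
    have h2 : yR W - algebraMap k _ y ∈ pointIdeal W (.some x' y' h') := by
      rw [← hPQ, mem_pointIdeal_some]; simp
    rw [mem_pointIdeal_some] at h1 h2
    simp only [map_sub, evalHom_xR, evalHom_yR, AlgHom.commutes, Algebra.algebraMap_self, RingHom.id_apply] at h1 h2
    obtain rfl := sub_eq_zero.1 h1
    obtain rfl := sub_eq_zero.1 h2
    rfl

lemma pointIdeal_neg_mul :
    pointIdeal W (-.some x y h) * pointIdeal W (.some x y h) =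
      Ideal.span {xR W - algebraMap k _ x} := by
  rw [← XClass_eq]
  exact XYIdeal_neg_mul h

end Eval

instance : Algebra.FiniteType k W.CoordinateRing :=
  (inferInstance : Algebra.FiniteType k k[X]).trans
    (inferInstance : Algebra.FiniteType k[X] W.CoordinateRing)

instance : IsNoetherianRing W.CoordinateRing := Algebra.FiniteType.isNoetherianRing k _

/-- Nullstellensatz: every maximal ideal of the coordinate ring is the ideal of a point. -/
lemma exists_pointIdeal_eq [IsAlgClosed k] [W.IsElliptic] (I : Ideal W.CoordinateRing)
    [hI : I.IsMaximal] : ∃ P : W.Point, P ≠ 0 ∧ pointIdeal W P = I := by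
  let _ : Field (W.CoordinateRing ⧸ I) := Ideal.Quotient.field I
  have : Module.Finite k (W.CoordinateRing ⧸ I) := finite_of_finite_type_of_isJacobsonRing k _
  have hs := (IsAlgClosed.algebraMap_bijective_of_isIntegral (k := k)
    (K := W.CoordinateRing ⧸ I)).2
  obtain ⟨x, hx⟩ := hs (Ideal.Quotient.mk I (xR W))
  obtain ⟨y, hy⟩ := hs (Ideal.Quotient.mk I (yR W))
  have hc (c : k) : Ideal.Quotient.mk I (algebraMap k _ c) = algebraMap k _ c := rfl
  have heq : W.Equation x y := by
    rw [equation_iff]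
    have := congrArg (Ideal.Quotient.mk I) (equation_xR_yR (W := W))
    simp only [map_add, map_mul, map_pow, ← hx, ← hy, hc] at this
    apply (algebraMap k (W.CoordinateRing ⧸ I)).injective
    simpa only [map_add, map_mul, map_pow] using this
  have h := equation_iff_nonsingular.1 heq
  refine ⟨.some x y h, Point.some_ne_zero h, ?_⟩
  apply (isMaximal_pointIdeal (Point.some_ne_zero h)).eq_of_le hI.ne_top
  rw [pointIdeal_some, Ideal.span_le]
  rintro _ (rfl | rfl) <;>
  · rw [SetLike.mem_coe, ← Ideal.Quotient.eq_zero_iff_mem, map_sub, hc]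
    simp [hx, hy]

/-- A Noetherian domain whose maximal ideals are invertible is a Dedekind domain. By Noetherian
induction, every nonzero ideal `I` has a nonzero principal multiple: for a maximal ideal `M` that
contains `I`, the ideal `I M⁻¹` is strictly larger than `I`. -/
theorem isDedekindDomain_of_maximal {R : Type*} [CommRing R] [IsDomain R] [IsNoetherianRing R]
    (H : ∀ M : Ideal R, M.IsMaximal → ∃ (N : Ideal R) (t : R), t ≠ 0 ∧ N * M = Ideal.span {t}) :
    IsDedekindDomain R := by
  have main (I : Ideal R) : I ≠ ⊥ → ∃ (J : Ideal R) (s : R), s ≠ 0 ∧ I * J = Ideal.span {s} := by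
    induction I using IsNoetherian.induction with
    | _ I ih =>
    intro hI
    by_cases htop : I = ⊤
    · exact ⟨⊤, 1, one_ne_zero, by simp [htop]⟩
    obtain ⟨M, hM, hIM⟩ := Ideal.exists_le_maximal I htop
    obtain ⟨N, t, ht0, hN⟩ := H M hM
    obtain ⟨J, hJ⟩ : ∃ J : Ideal R, I * N = Ideal.span {t} * J := by
      have hle : I * N ≤ Ideal.span {t} := by
        rw [← hN, mul_comm N]
        exact Ideal.mul_mono_left hIM
      refine ⟨Submodule.comap (LinearMap.mulLeft R t) (I * N), le_antisymm (fun a ha => ?_) ?_⟩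
      · obtain ⟨b, rfl⟩ := Ideal.mem_span_singleton.1 (hle ha)
        exact Ideal.mul_mem_mul (Ideal.mem_span_singleton_self t) ha
      · rw [Ideal.mul_le]
        intro a ha b hb
        obtain ⟨c, rfl⟩ := Ideal.mem_span_singleton.1 ha
        have : t * c * b = c * (t * b) := by ring
        rw [this]
        exact Ideal.mul_mem_left _ _ hb
    have htN : t ∈ N := by
      have : t ∈ N * M := hN ▸ Ideal.mem_span_singleton_self t
      exact Ideal.mul_le_left this
    have hIJ : I ≤ J := by
      intro a ha
      have : t * a ∈ Ideal.span {t} * J := by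
        rw [← hJ, mul_comm t]
        exact Ideal.mul_mem_mul ha htN
      obtain ⟨b, hb, e⟩ := Ideal.mem_span_singleton_mul.1 this
      rwa [← mul_left_cancel₀ ht0 e]
    have hne : I ≠ J := by
      rintro rfl
      -- Nakayama: `I = I * M` is impossible
      have h1 : I * M = I := by
        apply (Ideal.span_singleton_mul_right_inj ht0).1
        rw [← mul_assoc, ← hJ, mul_assoc, hN]
        exact (mul_comm _ _).trans hJ.symm
      obtain ⟨r, hr1, hr2⟩ := Submodule.exists_sub_one_mem_and_smul_eq_zero_of_fg_of_le_smul M I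
        (IsNoetherian.noetherian I) (by rw [smul_eq_mul, mul_comm, h1])
      obtain ⟨a, ha, ha0⟩ := Submodule.exists_mem_ne_zero_of_ne_bot hI
      have := hr2 a ha
      rw [smul_eq_mul, mul_eq_zero, or_iff_left ha0] at this
      rw [this, zero_sub, neg_mem_iff] at hr1
      exact hM.ne_top ((Ideal.eq_top_iff_one _).2 hr1)
    obtain ⟨J', s, hs, hJ'⟩ :=
      ih J (lt_of_le_of_ne hIJ hne) (fun h => hI (le_bot_iff.1 (h ▸ hIJ)))
    refine ⟨N * J', t * s, mul_ne_zero ht0 hs, ?_⟩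
    rw [← mul_assoc, hJ, mul_assoc, hJ', Ideal.span_singleton_mul_span_singleton]
  rw [isDedekindDomain_iff_mul_inv_cancel (K := FractionRing R)]
  intro I hI
  rw [FractionalIdeal.mul_inv_cancel_iff]
  obtain ⟨a, J, ha, rfl⟩ := FractionalIdeal.exists_eq_spanSingleton_mul I
  have hJ : J ≠ ⊥ := by
    rintro rfl
    simp at hI
  obtain ⟨J', s, hs, h⟩ := main J hJ
  have hs' : algebraMap R (FractionRing R) s ≠ 0 := by simpa
  have ha' : algebraMap R (FractionRing R) a ≠ 0 := by simpa
  refine ⟨FractionalIdeal.spanSingleton _ (algebraMap _ _ a / algebraMap _ _ s) *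
    (J' : FractionalIdeal (nonZeroDivisors R) (FractionRing R)), ?_⟩
  rw [mul_mul_mul_comm, ← FractionalIdeal.coeIdeal_mul, h,
    FractionalIdeal.coeIdeal_span_singleton, FractionalIdeal.spanSingleton_mul_spanSingleton,
    FractionalIdeal.spanSingleton_mul_spanSingleton]
  rw [← FractionalIdeal.spanSingleton_one]
  congr 1
  field_simp

/-- The coordinate ring of an elliptic curve is a Dedekind domain. -/
instance [IsAlgClosed k] [W.IsElliptic] : IsDedekindDomain W.CoordinateRing := by
  refine isDedekindDomain_of_maximal fun M hM => ?_
  obtain ⟨P, hP, rfl⟩ := exists_pointIdeal_eq M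
  rcases P with _ | ⟨x, y, h⟩
  · exact absurd rfl hP
  · exact ⟨_, _, by rw [← XClass_eq]; exact XClass_ne_zero x, pointIdeal_neg_mul h⟩

end CurveRing
end

/-! ### The degree of the norm, the function field and its valuations -/

noncomputable section
namespace CurveRing
open scoped Classical WithZero
open WeierstrassCurve WeierstrassCurve.Affine WeierstrassCurve.Affine.CoordinateRing WeilPairing
open IsDedekindDomain
variable {k : Type*} [Field k] {W : Affine k}

/-- The degree of the norm of a regular function, which is the order of its pole at infinity. -/
def normDegree (f : W.CoordinateRing) : ℕ := (Algebra.norm k[X] f).natDegree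

lemma norm_ne_zero {f : W.CoordinateRing} (hf : f ≠ 0) : Algebra.norm k[X] f ≠ 0 :=
  (Algebra.norm_ne_zero_iff_of_basis (CoordinateRing.basis W)).2 hf

lemma normDegree_mul {f g : W.CoordinateRing} (hf : f ≠ 0) (hg : g ≠ 0) :
    normDegree (f * g) = normDegree f + normDegree g := by
  rw [normDegree, map_mul, natDegree_mul (norm_ne_zero hf) (norm_ne_zero hg)]; rfl

lemma normDegree_pow (f : W.CoordinateRing) (n : ℕ) : normDegree (f ^ n) = n * normDegree f := by
  rw [normDegree, map_pow, natDegree_pow]; rfl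

lemma smul_one_add_smul (p q : k[X]) :
    p • (1 : W.CoordinateRing) + q • mk W X = aeval (xR W) p + aeval (xR W) q * yR W := by
  rw [Algebra.smul_def, Algebra.smul_def, algebraMap_poly_eq, algebraMap_poly_eq, mul_one]
  rfl

lemma degree_norm_eq (p q : k[X]) :
    (Algebra.norm k[X] (aeval (xR W) p + aeval (xR W) q * yR W)).degree =
      max (2 • p.degree) (2 • q.degree + 3) := by
  rw [← smul_one_add_smul, degree_norm_smul_basis]

/-- The pole of `p (x) + q (x) y` at infinity, when `p (x)` has the larger one. -/
lemma normDegree_eq_left {p q : k[X]} (hp : p ≠ 0) (h : q = 0 ∨ q.natDegree + 1 < p.natDegree) :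
    normDegree (aeval (xR W) p + aeval (xR W) q * yR W) = 2 * p.natDegree := by
  rw [normDegree]
  apply natDegree_eq_of_degree_eq_some
  rw [degree_norm_eq]
  rcases h with rfl | h
  · simp [degree_eq_natDegree hp]
  · by_cases hq : q = 0
    · simp [hq, degree_eq_natDegree hp]
    rw [degree_eq_natDegree hp, degree_eq_natDegree hq]
    simp only [nsmul_eq_mul]
    rw [max_eq_left (by exact_mod_cast (by omega : 2 * q.natDegree + 3 ≤ 2 * p.natDegree))]
    norm_cast

/-- The pole of `p (x) + q (x) y` at infinity, when `q (x) y` has the larger one. -/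
lemma normDegree_eq_right {p q : k[X]} (hq : q ≠ 0) (h : p = 0 ∨ p.natDegree ≤ q.natDegree + 1) :
    normDegree (aeval (xR W) p + aeval (xR W) q * yR W) = 2 * q.natDegree + 3 := by
  rw [normDegree]
  apply natDegree_eq_of_degree_eq_some
  rw [degree_norm_eq]
  rcases h with rfl | h
  · simp [degree_eq_natDegree hq]
  · by_cases hp : p = 0
    · simp [hp, degree_eq_natDegree hq]
    rw [degree_eq_natDegree hp, degree_eq_natDegree hq]
    simp only [nsmul_eq_mul]
    rw [max_eq_right (by exact_mod_cast (by omega : 2 * p.natDegree ≤ 2 * q.natDegree + 3))]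
    norm_cast

lemma eq_const_of_normDegree_eq_zero {f : W.CoordinateRing} (hf : normDegree f = 0) :
    ∃ c : k, f = algebraMap k _ c := by
  obtain ⟨p, q, rfl⟩ := exists_eq f
  have hq : q = 0 := by
    by_contra hq
    by_cases h : p = 0 ∨ p.natDegree ≤ q.natDegree + 1
    · rw [normDegree_eq_right hq h] at hf
      omega
    · push Not at h
      rw [normDegree_eq_left h.1 (Or.inr h.2)] at hf
      omega
  subst hq
  by_cases hp : p = 0
  · exact ⟨0, by simp [hp]⟩
  · rw [normDegree_eq_left hp (Or.inl rfl)] at hf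
    refine ⟨p.coeff 0, ?_⟩
    rw [eq_C_of_natDegree_eq_zero (p := p) (by omega)]
    simp

lemma exists_const_of_isUnit {f : W.CoordinateRing} (hf : IsUnit f) :
    ∃ c : k, c ≠ 0 ∧ f = algebraMap k _ c := by
  obtain ⟨c, hc⟩ := eq_const_of_normDegree_eq_zero (f := f)
    (natDegree_eq_zero_of_isUnit (hf.map (Algebra.norm k[X])))
  refine ⟨c, ?_, hc⟩
  rintro rfl
  rw [map_zero] at hc
  exact hf.ne_zero hc

/-- The involution of the coordinate ring given by negation on the curve. -/
def conj (W : Affine k) : W.CoordinateRing →ₐ[k] W.CoordinateRing :=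
  liftHom W (xR W) (-yR W - algebraMap k _ W.a₁ * xR W - algebraMap k _ W.a₃) <| by
    linear_combination equation_xR_yR (W := W)

@[simp] lemma conj_xR : conj W (xR W) = xR W := liftHom_xR _

@[simp] lemma conj_yR : conj W (yR W) =
    -yR W - algebraMap k _ W.a₁ * xR W - algebraMap k _ W.a₃ := liftHom_yR _

@[simp] lemma conj_conj (f : W.CoordinateRing) : conj W (conj W f) = f := by
  have : (conj W).comp (conj W) = AlgHom.id k _ := by
    apply algHom_ext
    · simp
    · simp
      ring
  exact DFunLike.congr_fun this f

lemma mul_conj (f : W.CoordinateRing) :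
    f * conj W f = algebraMap k[X] _ (Algebra.norm k[X] f) := by
  obtain ⟨p, q, rfl⟩ := exists_smul_basis_eq f
  rw [norm_smul_basis]
  have e := equation_xR_yR (W := W)
  simp only [smul_one_add_smul, map_add, map_mul, conj_yR, ← aeval_algHom_apply, conj_xR,
    algebraMap_poly_eq, map_sub, map_pow, aeval_X, aeval_C]
  linear_combination - aeval (xR W) q ^ 2 * e

lemma normDegree_conj (f : W.CoordinateRing) : normDegree (conj W f) = normDegree f := by
  have h1 := mul_conj f
  have h2 := mul_conj (conj W f)
  rw [conj_conj, mul_comm, h1] at h2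
  rw [normDegree, FaithfulSMul.algebraMap_injective k[X] W.CoordinateRing h2.symm]
  rfl

lemma normDegree_x_sub (c : k) : normDegree (xR W - algebraMap k _ c) = 2 := by
  have : xR W - algebraMap k _ c = aeval (xR W) (X - C c) + aeval (xR W) (0 : k[X]) * yR W := by
    simp
  rw [this, normDegree_eq_left (X_sub_C_ne_zero c) (Or.inl rfl)]
  simp

lemma span_conj_eq {P : W.Point} {n : ℕ} {f : W.CoordinateRing}
    (h : Ideal.span {f} = pointIdeal W P ^ n) : Ideal.span {conj W f} = pointIdeal W (-P) ^ n := by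
  have h1 := congrArg (Ideal.map (conj W)) h
  rw [Ideal.map_span, Set.image_singleton, Ideal.map_pow] at h1
  rw [h1]
  congr 1
  rcases P with _ | ⟨x, y, hxy⟩
  · exact Ideal.map_top _
  rw [Point.neg_some, pointIdeal_some, pointIdeal_some, Ideal.map_span, Set.image_pair]
  simp only [map_sub, conj_xR, conj_yR, AlgHom.commutes]
  have e : -yR W - algebraMap k _ W.a₁ * xR W - algebraMap k _ W.a₃ - algebraMap k _ y =
      -(yR W - algebraMap k _ (W.negY x y)) +
      (xR W - algebraMap k _ x) * (-algebraMap k _ W.a₁) := by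
    simp only [WeierstrassCurve.Affine.negY, map_sub, map_neg, map_mul]
    ring
  rw [e, Ideal.span_pair_add_left_mul, Ideal.span_insert, Ideal.span_insert,
    Ideal.span_singleton_neg]

lemma normDegree_eq_of_span {P : W.Point} {n : ℕ} {f : W.CoordinateRing} (hP : P ≠ 0)
    (h : Ideal.span {f} = pointIdeal W P ^ n) : normDegree f = n := by
  have h' := span_conj_eq h
  rcases P with _ | ⟨x, y, hxy⟩
  · exact absurd rfl hP
  have hf0 : f ≠ 0 := by
    rintro rfl
    rw [Ideal.span_singleton_eq_bot.2 rfl] at h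
    exact pow_ne_zero n (pointIdeal_ne_bot _) h.symm
  have hf0' : conj W f ≠ 0 := by
    intro h0
    apply hf0
    rw [← conj_conj f, h0, map_zero]
  have h2 : Ideal.span {conj W f * f} = Ideal.span {(xR W - algebraMap k _ x) ^ n} := by
    rw [← Ideal.span_singleton_mul_span_singleton, h, h', ← mul_pow, pointIdeal_neg_mul,
      Ideal.span_singleton_pow]
  obtain ⟨u, hu⟩ := Ideal.span_singleton_eq_span_singleton.1 h2
  have h3 := congrArg normDegree hu
  rw [normDegree_mul (mul_ne_zero hf0' hf0) u.ne_zero, normDegree_mul hf0' hf0, normDegree_conj,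
    normDegree_pow, normDegree_x_sub] at h3
  have h4 : normDegree (u : W.CoordinateRing) = 0 :=
    natDegree_eq_zero_of_isUnit (u.isUnit.map (Algebra.norm k[X]))
  omega

/-- The function field of the curve. It is a definition of its own, so that its structures as an
algebra over `k` and over the coordinate ring are the ones declared here. -/
def FF (W : Affine k) := W.FunctionField

instance : Field (FF W) := inferInstanceAs (Field W.FunctionField)
instance : Algebra W.CoordinateRing (FF W) :=
  inferInstanceAs (Algebra W.CoordinateRing W.FunctionField)
instance : IsFractionRing W.CoordinateRing (FF W) :=
  inferInstanceAs (IsFractionRing W.CoordinateRing W.FunctionField)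
instance : Algebra k (FF W) := inferInstanceAs (Algebra k W.FunctionField)
instance : IsScalarTower k W.CoordinateRing (FF W) :=
  inferInstanceAs (IsScalarTower k W.CoordinateRing W.FunctionField)

lemma FF.hom_ext {B : Type*} [Field B] [Algebra k B] {f g : FF W →ₐ[k] B}
    (hx : f (algebraMap _ _ (xR W)) = g (algebraMap _ _ (xR W)))
    (hy : f (algebraMap _ _ (yR W)) = g (algebraMap _ _ (yR W))) : f = g := by
  have h : (f.comp (Algebra.algHom k W.CoordinateRing (FF W))) =
      (g.comp (Algebra.algHom k W.CoordinateRing (FF W))) := algHom_ext hx hy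
  refine AlgHom.ext fun a => ?_
  obtain ⟨a, b, hb, rfl⟩ := IsFractionRing.div_surjective (A := W.CoordinateRing) a
  rw [map_div₀, map_div₀]
  have h1 := DFunLike.congr_fun h a
  have h2 := DFunLike.congr_fun h b
  exact congrArg₂ (· / ·) h1 h2

section Val
variable [IsAlgClosed k] [W.IsElliptic]

/-- The prime of the coordinate ring at a point of the affine curve. -/
def prime {P : W.Point} (hP : P ≠ 0) : HeightOneSpectrum W.CoordinateRing :=
  ⟨pointIdeal W P, (isMaximal_pointIdeal hP).isPrime, pointIdeal_ne_bot P⟩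

/-- The normalized valuation of the function field at a point of the affine curve. -/
def val {P : W.Point} (hP : P ≠ 0) : Valuation (FF W) ℤᵐ⁰ := (prime hP).valuation (FF W)

lemma val_const {P : W.Point} (hP : P ≠ 0) {c : k} (hc : c ≠ 0) :
    val hP (algebraMap k _ c) = 1 := by
  rw [IsScalarTower.algebraMap_apply k W.CoordinateRing, val,
    HeightOneSpectrum.valuation_eq_one_iff_notMem]
  intro h
  exact (isMaximal_pointIdeal hP).ne_top (Ideal.eq_top_of_isUnit_mem _ h
    ((isUnit_iff_ne_zero.2 hc).map (algebraMap k W.CoordinateRing)))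

/-- A function without zeros and poles on the affine curve is constant. -/
lemma exists_const_of_val {f : FF W} (h : ∀ (P : W.Point) (hP : P ≠ 0), val hP f = 1) :
    ∃ c : k, c ≠ 0 ∧ f = algebraMap k _ c := by
  have key (g : FF W) (hg : ∀ (P : W.Point) (hP : P ≠ 0), val hP g ≤ 1) :
      g ∈ (algebraMap W.CoordinateRing (FF W)).range := by
    refine HeightOneSpectrum.mem_integers_of_valuation_le_one _ g fun v => ?_
    have := v.isMaximal
    obtain ⟨P, hP, e⟩ := exists_pointIdeal_eq v.asIdeal
    have : v = prime hP := HeightOneSpectrum.ext e.symm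
    rw [this]
    exact hg P hP
  obtain ⟨a, ha⟩ := key f fun P hP => (h P hP).le
  obtain ⟨b, hb⟩ := key f⁻¹ fun P hP => by rw [map_inv₀, h P hP, inv_one]
  have hab : a * b = 1 := by
    apply IsFractionRing.injective W.CoordinateRing (FF W)
    rw [map_mul, ha, hb, map_one]
    apply mul_inv_cancel₀
    rintro rfl
    obtain ⟨P, hP, -⟩ := exists_pointIdeal_eq (W := W) (Classical.choose
      (Ideal.exists_maximal W.CoordinateRing)) (hI := Classical.choose_spec
      (Ideal.exists_maximal W.CoordinateRing))
    simpa using h P hP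
  obtain ⟨c, hc, rfl⟩ := exists_const_of_isUnit (IsUnit.of_mul_eq_one b hab)
  exact ⟨c, hc, by rw [← ha, ← IsScalarTower.algebraMap_apply]⟩

end Val

end CurveRing
end

/-! ### The places of the function field and the generic point -/

noncomputable section
namespace CurveRing
open scoped Classical WithZero
open WeierstrassCurve WeierstrassCurve.Affine WeierstrassCurve.Affine.CoordinateRing WeilPairing
open IsDedekindDomain
variable {k : Type*} [Field k] {W : Affine k}

/-- A nonzero regular function has finitely many zeros. -/
lemma finite_zeros {f : W.CoordinateRing} (hf : f ≠ 0) :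
    {P : W.Point | P ≠ 0 ∧ evalAt W f P = 0}.Finite := by
  set p := Algebra.norm k[X] f with hp
  have hp0 : p ≠ 0 := norm_ne_zero hf
  have key : ∀ (x y : k) (h : W.Nonsingular x y), evalHom h.1 f = 0 → x ∈ p.roots.toFinset := by
    intro x y h h0
    have := congrArg (evalHom h.1) (mul_conj f)
    rw [map_mul, h0, zero_mul, algebraMap_poly_eq, evalHom_aeval] at this
    rw [Multiset.mem_toFinset, mem_roots hp0]
    exact this.symm
  have hfin : ({z : k × k | z.1 ∈ p.roots.toFinset ∧ W.Equation z.1 z.2}).Finite := by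
    refine (p.roots.toFinset.finite_toSet.biUnion (t := fun x => (fun y => (x, y)) ''
      {y | W.Equation x y}) fun x _ => ?_).subset ?_
    · apply Set.Finite.image
      have hm : (W.polynomial.map (evalRingHom x)) ≠ 0 :=
        (Monic.map _ monic_polynomial).ne_zero
      refine (W.polynomial.map (evalRingHom x)).roots.toFinset.finite_toSet.subset ?_
      intro y hy
      simp only [Finset.mem_coe, Multiset.mem_toFinset]
      rw [mem_roots hm, IsRoot, eval_map, eval₂_evalRingHom]
      exact hy
    · rintro ⟨x, y⟩ ⟨h1, h2⟩
      exact Set.mem_biUnion (Finset.mem_coe.2 h1) ⟨y, h2, rfl⟩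
  refine Set.Finite.of_finite_image (f := fun P : W.Point => match P with
    | .zero => ((0 : k), (0 : k))
    | .some x y _ => (x, y)) (hfin.subset ?_) ?_
  · rintro _ ⟨P, ⟨hP, h0⟩, rfl⟩
    rcases P with _ | ⟨x, y, h⟩
    · exact absurd rfl hP
    · rw [evalAt_some] at h0
      exact ⟨key x y h h0, h.1⟩
  · rintro P ⟨hP, -⟩ Q ⟨hQ, -⟩ hPQ
    rcases P with _ | ⟨x, y, h⟩
    · exact absurd rfl hP
    rcases Q with _ | ⟨x', y', h'⟩
    · exact absurd rfl hQ
    obtain ⟨rfl, rfl⟩ := Prod.mk_inj.1 hPQ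
    rfl

section Place
variable [IsAlgClosed k] [W.IsElliptic]

lemma infinite_point : (Set.univ : Set W.Point).Infinite := by
  intro hfin
  have : Set.univ ⊆ (fun P : W.Point => match P with
    | .zero => (0 : k)
    | .some x _ _ => x) '' Set.univ := by
    intro x _
    obtain ⟨y, h⟩ := TorsionCount.exists_point W x
    exact ⟨.some x y h, trivial, rfl⟩
  exact Set.infinite_univ ((hfin.image _).subset this)

variable {P : W.Point} (hP : P ≠ 0)

lemma val_algebraMap_le (f : W.CoordinateRing) : val hP (algebraMap _ _ f) ≤ 1 :=
  HeightOneSpectrum.valuation_le_one _ f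

lemma val_algebraMap_eq_one {f : W.CoordinateRing} :
    val hP (algebraMap _ _ f) = 1 ↔ evalAt W f P ≠ 0 := by
  rw [val, HeightOneSpectrum.valuation_eq_one_iff_notMem, Ne, ← mem_pointIdeal hP]
  rfl

lemma val_algebraMap_lt_one {f : W.CoordinateRing} :
    val hP (algebraMap _ _ f) < 1 ↔ evalAt W f P = 0 := by
  rw [lt_iff_le_and_ne, and_iff_right (val_algebraMap_le hP f), Ne, val_algebraMap_eq_one, not_not]

/-- The constants inside the valuation ring of a point. -/
def constVal : k →+* (val hP).valuationSubring :=
  (algebraMap k (FF W)).codRestrict (val hP).valuationSubring.toSubring fun c => by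
    by_cases hc : c = 0
    · rw [hc, map_zero]
      exact zero_mem (val hP).valuationSubring
    · exact (val_const hP hc).le

lemma evalAt_mul_add (hP : P ≠ 0) : ∃ φ : W.CoordinateRing →ₐ[k] k, ∀ f, evalAt W f P = φ f := by
  rcases P with _ | ⟨x, y, h⟩
  · exact absurd rfl hP
  · exact ⟨evalHom h.1, evalAt_some h⟩

/-- The residue field of a point of the curve is the base field. -/
lemma residue_bijective :
    Function.Bijective ((IsLocalRing.residue (val hP).valuationSubring).comp (constVal hP)) := by
  refine ⟨RingHom.injective _, fun a => ?_⟩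
  obtain ⟨⟨a, ha⟩, rfl⟩ := IsLocalRing.residue_surjective a
  obtain ⟨n, ⟨d, hd⟩, e⟩ := HeightOneSpectrum.exists_primeCompl_mul_eq_of_integer (prime hP) a ha
  obtain ⟨φ, hφ⟩ := evalAt_mul_add hP
  have hd' : φ d ≠ 0 := by
    rw [← hφ]
    exact fun h => hd ((mem_pointIdeal hP).2 h)
  refine ⟨φ n / φ d, ?_⟩
  rw [RingHom.comp_apply, ← sub_eq_zero, ← map_sub, IsLocalRing.residue_eq_zero_iff,
    IsLocalRing.mem_maximalIdeal, mem_nonunits_iff]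
  intro h1
  replace h1 := (ValuationSubring.valuation_eq_one_iff _ _).1 h1
  have h2 : val hP (algebraMap k _ (φ n / φ d) - a) = 1 := by
    have := (Valuation.isEquiv_valuation_valuationSubring (val hP)).eq_one_iff_eq_one
      (x := algebraMap k _ (φ n / φ d) - a)
    rw [this]
    exact h1
  have hda : algebraMap W.CoordinateRing (FF W) d ≠ 0 := by
    intro h0
    have : d = 0 := (map_eq_zero_iff _ (IsFractionRing.injective W.CoordinateRing (FF W))).1 h0
    rw [this, map_zero] at hd'
    exact hd' rfl
  have e2 : algebraMap k (FF W) (φ n / φ d) - a =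
      algebraMap W.CoordinateRing (FF W) (algebraMap k _ (φ n / φ d) * d - n) /
        algebraMap W.CoordinateRing (FF W) d := by
    rw [eq_div_iff hda, map_sub, map_mul, ← e, ← IsScalarTower.algebraMap_apply]
    ring
  have h3 : val hP (algebraMap W.CoordinateRing (FF W) d) = 1 := by
    rw [val_algebraMap_eq_one, hφ]
    exact hd'
  rw [e2, map_div₀, h3, div_one, val_algebraMap_eq_one, hφ] at h2
  apply h2
  rw [map_sub, map_mul, AlgHom.commutes, Algebra.algebraMap_self, RingHom.id_apply,
    div_mul_cancel₀ _ hd', sub_self]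

/-- The place of the function field at a point of the affine curve. -/
def place : Place (FF W) k where
  ring := (val hP).valuationSubring
  res := (RingEquiv.ofBijective _ (residue_bijective hP)).symm.toRingHom.comp
    (IsLocalRing.residue (val hP).valuationSubring)
  isUnit_of_res_ne_zero a ha := by
    by_contra h
    apply ha
    rw [RingHom.comp_apply, (IsLocalRing.residue_eq_zero_iff a).2 h, map_zero]

lemma place_red_const (c : k) : (place hP).Red (algebraMap k _ c) c := by
  refine ⟨(constVal hP c).2, ?_⟩
  change (RingEquiv.ofBijective _ (residue_bijective hP)).symm _ = _
  rw [RingEquiv.symm_apply_eq]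
  rfl

lemma mem_place_iff {a : FF W} : a ∈ (place hP).ring ↔ val hP a ≤ 1 := Iff.rfl

lemma place_red_iff_lt {a : FF W} : (place hP).Red a 0 ↔ val hP a < 1 := by
  constructor
  · intro h
    refine lt_of_le_of_ne h.mem fun h1 => ?_
    have hi : a⁻¹ ∈ (place hP).ring := by
      rw [mem_place_iff, map_inv₀, h1, inv_one]
    obtain ⟨b, hb⟩ := Place.exists_red hi
    have ha : a ≠ 0 := by rintro rfl; simp at h1
    have := h.mul hb
    rw [mul_inv_cancel₀ ha, zero_mul] at this
    exact one_ne_zero (Place.red_one.unique this)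
  · intro h
    obtain ⟨b, hb⟩ := Place.exists_red (v := place hP) (a := a) h.le
    by_cases hb0 : b = 0
    · rwa [hb0] at hb
    · have := (hb.inv hb0).mem
      rw [mem_place_iff, map_inv₀] at this
      have ha : val hP a ≠ 0 := (Valuation.ne_zero_iff _).2 (hb.ne_zero hb0)
      exact absurd this (not_le.2 ((one_lt_inv₀ (zero_lt_iff.2 ha)).2 h))

lemma place_red_algebraMap (f : W.CoordinateRing) :
    (place hP).Red (algebraMap _ _ f) (evalAt W f P) := by
  obtain ⟨φ, hφ⟩ := evalAt_mul_add hP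
  have h0 : (place hP).Red (algebraMap _ _ (f - algebraMap k _ (φ f))) 0 := by
    rw [place_red_iff_lt, val_algebraMap_lt_one, hφ]
    simp
  have := h0.add (place_red_const hP (φ f))
  rw [map_sub, ← IsScalarTower.algebraMap_apply, sub_add_cancel, zero_add] at this
  rw [hφ]
  exact this

lemma redCurve : (place hP).RedCurve (W.baseChange (FF W)) W :=
  ⟨place_red_const hP _, place_red_const hP _, place_red_const hP _, place_red_const hP _,
    place_red_const hP _⟩

variable (W) in
/-- The generic point, a point over the function field. -/
def gen : (W.baseChange (FF W)).Point :=
  .some (algebraMap _ _ (xR W)) (algebraMap _ _ (yR W)) <| by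
    have : (W.baseChange (FF W)).IsElliptic := inferInstanceAs (W.map _).IsElliptic
    apply equation_iff_nonsingular.1
    rw [equation_iff]
    have := congrArg (algebraMap W.CoordinateRing (FF W)) (equation_xR_yR (W := W))
    simp only [map_add, map_mul, map_pow, ← IsScalarTower.algebraMap_apply] at this
    exact this

variable (W) in
/-- The points over the base field as points over the function field. -/
def const : W.Point →+ (W.baseChange (FF W)).Point :=
  Point.map (W' := W) (Algebra.ofId k (FF W))

/-- The reduction of points over the function field at a point of the affine curve: the value of
the corresponding morphism. -/
def spec : (W.baseChange (FF W)).Point →+ W.Point := (redCurve hP).hom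

lemma spec_const (Q : W.Point) : spec hP (const W Q) = Q := by
  apply (redCurve hP).hom_eq
  rcases Q with _ | ⟨x, y, h⟩
  · exact .zero
  · exact .some _ _ (place_red_const hP x) (place_red_const hP y)

lemma spec_gen : spec hP (gen W) = P := by
  apply (redCurve hP).hom_eq
  rcases P with _ | ⟨x, y, h⟩
  · exact absurd rfl hP
  · refine .some _ _ ?_ ?_
    · simpa [evalAt_some] using place_red_algebraMap hP (xR W)
    · simpa [evalAt_some] using place_red_algebraMap hP (yR W)

end Place

end CurveRing
end

/-! ### Normalized valuations with a given center -/

noncomputable section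
namespace CurveRing
open scoped Classical WithZero
open WeierstrassCurve WeierstrassCurve.Affine WeierstrassCurve.Affine.CoordinateRing WeilPairing
open IsDedekindDomain

/-- A normalized valuation is determined by its center. -/
theorem eq_valuation_of_center {R K : Type*} [CommRing R] [IsDedekindDomain R] [Field K]
    [Algebra R K] [IsFractionRing R K] (v : HeightOneSpectrum R) (w : Valuation K ℤᵐ⁰)
    (hs : Function.Surjective w) (h1 : ∀ r ∉ v.asIdeal, w (algebraMap R K r) = 1)
    (h2 : ∀ r ∈ v.asIdeal, w (algebraMap R K r) < 1) (z : K) : w z = v.valuation K z := by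
  have hle (r : R) : w (algebraMap R K r) ≤ 1 := by
    by_cases hr : r ∈ v.asIdeal
    exacts [(h2 r hr).le, (h1 r hr).le]
  have hunit (a : K) (ha : v.valuation K a = 1) : w a = 1 := by
    obtain ⟨n, ⟨d, hd⟩, e⟩ := v.exists_primeCompl_mul_eq_of_integer a ha.le
    have hn : n ∉ v.asIdeal := by
      rw [← v.valuation_eq_one_iff_notMem (K := K), ← e, map_mul, ha, one_mul]
      exact v.valuation_eq_one_iff_notMem.2 hd
    have := congrArg w e
    rwa [map_mul, h1 d hd, h1 n hn, mul_one] at this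
  obtain ⟨π, hπ⟩ := v.valuation_exists_uniformizer K
  have hπ0 : π ≠ 0 := by rintro rfl; rw [map_zero] at hπ; exact WithZero.exp_ne_zero hπ.symm
  -- Any `a` is a unit of `v` times a power of `π`, so `w` is determined by `w π`, which has to be the
  -- largest value less than one because `w` is surjective.
  have hpow (a : K) (ha : a ≠ 0) : w a = w π ^ (-(v.valuation K a).log) := by
    have hva : v.valuation K a ≠ 0 := (Valuation.ne_zero_iff _).2 ha
    have : v.valuation K (a / π ^ (-(v.valuation K a).log)) = 1 := by
      rw [map_div₀, map_zpow₀, hπ, ← WithZero.exp_zsmul, smul_eq_mul]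
      simp only [mul_neg, mul_one, neg_neg]
      rw [WithZero.exp_log hva, div_self hva]
    have h3 := hunit _ this
    rw [map_div₀, map_zpow₀] at h3
    exact (div_eq_one_iff_eq (zpow_ne_zero _ ((Valuation.ne_zero_iff _).2 hπ0))).1 h3
  have hwπ0 : w π ≠ 0 := (Valuation.ne_zero_iff _).2 hπ0
  have hlt : w π < 1 := by
    obtain ⟨n, ⟨d, hd⟩, e⟩ := v.exists_primeCompl_mul_eq_of_integer π (by
      rw [hπ]; exact (WithZero.exp_lt_exp.2 (by norm_num : (-1 : ℤ) < 0)).le)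
    have hn : n ∈ v.asIdeal := by
      have h3 : v.valuation K (algebraMap R K n) < 1 := by
        rw [← e, map_mul, hπ, v.valuation_eq_one_iff_notMem.2 hd, mul_one]
        exact (WithZero.exp_lt_exp.2 (by norm_num : (-1 : ℤ) < 0))
      exact (v.valuation_lt_one_iff_mem n).1 h3
    have := congrArg w e
    rw [map_mul, h1 d hd, mul_one] at this
    rw [this]
    exact h2 n hn
  have hwπ : w π = WithZero.exp (-1) := by
    obtain ⟨a, ha⟩ := hs (WithZero.exp 1)
    have ha0 : a ≠ 0 := by rintro rfl; rw [map_zero] at ha; exact WithZero.exp_ne_zero ha.symm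
    have h3 := congrArg WithZero.log ((hpow a ha0).symm.trans ha)
    rw [WithZero.log_zpow, WithZero.log_exp, smul_eq_mul] at h3
    have h4 : (w π).log < 0 := (WithZero.log_lt_iff_lt_exp hwπ0).2 hlt
    have h5 : (w π).log = 1 ∨ (w π).log = -1 := Int.isUnit_iff.1 (IsUnit.of_mul_eq_one _
      ((mul_comm _ _).trans h3))
    rw [← WithZero.exp_log hwπ0, h5.resolve_left (by omega)]
  by_cases hz : z = 0
  · simp [hz]
  · rw [hpow z hz, hwπ, ← WithZero.exp_zsmul, smul_eq_mul]
    simp only [mul_neg, mul_one, neg_neg]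
    exact WithZero.exp_log ((Valuation.ne_zero_iff _).2 hz)

variable {k : Type*} [Field k] {W : Affine k}

/-- A normalized valuation with center at infinity is given by the degree of the norm. -/
lemma eq_normDegree (w : Valuation (FF W) ℤᵐ⁰) (hs : Function.Surjective w)
    (htriv : ∀ c : k, c ≠ 0 → w (algebraMap k _ c) = 1)
    (hx : 1 < w (algebraMap _ _ (xR W))) {f : W.CoordinateRing} (hf : f ≠ 0) :
    w (algebraMap _ _ f) = WithZero.exp (normDegree f : ℤ) := by
  have : w.IsTrivialOn k := ⟨htriv⟩
  set X := algebraMap W.CoordinateRing (FF W) (xR W) with hX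
  set Y := algebraMap W.CoordinateRing (FF W) (yR W) with hY
  have hX0 : w X ≠ 0 := (zero_lt_one.trans hx).ne'
  have hconst (c : k) : w (algebraMap k _ c) ≤ 1 := by
    by_cases hc : c = 0
    · simp [hc]
    · exact (htriv c hc).le
  have hcub : w (X ^ 3 + algebraMap k _ W.a₂ * X ^ 2 + algebraMap k _ W.a₄ * X +
      algebraMap k _ W.a₆) = w X ^ 3 := by
    have e : X ^ 3 + algebraMap k _ W.a₂ * X ^ 2 + algebraMap k _ W.a₄ * X + algebraMap k _ W.a₆ =
        aeval X (Polynomial.X ^ 3 + C W.a₂ * Polynomial.X ^ 2 + C W.a₄ * Polynomial.X + C W.a₆) := by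
      simp
    have hdeg : (Polynomial.X ^ 3 + C W.a₂ * Polynomial.X ^ 2 + C W.a₄ * Polynomial.X +
      C W.a₆).natDegree = 3 := by compute_degree!
    rw [e, valuation_aeval_eq_valuation_X_pow_natDegree_of_one_lt_valuation_X X hx, hdeg]
    intro h0
    rw [h0] at hdeg
    simp at hdeg
  have heq := congrArg (algebraMap W.CoordinateRing (FF W)) (equation_xR_yR (W := W))
  simp only [map_add, map_mul, map_pow, ← IsScalarTower.algebraMap_apply, ← hX, ← hY] at heq
  have hYX : w X < w Y := by
    by_contra hle
    push Not at hle
    have h1 : w (Y ^ 2 + algebraMap k (FF W) W.a₁ * X * Y + algebraMap k (FF W) W.a₃ * Y) ≤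
        w X ^ 2 := by
      refine (w.map_add_le (w.map_add_le ?_ ?_) ?_)
      · rw [map_pow]; gcongr
      · rw [map_mul, map_mul, sq]
        gcongr
        exact mul_le_of_le_one_left' (hconst _)
      · rw [map_mul, sq]
        gcongr
        exact (hconst _).trans hx.le
    rw [heq, hcub] at h1
    exact absurd h1 (not_le.2 (pow_lt_pow_right₀ hx (by norm_num)))
  have hY1 : 1 < w Y := hx.trans hYX
  have hY0 : w Y ≠ 0 := (zero_lt_one.trans hY1).ne'
  have hsq : w Y ^ 2 = w X ^ 3 := by
    rw [← hcub, ← heq]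
    symm
    rw [← map_pow w, add_assoc]
    apply Valuation.map_add_eq_of_lt_left
    rw [map_pow]
    refine (w.map_add _ _).trans_lt (max_lt ?_ ?_)
    · rw [map_mul, map_mul, sq]
      have : w (algebraMap k (FF W) W.a₁) * w X < w Y :=
        (mul_le_of_le_one_left' (hconst _)).trans_lt hYX
      exact mul_lt_mul_of_pos_right this (zero_lt_iff.2 hY0)
    · rw [map_mul, sq]
      exact mul_lt_mul_of_pos_right ((hconst _).trans_lt hY1) (zero_lt_iff.2 hY0)
  -- the ratio `γ` of the values of `y` and `x` generates the value group
  set a := (w X).log with ha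
  set b := (w Y).log with hb
  have hab : 2 * b = 3 * a := by
    have := congrArg WithZero.log hsq
    rwa [WithZero.log_pow, WithZero.log_pow, nsmul_eq_mul, nsmul_eq_mul] at this
  have hapos : 0 < a := (WithZero.lt_log_iff_exp_lt hX0).2 hx
  set m := b - a with hm
  have ham : a = 2 * m := by omega
  have hbm : b = 3 * m := by omega
  have hwX : w X = WithZero.exp (2 * m) := by rw [← ham, ha, WithZero.exp_log hX0]
  have hwY : w Y = WithZero.exp (3 * m) := by rw [← hbm, hb, WithZero.exp_log hY0]
  have hpoly (p : k[X]) (hp : p ≠ 0) : w (aeval X p) = WithZero.exp (2 * p.natDegree * m) := by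
    rw [valuation_aeval_eq_valuation_X_pow_natDegree_of_one_lt_valuation_X X hx hp, hwX,
      ← WithZero.exp_nsmul, nsmul_eq_mul]
    congr 1; ring
  have hmpos : 0 < m := by omega
  have key (f : W.CoordinateRing) (hf : f ≠ 0) :
      w (algebraMap _ _ f) = WithZero.exp (normDegree f * m : ℤ) := by
    obtain ⟨p, q, rfl⟩ := exists_eq f
    have e : algebraMap W.CoordinateRing (FF W) (aeval (xR W) p + aeval (xR W) q * yR W) =
        aeval X p + aeval X q * Y := by
      rw [map_add, map_mul, hX, aeval_algebraMap_apply, aeval_algebraMap_apply]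
    rw [e]
    have hqv (hq : q ≠ 0) : w (aeval X q * Y) = WithZero.exp ((2 * q.natDegree + 3) * m : ℤ) := by
      rw [map_mul, hpoly q hq, hwY, ← WithZero.exp_add]
      congr 1; ring
    by_cases hq : q = 0
    · have hp : p ≠ 0 := by
        rintro rfl
        simp [hq] at hf
      rw [normDegree_eq_left hp (Or.inl hq), hq]
      simp [hpoly p hp]
    by_cases hp : p = 0
    · rw [normDegree_eq_right hq (Or.inl hp), hp]
      simp [-map_mul, hqv hq]
    rcases le_or_gt p.natDegree (q.natDegree + 1) with h | h
    · rw [normDegree_eq_right hq (Or.inr h), Valuation.map_add_eq_of_lt_right, hqv hq]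
      · push_cast; rfl
      · rw [hqv hq, hpoly p hp, WithZero.exp_lt_exp]
        have : (2 * p.natDegree : ℤ) < 2 * q.natDegree + 3 := by omega
        nlinarith
    · rw [normDegree_eq_left hp (Or.inr h), Valuation.map_add_eq_of_lt_left, hpoly p hp]
      · push_cast; rfl
      · rw [hqv hq, hpoly p hp, WithZero.exp_lt_exp]
        have : (2 * q.natDegree + 3 : ℤ) < 2 * p.natDegree := by omega
        nlinarith
  have hm1 : m = 1 := by
    obtain ⟨z, hz⟩ := hs (WithZero.exp 1)
    obtain ⟨r, s, hs0, rfl⟩ := IsFractionRing.div_surjective (A := W.CoordinateRing) z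
    have hs' : s ≠ 0 := nonZeroDivisors.ne_zero hs0
    have hr' : r ≠ 0 := by
      rintro rfl
      rw [map_zero, zero_div, map_zero] at hz
      exact WithZero.exp_ne_zero hz.symm
    rw [map_div₀, key r hr', key s hs', ← WithZero.exp_sub] at hz
    have := WithZero.exp_injective hz
    have h5 : ((normDegree r : ℤ) - normDegree s) * m = 1 := by linarith
    have := Int.isUnit_iff.1 (IsUnit.of_mul_eq_one _ ((mul_comm _ _).trans h5))
    omega
  rw [key f hf, hm1, mul_one]

end CurveRing
end

/-! ### Composition of functions with the maps `X ↦ m X + Q` -/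

noncomputable section
namespace CurveRing
open scoped Classical WithZero
open WeierstrassCurve WeierstrassCurve.Affine WeierstrassCurve.Affine.CoordinateRing WeilPairing
open IsDedekindDomain
variable {k : Type*} [Field k] {W : Affine k} [IsAlgClosed k] [W.IsElliptic]

section Red
variable {A : W.Point} (hA : A ≠ 0)

lemma red_aeval {a : FF W} {b : k} (h : (place hA).Red a b) (p : k[X]) :
    (place hA).Red (aeval a p) (p.eval b) := by
  induction p using Polynomial.induction_on' with
  | add p q hp hq => rw [map_add, eval_add]; exact hp.add hq
  | monomial n c =>
    rw [aeval_monomial, eval_monomial]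
    exact (place_red_const hA c).mul (h.pow n)

lemma red_algHom (ψ : W.CoordinateRing →ₐ[k] FF W) {x y : k} (h : W.Nonsingular x y)
    (hx : (place hA).Red (ψ (xR W)) x) (hy : (place hA).Red (ψ (yR W)) y) (f : W.CoordinateRing) :
    (place hA).Red (ψ f) (evalHom h.1 f) := by
  obtain ⟨p, q, rfl⟩ := exists_eq f
  rw [map_add, map_add, map_mul, map_mul, evalHom_aeval, evalHom_aeval, evalHom_yR,
    ← aeval_algHom_apply, ← aeval_algHom_apply]
  exact (red_aeval hA hx p).add ((red_aeval hA hx q).mul hy)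

end Red

/-- The action of a `k`-homomorphism of the function field on points. -/
abbrev mp (σ : FF W →ₐ[k] FF W) : (W.baseChange (FF W)).Point →+ (W.baseChange (FF W)).Point :=
  Point.map (W' := W) σ

lemma mp_gen (σ : FF W →ₐ[k] FF W) : ∃ h, mp σ (gen W) =
    .some (σ (algebraMap _ _ (xR W))) (σ (algebraMap _ _ (yR W))) h := ⟨_, rfl⟩

lemma mp_const (σ : FF W →ₐ[k] FF W) (Q : W.Point) : mp σ (const W Q) = const W Q := by
  rcases Q with _ | ⟨x, y, h⟩
  · rfl
  · exact (Point.some.injEq ..).mpr ⟨σ.commutes x, σ.commutes y⟩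

lemma mp_comp (σ τ : FF W →ₐ[k] FF W) (P : (W.baseChange (FF W)).Point) :
    mp σ (mp τ P) = mp (σ.comp τ) P := by
  rw [mp, mp, Point.map_map]

lemma hom_eq_of_mp {σ τ : FF W →ₐ[k] FF W} (h : mp σ (gen W) = mp τ (gen W)) : σ = τ := by
  obtain ⟨h1, e1⟩ := mp_gen σ
  obtain ⟨h2, e2⟩ := mp_gen τ
  rw [e1, e2, Point.some.injEq] at h
  exact FF.hom_ext h.1 h.2

/-- A point over the function field that takes infinitely many values is the image of the generic
point under a homomorphism. -/
lemma exists_hom (ξ : (W.baseChange (FF W)).Point)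
    (hinf : (Set.range fun A : {A : W.Point // A ≠ 0} => spec A.2 ξ).Infinite) :
    ∃ σ : FF W →ₐ[k] FF W, mp σ (gen W) = ξ := by
  rcases ξ with _ | ⟨X, Y, h⟩
  · exfalso
    apply hinf
    refine (Set.finite_singleton (0 : W.Point)).subset ?_
    rintro _ ⟨A, rfl⟩
    exact map_zero (spec A.2)
  have he : Y ^ 2 + algebraMap k (FF W) W.a₁ * X * Y + algebraMap k (FF W) W.a₃ * Y =
      X ^ 3 + algebraMap k (FF W) W.a₂ * X ^ 2 + algebraMap k (FF W) W.a₄ * X +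
        algebraMap k (FF W) W.a₆ := (equation_iff ..).1 h.1
  set ψ : W.CoordinateRing →ₐ[k] FF W := liftHom W X Y he with hψ
  have hinj : Function.Injective ψ := by
    rw [injective_iff_map_eq_zero]
    intro f hf
    by_contra hf0
    apply hinf
    -- If a function vanishes at the point `ξ`, then it vanishes at all values of `ξ` that are not at
    -- infinity.
    refine ((finite_zeros hf0).union (Set.finite_singleton 0)).subset ?_
    rintro _ ⟨A, rfl⟩
    have hr := (redCurve A.2).redPt_hom (.some X Y h)
    change Place.RedPt _ _ _ _ (spec A.2 (.some X Y h)) at hr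
    generalize hB : spec A.2 (.some X Y h) = B at hr
    change spec A.2 (.some X Y h) ∈ _
    rw [hB]
    cases hr with
    | pole => exact Or.inr rfl
    | some _ h' hx hy =>
      refine Or.inl ⟨Point.some_ne_zero h', ?_⟩
      have := red_algHom A.2 ψ h' (by simpa [hψ] using hx) (by simpa [hψ] using hy) f
      rw [hf] at this
      rw [evalAt_some]
      exact this.unique Place.red_zero
  refine ⟨IsFractionRing.liftAlgHom (K := FF W) hinj, ?_⟩
  obtain ⟨h1, e1⟩ := mp_gen (IsFractionRing.liftAlgHom (K := FF W) hinj)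
  rw [e1, Point.some.injEq, IsFractionRing.liftAlgHom_apply, IsFractionRing.liftAlgHom_apply,
    IsFractionRing.lift_algebraMap, IsFractionRing.lift_algebraMap]
  simp [hψ]

lemma spec_smul_gen_add {A : W.Point} (hA : A ≠ 0) (m : ℤ) (Q : W.Point) :
    spec hA (m • gen W + const W Q) = m • A + Q := by
  rw [map_add, map_zsmul, spec_gen, spec_const]

lemma zsmul_surjective {m : ℤ} (hm : m ≠ 0) (Q : W.Point) : ∃ T : W.Point, m • T = Q := by
  obtain ⟨T, hT⟩ := TorsionCount.nsmul_surjective W (Int.natAbs_ne_zero.2 hm) Q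
  rcases Int.natAbs_eq m with h | h
  · exact ⟨T, by rw [h, natCast_zsmul, hT]⟩
  · exact ⟨-T, by rw [h, zsmul_neg, neg_zsmul, neg_neg, natCast_zsmul, hT]⟩

/-- The point `m X + Q`, for the generic point `X`, takes all values other than `Q`. -/
lemma exists_hom_smul_gen_add {m : ℤ} (hm : m ≠ 0) (Q : W.Point) :
    ∃ σ : FF W →ₐ[k] FF W, mp σ (gen W) = m • gen W + const W Q := by
  apply exists_hom
  have h : {R : W.Point | R ≠ Q} ⊆
      Set.range fun A : {A : W.Point // A ≠ 0} => spec A.2 (m • gen W + const W Q) := by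
    intro R hR
    obtain ⟨A, hA⟩ := zsmul_surjective hm (R - Q)
    have hA0 : A ≠ 0 := by
      rintro rfl
      rw [smul_zero] at hA
      exact hR (sub_eq_zero.1 hA.symm)
    exact ⟨⟨A, hA0⟩, by simp only; rw [spec_smul_gen_add, hA, sub_add_cancel]⟩
  refine Set.Infinite.mono h fun hf => infinite_point (W := W) ?_
  exact (hf.union (Set.finite_singleton Q)).subset fun R _ => by
    by_cases h : R = Q
    · exact Or.inr h
    · exact Or.inl h

/-- The homomorphism of the function field given by composition with the map `X ↦ m X + Q` of the
curve, for `m ≠ 0`; the identity, as a placeholder, for `m = 0`. -/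
def mulAdd (m : ℤ) (Q : W.Point) : FF W →ₐ[k] FF W :=
  if h : m ≠ 0 then (exists_hom_smul_gen_add h Q).choose else AlgHom.id k _

lemma mp_mulAdd {m : ℤ} (hm : m ≠ 0) (Q : W.Point) :
    mp (mulAdd m Q) (gen W) = m • gen W + const W Q := by
  rw [mulAdd, dif_pos hm]
  exact (exists_hom_smul_gen_add hm Q).choose_spec

lemma mulAdd_comp {m n : ℤ} (hm : m ≠ 0) (hn : n ≠ 0) (Q R : W.Point) :
    (mulAdd m Q).comp (mulAdd n R) = mulAdd (n * m) (n • Q + R) := by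
  apply hom_eq_of_mp
  rw [← mp_comp, mp_mulAdd hn, map_add, map_zsmul, mp_mulAdd hm, mp_const,
    mp_mulAdd (mul_ne_zero hn hm), mul_smul, smul_add, map_add, map_zsmul, add_assoc]

lemma mulAdd_mulAdd {m n : ℤ} (hm : m ≠ 0) (hn : n ≠ 0) (Q R : W.Point) (f : FF W) :
    mulAdd m Q (mulAdd n R f) = mulAdd (n * m) (n • Q + R) f := by
  rw [← mulAdd_comp hm hn]; rfl

lemma mulAdd_one_zero (f : FF W) : mulAdd (1 : ℤ) (0 : W.Point) f = f := by
  have : mulAdd (1 : ℤ) (0 : W.Point) = AlgHom.id k (FF W) := by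
    apply hom_eq_of_mp
    rw [mp_mulAdd one_ne_zero, one_smul, map_zero, add_zero]
    exact (Point.map_id (W' := W) _).symm
  rw [this]; rfl

lemma mulAdd_one_surjective (Q : W.Point) : Function.Surjective (mulAdd (1 : ℤ) Q) := by
  intro f
  refine ⟨mulAdd 1 (-Q) f, ?_⟩
  rw [mulAdd_mulAdd one_ne_zero one_ne_zero, one_smul, add_neg_cancel, mul_one, mulAdd_one_zero]

lemma mulAdd_neg_one_surjective (Q : W.Point) : Function.Surjective (mulAdd (-1 : ℤ) Q) := by
  intro f
  refine ⟨mulAdd (-1) Q f, ?_⟩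
  rw [mulAdd_mulAdd (by norm_num) (by norm_num), neg_smul, one_smul, neg_add_cancel, neg_mul_neg,
    mul_one, mulAdd_one_zero]

/-- The map `X ↦ m X + Q` is unramified at the points of the affine curve: the composition of the
pull-back of functions with the normalized valuation at a point is still normalized. -/
def Unram (m : ℤ) (Q : W.Point) : Prop :=
  ∀ (A : W.Point) (hA : A ≠ 0), Function.Surjective fun z => val hA (mulAdd m Q z)

lemma val_surjective {A : W.Point} (hA : A ≠ 0) : Function.Surjective (val hA) :=
  HeightOneSpectrum.valuation_surjective _ _

lemma unram_one (Q : W.Point) : Unram 1 Q := fun _ hA =>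
  (val_surjective hA).comp (mulAdd_one_surjective Q)

lemma unram_neg_one (Q : W.Point) : Unram (-1) Q := fun _ hA =>
  (val_surjective hA).comp (mulAdd_neg_one_surjective Q)

/-- The value at `A` of the pull-back of `f` is the value of `f` at the image `m A + Q`. -/
lemma red_mulAdd_of_ne {m : ℤ} (hm : m ≠ 0) {Q A : W.Point} (hA : A ≠ 0) (hB : m • A + Q ≠ 0)
    (f : W.CoordinateRing) :
    (place hA).Red (mulAdd m Q (algebraMap _ _ f)) (evalAt W f (m • A + Q)) := by
  have hr := (redCurve hA).redPt_hom (mp (mulAdd m Q) (gen W))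
  have e : (redCurve hA).hom (mp (mulAdd m Q) (gen W)) = m • A + Q := by
    rw [mp_mulAdd hm]
    exact spec_smul_gen_add hA m Q
  rw [e] at hr
  obtain ⟨h1, e1⟩ := mp_gen (mulAdd m Q)
  rw [e1] at hr
  generalize m • A + Q = B at hr hB
  cases hr with
  | pole => exact absurd rfl hB
  | some _ h' hx hy =>
    have := red_algHom hA ((mulAdd m Q).comp (Algebra.algHom k W.CoordinateRing (FF W))) h' hx hy f
    rw [evalAt_some]
    exact this

/-- The pull-back of `x` has a pole where the image point is at infinity. -/
lemma one_lt_val_mulAdd {m : ℤ} (hm : m ≠ 0) {Q A : W.Point} (hA : A ≠ 0) (hB : m • A + Q = 0) :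
    1 < val hA (mulAdd m Q (algebraMap _ _ (xR W))) := by
  have hr := (redCurve hA).redPt_hom (mp (mulAdd m Q) (gen W))
  have e : (redCurve hA).hom (mp (mulAdd m Q) (gen W)) = m • A + Q := by
    rw [mp_mulAdd hm]
    exact spec_smul_gen_add hA m Q
  rw [e] at hr
  obtain ⟨h1, e1⟩ := mp_gen (mulAdd m Q)
  rw [e1, hB] at hr
  cases hr with
  | pole _ hx => exact not_le.1 hx

/-- The value of an unramified pull-back at a point is the value at the image point. -/
lemma val_mulAdd_eq {m : ℤ} (hm : m ≠ 0) {Q : W.Point} (hu : Unram m Q) {A : W.Point} (hA : A ≠ 0)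
    (hB : m • A + Q ≠ 0) (z : FF W) : val hA (mulAdd m Q z) = val hB z := by
  refine eq_valuation_of_center (prime hB) ((val hA).comap (mulAdd m Q).toRingHom) (hu A hA) ?_ ?_ z
  · intro r hr
    have h1 := red_mulAdd_of_ne hm hA hB r
    have h2 : evalAt W r (m • A + Q) ≠ 0 := fun h0 => hr ((mem_pointIdeal hB).2 h0)
    refine le_antisymm h1.mem ?_
    have h3 : val hA (mulAdd m Q (algebraMap _ _ r))⁻¹ ≤ 1 := (h1.inv h2).mem
    rw [map_inv₀] at h3
    have h0 : val hA (mulAdd m Q (algebraMap _ _ r)) ≠ 0 :=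
      (Valuation.ne_zero_iff _).2 (h1.ne_zero h2)
    exact (inv_le_one₀ (zero_lt_iff.2 h0)).1 h3
  · intro r hr
    have h1 := red_mulAdd_of_ne hm hA hB r
    rw [(mem_pointIdeal hB).1 hr] at h1
    exact (place_red_iff_lt hA).1 h1

lemma ne_zero_of_span {P : W.Point} {n : ℕ} {f : W.CoordinateRing}
    (hf : Ideal.span {f} = pointIdeal W P ^ n) : f ≠ 0 := by
  rintro rfl
  rw [Ideal.span_singleton_eq_bot.2 rfl] at hf
  exact pow_ne_zero n (pointIdeal_ne_bot _) hf.symm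

lemma val_of_span {P : W.Point} {n : ℕ} {f : W.CoordinateRing}
    (hf : Ideal.span {f} = pointIdeal W P ^ n) {A : W.Point} (hA : A ≠ 0) :
    val hA (algebraMap _ _ f) = WithZero.exp (-(n * if A = P then 1 else 0) : ℤ) := by
  by_cases h : A = P
  · subst h
    rw [val, HeightOneSpectrum.valuation_of_algebraMap,
      HeightOneSpectrum.intValuation_eq_exp_neg_multiplicity _ (ne_zero_of_span hf), hf]
    have hp : Prime (pointIdeal W A) :=
      Ideal.prime_of_isPrime (pointIdeal_ne_bot A) (isMaximal_pointIdeal hA).isPrime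
    have : multiplicity (prime hA).asIdeal (pointIdeal W A ^ n) = n :=
      multiplicity_pow_self_of_prime hp n
    rw [this]
    simp
  · rw [if_neg h, mul_zero, neg_zero, WithZero.exp_zero, val_algebraMap_eq_one, Ne,
      ← mem_pointIdeal hA]
    intro hm
    have : pointIdeal W P ^ n ≤ pointIdeal W A := by
      rw [← hf, Ideal.span_singleton_le_iff_mem]
      exact hm
    have h2 := (isMaximal_pointIdeal hA).isPrime.le_of_pow_le this
    by_cases hP : P = 0
    · rw [hP, pointIdeal_zero, top_le_iff] at h2
      exact (isMaximal_pointIdeal hA).ne_top h2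
    · exact h (pointIdeal_injective
        ((isMaximal_pointIdeal hP).eq_of_le (isMaximal_pointIdeal hA).ne_top h2)).symm

lemma isUnit_of_span_zero {n : ℕ} {f : W.CoordinateRing}
    (hf : Ideal.span {f} = pointIdeal W (0 : W.Point) ^ n) : IsUnit f := by
  rw [pointIdeal_zero, ← Ideal.one_eq_top, one_pow, Ideal.one_eq_top] at hf
  exact Ideal.span_singleton_eq_top.1 hf

/-- The divisor of the pull-back of a function with divisor `n (P) - n (O)` under an unramified
map `X ↦ m X + Q`. -/
lemma val_mulAdd_of_span {m : ℤ} (hm : m ≠ 0) {Q : W.Point} (hu : Unram m Q) {P : W.Point} {n : ℕ}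
    {f : W.CoordinateRing} (hf : Ideal.span {f} = pointIdeal W P ^ n) {A : W.Point} (hA : A ≠ 0) :
    val hA (mulAdd m Q (algebraMap _ _ f)) =
      WithZero.exp (n * ((if m • A + Q = 0 then 1 else 0) - if m • A + Q = P then 1 else 0) : ℤ) := by
  by_cases hB : m • A + Q = 0
  · by_cases hP : P = 0
    · subst hP
      rw [sub_self, mul_zero, WithZero.exp_zero]
      obtain ⟨c, hc, rfl⟩ := exists_const_of_isUnit (isUnit_of_span_zero hf)
      rw [← IsScalarTower.algebraMap_apply, AlgHom.commutes, val_const hA hc]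
    · rw [hB, if_pos rfl, if_neg (Ne.symm hP), sub_zero, mul_one]
      have := eq_normDegree ((val hA).comap (mulAdd m Q).toRingHom) (hu A hA) (fun c hc => by
        change val hA (mulAdd m Q _) = 1
        rw [AlgHom.commutes, val_const hA hc]) (one_lt_val_mulAdd hm hA hB) (ne_zero_of_span hf)
      rw [normDegree_eq_of_span hP hf] at this
      exact this
  · rw [val_mulAdd_eq hm hu hA hB, val_of_span hf, if_neg hB, zero_sub, mul_neg]

end CurveRing
end

/-! ### The Weil pairing is well defined -/

noncomputable section
namespace CurveRing
open scoped Classical WithZero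
open WeierstrassCurve WeierstrassCurve.Affine WeierstrassCurve.Affine.CoordinateRing WeilPairing
open IsDedekindDomain
variable {k : Type*} [Field k] {W : Affine k} [IsAlgClosed k] [W.IsElliptic]

lemma algebraMap_ne_zero {f : W.CoordinateRing} (hf : f ≠ 0) :
    algebraMap W.CoordinateRing (FF W) f ≠ 0 := by
  rwa [Ne, map_eq_zero_iff _ (IsFractionRing.injective W.CoordinateRing (FF W))]

section Value
variable {n : ℕ} {P Q : W.Point} {f g : W.CoordinateRing} (hf : HasTorsionDivisor W n P f)
  (hg : HasTorsionDivisor W n Q g)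
include hf hg

/-- The quotient of translates of `f` and `g` that defines the Weil pairing is constant, since its
divisor is trivial. -/
lemma exists_const : ∃ c : k, c ≠ 0 ∧
    mulAdd 1 Q (algebraMap _ _ f) * mulAdd (-1) 0 (algebraMap _ _ g) =
      algebraMap k (FF W) c * (algebraMap _ _ f * mulAdd (-1) P (algebraMap _ _ g)) := by
  have hf0 := algebraMap_ne_zero (ne_zero_of_span hf)
  have hg0 := algebraMap_ne_zero (ne_zero_of_span hg)
  have hd : algebraMap _ (FF W) f * mulAdd (-1) P (algebraMap _ _ g) ≠ 0 :=
    mul_ne_zero hf0 ((_root_.map_ne_zero _).2 hg0)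
  obtain ⟨c, hc, e⟩ := exists_const_of_val (f := (mulAdd 1 Q (algebraMap _ _ f) *
    mulAdd (-1) 0 (algebraMap _ _ g)) / (algebraMap _ _ f * mulAdd (-1) P (algebraMap _ _ g))) <| by
    intro A hA
    rw [map_div₀, map_mul, map_mul, val_mulAdd_of_span one_ne_zero (unram_one _) hf hA,
      val_mulAdd_of_span (by norm_num) (unram_neg_one _) hg hA,
      val_mulAdd_of_span (by norm_num) (unram_neg_one _) hg hA, val_of_span hf hA,
      ← WithZero.exp_add, ← WithZero.exp_add, ← WithZero.exp_sub, ← WithZero.exp_zero]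
    congr 1
    simp only [one_smul, neg_smul, add_zero, neg_eq_zero, if_neg hA]
    have h1 : A + Q = 0 ↔ -A = Q := by rw [add_comm, add_eq_zero_iff_eq_neg, eq_comm]
    have h2 : A + Q = P ↔ -A + P = Q := by
      rw [← eq_sub_iff_add_eq', eq_comm, sub_eq_neg_add]
    have h3 : -A + P = 0 ↔ A = P := by rw [neg_add_eq_zero]
    simp only [h1, h2, h3]
    ring
  refine ⟨c, hc, ?_⟩
  rw [← e, div_mul_cancel₀ _ hd]

/-- Evaluating the relation of functions at `S` gives the expression for the Weil pairing. -/
lemma eq_of_isValue_aux {c : k} (hc : mulAdd 1 Q (algebraMap _ _ f) *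
    mulAdd (-1) 0 (algebraMap _ _ g) =
      algebraMap k (FF W) c * (algebraMap _ _ f * mulAdd (-1) P (algebraMap _ _ g)))
    {S : W.Point} (hS : S ≠ 0) (hSP : S ≠ P) (hSQ : S ≠ -Q) (hSPQ : S ≠ P - Q) :
    (evalAt W f (Q + S) / evalAt W f S) / (evalAt W g (P - S) / evalAt W g (-S)) = c := by
  have r1 := red_mulAdd_of_ne (W := W) one_ne_zero (Q := Q) hS (by
    rw [one_smul]; exact fun h => hSQ (add_eq_zero_iff_eq_neg.1 h)) f
  have r2 := red_mulAdd_of_ne (W := W) (m := -1) (by norm_num) (Q := 0) hS (by simpa) g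
  have r3 := red_mulAdd_of_ne (W := W) (m := -1) (by norm_num) (Q := P) hS (by
    rw [neg_smul, one_smul, Ne, neg_add_eq_zero]; exact hSP) g
  have r4 := place_red_algebraMap hS f
  have h := (r1.mul r2).unique (hc ▸ (place_red_const hS c).mul (r4.mul r3))
  rw [one_smul, neg_smul, one_smul, add_zero, add_comm S Q, neg_add_eq_sub] at h
  have hnz {R T : W.Point} {a : W.CoordinateRing} (ha : HasTorsionDivisor W n R a) (hT : T ≠ 0)
      (hTR : T ≠ R) : evalAt W a T ≠ 0 := by
    have := val_of_span ha hT
    rw [if_neg hTR, mul_zero, neg_zero, WithZero.exp_zero, val_algebraMap_eq_one] at this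
    exact this
  have n1 := hnz hf hS hSP
  have n2 := hnz hg (T := P - S) (sub_ne_zero.2 (Ne.symm hSP)) (by
    rw [Ne, sub_eq_iff_eq_add, ← sub_eq_iff_eq_add']; exact Ne.symm hSPQ)
  have n3 := hnz hg (T := -S) (neg_ne_zero.2 hS) (by rw [Ne, neg_eq_iff_eq_neg]; exact hSQ)
  rw [div_div_div_eq, div_eq_iff (mul_ne_zero n1 n2), h]

lemma isValue_of_const {c : k} (hc : mulAdd 1 Q (algebraMap _ _ f) *
    mulAdd (-1) 0 (algebraMap _ _ g) =
      algebraMap k (FF W) c * (algebraMap _ _ f * mulAdd (-1) P (algebraMap _ _ g))) :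
    IsValue W n P Q c := by
  obtain ⟨S, -, hS⟩ := (infinite_point (W := W)).exists_notMem_finset {0, P, -Q, P - Q}
  simp only [Finset.mem_insert, Finset.mem_singleton, not_or] at hS
  exact ⟨f, g, S, hf, hg, hS.1, hS.2.1, hS.2.2.1, hS.2.2.2,
    (eq_of_isValue_aux hf hg hc hS.1 hS.2.1 hS.2.2.1 hS.2.2.2).symm⟩

omit hf hg in
lemma exists_eq_const_mul {f f' : W.CoordinateRing} (hf : HasTorsionDivisor W n P f)
    (hf' : HasTorsionDivisor W n P f') : ∃ a : k, a ≠ 0 ∧ f' = algebraMap k _ a * f := by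
  obtain ⟨u, hu⟩ := Ideal.span_singleton_eq_span_singleton.1 (hf.trans hf'.symm)
  obtain ⟨a, ha, e⟩ := exists_const_of_isUnit u.isUnit
  exact ⟨a, ha, by rw [← hu, e, mul_comm]⟩

omit hf hg in
/-- The Weil pairing is well defined. -/
lemma isValue_unique {z z' : k} (h : IsValue W n P Q z) (h' : IsValue W n P Q z') : z = z' := by
  obtain ⟨f, g, S, hf, hg, h1, h2, h3, h4, rfl⟩ := h
  obtain ⟨f', g', S', hf', hg', h1', h2', h3', h4', rfl⟩ := h'
  obtain ⟨c, -, hc⟩ := exists_const hf hg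
  obtain ⟨a, ha, rfl⟩ := exists_eq_const_mul hf hf'
  obtain ⟨b, hb, rfl⟩ := exists_eq_const_mul hg hg'
  rw [eq_of_isValue_aux hf hg hc h1 h2 h3 h4]
  refine (eq_of_isValue_aux hf' hg' ?_ h1' h2' h3' h4').symm
  simp only [map_mul, ← IsScalarTower.algebraMap_apply, AlgHom.commutes]
  linear_combination (algebraMap k (FF W) a * algebraMap k (FF W) b) * hc

omit hf hg in
lemma weilPairing_eq_of_isValue {z : k} (h : IsValue W n P Q z) : weilPairing W n P Q = z := by
  have hex : ∃ z, IsValue W n P Q z := ⟨z, h⟩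
  rw [weilPairing, dif_pos hex]
  exact isValue_unique hex.choose_spec h

/-- The identity of functions that defines the Weil pairing. -/
lemma weilPairing_relation : mulAdd 1 Q (algebraMap _ _ f) * mulAdd (-1) 0 (algebraMap _ _ g) =
    algebraMap k (FF W) (weilPairing W n P Q) *
      (algebraMap _ _ f * mulAdd (-1) P (algebraMap _ _ g)) := by
  obtain ⟨c, hc, e⟩ := exists_const hf hg
  rwa [weilPairing_eq_of_isValue (isValue_of_const hf hg e)]

lemma isValue_weilPairing : IsValue W n P Q (weilPairing W n P Q) :=
  isValue_of_const hf hg (weilPairing_relation hf hg)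

/-- The Weil pairing is antisymmetric. -/
lemma weilPairing_mul_swap : weilPairing W n P Q * weilPairing W n Q P = 1 := by
  have h1 := weilPairing_relation hf hg
  have h2 := congrArg (mulAdd (-1) 0) (weilPairing_relation hg hf)
  have h10 : (-1 : ℤ) ≠ 0 := by norm_num
  simp only [map_mul, mulAdd_mulAdd h10 one_ne_zero, mulAdd_mulAdd h10 h10, AlgHom.commutes] at h2
  simp only [mul_neg, mul_one, neg_neg, smul_zero, zero_add,
    mulAdd_one_zero] at h2
  have hf0 := algebraMap_ne_zero (ne_zero_of_span hf)
  have hg0 := algebraMap_ne_zero (ne_zero_of_span hg)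
  have h3 : mulAdd (-1) P (algebraMap _ _ g) ≠ 0 := (_root_.map_ne_zero _).2 hg0
  apply (algebraMap k (FF W)).injective
  rw [map_mul, map_one]
  apply mul_right_cancel₀ (mul_ne_zero hf0 h3)
  linear_combination -h2 - algebraMap k (FF W) (weilPairing W n Q P) * h1

end Value

/-- The ideal of a point as a nonzero divisor among the ideals. -/
def pointIdeal₀ (P : W.Point) : nonZeroDivisors (Ideal W.CoordinateRing) :=
  ⟨pointIdeal W P, mem_nonZeroDivisors_iff_ne_zero.2 (pointIdeal_ne_bot P)⟩

lemma toClass_eq_mk0 (P : W.Point) :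
    (Point.toClass P).toMul = ClassGroup.mk0 (pointIdeal₀ P) := by
  rcases P with _ | ⟨x, y, h⟩
  · symm
    exact (ClassGroup.mk0_eq_one_iff (pointIdeal₀ (0 : W.Point)).2).2
      ⟨⟨1, by simp [pointIdeal₀, pointIdeal_zero]⟩⟩
  · rw [Point.toClass_some, ← ClassGroup.mk_mk0 W.FunctionField]
    exact congrArg (ClassGroup.mk (R := W.CoordinateRing) (K := W.FunctionField))
      (Units.ext ((XYIdeal'_eq h).trans rfl))

/-- Sums of points are equal if and only if the products of their ideals are equivalent. -/
lemma sum_eq_iff_exists_span {ι : Type*} (s t : Finset ι) (P Q : ι → W.Point) :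
    ∑ i ∈ s, P i = ∑ i ∈ t, Q i ↔ ∃ a b : W.CoordinateRing, a ≠ 0 ∧ b ≠ 0 ∧
      Ideal.span {a} * ∏ i ∈ s, pointIdeal W (P i) =
        Ideal.span {b} * ∏ i ∈ t, pointIdeal W (Q i) := by
  have key (s : Finset ι) (P : ι → W.Point) : (Point.toClass (∑ i ∈ s, P i)).toMul =
      ClassGroup.mk0 (∏ i ∈ s, pointIdeal₀ (P i)) := by
    rw [map_sum, toMul_sum, map_prod]
    exact Finset.prod_congr rfl fun i _ => toClass_eq_mk0 _
  rw [← Point.toClass_injective.eq_iff, ← Additive.toMul.injective.eq_iff, key, key,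
    ClassGroup.mk0_eq_mk0_iff]
  simp only [Submonoid.coe_finsetProd]
  constructor
  · rintro ⟨a, b, ha, hb, h⟩
    exact ⟨a, b, ha, hb, h⟩
  · rintro ⟨a, b, ha, hb, h⟩
    exact ⟨a, b, ha, hb, h⟩

/-- A function with divisor `n (P) - n (O)` exists if and only if `P` is an `n`-torsion point. -/
lemma exists_hasTorsionDivisor_iff {n : ℕ} {P : W.Point} :
    n • P = 0 ↔ ∃ f, HasTorsionDivisor W n P f := by
  have h := sum_eq_iff_exists_span (Finset.range n) ∅ (fun _ => P) (fun _ => (0 : W.Point))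
  simp only [Finset.sum_const, Finset.card_range, Finset.prod_const, Finset.card_empty,
    zero_smul, pow_zero, mul_one] at h
  rw [h]
  constructor
  · rintro ⟨a, b, ha, hb, h⟩
    have hdvd : b ∈ Ideal.span {a} * pointIdeal W P ^ n := h ▸ Ideal.mem_span_singleton_self b
    obtain ⟨f, hf, rfl⟩ := Ideal.mem_span_singleton_mul.1 hdvd
    refine ⟨f, ?_⟩
    rw [← Ideal.span_singleton_mul_span_singleton] at h
    exact ((Ideal.span_singleton_mul_right_inj ha).1 h).symm
  · rintro ⟨f, hf⟩
    exact ⟨1, f, one_ne_zero, ne_zero_of_span hf, by rw [hf]; simp⟩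

end CurveRing
end

/-! ### Multiplication by `n` is unramified -/

noncomputable section
namespace CurveRing
open scoped Classical WithZero
open WeierstrassCurve WeierstrassCurve.Affine WeierstrassCurve.Affine.CoordinateRing WeilPairing
open IsDedekindDomain TorsionCount
variable {k : Type*} [Field k] {W : Affine k} [IsAlgClosed k] [W.IsElliptic]

/-- A function that vanishes at infinitely many points is zero. -/
lemma eq_zero_of_red {d : FF W} (h : {A | ∃ hA : A ≠ 0, (place hA).Red d 0}.Infinite) : d = 0 := by
  obtain ⟨r, s, hs, rfl⟩ := IsFractionRing.div_surjective (A := W.CoordinateRing) d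
  have hs' := algebraMap_ne_zero (nonZeroDivisors.ne_zero hs)
  by_contra h0
  have hr : r ≠ 0 := by rintro rfl; simp at h0
  refine h ((finite_zeros hr).subset ?_)
  rintro A ⟨hA, hd⟩
  refine ⟨hA, ?_⟩
  have := hd.mul (place_red_algebraMap hA s)
  rw [div_mul_cancel₀ _ hs', zero_mul] at this
  exact (place_red_algebraMap hA r).unique this

variable [CharZero k]

lemma infinite_smul_ne {n : ℕ} (hn : n ≠ 0) : {A : W.Point | A ≠ 0 ∧ n • A ≠ 0}.Infinite := by
  intro hf
  refine infinite_point (W := W) ((hf.union (finite_torsion W (Nat.cast_ne_zero.2 hn))).subset ?_)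
  intro A _
  by_cases h : n • A = 0
  · exact Or.inr h
  · refine Or.inl ⟨?_, h⟩
    rintro rfl
    exact h (smul_zero n)

/-- The generic form of the formula for multiplication on `x`-coordinates. -/
lemma mulAdd_xR {n : ℕ} (hn : n ≠ 0) {Φ Ψ : k[X]} (hm : IsMulPair W n Φ Ψ) :
    mulAdd (n : ℤ) (0 : W.Point) (algebraMap _ _ (xR W)) * aeval (algebraMap _ (FF W) (xR W)) Ψ =
      aeval (algebraMap _ (FF W) (xR W)) Φ := by
  rw [← sub_eq_zero]
  apply eq_zero_of_red
  refine (infinite_smul_ne hn).mono ?_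
  rintro A ⟨hA, hnA⟩
  refine ⟨hA, ?_⟩
  have h1 := red_mulAdd_of_ne (Nat.cast_ne_zero.2 hn : (n : ℤ) ≠ 0) (Q := 0) hA
    (by simpa using hnA) (xR W)
  rcases A with _ | ⟨x, y, h⟩
  · exact absurd rfl hA
  have h2 := place_red_algebraMap hA (xR W)
  rw [evalAt_some, evalHom_xR] at h2
  have h3 := (h1.mul (red_aeval hA h2 Ψ)).sub (red_aeval hA h2 Φ)
  have hs := hm.spec h
  rw [add_zero, natCast_zsmul] at h3
  rcases hP : n • Point.some x y h with _ | ⟨x', y', h'⟩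
  · exact absurd hP hnA
  rw [hP] at hs h3
  rw [evalAt_some, evalHom_xR] at h3
  simp only [Point.xRep_some, Matrix.cons_val_zero, Matrix.cons_val_one, mul_one] at hs
  rwa [hs, mul_comm x', sub_self] at h3

/-- Away from the points of order two, `x - x (P)` is a uniformizer at `P`. -/
lemma val_xR_sub {x y : k} (h : W.Nonsingular x y) (h2 : Point.some x y h ≠ -Point.some x y h) :
    val (Point.some_ne_zero h) (algebraMap _ _ (xR W - algebraMap k _ x)) = WithZero.exp (-1) := by
  have h0 : xR W - algebraMap k _ x ≠ 0 := by rw [← XClass_eq]; exact XClass_ne_zero x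
  rw [val, HeightOneSpectrum.valuation_of_algebraMap,
    HeightOneSpectrum.intValuation_eq_exp_neg_multiplicity _ h0, ← pointIdeal_neg_mul h]
  have hp : Prime (pointIdeal W (.some x y h)) := Ideal.prime_of_isPrime (pointIdeal_ne_bot _)
    (isMaximal_pointIdeal (Point.some_ne_zero h)).isPrime
  have : multiplicity (prime (Point.some_ne_zero h)).asIdeal
      (pointIdeal W (-.some x y h) * pointIdeal W (.some x y h)) = 1 := by
    apply multiplicity_eq_of_dvd_of_not_dvd
    · rw [pow_one]
      exact dvd_mul_left _ _
    · change ¬ pointIdeal W (.some x y h) ^ 2 ∣ _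
      rw [sq]
      intro hd
      have h3 := (mul_dvd_mul_iff_right (pointIdeal_ne_bot (.some x y h))).1 hd
      have h4 := Ideal.le_of_dvd h3
      have h5 := (isMaximal_pointIdeal (W := W) (P := -.some x y h)
        (neg_ne_zero.2 (Point.some_ne_zero h))).eq_of_le
        (isMaximal_pointIdeal (Point.some_ne_zero h)).ne_top h4
      exact h2 (pointIdeal_injective h5.symm)
  rw [this]
  rfl

/-- Multiplication by `n` is unramified at some point. -/
lemma exists_val_mul_surjective {n : ℕ} (hn : n ≠ 0) : ∃ (A : W.Point) (hA : A ≠ 0),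
    Function.Surjective fun z => val hA (mulAdd (n : ℤ) 0 z) := by
  obtain ⟨Φ, Ψ, hm⟩ := exists_isMulPair W n
  have hfin : {x : k | ∃ y, ∃ h : W.Nonsingular x y, 2 • Point.some x y h = 0}.Finite := by
    refine ((finite_torsion W (n := 2) (by norm_num)).image (fun P : W.Point => match P with
      | .zero => 0
      | .some x _ _ => x)).subset ?_
    rintro x ⟨y, h, h2⟩
    exact ⟨_, h2, rfl⟩
  -- At a point `A` of a separable fibre over `x = c`, away from the points of order two, the function
  -- `x - x (A)` is a uniformizer, and the pull-back of `x - c` has a simple zero.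
  obtain ⟨c, hcS, hc⟩ := hm.exists_separable hn (hfin.toFinset.image fun x => Φ.eval x / Ψ.eval x)
  have hdeg : (Φ - C c * Ψ).degree ≠ 0 := by
    rw [hm.degree_sub]
    exact_mod_cast pow_ne_zero 2 hn
  obtain ⟨x, hx⟩ := IsAlgClosed.exists_root _ hdeg
  obtain ⟨y, h⟩ := exists_point W x
  have e1 : Φ.eval x = c * Ψ.eval x := by simpa [sub_eq_zero] using hx
  have hΨ : Ψ.eval x ≠ 0 := by
    intro h0
    rcases eval_ne_of_isCoprime hm.coprime x with h1 | h1
    · exact h1 (by rw [e1, h0, mul_zero])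
    · exact h1 h0
  have h2 : Point.some x y h ≠ -Point.some x y h := by
    intro h2
    apply hcS
    rw [Finset.mem_image]
    refine ⟨x, ?_, by rw [e1]; field_simp⟩
    rw [Set.Finite.mem_toFinset]
    refine ⟨y, h, ?_⟩
    rw [two_smul]
    exact eq_neg_iff_add_eq_zero.1 h2
  have hA := Point.some_ne_zero h
  refine ⟨.some x y h, hA, ?_⟩
  obtain ⟨g, hg⟩ := dvd_iff_isRoot.2 hx
  have hgx : g.eval x ≠ 0 := by
    have := hc x hx
    rw [hg, derivative_mul] at this
    simpa using this
  have hval (p : k[X]) (hp : p.eval x ≠ 0) : val hA (aeval (algebraMap _ (FF W) (xR W)) p) = 1 := by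
    rw [aeval_algebraMap_apply, val_algebraMap_eq_one, evalAt_some, evalHom_aeval]
    exact hp
  have key : val hA (mulAdd (n : ℤ) 0 (algebraMap _ _ (xR W) - algebraMap k _ c)) =
      WithZero.exp (-1) := by
    have e2 := mulAdd_xR hn hm
    have e3 : mulAdd (n : ℤ) (0 : W.Point) (algebraMap _ _ (xR W) - algebraMap k _ c) *
        aeval (algebraMap _ (FF W) (xR W)) Ψ =
        algebraMap _ _ (xR W - algebraMap k _ x) * aeval (algebraMap _ (FF W) (xR W)) g := by
      have e4 := congrArg (aeval (algebraMap _ (FF W) (xR W))) hg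
      simp only [map_sub, map_mul, aeval_X, aeval_C] at e4
      rw [map_sub, map_sub, AlgHom.commutes, sub_mul, e2, ← IsScalarTower.algebraMap_apply]
      exact e4
    have e5 := congrArg (val hA) e3
    rw [map_mul, map_mul, hval Ψ hΨ, hval g hgx, mul_one, mul_one, val_xR_sub h h2] at e5
    exact e5
  intro γ
  by_cases hγ : γ = 0
  · exact ⟨0, by simp [hγ]⟩
  · refine ⟨(algebraMap _ _ (xR W) - algebraMap k _ c) ^ (-γ.log), ?_⟩
    simp only
    rw [map_zpow₀, map_zpow₀, key, ← WithZero.exp_zsmul, smul_eq_mul]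
    simp only [mul_neg, mul_one, neg_neg]
    exact WithZero.exp_log hγ

/-- Multiplication by `n`, followed by a translation, is unramified: translations move a point
where this is known to any other point. -/
lemma unram_mul {n : ℕ} (hn : n ≠ 0) (Q : W.Point) : Unram (n : ℤ) Q := by
  intro A hA
  obtain ⟨A₀, hA₀, hs⟩ := exists_val_mul_surjective (W := W) hn
  have hn' : (n : ℤ) ≠ 0 := Nat.cast_ne_zero.2 hn
  have e (z : FF W) : val hA₀ (mulAdd (n : ℤ) 0 z) = val hA (mulAdd (n : ℤ) (n • (A₀ - A)) z) := by
    have h1 : (1 : ℤ) • A + (A₀ - A) = A₀ := by rw [one_smul, add_sub_cancel]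
    have h2 := val_mulAdd_eq one_ne_zero (unram_one (A₀ - A)) hA (by rw [h1]; exact hA₀)
      (mulAdd (n : ℤ) 0 z)
    rw [mulAdd_mulAdd one_ne_zero hn', mul_one, add_zero, natCast_zsmul] at h2
    rw [h2]
    congr 2
    rw [h1]
  intro γ
  obtain ⟨z, hz⟩ := hs γ
  obtain ⟨z', rfl⟩ := mulAdd_one_surjective (Q - n • (A₀ - A)) z
  refine ⟨z', ?_⟩
  simp only at hz ⊢
  rwa [e, mulAdd_mulAdd hn' one_ne_zero, one_mul, one_smul, add_sub_cancel] at hz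

end CurveRing
end

/-! ### Bilinearity of the Weil pairing -/

noncomputable section
namespace CurveRing
open scoped Classical WithZero
open WeierstrassCurve WeierstrassCurve.Affine WeierstrassCurve.Affine.CoordinateRing WeilPairing
open IsDedekindDomain TorsionCount
variable {k : Type*} [Field k] {W : Affine k} [IsAlgClosed k] [W.IsElliptic]

/-- The base field is algebraically closed in the function field. -/
lemma exists_const_of_pow {z : FF W} {n : ℕ} (hn : n ≠ 0) {c : k}
    (h : z ^ n = algebraMap k _ c) : ∃ c' : k, z = algebraMap k _ c' := by
  have hi : IsIntegral k z := by
    refine ⟨X ^ n - C c, monic_X_pow_sub_C c hn, ?_⟩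
    simp [h]
  have hd := IsAlgClosed.degree_eq_one_of_irreducible k (minpoly.irreducible hi)
  obtain ⟨c', hc'⟩ := minpoly.mem_range_of_degree_eq_one k z hd
  exact ⟨c', hc'.symm⟩

lemma emultiplicity_pointIdeal {A : W.Point} (hA : A ≠ 0) (B : W.Point) :
    emultiplicity (pointIdeal W A) (pointIdeal W B) = if B = A then 1 else 0 := by
  have hp : Prime (pointIdeal W A) :=
    Ideal.prime_of_isPrime (pointIdeal_ne_bot A) (isMaximal_pointIdeal hA).isPrime
  split_ifs with h
  · rw [h]
    have := emultiplicity_pow_self_of_prime hp 1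
    rwa [pow_one] at this
  · rw [emultiplicity_eq_zero, Ideal.dvd_iff_le]
    intro hle
    by_cases hB : B = 0
    · rw [hB, pointIdeal_zero, top_le_iff] at hle
      exact (isMaximal_pointIdeal hA).ne_top hle
    · exact h (pointIdeal_injective
        ((isMaximal_pointIdeal hB).eq_of_le (isMaximal_pointIdeal hA).ne_top hle))

lemma emultiplicity_span_mul_prod {A : W.Point} (hA : A ≠ 0) {a : W.CoordinateRing} (ha : a ≠ 0)
    {ι : Type*} (s : Finset ι) (B : ι → W.Point) :
    emultiplicity (pointIdeal W A) (Ideal.span {a} * ∏ i ∈ s, pointIdeal W (B i)) =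
      (multiplicity (pointIdeal W A) (Ideal.span {a}) + (s.filter fun i => B i = A).card : ℕ) := by
  have hp : Prime (pointIdeal W A) :=
    Ideal.prime_of_isPrime (pointIdeal_ne_bot A) (isMaximal_pointIdeal hA).isPrime
  have hf : FiniteMultiplicity (pointIdeal W A) (Ideal.span {a}) :=
    FiniteMultiplicity.of_prime_left hp (by simpa using ha)
  rw [emultiplicity_mul hp, Finset.emultiplicity_prod hp, hf.emultiplicity_eq_multiplicity,
    Finset.card_filter]
  push_cast
  congr 1
  exact Finset.sum_congr rfl fun i _ => emultiplicity_pointIdeal hA (B i)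

lemma val_eq_exp {A : W.Point} (hA : A ≠ 0) {a : W.CoordinateRing} (ha : a ≠ 0) :
    val hA (algebraMap _ _ a) =
      WithZero.exp (-(multiplicity (pointIdeal W A) (Ideal.span {a}) : ℤ)) := by
  rw [val, HeightOneSpectrum.valuation_of_algebraMap,
    HeightOneSpectrum.intValuation_eq_exp_neg_multiplicity _ ha]
  rfl

/-- The function `g` is an `n`-th root, up to a constant, of the pull-back under multiplication by
`n` of a function with divisor `n (P) - n (O)`. -/
def IsRootFun (n : ℕ) (P : W.Point) (g : FF W) : Prop :=
  g ≠ 0 ∧ ∃ (f : W.CoordinateRing) (c : k), HasTorsionDivisor W n P f ∧ c ≠ 0 ∧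
    g ^ n = algebraMap k _ c * mulAdd (n : ℤ) 0 (algebraMap _ _ f)

variable [CharZero k]

/-- For `P = p P'`, the divisor `∑ (P' + T) - (T)` over the `p`-torsion points `T` is principal,
since the sum of its points is `p ^ 2 P' = 0`. A function `g` with this divisor is a root function:
the divisor of `g ^ p` is the pull-back of `p (P) - p (O)` under multiplication by `p`. -/
lemma exists_isRootFun {p : ℕ} [hp : Fact p.Prime] {P : W.Point} (hP : p • P = 0) :
    ∃ g, IsRootFun p P g := by
  have hp0 : p ≠ 0 := hp.1.ne_zero
  obtain ⟨f, hf⟩ := exists_hasTorsionDivisor_iff.1 hP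
  obtain ⟨P', hP'⟩ := nsmul_surjective W hp0 P
  have hfin := finite_torsion W (Nat.cast_ne_zero.2 hp0 : (p : k) ≠ 0)
  set s := hfin.toFinset with hs
  have hmem (T : W.Point) : T ∈ s ↔ p • T = 0 := by
    rw [hs, Set.Finite.mem_toFinset, Set.mem_ofPred_eq]
  have hcard : s.card = p ^ 2 := by
    rw [← card_torsion W p, hs, ← Set.ncard_eq_toFinset_card _ hfin, ← Nat.card_coe_set_eq]
    apply Nat.card_congr
    exact Equiv.subtypeEquivRight fun T => by
      rw [Set.mem_ofPred_eq, AddSubgroup.torsionBy.nsmul_iff]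
  have hsum : ∑ T ∈ s, (P' + T) = ∑ T ∈ s, T := by
    rw [Finset.sum_add_distrib, Finset.sum_const, hcard, sq, mul_smul, hP', hP, zero_add]
  obtain ⟨a, b, ha, hb, hab⟩ := (sum_eq_iff_exists_span s s (fun T => P' + T) id).1 hsum
  have ha' := algebraMap_ne_zero ha
  have hb' := algebraMap_ne_zero hb
  have hf' := algebraMap_ne_zero (ne_zero_of_span hf)
  have hτ : mulAdd (p : ℤ) (0 : W.Point) (algebraMap _ _ f) ≠ 0 := (_root_.map_ne_zero _).2 hf'
  refine ⟨algebraMap _ _ b / algebraMap _ _ a, div_ne_zero hb' ha', f, ?_⟩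
  obtain ⟨c, hc, e⟩ := exists_const_of_val (f := (algebraMap _ (FF W) b / algebraMap _ _ a) ^ p /
      mulAdd (p : ℤ) 0 (algebraMap _ _ f)) <| by
    intro A hA
    have h1 := emultiplicity_span_mul_prod hA ha s (fun T => P' + T)
    have h2 := emultiplicity_span_mul_prod hA hb s id
    rw [hab, h2, Nat.cast_inj] at h1
    -- The zeros and poles of the quotient at `A`, counted through the ideals of `a` and `b`.
    have c1 : (s.filter fun T => P' + T = A).card = if p • A = P then 1 else 0 := by
      have : (s.filter fun T => P' + T = A) = if p • A = P then {A - P'} else ∅ := by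
        ext T
        rw [Finset.mem_filter, hmem]
        have : p • (A - P') = p • A - P := by rw [smul_sub, hP']
        split_ifs with h
        · rw [Finset.mem_singleton]
          constructor
          · rintro ⟨-, rfl⟩; rw [add_sub_cancel_left]
          · rintro rfl; rw [this, h, sub_self, add_sub_cancel]; exact ⟨rfl, rfl⟩
        · simp only [Finset.notMem_empty, iff_false, not_and]
          rintro hT rfl
          rw [smul_add, hT, add_zero] at h
          exact h hP'
      rw [this]; split_ifs <;> simp
    have c2 : (s.filter fun T => id T = A).card = if p • A = 0 then 1 else 0 := by
      simp only [id, Finset.filter_eq', hmem]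
      split_ifs <;> simp
    rw [c1, c2] at h1
    rw [map_div₀, map_pow, map_div₀, val_eq_exp hA ha, val_eq_exp hA hb,
      val_mulAdd_of_span (Nat.cast_ne_zero.2 hp0) (unram_mul hp0 0) hf hA, ← WithZero.exp_sub,
      ← WithZero.exp_nsmul, ← WithZero.exp_sub, ← WithZero.exp_zero]
    congr 1
    rw [add_zero, natCast_zsmul, nsmul_eq_mul]
    have h3 := congrArg (Nat.cast : ℕ → ℤ) h1
    push_cast at h3
    rw [← mul_sub]
    apply mul_eq_zero_of_right
    linarith
  refine ⟨c, hf, hc, ?_⟩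
  rw [← e, div_mul_cancel₀ _ hτ]

section Translate
variable {n : ℕ} {P Q : W.Point} {g h : FF W}

/-- Translation by an `n`-torsion point multiplies a root function by an `n`-th root of unity. -/
lemma IsRootFun.exists_translate (hg : IsRootFun n P g) (hn : n ≠ 0) (hQ : n • Q = 0) :
    ∃ ε : k, ε ^ n = 1 ∧ mulAdd 1 Q g = algebraMap k _ ε * g := by
  obtain ⟨hg0, f, c, hf, hc, e⟩ := hg
  have h1 : (mulAdd 1 Q g / g) ^ n = algebraMap k _ 1 := by
    rw [div_pow, ← map_pow, e, map_mul, AlgHom.commutes,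
      mulAdd_mulAdd one_ne_zero (Nat.cast_ne_zero.2 hn), mul_one, natCast_zsmul, hQ, add_zero,
      ← e, map_one, div_self (pow_ne_zero n hg0)]
  obtain ⟨ε, hε⟩ := exists_const_of_pow hn h1
  refine ⟨ε, ?_, by rw [← hε, div_mul_cancel₀ _ hg0]⟩
  apply (algebraMap k (FF W)).injective
  rw [map_pow, ← hε, h1]

/-- The product of the translates of a root function by the multiples of an `n`-division point of
`Q` is constant. -/
lemma IsRootFun.prod_translate (hh : IsRootFun n Q h) (hn : n ≠ 0) (hQ : n • Q = 0) {Q' : W.Point}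
    (hQ' : n • Q' = Q) :
    ∃ c : k, ∏ i ∈ Finset.range n, mulAdd 1 (-(i • Q')) h = algebraMap k _ c := by
  obtain ⟨hh0, f, c, hf, hc, e⟩ := hh
  have hn' : (n : ℤ) ≠ 0 := Nat.cast_ne_zero.2 hn
  have h1 (i : ℕ) : (mulAdd 1 (-(i • Q')) h) ^ n =
      algebraMap k _ c * mulAdd (n : ℤ) (-(i • Q)) (algebraMap _ _ f) := by
    rw [← map_pow, e, map_mul, AlgHom.commutes, mulAdd_mulAdd one_ne_zero hn', mul_one, smul_neg,
      natCast_zsmul, smul_comm, hQ', add_zero]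
  obtain ⟨d, hd, hd'⟩ := exists_const_of_val
    (f := (∏ i ∈ Finset.range n, mulAdd 1 (-(i • Q')) h) ^ n) <| by
    intro A hA
    rw [← Finset.prod_pow, map_prod]
    have (i : ℕ) : val hA (mulAdd 1 (-(i • Q')) h ^ n) = WithZero.exp
        (n * ((if n • A = i • Q then 1 else 0) - (if n • A = (i + 1) • Q then 1 else 0)) : ℤ) := by
      rw [h1, map_mul, val_const hA hc, one_mul,
        val_mulAdd_of_span hn' (unram_mul hn _) hf hA]
      simp only [natCast_zsmul, zero_add, ← sub_eq_add_neg, sub_eq_iff_eq_add, add_smul,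
        one_smul, add_comm Q]
    simp only [this]
    have hex (g : ℕ → ℤ) (s : Finset ℕ) :
        ∏ i ∈ s, WithZero.exp (g i) = WithZero.exp (∑ i ∈ s, g i) := by
      induction s using Finset.induction_on with
      | empty => simp
      | insert a s ha ih => rw [Finset.prod_insert ha, Finset.sum_insert ha, ih, WithZero.exp_add]
    -- The divisor of the product telescopes, because `n Q = 0`.
    rw [hex, ← Finset.mul_sum,
      Finset.sum_range_sub' (fun i => if n • A = i • Q then (1 : ℤ) else 0)]
    simp [hQ]
  exact exists_const_of_pow hn hd'

/-- The Weil pairing is computed by the translation of a root function. For root functions `g` and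
`h` of `P` and `Q`, and `P = p P'`, `Q = p Q'`, the pull-back of the relation that defines the pairing
is the `p`-th power of a relation between `a = g (X + Q') h (-X)` and `b = g (X) h (P' - X)`, so that
`a = m b` with a constant `m` such that `m ^ p = e (P, Q)`. In the product of the translates of this
relation by `0, Q', …, (p - 1) Q'`, the factors with `h` are constant, and those with `g` telescope to
`g (X + Q) = m ^ p g (X)`. -/
lemma IsRootFun.translate_eq {p : ℕ} [hp : Fact p.Prime] (hg : IsRootFun p P g)
    (hQ : p • Q = 0) : mulAdd 1 Q g = algebraMap k _ (weilPairing W p P Q) * g := by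
  have hp0 : p ≠ 0 := hp.1.ne_zero
  have hp' : (p : ℤ) ≠ 0 := Nat.cast_ne_zero.2 hp0
  have h10 : (-1 : ℤ) ≠ 0 := by norm_num
  obtain ⟨h, hh⟩ := exists_isRootFun (p := p) hQ
  obtain ⟨P', hP'⟩ := nsmul_surjective W hp0 P
  obtain ⟨Q', hQ'⟩ := nsmul_surjective W hp0 Q
  obtain ⟨γ, hγ⟩ := hh.prod_translate hp0 hQ hQ'
  obtain ⟨hg0, f, c, hf, hc, e⟩ := hg
  obtain ⟨hh0, f', c', hf', hc', e'⟩ := hh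
  have hrel := congrArg (mulAdd (p : ℤ) (0 : W.Point)) (weilPairing_relation hf hf')
  simp only [map_mul, mulAdd_mulAdd hp' one_ne_zero, mulAdd_mulAdd hp' h10, AlgHom.commutes,
    smul_zero, zero_add] at hrel
  set E := weilPairing W p P Q with hE
  set a := mulAdd 1 Q' g * mulAdd (-1) 0 h with ha
  set b := g * mulAdd (-1) P' h with hb
  have hb0 : b ≠ 0 := mul_ne_zero hg0 ((_root_.map_ne_zero _).2 hh0)
  have hpow : (a / b) ^ p = algebraMap k _ E := by
    rw [div_pow, div_eq_iff (pow_ne_zero p hb0), ha, hb, mul_pow, mul_pow, ← map_pow, ← map_pow,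
      ← map_pow, e, e', map_mul, map_mul, map_mul, AlgHom.commutes, AlgHom.commutes,
      AlgHom.commutes, mulAdd_mulAdd one_ne_zero hp', mulAdd_mulAdd h10 hp',
      mulAdd_mulAdd h10 hp', natCast_zsmul, natCast_zsmul, natCast_zsmul, hQ', hP', smul_zero]
    simp only [add_zero, one_mul, mul_one, mul_neg, neg_mul] at hrel ⊢
    linear_combination (algebraMap k (FF W) c * algebraMap k (FF W) c') * hrel
  obtain ⟨m, hm⟩ := exists_const_of_pow hp0 hpow
  have hmE : m ^ p = E := by
    apply (algebraMap k (FF W)).injective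
    rw [map_pow, ← hm, hpow]
  have hab : a = algebraMap k _ m * b := by rw [← hm, div_mul_cancel₀ _ hb0]
  have hprod : ∏ i ∈ Finset.range p, mulAdd 1 (i • Q') a =
      ∏ i ∈ Finset.range p, mulAdd 1 (i • Q') (algebraMap k _ m * b) := by rw [hab]
  -- The products over the translates of `h` are the same constant on both sides.
  have hG (R : W.Point) : ∏ i ∈ Finset.range p, mulAdd 1 (i • Q') (mulAdd (-1) R h) =
      algebraMap k _ γ := by
    have := congrArg (mulAdd (-1) R) hγ
    rw [map_prod, AlgHom.commutes] at this
    rw [← this]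
    refine Finset.prod_congr rfl fun i _ => ?_
    rw [mulAdd_mulAdd one_ne_zero h10, mulAdd_mulAdd h10 one_ne_zero, mul_one, one_mul, one_smul,
      neg_smul, one_smul, add_comm]
  have hγ0 : algebraMap k (FF W) γ ≠ 0 := by
    rw [← hγ, Finset.prod_ne_zero_iff]
    exact fun i _ => (_root_.map_ne_zero _).2 hh0
  simp only [ha, hb, map_mul, Finset.prod_mul_distrib, AlgHom.commutes, hG, Finset.prod_const,
    Finset.card_range] at hprod
  rw [← map_pow, hmE, ← mul_assoc] at hprod
  have h1 := mul_right_cancel₀ hγ0 hprod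
  have h2 (i : ℕ) : mulAdd 1 (i • Q') (mulAdd 1 Q' g) = mulAdd 1 ((i + 1) • Q') g := by
    rw [mulAdd_mulAdd one_ne_zero one_ne_zero, mul_one, one_smul, add_smul, one_smul]
  simp only [h2] at h1
  -- The products over the translates of `g` telescope.
  have h3 := Finset.prod_range_succ (fun i => mulAdd 1 (i • Q') g) p
  have h4 := Finset.prod_range_succ' (fun i => mulAdd 1 (i • Q') g) p
  simp only [zero_smul, mulAdd_one_zero] at h4
  rw [h3, h1, hQ'] at h4
  have h5 : ∏ i ∈ Finset.range p, mulAdd 1 (i • Q') g ≠ 0 :=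
    Finset.prod_ne_zero_iff.2 fun i _ => (_root_.map_ne_zero _).2 hg0
  apply mul_left_cancel₀ h5
  rw [h4]
  ring

end Translate

section Bilinear
variable {p : ℕ} [hp : Fact p.Prime] {P Q R : W.Point}

lemma weilPairing_add_right (hP : p • P = 0) (hQ : p • Q = 0) (hR : p • R = 0) :
    weilPairing W p P (Q + R) = weilPairing W p P Q * weilPairing W p P R := by
  obtain ⟨g, hg⟩ := exists_isRootFun (p := p) hP
  have h1 := hg.translate_eq hQ
  have h2 := hg.translate_eq hR
  have h3 := hg.translate_eq (show p • (Q + R) = 0 by rw [smul_add, hQ, hR, add_zero])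
  have h4 := congrArg (mulAdd 1 Q) h2
  rw [mulAdd_mulAdd one_ne_zero one_ne_zero, mul_one, one_smul, h3, map_mul, AlgHom.commutes, h1,
    ← mul_assoc] at h4
  apply (algebraMap k (FF W)).injective
  rw [mul_right_cancel₀ hg.1 h4, map_mul, mul_comm]

lemma weilPairing_swap (hP : p • P = 0) (hQ : p • Q = 0) :
    weilPairing W p P Q * weilPairing W p Q P = 1 := by
  obtain ⟨f, hf⟩ := exists_hasTorsionDivisor_iff.1 hP
  obtain ⟨g, hg⟩ := exists_hasTorsionDivisor_iff.1 hQ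
  exact weilPairing_mul_swap hf hg

lemma weilPairing_pow (hP : p • P = 0) (hQ : p • Q = 0) : weilPairing W p P Q ^ p = 1 := by
  obtain ⟨g, hg⟩ := exists_isRootFun (p := p) hP
  obtain ⟨ε, hε, h⟩ := hg.exists_translate hp.1.ne_zero hQ
  rw [hg.translate_eq hQ] at h
  rw [(algebraMap k (FF W)).injective (mul_right_cancel₀ hg.1 h), hε]

lemma weilPairing_zero_right (hP : p • P = 0) : weilPairing W p P 0 = 1 := by
  obtain ⟨g, hg⟩ := exists_isRootFun (p := p) hP
  have h := hg.translate_eq (smul_zero p : p • (0 : W.Point) = 0)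
  rw [mulAdd_one_zero] at h
  apply (algebraMap k (FF W)).injective
  apply mul_right_cancel₀ hg.1
  rw [← h, map_one, one_mul]

lemma weilPairing_nsmul_right (hP : p • P = 0) (hQ : p • Q = 0) (n : ℕ) :
    weilPairing W p P (n • Q) = weilPairing W p P Q ^ n := by
  induction n with
  | zero => rw [zero_smul, pow_zero, weilPairing_zero_right hP]
  | succ n ih =>
    rw [add_smul, one_smul, weilPairing_add_right hP (by rw [smul_comm, hQ, smul_zero]) hQ, ih,
      pow_succ]

lemma weilPairing_nsmul_left (hP : p • P = 0) (hQ : p • Q = 0) (n : ℕ) :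
    weilPairing W p (n • P) Q = weilPairing W p P Q ^ n := by
  have hnP : p • n • P = 0 := by rw [smul_comm, hP, smul_zero]
  have h1 := weilPairing_swap hnP hQ
  have h2 := weilPairing_swap hP hQ
  rw [weilPairing_nsmul_right hQ hP] at h1
  have h4 : weilPairing W p Q P ≠ 0 := right_ne_zero_of_mul_eq_one h2
  apply mul_right_cancel₀ (pow_ne_zero n h4)
  rw [h1, ← mul_pow, h2, one_pow]

end Bilinear

end CurveRing
end

/-! ### Nondegeneracy of the Weil pairing -/

noncomputable section
namespace CurveRing
open scoped Classical WithZero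
open WeierstrassCurve WeierstrassCurve.Affine WeierstrassCurve.Affine.CoordinateRing WeilPairing
open IsDedekindDomain TorsionCount
variable {k : Type*} [Field k] {W : Affine k} [IsAlgClosed k] [W.IsElliptic]

/-- Every function is `(p (x) + q (x) y) / N (x)`: the denominator can be multiplied by its
conjugate. -/
lemma exists_norm_eq (z : FF W) : ∃ N p q : k[X], N ≠ 0 ∧
    z * aeval (algebraMap _ (FF W) (xR W)) N =
      aeval (algebraMap _ (FF W) (xR W)) p + aeval (algebraMap _ (FF W) (xR W)) q *
        algebraMap _ (FF W) (yR W) := by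
  obtain ⟨r, s, hs, rfl⟩ := IsFractionRing.div_surjective (A := W.CoordinateRing) z
  have hs0 := nonZeroDivisors.ne_zero hs
  have hs' := algebraMap_ne_zero hs0
  obtain ⟨p, q, h⟩ := exists_eq (r * conj W s)
  refine ⟨Algebra.norm k[X] s, p, q, norm_ne_zero hs0, ?_⟩
  have h1 := mul_conj s
  rw [algebraMap_poly_eq] at h1
  simp only [aeval_algebraMap_apply]
  rw [← map_mul, ← map_add, ← h, ← h1, map_mul, map_mul, ← mul_assoc, div_mul_cancel₀ _ hs']

lemma aeval_gen_ne_zero {q : k[X]} (hq : q ≠ 0) : aeval (algebraMap _ (FF W) (xR W)) q ≠ 0 := by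
  rw [aeval_algebraMap_apply]
  apply algebraMap_ne_zero
  rw [← algebraMap_poly_eq]
  intro h
  apply hq
  rwa [map_eq_zero_iff _ (FaithfulSMul.algebraMap_injective k[X] W.CoordinateRing)] at h

lemma mulAdd_neg_one_xR : mulAdd (-1) (0 : W.Point) (algebraMap _ (FF W) (xR W)) =
    algebraMap _ (FF W) (xR W) := by
  obtain ⟨h, e⟩ := mp_gen (mulAdd (-1) (0 : W.Point))
  rw [mp_mulAdd (by norm_num), map_zero, add_zero, neg_smul, one_smul] at e
  rw [gen, Point.neg_some, Point.some.injEq] at e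
  exact e.1.symm

/-- Translates of the function `x` by different points are different: they have different poles. -/
lemma mulAdd_one_xR_injective :
    Function.Injective fun T : W.Point => mulAdd 1 T (algebraMap _ (FF W) (xR W)) := by
  have key (T T' : W.Point) (hT : T ≠ 0) (h : mulAdd 1 T (algebraMap _ (FF W) (xR W)) =
      mulAdd 1 T' (algebraMap _ (FF W) (xR W))) : T = T' := by
    by_contra hne
    have hA : -T ≠ 0 := neg_ne_zero.2 hT
    have h1 := one_lt_val_mulAdd (W := W) one_ne_zero (Q := T) hA (by rw [one_smul, neg_add_cancel])
    have h2 := red_mulAdd_of_ne (W := W) one_ne_zero (Q := T') hA (by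
      rw [one_smul]; exact fun h0 => hne (neg_add_eq_zero.1 h0)) (xR W)
    rw [h] at h1
    exact h1.not_ge h2.mem
  intro T T' h
  by_cases hT : T = 0
  · by_cases hT' : T' = 0
    · rw [hT, hT']
    · exact (key T' T hT' h.symm).symm
  · exact key T T' hT h

variable [CharZero k] {p : ℕ} [hp : Fact p.Prime]

lemma mulAdd_neg_one_ne : ∃ z, mulAdd (-1) (0 : W.Point) z ≠ z := by
  by_contra! h
  obtain ⟨A, hA, h2⟩ := (infinite_smul_ne (W := W) two_ne_zero).nonempty
  have h3 : mp (mulAdd (-1) (0 : W.Point)) (gen W) = mp (mulAdd 1 (0 : W.Point)) (gen W) := by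
    congr 2
    ext z
    rw [h, mulAdd_one_zero]
  rw [mp_mulAdd (by norm_num), mp_mulAdd one_ne_zero, map_zero, add_zero, add_zero, neg_smul,
    one_smul] at h3
  have h4 := congrArg (spec hA) h3
  rw [map_neg, spec_gen, neg_eq_iff_add_eq_zero, ← two_smul ℕ] at h4
  exact h2 h4

/-- The functions pulled back under multiplication by `p`, as a subfield. -/
def pullbackField (W : Affine k) [W.IsElliptic] (p : ℕ) : IntermediateField k (FF W) :=
  (mulAdd (p : ℤ) (0 : W.Point)).fieldRange

lemma mulAdd_mem (z : FF W) : mulAdd (p : ℤ) (0 : W.Point) z ∈ pullbackField W p := ⟨z, rfl⟩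

/-- The function field is generated by `x` over the functions pulled back under multiplication by
`p`: the pull-back of `y` is not a function of `x` alone, because it is not an even function. -/
lemma adjoin_xR_eq_top :
    IntermediateField.adjoin (pullbackField W p) {algebraMap _ (FF W) (xR W)} = ⊤ := by
  set x := algebraMap _ (FF W) (xR W) with hx
  set M := IntermediateField.adjoin (pullbackField W p) {x} with hM
  have hp0 : (p : ℤ) ≠ 0 := Nat.cast_ne_zero.2 hp.1.ne_zero
  have hσ (z : FF W) : mulAdd (p : ℤ) (0 : W.Point) z ∈ M :=
    M.algebraMap_mem ⟨_, mulAdd_mem z⟩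
  have hxM : x ∈ M := IntermediateField.subset_adjoin _ _ rfl
  have hc (c : k) : algebraMap k (FF W) c ∈ M := by
    rw [← AlgHom.commutes (mulAdd (p : ℤ) (0 : W.Point))]; exact hσ _
  have hpoly (q : k[X]) : aeval x q ∈ M := by
    induction q using Polynomial.induction_on' with
    | add p q hp hq => rw [map_add]; exact add_mem hp hq
    | monomial n a => rw [aeval_monomial]; exact mul_mem (hc a) (pow_mem hxM n)
  have hy : algebraMap _ (FF W) (yR W) ∈ M := by
    obtain ⟨N, r, q, hN, e⟩ :=
      exists_norm_eq (mulAdd (p : ℤ) (0 : W.Point) (algebraMap _ (FF W) (yR W)))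
    by_cases hq : q = 0
    · exfalso
      have h10 : (-1 : ℤ) ≠ 0 := by norm_num
      rw [hq, map_zero, zero_mul, add_zero] at e
      have hN' := aeval_gen_ne_zero (W := W) hN
      have h1 := congrArg (mulAdd (-1) (0 : W.Point)) e
      rw [map_mul, ← aeval_algHom_apply, ← aeval_algHom_apply, mulAdd_neg_one_xR, ← e] at h1
      have h2 := mul_right_cancel₀ hN' h1
      rw [mulAdd_mulAdd h10 hp0, smul_zero, add_zero, mul_comm] at h2
      have h3 : mulAdd (p : ℤ) (0 : W.Point) (mulAdd (-1) 0 (algebraMap _ (FF W) (yR W))) =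
          mulAdd (p : ℤ) (0 : W.Point) (algebraMap _ (FF W) (yR W)) := by
        rw [mulAdd_mulAdd hp0 h10, smul_zero, add_zero, h2]
      have h4 := (mulAdd (p : ℤ) (0 : W.Point)).injective h3
      obtain ⟨z, hz⟩ := mulAdd_neg_one_ne (W := W)
      apply hz
      have : mulAdd (-1) (0 : W.Point) = AlgHom.id k (FF W) :=
        FF.hom_ext mulAdd_neg_one_xR h4
      rw [this, AlgHom.id_apply]
    · have hq' := aeval_gen_ne_zero (W := W) hq
      rw [← hx] at hq' e
      rw [← mul_div_cancel_left₀ (algebraMap _ (FF W) (yR W)) hq', ← sub_eq_of_eq_add' e]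
      exact div_mem (sub_mem (mul_mem (hσ _) (hpoly _)) (hpoly _)) (hpoly _)
  have hR (f : W.CoordinateRing) : algebraMap _ (FF W) f ∈ M := by
    obtain ⟨r, q, rfl⟩ := exists_eq f
    rw [map_add, map_mul, ← aeval_algebraMap_apply, ← aeval_algebraMap_apply]
    exact add_mem (hpoly _) (mul_mem (hpoly _) hy)
  rw [eq_top_iff]
  rintro z -
  obtain ⟨r, s, hs, rfl⟩ := IsFractionRing.div_surjective (A := W.CoordinateRing) z
  exact div_mem (hR _) (hR _)

/-- A function that is invariant under translation by the `p`-torsion points is a pull-back under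
multiplication by `p`. It is a polynomial in `x` of degree less than `p ^ 2` with coefficients in the
subfield of pull-backs, and this polynomial takes the same value at the `p ^ 2` translates of `x`;
hence it is constant. -/
lemma exists_eq_mulAdd_of_invariant {g : FF W}
    (hg : ∀ T : W.Point, p • T = 0 → mulAdd 1 T g = g) :
    ∃ h, g = mulAdd (p : ℤ) (0 : W.Point) h := by
  set x := algebraMap _ (FF W) (xR W) with hx
  have hp0 : p ≠ 0 := hp.1.ne_zero
  have hp0' : (p : ℤ) ≠ 0 := Nat.cast_ne_zero.2 hp0
  set L := pullbackField W p with hL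
  obtain ⟨Φ, Ψ, hm⟩ := exists_isMulPair W p
  -- The equation of `x` over the pull-backs, given by `x (p X) Ψ (x) = Φ (x)`.
  set m : L[X] := Φ.map (algebraMap k L) -
    C ⟨mulAdd (p : ℤ) (0 : W.Point) x, mulAdd_mem x⟩ * Ψ.map (algebraMap k L) with hmdef
  have hlt : (C (⟨mulAdd (p : ℤ) (0 : W.Point) x, mulAdd_mem x⟩ : L) *
      Ψ.map (algebraMap k L)).degree < (Φ.map (algebraMap k L)).degree := by
    rw [degree_map, degree_eq_natDegree hm.monic.ne_zero, hm.natDegree_eq]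
    refine (degree_mul_le _ _).trans_lt ((add_le_add_left degree_C_le _).trans_lt ?_)
    rw [zero_add, degree_map]
    exact hm.degree_lt
  have hmm : m.Monic := (hm.monic.map _).sub_of_left hlt
  have hmd : m.degree = (p ^ 2 : ℕ) := by
    rw [hmdef, degree_sub_eq_left_of_degree_lt hlt, degree_map,
      degree_eq_natDegree hm.monic.ne_zero, hm.natDegree_eq]
  have hmx : aeval x m = 0 := by
    have := mulAdd_xR hp0 hm
    rw [hmdef, map_sub, map_mul, aeval_C, aeval_map_algebraMap, aeval_map_algebraMap, sub_eq_zero]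
    exact this.symm
  have hgM : g ∈ IntermediateField.adjoin L {x} := by
    rw [adjoin_xR_eq_top]; trivial
  have hint : IsIntegral L x := ⟨m, hmm, hmx⟩
  rw [← IntermediateField.mem_toSubalgebra,
    IntermediateField.adjoin_simple_toSubalgebra_of_isAlgebraic hint.isAlgebraic,
    Algebra.adjoin_singleton_eq_range_aeval] at hgM
  obtain ⟨q₀, hq₀⟩ := hgM
  set q := q₀ %ₘ m with hq
  have hqx : aeval x q = g := by
    rw [← hq₀]
    conv_rhs => rw [← modByMonic_add_div q₀ m]
    simp [hmx, hq]
  have hqd : q.degree < (p ^ 2 : ℕ) := hmd ▸ degree_modByMonic_lt q₀ hmm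
  have hfix (T : W.Point) (hT : p • T = 0) :
      (mulAdd 1 T : FF W →ₐ[k] FF W).toRingHom.comp (algebraMap L (FF W)) =
        algebraMap L (FF W) := by
    ext ⟨_, z, rfl⟩
    change mulAdd 1 T (mulAdd (p : ℤ) 0 z) = mulAdd (p : ℤ) 0 z
    rw [mulAdd_mulAdd one_ne_zero hp0', mul_one, natCast_zsmul, hT, add_zero]
  have hfin := finite_torsion W (Nat.cast_ne_zero.2 hp0 : (p : k) ≠ 0)
  have hcard : hfin.toFinset.card = p ^ 2 := by
    rw [← card_torsion W p, ← Set.ncard_eq_toFinset_card _ hfin, ← Nat.card_coe_set_eq]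
    exact Nat.card_congr (Equiv.subtypeEquivRight fun T => by
      rw [Set.mem_ofPred_eq, AddSubgroup.torsionBy.nsmul_iff])
  have hQ : q.map (algebraMap L (FF W)) - C g = 0 := by
    apply eq_zero_of_degree_lt_of_eval_finset_eq_zero
      (hfin.toFinset.image fun T => mulAdd 1 T x)
    · rw [Finset.card_image_of_injective _ mulAdd_one_xR_injective, hcard]
      refine (degree_sub_le _ _).trans_lt (max_lt (by rwa [degree_map]) ?_)
      refine degree_C_le.trans_lt ?_
      exact_mod_cast Nat.pos_of_ne_zero (pow_ne_zero 2 hp0)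
    · intro z hz
      obtain ⟨T, hT, rfl⟩ := Finset.mem_image.1 hz
      have hT' : p • T = 0 := by simpa using hT
      have h1 := hom_eval₂ q (algebraMap L (FF W)) (mulAdd 1 T : FF W →ₐ[k] FF W).toRingHom x
      rw [hfix T hT', ← aeval_def, hqx] at h1
      rw [eval_sub, eval_C, eval_map, sub_eq_zero]
      exact h1.symm.trans (hg T hT')
  have h0 := congrArg (fun r => r.coeff 0) hQ
  simp only [coeff_sub, coeff_map, coeff_C_zero, coeff_zero, sub_eq_zero] at h0
  obtain ⟨z, hz⟩ := (q.coeff 0).2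
  exact ⟨z, h0.symm.trans hz.symm⟩

/-- The Weil pairing is nondegenerate. If `e (P, ·)` is trivial, then the root function of `P` is a
pull-back of some `h` under multiplication by `p`, and `h ^ p` has divisor `p (P) - p (O)`. Hence `h`
has divisor `(P) - (O)`, which forces `P = O`. -/
theorem exists_weilPairing_ne_one {P : W.Point} (hP : p • P = 0) (hP0 : P ≠ 0) :
    ∃ Q : W.Point, p • Q = 0 ∧ weilPairing W p P Q ≠ 1 := by
  by_contra! H
  have hp0 : p ≠ 0 := hp.1.ne_zero
  obtain ⟨g, hg⟩ := exists_isRootFun (p := p) hP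
  obtain ⟨h, rfl⟩ := exists_eq_mulAdd_of_invariant (p := p) (g := g) fun T hT => by
    rw [hg.translate_eq hT, H T hT, map_one, one_mul]
  obtain ⟨-, f, c, hf, hc, e⟩ := hg
  rw [← map_pow, ← AlgHom.commutes (mulAdd (p : ℤ) (0 : W.Point)), ← map_mul] at e
  have e1 := (mulAdd (p : ℤ) (0 : W.Point)).injective e
  have hi : IsIntegral W.CoordinateRing h := by
    refine IsIntegral.of_pow (Nat.pos_of_ne_zero hp0) ?_
    rw [e1, IsScalarTower.algebraMap_apply k W.CoordinateRing (FF W), ← map_mul]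
    exact isIntegral_algebraMap
  obtain ⟨h', rfl⟩ := IsIntegrallyClosed.isIntegral_iff.1 hi
  rw [IsScalarTower.algebraMap_apply k W.CoordinateRing (FF W), ← map_mul, ← map_pow] at e1
  have e2 := IsFractionRing.injective W.CoordinateRing (FF W) e1
  have e3 : Ideal.span {h'} ^ p = pointIdeal W P ^ p := by
    rw [Ideal.span_singleton_pow, e2, ← hf]
    exact Ideal.span_singleton_mul_left_unit ((Ne.isUnit hc).map _) f
  have hd1 : Ideal.span {h'} = pointIdeal W P := by
    have hI : ∀ I J : Ideal W.CoordinateRing, I ^ p = J ^ p → I ∣ J := by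
      intro I J hIJ
      exact (pow_left_injective hp0 hIJ).dvd
    exact dvd_antisymm (hI _ _ e3) (hI _ _ e3.symm)
  have := exists_hasTorsionDivisor_iff.2 ⟨h', show HasTorsionDivisor W 1 P h' by
    rw [HasTorsionDivisor, pow_one, hd1]⟩
  rw [one_smul] at this
  exact hP0 this

end CurveRing
end

/-! ### Semilinear changes of coordinates and the Weil pairing -/

noncomputable section
namespace CurveRing
open scoped Classical
open WeierstrassCurve WeierstrassCurve.Affine WeierstrassCurve.Affine.CoordinateRing WeilPairing
open IsDedekindDomain TorsionCount

section Semilinear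
variable {k k' : Type*} [Field k] [Field k'] {W : Affine k} {W' : Affine k'}

/-- A semilinear change of coordinates from `W` to `W'`: a homomorphism `φ` of the base fields,
with an admissible change of variables that turns `W'` into the image of `W` under `φ`. -/
structure SemilinearChange (W : Affine k) (W' : Affine k') where
  φ : k →+* k'
  C : VariableChange k'
  smul_eq : C • (W' : WeierstrassCurve k') = WeierstrassCurve.map W φ

namespace SemilinearChange
variable (S : SemilinearChange W W')

/-- The image of the first coordinate. -/
def X (x : k) : k' := S.C.u ^ 2 * S.φ x + S.C.r

/-- The image of the second coordinate. -/
def Y (x y : k) : k' := S.C.u ^ 3 * S.φ y + S.C.s * S.C.u ^ 2 * S.φ x + S.C.t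

lemma coeff_eq :
    S.C.u * S.φ W.a₁ = W'.a₁ + 2 * S.C.s ∧
    S.C.u ^ 2 * S.φ W.a₂ = W'.a₂ - S.C.s * W'.a₁ + 3 * S.C.r - S.C.s ^ 2 ∧
    S.C.u ^ 3 * S.φ W.a₃ = W'.a₃ + S.C.r * W'.a₁ + 2 * S.C.t ∧
    S.C.u ^ 4 * S.φ W.a₄ = W'.a₄ - S.C.s * W'.a₃ + 2 * S.C.r * W'.a₂ -
      (S.C.t + S.C.r * S.C.s) * W'.a₁ + 3 * S.C.r ^ 2 - 2 * S.C.s * S.C.t ∧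
    S.C.u ^ 6 * S.φ W.a₆ = W'.a₆ + S.C.r * W'.a₄ + S.C.r ^ 2 * W'.a₂ + S.C.r ^ 3 - S.C.t * W'.a₃ -
      S.C.t ^ 2 - S.C.r * S.C.t * W'.a₁ := by
  have hu : (S.C.u : k') ≠ 0 := S.C.u.ne_zero
  have h1 := congrArg WeierstrassCurve.a₁ S.smul_eq
  have h2 := congrArg WeierstrassCurve.a₂ S.smul_eq
  have h3 := congrArg WeierstrassCurve.a₃ S.smul_eq
  have h4 := congrArg WeierstrassCurve.a₄ S.smul_eq
  have h6 := congrArg WeierstrassCurve.a₆ S.smul_eq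
  simp only [variableChange_a₁, variableChange_a₂, variableChange_a₃, variableChange_a₄,
    variableChange_a₆, map_a₁, map_a₂, map_a₃, map_a₄, map_a₆, Units.val_inv_eq_inv_val]
    at h1 h2 h3 h4 h6
  rw [← h1, ← h2, ← h3, ← h4, ← h6]
  refine ⟨?_, ?_, ?_, ?_, ?_⟩ <;> field_simp

lemma X_injective : Function.Injective S.X := by
  intro x x' h
  have hu : (S.C.u : k') ^ 2 ≠ 0 := pow_ne_zero _ S.C.u.ne_zero
  exact S.φ.injective (mul_left_cancel₀ hu (add_right_cancel h))

lemma Y_injective (x : k) : Function.Injective (S.Y x) := by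
  intro y y' h
  have hu : (S.C.u : k') ^ 3 ≠ 0 := pow_ne_zero _ S.C.u.ne_zero
  exact S.φ.injective (mul_left_cancel₀ hu (add_right_cancel (add_right_cancel h)))

lemma negY (x y : k) : W'.negY (S.X x) (S.Y x y) = S.Y x (W.negY x y) := by
  obtain ⟨h1, -, h3, -, -⟩ := S.coeff_eq
  simp only [Affine.negY, X, Y, map_sub, map_neg, map_mul]
  linear_combination (S.C.u : k') ^ 2 * S.φ x * h1 + h3

lemma equation {x y : k} (h : W.Equation x y) : W'.Equation (S.X x) (S.Y x y) := by
  obtain ⟨h1, h2, h3, h4, h6⟩ := S.coeff_eq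
  have e := congrArg S.φ ((equation_iff ..).1 h)
  simp only [map_add, map_mul, map_pow] at e
  rw [equation_iff, X, Y]
  generalize S.φ x = x' at *
  generalize S.φ y = y' at *
  generalize (S.C.u : k') = u at *
  linear_combination u ^ 6 * e + u ^ 5 * x' * y' * (- h1) + u ^ 3 * y' * (- h3) +
    u ^ 4 * x' ^ 2 * h2 + u ^ 2 * x' * h4 + h6

lemma slope {x₁ y₁ x₂ y₂ : k} (h₁ : W.Equation x₁ y₁) (h₂ : W.Equation x₂ y₂)
    (hxy : ¬(x₁ = x₂ ∧ y₁ = W.negY x₂ y₂)) :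
    W'.slope (S.X x₁) (S.X x₂) (S.Y x₁ y₁) (S.Y x₂ y₂) =
      S.C.u * S.φ (W.slope x₁ x₂ y₁ y₂) + S.C.s := by
  have hu : (S.C.u : k') ≠ 0 := S.C.u.ne_zero
  by_cases hx : x₁ = x₂
  · subst hx
    have hy : y₁ ≠ W.negY x₁ y₂ := fun h => hxy ⟨rfl, h⟩
    have hy12 : y₁ = y₂ := Y_eq_of_Y_ne h₁ h₂ rfl hy
    subst hy12
    have hY : S.Y x₁ y₁ ≠ W'.negY (S.X x₁) (S.Y x₁ y₁) := by
      rw [S.negY]; exact fun h => hy (S.Y_injective x₁ h)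
    rw [slope_of_Y_ne rfl hY, slope_of_Y_ne rfl hy, div_eq_iff (sub_ne_zero.2 hY), S.negY]
    have hD : S.φ (y₁ - W.negY x₁ y₁) ≠ 0 := (_root_.map_ne_zero S.φ).2 (sub_ne_zero.2 hy)
    have e1 : S.Y x₁ y₁ - S.Y x₁ (W.negY x₁ y₁) =
        S.C.u ^ 3 * S.φ (y₁ - W.negY x₁ y₁) := by
      simp only [Y, map_sub]; ring
    rw [e1, map_div₀]
    obtain ⟨h1, h2, h3, h4, h6⟩ := S.coeff_eq
    have e2 : 3 * S.X x₁ ^ 2 + 2 * W'.a₂ * S.X x₁ + W'.a₄ - W'.a₁ * S.Y x₁ y₁ = S.C.u ^ 4 *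
        S.φ (3 * x₁ ^ 2 + 2 * W.a₂ * x₁ + W.a₄ - W.a₁ * y₁) +
        S.C.s * (S.C.u ^ 3 * S.φ (y₁ - W.negY x₁ y₁)) := by
      simp only [X, Y, Affine.negY, map_sub, map_add, map_mul, map_pow, map_ofNat, map_neg]
      generalize S.φ x₁ = x at *
      generalize S.φ y₁ = y at *
      generalize (S.C.u : k') = u at *
      linear_combination u ^ 3 * y * h1 - 2 * u ^ 2 * x * h2 - h4 - S.C.s * u ^ 2 * x * h1 -
        S.C.s * h3
    rw [e2]
    field_simp
  · have hX : S.X x₁ ≠ S.X x₂ := fun h => hx (S.X_injective h)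
    rw [slope_of_X_ne hX, slope_of_X_ne hx, div_eq_iff (sub_ne_zero.2 hX), map_div₀]
    have hD : S.φ (x₁ - x₂) ≠ 0 := (_root_.map_ne_zero S.φ).2 (sub_ne_zero.2 hx)
    have e1 : S.X x₁ - S.X x₂ = S.C.u ^ 2 * S.φ (x₁ - x₂) := by
      simp only [X, map_sub]; ring
    rw [e1, add_mul, mul_left_comm, mul_assoc, div_mul_cancel₀ _ hD]
    simp only [Y, map_sub]
    ring

lemma addX (x₁ x₂ l : k) :
    W'.addX (S.X x₁) (S.X x₂) (S.C.u * S.φ l + S.C.s) = S.X (W.addX x₁ x₂ l) := by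
  obtain ⟨h1, h2, -, -, -⟩ := S.coeff_eq
  simp only [Affine.addX, X, map_add, map_sub, map_mul, map_pow]
  linear_combination h2 - S.C.u * S.φ l * h1

lemma negAddY (x₁ x₂ y₁ l : k) :
    W'.negAddY (S.X x₁) (S.X x₂) (S.Y x₁ y₁) (S.C.u * S.φ l + S.C.s) =
      S.Y (W.addX x₁ x₂ l) (W.negAddY x₁ x₂ y₁ l) := by
  rw [Affine.negAddY, addX, Affine.negAddY]
  simp only [X, Y, map_add, map_sub, map_mul]
  ring

lemma addY (x₁ x₂ y₁ l : k) :
    W'.addY (S.X x₁) (S.X x₂) (S.Y x₁ y₁) (S.C.u * S.φ l + S.C.s) =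
      S.Y (W.addX x₁ x₂ l) (W.addY x₁ x₂ y₁ l) := by
  rw [Affine.addY, negAddY, addX, S.negY, Affine.addY]

variable [W'.IsElliptic]

lemma nonsingular {x y : k} (h : W.Nonsingular x y) : W'.Nonsingular (S.X x) (S.Y x y) :=
  equation_iff_nonsingular.1 (S.equation h.1)

/-- The map of points. -/
def mapPoint : W.Point → W'.Point
  | .zero => 0
  | .some _ _ h => .some _ _ (S.nonsingular h)

/-- The homomorphism of groups of points that belongs to a semilinear change of coordinates. -/
def hom : W.Point →+ W'.Point where
  toFun := S.mapPoint
  map_zero' := rfl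
  map_add' P Q := by
    rcases P with _ | ⟨x₁, y₁, h₁⟩
    · change S.mapPoint (0 + Q) = 0 + S.mapPoint Q
      rw [zero_add, zero_add]
    rcases Q with _ | ⟨x₂, y₂, h₂⟩
    · change S.mapPoint (_ + 0) = S.mapPoint _ + 0
      rw [add_zero, add_zero]
    by_cases hxy : x₁ = x₂ ∧ y₁ = W.negY x₂ y₂
    · rw [Point.add_of_Y_eq hxy.1 hxy.2]
      symm
      refine Point.add_of_Y_eq (congrArg S.X hxy.1) ?_
      rw [S.negY, hxy.2, hxy.1]
    · have hxy' : ¬(S.X x₁ = S.X x₂ ∧ S.Y x₁ y₁ = W'.negY (S.X x₂) (S.Y x₂ y₂)) := by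
        rintro ⟨h3, h4⟩
        have h5 := S.X_injective h3
        subst h5
        rw [S.negY] at h4
        exact hxy ⟨rfl, S.Y_injective _ h4⟩
      rw [Point.add_some hxy]
      simp only [mapPoint]
      rw [Point.add_some hxy', Point.some.injEq, S.slope h₁.1 h₂.1 hxy, addX, addY]
      exact ⟨rfl, rfl⟩

lemma hom_some {x y : k} (h : W.Nonsingular x y) :
    S.hom (.some x y h) = .some _ _ (S.nonsingular h) := rfl

lemma hom_injective : Function.Injective S.hom := by
  rw [injective_iff_map_eq_zero]
  rintro (_ | ⟨x, y, h⟩) h0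
  · rfl
  · exact absurd h0 (Point.some_ne_zero _)

omit [W'.IsElliptic]

/-- The homomorphism of coordinate rings: the pull-back of functions along the inverse of the map
of points. -/
lemma exists_ringHom (S : SemilinearChange W W') :
    ∃ Θ : W.CoordinateRing →+* W'.CoordinateRing,
      (∀ c, Θ (algebraMap k _ c) = algebraMap k' _ (S.φ c)) ∧
      algebraMap k' _ (S.C.u ^ 2 : k') * Θ (xR W) = xR W' - algebraMap k' _ S.C.r ∧
      algebraMap k' _ (S.C.u ^ 3 : k') * Θ (yR W) =
        yR W' - algebraMap k' _ S.C.s * (xR W' - algebraMap k' _ S.C.r) - algebraMap k' _ S.C.t := by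
  obtain ⟨h1, h2, h3, h4, h6⟩ := S.coeff_eq
  let : Algebra k W'.CoordinateRing := ((algebraMap k' W'.CoordinateRing).comp S.φ).toAlgebra
  have hal (c : k) : algebraMap k W'.CoordinateRing c = algebraMap k' _ (S.φ c) := rfl
  have hu : (S.C.u : k') ≠ 0 := S.C.u.ne_zero
  set v : k' := (S.C.u : k')⁻¹ with hv
  have huv : (S.C.u : k') * v = 1 := mul_inv_cancel₀ hu
  set A := algebraMap k' W'.CoordinateRing with hA
  have e := equation_xR_yR (W := W')
  have a1 : A S.C.u * A (S.φ W.a₁) = A W'.a₁ + 2 * A S.C.s := by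
    rw [← map_mul, h1]; simp only [map_add, map_mul, map_ofNat]
  have a2 := congrArg A h2
  have a3 := congrArg A h3
  have a4 := congrArg A h4
  have a6 := congrArg A h6
  have auv := congrArg A huv
  simp only [map_add, map_sub, map_mul, map_pow, map_ofNat, map_one] at a2 a3 a4 a6 auv
  refine ⟨(liftHom W (A v ^ 2 * (xR W' - A S.C.r))
    (A v ^ 3 * (yR W' - A S.C.s * (xR W' - A S.C.r) - A S.C.t)) ?_).toRingHom, ?_, ?_, ?_⟩
  · simp only [hal]
    rw [← hA] at e
    have hu6 : A S.C.u ^ 6 * A v ^ 6 = 1 := by rw [← mul_pow, auv, one_pow]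
    generalize A S.C.u = u at *
    generalize A v = w at *
    generalize A (S.φ W.a₁) = b1 at *
    generalize A (S.φ W.a₂) = b2 at *
    generalize A (S.φ W.a₃) = b3 at *
    generalize A (S.φ W.a₄) = b4 at *
    generalize A (S.φ W.a₆) = b6 at *
    generalize A S.C.r = r at *
    generalize A S.C.s = s at *
    generalize A S.C.t = t at *
    generalize A W'.a₁ = c1 at *
    generalize A W'.a₂ = c2 at *
    generalize A W'.a₃ = c3 at *
    generalize A W'.a₄ = c4 at *
    generalize A W'.a₆ = c6 at *
    have d1 : b1 = w * (c1 + 2 * s) := by linear_combination w * a1 - b1 * auv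
    have d2 : b2 = w ^ 2 * (c2 - s * c1 + 3 * r - s ^ 2) := by
      rw [← a2, ← mul_assoc, ← mul_pow, mul_comm w, auv, one_pow, one_mul]
    have d3 : b3 = w ^ 3 * (c3 + r * c1 + 2 * t) := by
      rw [← a3, ← mul_assoc, ← mul_pow, mul_comm w, auv, one_pow, one_mul]
    have d4 : b4 = w ^ 4 * (c4 - s * c3 + 2 * r * c2 - (t + r * s) * c1 + 3 * r ^ 2 - 2 * s * t) := by
      rw [← a4, ← mul_assoc, ← mul_pow, mul_comm w, auv, one_pow, one_mul]
    have d6 : b6 = w ^ 6 * (c6 + r * c4 + r ^ 2 * c2 + r ^ 3 - t * c3 - t ^ 2 - r * t * c1) := by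
      rw [← a6, ← mul_assoc, ← mul_pow, mul_comm w, auv, one_pow, one_mul]
    rw [d1, d2, d3, d4, d6]
    linear_combination w ^ 6 * e
  · exact fun c => (liftHom W _ _ _).commutes c
  · change _ * liftHom W _ _ _ (xR W) = _
    rw [liftHom_xR, map_pow, ← mul_assoc, ← mul_pow, auv, one_pow, one_mul]
  · change _ * liftHom W _ _ _ (yR W) = _
    rw [liftHom_yR, map_pow, ← mul_assoc, ← mul_pow, auv, one_pow, one_mul]

variable [W'.IsElliptic]

/-- Semilinear changes of coordinates are compatible with the values of the Weil pairing. -/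
theorem isValue (S : SemilinearChange W W') {n : ℕ} {P Q : W.Point} {z : k}
    (h : IsValue W n P Q z) : IsValue W' n (S.hom P) (S.hom Q) (S.φ z) := by
  obtain ⟨Θ, h0, hx, hy⟩ := S.exists_ringHom
  have hu2 : IsUnit (algebraMap k' W'.CoordinateRing (S.C.u ^ 2 : k')) :=
    (Ne.isUnit (pow_ne_zero 2 S.C.u.ne_zero)).map _
  have hu3 : IsUnit (algebraMap k' W'.CoordinateRing (S.C.u ^ 3 : k')) :=
    (Ne.isUnit (pow_ne_zero 3 S.C.u.ne_zero)).map _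
  -- The map of coordinate rings takes the ideals of points, and values at points, to those of the
  -- images, so that it transports the data in the definition of the pairing.
  have hmap (P : W.Point) : (pointIdeal W P).map Θ = pointIdeal W' (S.hom P) := by
    rcases P with _ | ⟨x, y, hxy⟩
    · exact Ideal.map_top Θ
    · rw [S.hom_some, pointIdeal_some, pointIdeal_some, Ideal.map_span, Set.image_pair]
      have e1 : xR W' - algebraMap k' _ (S.X x) =
          algebraMap k' _ (S.C.u ^ 2 : k') * Θ (xR W - algebraMap k _ x) := by
        rw [map_sub, mul_sub, hx, h0, X, map_add, map_mul]; ring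
      have e2 : yR W' - algebraMap k' _ (S.Y x y) =
          algebraMap k' _ (S.C.u ^ 3 : k') * Θ (yR W - algebraMap k _ y) +
          algebraMap k' _ S.C.s * (xR W' - algebraMap k' _ (S.X x)) := by
        rw [map_sub, mul_sub, hy, h0, X, Y]; simp only [map_add, map_mul]; ring
      apply le_antisymm
      · rw [Ideal.span_le, Set.pair_subset_iff]
        have m1 := Ideal.subset_span (α := W'.CoordinateRing)
          (s := {xR W' - algebraMap k' _ (S.X x), yR W' - algebraMap k' _ (S.Y x y)})
          (Set.mem_insert _ _)
        have m2 := Ideal.subset_span (α := W'.CoordinateRing)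
          (s := {xR W' - algebraMap k' _ (S.X x), yR W' - algebraMap k' _ (S.Y x y)})
          (Set.mem_insert_of_mem _ rfl)
        refine ⟨(Ideal.unit_mul_mem_iff_mem _ hu2).1 (e1 ▸ m1),
          (Ideal.unit_mul_mem_iff_mem _ hu3).1 ?_⟩
        rw [eq_sub_of_add_eq e2.symm]
        exact sub_mem m2 (Ideal.mul_mem_left _ _ m1)
      · rw [Ideal.span_le, Set.pair_subset_iff]
        have m1 : xR W' - algebraMap k' _ (S.X x) ∈ Ideal.span
            {Θ (xR W - algebraMap k _ x), Θ (yR W - algebraMap k _ y)} := by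
          rw [e1]
          exact Ideal.mul_mem_left _ _ (Ideal.subset_span (Set.mem_insert _ _))
        refine ⟨m1, ?_⟩
        rw [SetLike.mem_coe, e2]
        exact add_mem (Ideal.mul_mem_left _ _ (Ideal.subset_span (Set.mem_insert_of_mem _ rfl)))
          (Ideal.mul_mem_left _ _ m1)
  have heval (f : W.CoordinateRing) (P : W.Point) :
      evalAt W' (Θ f) (S.hom P) = S.φ (evalAt W f P) := by
    rcases P with _ | ⟨x, y, hxy⟩
    · exact (map_zero S.φ).symm
    · rw [S.hom_some, evalAt_some, evalAt_some]
      have hm := Ideal.mem_map_of_mem Θ (sub_eval_mem hxy f)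
      rw [hmap, S.hom_some, mem_pointIdeal_some, map_sub, map_sub, h0, AlgHom.commutes] at hm
      exact sub_eq_zero.1 hm
  have htd {P : W.Point} {f : W.CoordinateRing} (hf : HasTorsionDivisor W n P f) :
      HasTorsionDivisor W' n (S.hom P) (Θ f) := by
    have := congrArg (Ideal.map Θ) hf
    rwa [Ideal.map_span, Set.image_singleton, Ideal.map_pow, hmap] at this
  obtain ⟨f, g, T, hf, hg, h1, h2, h3, h4, rfl⟩ := h
  refine ⟨Θ f, Θ g, S.hom T, htd hf, htd hg, ?_, ?_, ?_, ?_, ?_⟩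
  · rw [← map_zero S.hom]; exact fun h => h1 (S.hom_injective h)
  · exact fun h => h2 (S.hom_injective h)
  · rw [← map_neg]; exact fun h => h3 (S.hom_injective h)
  · rw [← map_sub]; exact fun h => h4 (S.hom_injective h)
  · simp only [← map_add, ← map_sub, ← map_neg, heval, map_div₀]

/-- Semilinear changes of coordinates are compatible with the Weil pairing. -/
theorem weilPairing_hom [IsAlgClosed k] [IsAlgClosed k'] [W.IsElliptic] (S : SemilinearChange W W')
    {n : ℕ} {P Q : W.Point} (hP : n • P = 0) (hQ : n • Q = 0) :
    weilPairing W' n (S.hom P) (S.hom Q) = S.φ (weilPairing W n P Q) := by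
  obtain ⟨f, hf⟩ := exists_hasTorsionDivisor_iff.1 hP
  obtain ⟨g, hg⟩ := exists_hasTorsionDivisor_iff.1 hQ
  exact weilPairing_eq_of_isValue (S.isValue (isValue_weilPairing hf hg))

end SemilinearChange
end Semilinear
end CurveRing
end

/-! ### Functions with a given norm -/

noncomputable section
namespace CurveRing
open scoped Classical
open WeierstrassCurve WeierstrassCurve.Affine WeierstrassCurve.Affine.CoordinateRing WeilPairing
open IsDedekindDomain TorsionCount

section Norm
variable {k : Type*} [Field k] [IsAlgClosed k] {W : Affine k} [W.IsElliptic]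

/-- A function with divisor `a (P) + b (-P)` on the affine curve is divisible by the power `d ^ b` of
the function `d` with divisor `(P) + (-P)`. -/
lemma exists_span_eq_pow_sub {P : W.Point} {d f : W.CoordinateRing} {a b : ℕ}
    (hd : Ideal.span {d} = pointIdeal W P * pointIdeal W (-P)) (hab : b ≤ a)
    (hf : Ideal.span {f} = pointIdeal W P ^ a * pointIdeal W (-P) ^ b) :
    ∃ g, f = d ^ b * g ∧ Ideal.span {g} = pointIdeal W P ^ (a - b) := by
  have h1 : Ideal.span {f} = Ideal.span {d ^ b} * pointIdeal W P ^ (a - b) := by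
    rw [← Ideal.span_singleton_pow, hd, mul_pow, hf, mul_right_comm, ← pow_add,
      Nat.add_sub_cancel' hab]
  have h2 : f ∈ Ideal.span {d ^ b} := by
    rw [← Ideal.span_singleton_le_iff_mem (Ideal.span {d ^ b}), h1]
    exact Ideal.mul_le_left
  obtain ⟨g, rfl⟩ := Ideal.mem_span_singleton'.1 h2
  refine ⟨g, mul_comm _ _, ?_⟩
  rw [mul_comm, ← Ideal.span_singleton_mul_span_singleton] at h1
  refine mul_left_cancel₀ ?_ h1
  rw [← Ideal.span_singleton_pow, hd]
  exact pow_ne_zero _ (mul_ne_zero (pointIdeal_ne_bot _) (pointIdeal_ne_bot _))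

/-- A function whose norm is `c (x - x(P)) ^ p`, and that vanishes at the `p`-torsion point `P`,
has divisor `p (P) - p (O)` if the prime `p` is odd. -/
lemma hasTorsionDivisor_of_norm {p : ℕ} [hp : Fact p.Prime] (hp2 : p ≠ 2) {x y : k}
    {h : W.Nonsingular x y} (hP : p • Point.some x y h = 0) {f : W.CoordinateRing} {c : k}
    (hc : c ≠ 0) (hN : f * conj W f = algebraMap k _ c * (xR W - algebraMap k _ x) ^ p)
    (h0 : evalAt W f (.some x y h) = 0) : HasTorsionDivisor W p (.some x y h) f := by
  set P := Point.some x y h with hPdef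
  have hP0 : P ≠ 0 := Point.some_ne_zero h
  set d := xR W - algebraMap k _ x with hd
  have hd0 : d ≠ 0 := by rw [hd, ← XClass_eq]; exact XClass_ne_zero x
  have hdI : Ideal.span {d} = pointIdeal W P * pointIdeal W (-P) := by
    rw [mul_comm]; exact (pointIdeal_neg_mul h).symm
  have hIp : Prime (pointIdeal W P) :=
    Ideal.prime_of_isPrime (pointIdeal_ne_bot P) (isMaximal_pointIdeal hP0).isPrime
  have hJp : Prime (pointIdeal W (-P)) :=
    Ideal.prime_of_isPrime (pointIdeal_ne_bot _) (isMaximal_pointIdeal (neg_ne_zero.2 hP0)).isPrime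
  have hdvd : Ideal.span {f} ∣ pointIdeal W P ^ p * pointIdeal W (-P) ^ p := by
    refine ⟨Ideal.span {conj W f}, ?_⟩
    rw [Ideal.span_singleton_mul_span_singleton, hN, ← mul_pow, ← hdI, Ideal.span_singleton_pow]
    exact (Ideal.span_singleton_mul_left_unit ((Ne.isUnit hc).map _) _).symm
  have hord {m : ℕ} (hm : m ≤ p) {Q : W.Point} (hQ0 : Q ≠ 0) (hQ : p • Q = 0) (hmQ : m • Q = 0) :
      m = 0 ∨ m = p := by
    have h1 := addOrderOf_eq_prime hQ hQ0
    have h2 := addOrderOf_dvd_of_nsmul_eq_zero hmQ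
    rw [h1] at h2
    rcases Nat.eq_zero_or_pos m with h3 | h3
    · exact Or.inl h3
    · exact Or.inr (le_antisymm hm (Nat.le_of_dvd h3 h2))
  -- the case of equal multiplicities contradicts the parity of `p`
  have hparity {a : ℕ} {g : W.CoordinateRing} (hg : f = d ^ a * g) (hgu : IsUnit g) : False := by
    obtain ⟨e, he, rfl⟩ := exists_const_of_isUnit hgu
    have hcd : conj W d = d := by rw [hd, map_sub, conj_xR, AlgHom.commutes]
    rw [hg, map_mul, map_pow, hcd, AlgHom.commutes] at hN
    have h1 : algebraMap k W.CoordinateRing (e * e) * d ^ (2 * a) = algebraMap k _ c * d ^ p := by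
      rw [← hN, map_mul]; ring
    have h2 := congrArg normDegree h1
    have hcst {z : k} (hz : z ≠ 0) : normDegree (algebraMap k W.CoordinateRing z) = 0 := by
      have := natDegree_eq_zero_of_isUnit (((Ne.isUnit hz).map
        (algebraMap k W.CoordinateRing)).map (Algebra.norm k[X]))
      exact this
    have hne {z : k} (hz : z ≠ 0) : algebraMap k W.CoordinateRing z ≠ 0 :=
      ((Ne.isUnit hz).map (algebraMap k W.CoordinateRing)).ne_zero
    rw [normDegree_mul (hne (mul_ne_zero he he)) (pow_ne_zero _ hd0),
      normDegree_mul (hne hc) (pow_ne_zero _ hd0), hcst (mul_ne_zero he he), hcst hc,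
      normDegree_pow, normDegree_pow, hd, normDegree_x_sub] at h2
    rcases hp.1.eq_two_or_odd' with h3 | ⟨m, h3⟩
    · exact hp2 h3
    · omega
  -- The divisor of `f` is `a (P) + b (-P)` with `a, b ≤ p`. After division by a power of `x - x (P)` it
  -- is a multiple of `P` or of `-P`, and the multiplicity is `0` or `p` because `P` has order `p`.
  obtain ⟨A, B, hA, hB, hAB⟩ := exists_dvd_and_dvd_of_dvd_mul hdvd
  obtain ⟨a, hap, hA'⟩ := (dvd_prime_pow hIp p).1 hA
  obtain ⟨b, hbp, hB'⟩ := (dvd_prime_pow hJp p).1 hB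
  rw [associated_iff_eq] at hA' hB'
  rw [hA', hB'] at hAB
  have hunit {P : W.Point} {g : W.CoordinateRing} (hg : Ideal.span {g} = pointIdeal W P ^ 0) :
      IsUnit g := by
    rwa [pow_zero, Ideal.one_eq_top, Ideal.span_singleton_eq_top] at hg
  rcases le_total b a with hba | hba
  · obtain ⟨g, hg, hgI⟩ := exists_span_eq_pow_sub hdI hba hAB
    rcases hord (by omega) hP0 hP (exists_hasTorsionDivisor_iff.2 ⟨g, hgI⟩) with h1 | h1
    · rw [h1] at hgI
      exact (hparity hg (hunit hgI)).elim
    · have hb : b = 0 := by omega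
      have ha : a = p := by omega
      rw [hb, ha, pow_zero, mul_one] at hAB
      exact hAB
  · exfalso
    have hdI' : Ideal.span {d} = pointIdeal W (-P) * pointIdeal W (-(-P)) := by
      rw [neg_neg, hdI, mul_comm]
    obtain ⟨g, hg, hgI⟩ := exists_span_eq_pow_sub hdI' hba (by rw [neg_neg, hAB, mul_comm])
    have hQ : p • (-P) = 0 := by rw [smul_neg, hP, neg_zero]
    rcases hord (by omega) (neg_ne_zero.2 hP0) hQ
      (exists_hasTorsionDivisor_iff.2 ⟨g, hgI⟩) with h1 | h1
    · rw [h1] at hgI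
      exact hparity hg (hunit hgI)
    · have ha : a = 0 := by omega
      have hb : b = p := by omega
      rw [hb, ha, pow_zero, one_mul] at hAB
      -- The divisor `p (-P)` is excluded, since `f` vanishes at `P ≠ -P`.
      have h2 : pointIdeal W P ∣ pointIdeal W (-P) ^ p := by
        rw [← hAB, Ideal.dvd_iff_le, Ideal.span_singleton_le_iff_mem]
        exact (mem_pointIdeal hP0).2 h0
      have h3 := Ideal.le_of_dvd (hIp.dvd_of_dvd_pow h2)
      have h4 := (isMaximal_pointIdeal (neg_ne_zero.2 hP0)).eq_of_le
        (isMaximal_pointIdeal hP0).ne_top h3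
      have h5 := pointIdeal_injective h4
      have h6 : 2 • P = 0 := by rw [two_smul]; exact eq_neg_iff_add_eq_zero.1 h5.symm
      rcases hord hp.1.two_le hP0 hP h6 with h7 | h7
      · omega
      · exact hp2 h7.symm

end Norm
end CurveRing
end

/-! ### Reduction of the Weil pairing -/

noncomputable section
namespace CurveRing
open scoped Classical
open WeierstrassCurve WeierstrassCurve.Affine WeierstrassCurve.Affine.CoordinateRing WeilPairing
open IsDedekindDomain TorsionCount

section Reduction
variable {K κ : Type*} [Field K] [Field κ] (v : Place K κ)

/-- Two polynomials can be scaled so that they have regular coefficients and do not both vanish at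
the place. -/
lemma exists_primitive {a b : K[X]} (h : a ≠ 0 ∨ b ≠ 0) :
    ∃ (c : K) (a₀ b₀ : v.ring[X]), c ≠ 0 ∧ C c * a = a₀.map v.ring.subtype ∧
      C c * b = b₀.map v.ring.subtype ∧ (a₀.map v.res ≠ 0 ∨ b₀.map v.res ≠ 0) := by
  set s := a.support.image a.coeff ∪ b.support.image b.coeff with hs
  have hmem (z : K) : z ∈ s ↔ z ≠ 0 ∧ ((∃ n, a.coeff n = z) ∨ ∃ n, b.coeff n = z) := by
    rw [hs, Finset.mem_union, Finset.mem_image, Finset.mem_image]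
    simp only [mem_support_iff]
    constructor
    · rintro (⟨n, hn, rfl⟩ | ⟨n, hn, rfl⟩)
      · exact ⟨hn, Or.inl ⟨n, rfl⟩⟩
      · exact ⟨hn, Or.inr ⟨n, rfl⟩⟩
    · rintro ⟨h0, ⟨n, rfl⟩ | ⟨n, rfl⟩⟩
      · exact Or.inl ⟨n, h0, rfl⟩
      · exact Or.inr ⟨n, h0, rfl⟩
  have hne : s.Nonempty := by
    rcases h with h | h
    · exact ⟨a.leadingCoeff, (hmem _).2 ⟨leadingCoeff_ne_zero.2 h, Or.inl ⟨_, rfl⟩⟩⟩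
    · exact ⟨b.leadingCoeff, (hmem _).2 ⟨leadingCoeff_ne_zero.2 h, Or.inr ⟨_, rfl⟩⟩⟩
  obtain ⟨z, hz, hmax⟩ := s.exists_max_image v.ring.valuation hne
  obtain ⟨hz0, hz'⟩ := (hmem z).1 hz
  have hreg (w : K) (hw : (∃ n, a.coeff n = w) ∨ ∃ n, b.coeff n = w) : z⁻¹ * w ∈ v.ring := by
    by_cases hw0 : w = 0
    · rw [hw0, mul_zero]; exact zero_mem _
    · rw [← ValuationSubring.valuation_le_one_iff, map_mul, map_inv₀]
      have h1 := hmax w ((hmem w).2 ⟨hw0, hw⟩)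
      have h2 : v.ring.valuation z ≠ 0 := (_root_.map_ne_zero _).2 hz0
      calc _ ≤ (v.ring.valuation z)⁻¹ * v.ring.valuation z := by gcongr
        _ = 1 := inv_mul_cancel₀ h2
  have hlift {q : K[X]} (hq : ∀ n, z⁻¹ * q.coeff n ∈ v.ring) :
      ∃ q₀ : v.ring[X], C z⁻¹ * q = q₀.map v.ring.subtype := by
    have : C z⁻¹ * q ∈ Polynomial.lifts v.ring.subtype := by
      rw [Polynomial.lifts_iff_coeff_lifts]
      intro n
      rw [coeff_C_mul]
      exact ⟨⟨_, hq n⟩, rfl⟩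
    obtain ⟨q₀, hq₀⟩ := this
    exact ⟨q₀, hq₀.symm⟩
  obtain ⟨a₀, ha₀⟩ := hlift fun n => hreg _ (Or.inl ⟨n, rfl⟩)
  obtain ⟨b₀, hb₀⟩ := hlift fun n => hreg _ (Or.inr ⟨n, rfl⟩)
  refine ⟨z⁻¹, a₀, b₀, inv_ne_zero hz0, ha₀, hb₀, ?_⟩
  have hone {q : K[X]} {q₀ : v.ring[X]} {n : ℕ} (hn : q.coeff n = z)
      (hq : C z⁻¹ * q = q₀.map v.ring.subtype) : q₀.map v.res ≠ 0 := by
    intro h0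
    have h1 := congrArg (fun r => r.coeff n) hq
    simp only [coeff_C_mul, coeff_map, hn, inv_mul_cancel₀ hz0] at h1
    have h2 : q₀.coeff n = 1 := Subtype.ext h1.symm
    have h3 := congrArg (fun r => r.coeff n) h0
    simp [h2] at h3
  rcases hz' with ⟨n, hn⟩ | ⟨n, hn⟩
  · exact Or.inl (hone hn ha₀)
  · exact Or.inr (hone hn hb₀)

variable {v}

lemma red_eval_map (q : v.ring[X]) {x : K} {x' : κ} (hx : v.Red x x') :
    v.Red ((q.map v.ring.subtype).eval x) ((q.map v.res).eval x') := by
  obtain ⟨hx, rfl⟩ := hx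
  have h1 := hom_eval₂ q (RingHom.id v.ring) v.ring.subtype ⟨x, hx⟩
  have h2 := hom_eval₂ q (RingHom.id v.ring) v.res ⟨x, hx⟩
  rw [RingHom.comp_id] at h1 h2
  rw [eval_map, eval_map, ← h2]
  refine ⟨?_, ?_⟩
  · rw [← show v.ring.subtype ⟨x, hx⟩ = x from rfl, ← h1]
    exact Subtype.property _
  · congr 1
    apply Subtype.ext
    exact h1.symm

variable {W : Affine K} {W' : Affine κ}

lemma _root_.Place.RedPt.red_evalAt {P : W.Point} {P' : W'.Point} (h : v.RedPt W W' P P') (hP' : P' ≠ 0)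
    (a b : v.ring[X]) :
    v.Red (evalAt W (aeval (xR W) (a.map v.ring.subtype) +
        aeval (xR W) (b.map v.ring.subtype) * yR W) P)
      (evalAt W' (aeval (xR W') (a.map v.res) + aeval (xR W') (b.map v.res) * yR W') P') := by
  cases h with
  | zero => exact absurd rfl hP'
  | pole h hx => exact absurd rfl hP'
  | some h h' hx hy =>
    rw [evalAt_some, evalAt_some]
    simp only [map_add, map_mul, evalHom_aeval, evalHom_yR]
    exact (red_eval_map a hx).add ((red_eval_map b hx).mul hy)

variable [IsAlgClosed K] [IsAlgClosed κ] [W.IsElliptic] [W'.IsElliptic]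

lemma norm_eq (a b : K[X]) : Algebra.norm K[X] (aeval (xR W) a + aeval (xR W) b * yR W) =
    a ^ 2 - a * b * (C W.a₁ * X + C W.a₃) -
      b ^ 2 * (X ^ 3 + C W.a₂ * X ^ 2 + C W.a₄ * X + C W.a₆) := by
  rw [← smul_one_add_smul]
  exact norm_smul_basis a b

/-- A function with divisor `p (P) - p (O)` on `W`, suitably scaled, reduces to a function with the
corresponding divisor on the reduced curve. The norm of the function is a constant times
`(x - x (P)) ^ p`, and this equation reduces, so that the reduced divisor is determined by
`hasTorsionDivisor_of_norm`. -/
lemma exists_hasTorsionDivisor_reduction (hW : v.RedCurve W W') {p : ℕ} [hp : Fact p.Prime]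
    (hp2 : p ≠ 2) {P : W.Point} (hP : p • P = 0) (hP0 : hW.hom P = 0 → P = 0) :
    ∃ (f : W.CoordinateRing) (f' : W'.CoordinateRing), HasTorsionDivisor W p P f ∧
      HasTorsionDivisor W' p (hW.hom P) f' ∧
      ∀ S, hW.hom S ≠ 0 → v.Red (evalAt W f S) (evalAt W' f' (hW.hom S)) := by
  by_cases h0 : P = 0
  · subst h0
    refine ⟨1, 1, ?_, ?_, fun S hS => ?_⟩
    · rw [HasTorsionDivisor, pointIdeal_zero, Ideal.span_singleton_one, ← Ideal.one_eq_top, one_pow]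
    · rw [map_zero, HasTorsionDivisor, pointIdeal_zero, Ideal.span_singleton_one,
        ← Ideal.one_eq_top, one_pow]
    · have hS0 : S ≠ 0 := by rintro rfl; exact hS (map_zero _)
      obtain ⟨φ, hφ⟩ := evalAt_mul_add hS0
      obtain ⟨φ', hφ'⟩ := evalAt_mul_add hS
      rw [hφ, hφ', map_one, map_one]
      exact Place.red_one
  have hP' : hW.hom P ≠ 0 := fun h => h0 (hP0 h)
  have hpP' : p • hW.hom P = 0 := by rw [← map_nsmul, hP, map_zero]
  have hred := hW.redPt_hom P
  obtain ⟨f₁, hf₁⟩ := exists_hasTorsionDivisor_iff.1 hP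
  obtain ⟨a, b, hab⟩ := exists_eq f₁
  have hab0 : a ≠ 0 ∨ b ≠ 0 := by
    by_contra! h
    apply ne_zero_of_span hf₁
    rw [hab, h.1, h.2, map_zero, zero_mul, add_zero]
  obtain ⟨c, a₀, b₀, hc, ha₀, hb₀, hne⟩ := exists_primitive v hab0
  set f := aeval (xR W) (a₀.map v.ring.subtype) + aeval (xR W) (b₀.map v.ring.subtype) * yR W
    with hf
  set f' := aeval (xR W') (a₀.map v.res) + aeval (xR W') (b₀.map v.res) * yR W' with hf'
  have hff₁ : f = algebraMap K _ c * f₁ := by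
    rw [hf, ← ha₀, ← hb₀, hab]
    simp only [map_mul, aeval_C]
    ring
  have hfd : HasTorsionDivisor W p P f := by
    rw [HasTorsionDivisor, hff₁, Ideal.span_singleton_mul_left_unit ((Ne.isUnit hc).map _)]
    exact hf₁
  refine ⟨f, f', hfd, ?_, fun S hS => (hW.redPt_hom S).red_evalAt hS a₀ b₀⟩
  have hf0 : evalAt W' f' (hW.hom P) = 0 := by
    have h1 := hred.red_evalAt hP' a₀ b₀
    rw [← hf, ← hf'] at h1
    have h2 : evalAt W f P = 0 := by
      rw [← mem_pointIdeal h0]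
      apply Ideal.pow_le_self hp.1.ne_zero
      rw [← show Ideal.span {f} = _ from hfd]
      exact Ideal.mem_span_singleton_self f
    rw [h2] at h1
    exact h1.unique Place.red_zero
  have hf'0 : f' ≠ 0 := by
    intro h
    rw [hf', ← smul_one_add_smul] at h
    have := (smul_basis_eq_zero h)
    rcases hne with h1 | h1
    · exact h1 this.1
    · exact h1 this.2
  have hnorm' := norm_ne_zero hf'0
  generalize hW.hom P = P' at *
  cases hred with
  | zero => exact absurd rfl hP'
  | pole h hx => exact absurd rfl hP'
  | some h h' hx hy =>
    rename_i x y x' y'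
    obtain ⟨e, he, hfe⟩ : ∃ e : K, e ≠ 0 ∧
        f * conj W f = algebraMap K _ e * (xR W - algebraMap K _ x) ^ p := by
      have h1 : Ideal.span {f * conj W f} = Ideal.span {(xR W - algebraMap K _ x) ^ p} := by
        rw [← Ideal.span_singleton_mul_span_singleton, span_conj_eq hfd,
          show Ideal.span {f} = _ from hfd, ← Ideal.span_singleton_pow, ← pointIdeal_neg_mul h,
          mul_pow, mul_comm]
      obtain ⟨u, hu⟩ := Ideal.span_singleton_eq_span_singleton.1 h1.symm
      obtain ⟨e, he, e1⟩ := exists_const_of_isUnit u.isUnit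
      exact ⟨e, he, by rw [← hu, e1, mul_comm]⟩
    have hnorm : Algebra.norm K[X] f = C e * (X - C x) ^ p := by
      apply FaithfulSMul.algebraMap_injective K[X] W.CoordinateRing
      rw [← mul_conj, hfe, algebraMap_poly_eq]
      simp
    obtain ⟨hx, rfl⟩ := hx
    obtain ⟨m1, e1⟩ := hW.a₁
    obtain ⟨m2, e2⟩ := hW.a₂
    obtain ⟨m3, e3⟩ := hW.a₃
    obtain ⟨m4, e4⟩ := hW.a₄
    obtain ⟨m6, e6⟩ := hW.a₆
    -- The norm of the scaled function, with coefficients in the valuation ring.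
    set N₀ : v.ring[X] := a₀ ^ 2 - a₀ * b₀ * (C ⟨W.a₁, m1⟩ * X + C ⟨W.a₃, m3⟩) -
      b₀ ^ 2 * (X ^ 3 + C ⟨W.a₂, m2⟩ * X ^ 2 + C ⟨W.a₄, m4⟩ * X + C ⟨W.a₆, m6⟩) with hN₀
    have hN : N₀.map v.ring.subtype = C e * (X - C x) ^ p := by
      rw [← hnorm, hf, norm_eq, hN₀]
      simp only [Polynomial.map_sub, Polynomial.map_add, Polynomial.map_mul, Polynomial.map_pow,
        map_C, map_X]
      rfl
    have hN' : N₀.map v.res = Algebra.norm κ[X] f' := by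
      rw [hf', norm_eq, hN₀]
      simp only [Polynomial.map_sub, Polynomial.map_add, Polynomial.map_mul, Polynomial.map_pow,
        map_C, map_X, e1, e2, e3, e4, e6]
    have hlead : (N₀.coeff p : K) = e := by
      have h1 := congrArg (fun r => r.coeff p) hN
      have h2 : ((X - C x) ^ p).coeff p = 1 := by
        have := ((monic_X_sub_C x).pow p).coeff_natDegree
        rwa [natDegree_pow, natDegree_X_sub_C, mul_one] at this
      simp only [coeff_map, coeff_C_mul, h2, mul_one] at h1
      exact h1
    have hN₀' : N₀ = C (N₀.coeff p) * (X - C ⟨x, hx⟩) ^ p := by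
      apply Polynomial.map_injective v.ring.subtype Subtype.val_injective
      rw [hN, ← hlead]
      simp only [Polynomial.map_sub, Polynomial.map_mul, Polynomial.map_pow, map_C, map_X]
      rfl
    have hN'' : Algebra.norm κ[X] f' = C (v.res (N₀.coeff p)) * (X - C (v.res ⟨x, hx⟩)) ^ p := by
      rw [← hN']
      conv_lhs => rw [hN₀']
      simp only [Polynomial.map_sub, Polynomial.map_mul, Polynomial.map_pow, map_C, map_X]
    refine hasTorsionDivisor_of_norm hp2 hpP' (c := v.res (N₀.coeff p)) ?_ ?_ hf0
    · intro h0
      rw [hN'', h0, C_0, zero_mul] at hnorm'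
      exact hnorm' rfl
    · rw [mul_conj, hN'', algebraMap_poly_eq]
      simp

/-- The reduction of points is surjective onto the points of the reduced curve. -/
lemma _root_.Place.RedCurve.hom_surjective (hW : v.RedCurve W W') (hv : Function.Surjective v.res) :
    Function.Surjective hW.hom := by
  intro P'
  rcases P' with _ | ⟨x', y', h'⟩
  · exact ⟨0, map_zero _⟩
  obtain ⟨⟨x, hx⟩, hxx⟩ := hv x'
  obtain ⟨y, h⟩ := exists_point W x
  have hxr : v.Red x x' := ⟨hx, hxx⟩
  obtain ⟨y₁, hy⟩ := Place.exists_red (hW.y_mem h.1 hx)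
  have h1 : W'.Nonsingular x' y₁ := equation_iff_nonsingular.1 (hW.equation h.1 hxr hy)
  have h2 := hW.hom_eq (.some h h1 hxr hy)
  rcases (Point.X_eq_iff (h₁ := h1) (h₂ := h')).1 rfl with h3 | h3
  · exact ⟨_, h2.trans h3⟩
  · refine ⟨-.some x y h, ?_⟩
    rw [map_neg, h2, h3, neg_neg]

/-- The Weil pairing is compatible with reduction. -/
theorem red_weilPairing (hW : v.RedCurve W W') (hv : Function.Surjective v.res) {p : ℕ}
    [hp : Fact p.Prime] (hp2 : p ≠ 2) {P Q : W.Point} (hP : p • P = 0) (hQ : p • Q = 0)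
    (hP0 : hW.hom P = 0 → P = 0) (hQ0 : hW.hom Q = 0 → Q = 0) :
    v.Red (weilPairing W p P Q) (weilPairing W' p (hW.hom P) (hW.hom Q)) := by
  obtain ⟨f, f', hf, hf', hfr⟩ := exists_hasTorsionDivisor_reduction hW hp2 hP hP0
  obtain ⟨g, g', hg, hg', hgr⟩ := exists_hasTorsionDivisor_reduction hW hp2 hQ hQ0
  set P' := hW.hom P with hP'
  set Q' := hW.hom Q with hQ'
  obtain ⟨S', -, hS'⟩ := (infinite_point (W := W')).exists_notMem_finset {0, P', -Q', P' - Q'}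
  simp only [Finset.mem_insert, Finset.mem_singleton, not_or] at hS'
  obtain ⟨hS0, hSP, hSQ, hSPQ⟩ := hS'
  obtain ⟨S, rfl⟩ := hW.hom_surjective hv S'
  have hne {n : ℕ} {A B : W'.Point} {f : W'.CoordinateRing} (hf : HasTorsionDivisor W' n A f)
      (hB : B ≠ 0) (hBA : B ≠ A) : evalAt W' f B ≠ 0 := by
    rw [← val_algebraMap_eq_one hB, val_of_span hf hB, if_neg hBA]
    simp
  have h1 : weilPairing W p P Q =
      (evalAt W f (Q + S) / evalAt W f S) / (evalAt W g (P - S) / evalAt W g (-S)) := by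
    refine weilPairing_eq_of_isValue ⟨f, g, S, hf, hg, ?_, ?_, ?_, ?_, rfl⟩
    · rintro rfl; exact hS0 (map_zero _)
    · rintro rfl; exact hSP rfl
    · rintro rfl; exact hSQ (map_neg _ _)
    · rintro rfl; exact hSPQ (map_sub _ _ _)
  have h2 : weilPairing W' p P' Q' = (evalAt W' f' (Q' + hW.hom S) / evalAt W' f' (hW.hom S)) /
      (evalAt W' g' (P' - hW.hom S) / evalAt W' g' (-hW.hom S)) :=
    weilPairing_eq_of_isValue ⟨f', g', hW.hom S, hf', hg', hS0, hSP, hSQ, hSPQ, rfl⟩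
  have n1 : Q' + hW.hom S ≠ 0 := fun h => hSQ (add_eq_zero_iff_eq_neg'.1 h)
  have n2 : P' - hW.hom S ≠ 0 := fun h => hSP (sub_eq_zero.1 h).symm
  have n3 : -hW.hom S ≠ 0 := neg_ne_zero.2 hS0
  have n4 : P' - hW.hom S ≠ Q' := fun h => hSPQ (by rw [← h, sub_sub_cancel])
  have n5 : -hW.hom S ≠ Q' := fun h => hSQ (by rw [← h, neg_neg])
  have r1 := hfr (Q + S) (by rw [map_add]; exact n1)
  have r2 := hfr S hS0
  have r3 := hgr (P - S) (by rw [map_sub]; exact n2)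
  have r4 := hgr (-S) (by rw [map_neg]; exact n3)
  rw [map_add] at r1
  rw [map_sub] at r3
  rw [map_neg] at r4
  rw [h1, h2]
  exact (r1.div r2 (hne hf' hS0 hSP)).div (r3.div r4 (hne hg' n3 n5))
    (div_ne_zero (hne hg' n2 n4) (hne hg' n3 n5))

end Reduction
end CurveRing
end

/-! ### Odd torsion in residue characteristic two -/

noncomputable section
namespace CurveRing
open scoped Classical
open WeierstrassCurve WeierstrassCurve.Affine WeierstrassCurve.Affine.CoordinateRing WeilPairing
open IsDedekindDomain TorsionCount

section TorsionReduction
variable {K κ : Type*} [Field K] [Field κ] {v : Place K κ} {W : Affine K} {W' : Affine κ}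

lemma valuation_lt_one_of_red {a : K} (h : v.Red a 0) : v.ring.valuation a < 1 := by
  by_cases ha : a = 0
  · rw [ha, map_zero]; exact zero_lt_one
  by_contra hc
  have h1 : a⁻¹ ∈ v.ring := by
    rw [← ValuationSubring.valuation_le_one_iff, map_inv₀]
    exact inv_le_one_of_one_le₀ (not_lt.1 hc)
  obtain ⟨b, hb⟩ := Place.exists_red h1
  have h2 := h.mul hb
  rw [mul_inv_cancel₀ ha, zero_mul] at h2
  exact one_ne_zero (Place.red_one.unique h2)

/-- In residue characteristic two, doubling moves a point of the kernel of reduction closer to the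
point at infinity. -/
lemma exists_double_pole [CharP κ 2] (hW : v.RedCurve W W') {x y : K} {h : W.Nonsingular x y}
    (hx : x ∉ v.ring) (h2 : 2 • Point.some x y h ≠ 0) :
    ∃ x₂ y₂ h₂, 2 • Point.some x y h = .some x₂ y₂ h₂ ∧ x₂ ∉ v.ring ∧
      v.ring.valuation x < v.ring.valuation x₂ := by
  have hy : y ≠ W.negY x y := by
    intro hy
    apply h2
    rw [two_smul, Point.add_self_of_Y_eq hy]
  refine ⟨_, _, _, (two_smul ℕ _).trans (Point.add_self_of_Y_ne hy), ?_⟩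
  obtain ⟨hA, hB⟩ := forms_double W h.1 hy
  set X₂ := W.addX x x (W.slope x x y y) with hX₂
  set D := y - W.negY x y with hD
  have hD0 : D ≠ 0 := sub_ne_zero.2 hy
  have hx0 : x ≠ 0 := by rintro rfl; exact hx (zero_mem _)
  have hz := Place.red_inv_of_notMem hx
  set z := x⁻¹ with hzdef
  have hxz : x * z = 1 := mul_inv_cancel₀ hx0
  have hz0 : z ≠ 0 := inv_ne_zero hx0
  -- With `z = 1 / x`, the duplication formula expresses `x (2 P)` and `x (P)` over the common factor
  -- `D ^ 2 z ^ 4`, where the first numerator reduces to `1`, and the second one to `0` because `2`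
  -- reduces to `0`.
  have two {a : K} {a' : κ} (ha : v.Red a a') : v.Red (2 * a) 0 := by
    have h1 := (Place.red_ofNat (v := v) 2).mul ha
    have h2 : (OfNat.ofNat 2 : κ) = 0 := CharTwo.two_eq_zero
    rwa [h2, zero_mul] at h1
  have b2 : v.Red W.b₂ (W'.a₁ ^ 2 + 4 * W'.a₂) :=
    (hW.a₁.pow 2).add ((Place.red_ofNat 4).mul hW.a₂)
  have b4 : v.Red W.b₄ (2 * W'.a₄ + W'.a₁ * W'.a₃) :=
    ((Place.red_ofNat 2).mul hW.a₄).add (hW.a₁.mul hW.a₃)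
  have b6 : v.Red W.b₆ (W'.a₃ ^ 2 + 4 * W'.a₆) := (hW.a₃.pow 2).add ((Place.red_ofNat 4).mul hW.a₆)
  have b8 : v.Red W.b₈ W'.b₈ := by
    rw [b₈, b₈]
    exact (((((hW.a₁.pow 2).mul hW.a₆).add (((Place.red_ofNat 4).mul hW.a₂).mul hW.a₆)).sub
      ((hW.a₁.mul hW.a₃).mul hW.a₄)).add (hW.a₂.mul (hW.a₃.pow 2))).sub (hW.a₄.pow 2)
  have r1 : v.Red (D ^ 2 * X₂ * z ^ 4) 1 := by
    have e : D ^ 2 * X₂ * z ^ 4 = 1 - W.b₄ * z ^ 2 - 2 * W.b₆ * z ^ 3 - W.b₈ * z ^ 4 := by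
      rw [← hA, formA]
      linear_combination ((x * z) ^ 3 + (x * z) ^ 2 + x * z + 1 - W.b₄ * z ^ 2 * (x * z + 1) -
        2 * W.b₆ * z ^ 3) * hxz
    rw [e]
    have := ((Place.red_one.sub (b4.mul (hz.pow 2))).sub
      (((Place.red_ofNat 2).mul b6).mul (hz.pow 3))).sub (b8.mul (hz.pow 4))
    simpa using this
  have r2 : v.Red (D ^ 2 * x * z ^ 4) 0 := by
    have e : D ^ 2 * x * z ^ 4 = 2 * 2 + W.b₂ * z + 2 * W.b₄ * z ^ 2 + W.b₆ * z ^ 3 := by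
      rw [← hB, formB]
      linear_combination (4 * ((x * z) ^ 3 + (x * z) ^ 2 + x * z + 1) +
        W.b₂ * z * ((x * z) ^ 2 + x * z + 1) + 2 * W.b₄ * z ^ 2 * (x * z + 1) +
        W.b₆ * z ^ 3) * hxz
    rw [e]
    have := (((two (Place.red_ofNat 2)).add (b2.mul hz)).add
      (((Place.red_ofNat 2).mul b4).mul (hz.pow 2))).add (b6.mul (hz.pow 3))
    simpa using this
  have r3 := r2.div r1 one_ne_zero
  have hX0 : X₂ ≠ 0 := by
    intro h0
    rw [h0, mul_zero, zero_mul] at r1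
    exact one_ne_zero (r1.unique Place.red_zero)
  have e3 : D ^ 2 * x * z ^ 4 / (D ^ 2 * X₂ * z ^ 4) = x / X₂ := by field_simp
  rw [e3, zero_div] at r3
  have hlt := valuation_lt_one_of_red r3
  rw [map_div₀, div_lt_one₀ (zero_lt_iff.2 ((_root_.map_ne_zero _).2 hX0))] at hlt
  refine ⟨fun hc => hx ?_, hlt⟩
  rw [← ValuationSubring.valuation_le_one_iff] at hc ⊢
  exact hlt.le.trans hc

/-- In residue characteristic two, the kernel of reduction has no torsion of odd prime order. -/
lemma eq_zero_of_hom_eq_zero [CharP κ 2] [W'.IsElliptic] (hW : v.RedCurve W W') {p : ℕ}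
    [hp : Fact p.Prime] (hp2 : p ≠ 2) {P : W.Point} (hP : p • P = 0) (h0 : hW.hom P = 0) :
    P = 0 := by
  by_contra hP0
  have hco : Nat.Coprime 2 p := (Nat.coprime_primes Nat.prime_two hp.1).2 (Ne.symm hp2)
  have hne (n : ℕ) : 2 ^ n • P ≠ 0 := by
    intro h
    have h1 := Nat.dvd_gcd (addOrderOf_dvd_of_nsmul_eq_zero h) (addOrderOf_dvd_of_nsmul_eq_zero hP)
    rw [Nat.Coprime.pow_left n hco] at h1
    exact hP0 (AddMonoid.addOrderOf_eq_one_iff.1 (Nat.dvd_one.1 h1))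
  have hred := hW.redPt_hom P
  rw [h0] at hred
  cases hred with
  | zero => exact hP0 rfl
  | pole h hx =>
    rename_i x y
    have key (n : ℕ) : ∃ x' y' h', 2 ^ (n + 1) • Point.some x y h = .some x' y' h' ∧ x' ∉ v.ring ∧
        v.ring.valuation x < v.ring.valuation x' := by
      induction n with
      | zero => exact exists_double_pole hW hx (hne 1)
      | succ n ih =>
        obtain ⟨x', y', h', e, hx', hlt⟩ := ih
        have hne' := hne (n + 2)
        have e2 : 2 ^ (n + 2) • Point.some x y h = 2 • Point.some x' y' h' := by
          rw [← e, ← mul_smul, ← pow_succ']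
        rw [e2] at hne' ⊢
        obtain ⟨x₂, y₂, h₂, e₂, hx₂, hlt₂⟩ := exists_double_pole hW hx' hne'
        exact ⟨x₂, y₂, h₂, e₂, hx₂, hlt.trans hlt₂⟩
    have hp1 := hp.1.two_le
    -- Since `2 ^ (p - 1)` is `1` modulo `p`, doubling leads back to `P`, against the growth of the poles.
    obtain ⟨x', y', h', e, -, hlt⟩ := key (p - 2)
    have e1 : 2 ^ (p - 2 + 1) • Point.some x y h = Point.some x y h := by
      have h1 : p ∣ 2 ^ (p - 1) - 1 := by
        have := Nat.ModEq.pow_totient hco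
        rw [Nat.totient_prime hp.1] at this
        exact (Nat.modEq_iff_dvd' Nat.one_le_two_pow).1 this.symm
      obtain ⟨m, hm⟩ := h1
      have h2 : 2 ^ (p - 2 + 1) = m * p + 1 := by
        have : 1 ≤ 2 ^ (p - 1) := Nat.one_le_two_pow
        rw [show p - 2 + 1 = p - 1 by omega, mul_comm m, ← hm]; omega
      rw [h2, add_smul, one_smul, mul_smul, hP, smul_zero, zero_add]
    rw [e1, Point.some.injEq] at e
    rw [e.1] at hlt
    exact lt_irrefl _ hlt

variable [IsAlgClosed K] [IsAlgClosed κ] [W.IsElliptic] [W'.IsElliptic] [CharZero K] [CharP κ 2]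

/-- In residue characteristic two, reduction is an isomorphism on torsion of odd prime order: it is
injective, and the reduced curve has no more than `p ^ 2` points of `p`-torsion. -/
theorem exists_torsion_equiv (hW : v.RedCurve W W') {p : ℕ} [hp : Fact p.Prime] (hp2 : p ≠ 2) :
    ∃ θ : AddSubgroup.torsionBy W.Point (p : ℤ) ≃+ AddSubgroup.torsionBy W'.Point (p : ℤ),
      ∀ P, (θ P : W'.Point) = hW.hom P := by
  set θ₀ : AddSubgroup.torsionBy W.Point (p : ℤ) →+ AddSubgroup.torsionBy W'.Point (p : ℤ) :=
    (hW.hom.comp (AddSubgroup.torsionBy W.Point (p : ℤ)).subtype).codRestrict _ fun P => by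
      rw [AddSubgroup.torsionBy.nsmul_iff]
      change p • hW.hom (P : W.Point) = 0
      rw [← map_nsmul, AddSubgroup.torsionBy.nsmul_iff.1 P.2, map_zero]
    with hθ₀
  have hinj : Function.Injective θ₀ := by
    rw [injective_iff_map_eq_zero]
    intro P hP
    apply Subtype.ext
    exact eq_zero_of_hom_eq_zero hW hp2 (AddSubgroup.torsionBy.nsmul_iff.1 P.2)
      (congrArg Subtype.val hP)
  have hpk : (p : κ) ≠ 0 := by
    rw [Ne, CharP.cast_eq_zero_iff κ 2 p]
    intro h
    exact hp2 ((Nat.prime_dvd_prime_iff_eq Nat.prime_two hp.1).1 h).symm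
  have hset : ((AddSubgroup.torsionBy W'.Point (p : ℤ) : Set W'.Point)) =
      {P : W'.Point | p • P = 0} := by
    ext P
    exact AddSubgroup.torsionBy.nsmul_iff
  have hfin : Finite (AddSubgroup.torsionBy W'.Point (p : ℤ)) := by
    have := (finite_torsion W' hpk)
    rw [← hset] at this
    exact this.to_subtype
  have hcard : Nat.card (AddSubgroup.torsionBy W'.Point (p : ℤ)) = p ^ 2 := by
    have hlt := ncard_torsion_lt W' hpk
    rw [← hset, ← Nat.card_coe_set_eq] at hlt
    change Nat.card (AddSubgroup.torsionBy W'.Point (p : ℤ)) < _ at hlt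
    have hle := Nat.card_le_card_of_injective θ₀ hinj
    rw [card_torsion W p] at hle
    let : Module (ZMod p) (AddSubgroup.torsionBy W'.Point (p : ℤ)) :=
      AddSubgroup.torsionBy.zmodModule
    have hpow := Module.natCard_eq_pow_finrank (K := ZMod p)
      (V := AddSubgroup.torsionBy W'.Point (p : ℤ))
    rw [Nat.card_zmod] at hpow
    rw [hpow] at hle hlt ⊢
    have h1 := (Nat.pow_le_pow_iff_right hp.1.one_lt).1 hle
    have h2 : p ^ Module.finrank (ZMod p) (AddSubgroup.torsionBy W'.Point (p : ℤ)) < p ^ 3 :=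
      hlt.trans_le (by rw [pow_succ p 2, mul_comm]; exact Nat.mul_le_mul_left _ hp.1.two_le)
    have h3 := (Nat.pow_lt_pow_iff_right hp.1.one_lt).1 h2
    rw [show Module.finrank (ZMod p) (AddSubgroup.torsionBy W'.Point (p : ℤ)) = 2 by omega]
  have hbij : Function.Bijective θ₀ := by
    rw [Nat.bijective_iff_injective_and_card]
    exact ⟨hinj, by rw [hcard, card_torsion W p]⟩
  exact ⟨AddEquiv.ofBijective θ₀ hbij, fun P => rfl⟩

/-- Away from the residue characteristic, roots of unity are determined by their reduction. -/
lemma eq_of_red_rootOfUnity {p : ℕ} [hp : Fact p.Prime] (hp2 : p ≠ 2) {a b : K} {c : κ}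
    (ha : v.Red a c) (hb : v.Red b c) (ha1 : a ^ p = 1) (hb1 : b ^ p = 1) : a = b := by
  have hpk : (p : κ) ≠ 0 := by
    rw [Ne, CharP.cast_eq_zero_iff κ 2 p]
    intro h
    exact hp2 ((Nat.prime_dvd_prime_iff_eq Nat.prime_two hp.1).1 h).symm
  have hc1 : c ^ p = 1 := by
    have := ha.pow p
    rw [ha1] at this
    exact this.unique Place.red_one
  have hc0 : c ≠ 0 := by
    rintro rfl
    rw [zero_pow hp.1.ne_zero] at hc1
    exact zero_ne_one hc1
  have hb0 : b ≠ 0 := hb.ne_zero hc0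
  have h1 := ha.div hb hc0
  rw [div_self hc0] at h1
  by_contra hab
  have h2 : a / b ≠ 1 := fun h => hab ((div_eq_one_iff_eq hb0).1 h)
  -- The sum of the powers of `a / b ≠ 1` is zero, but it reduces to `p`.
  have h3 : ∑ i ∈ Finset.range p, (a / b) ^ i = 0 := by
    have := mul_geom_sum (a / b) p
    rw [div_pow, ha1, hb1, div_one, sub_self, mul_eq_zero] at this
    exact this.resolve_left (sub_ne_zero.2 h2)
  have h4 (n : ℕ) : v.Red (∑ i ∈ Finset.range n, (a / b) ^ i) (n : κ) := by
    induction n with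
    | zero => simpa using Place.red_zero
    | succ n ih =>
      rw [Finset.sum_range_succ, Nat.cast_succ]
      have := h1.pow n
      rw [one_pow] at this
      exact ih.add this
  have h5 := h4 p
  rw [h3] at h5
  exact hpk (h5.unique Place.red_zero)

end TorsionReduction
end CurveRing
end

/-! ### The residue field of the algebraic closure of `ℚ_ℓ` -/

noncomputable section
namespace EllipticLocal
open scoped Classical
open LocalInertia

section Place
variable (ℓ : ℕ) [Fact ℓ.Prime]

/-- The valuation ring of the algebraic closure of `ℚ_ℓ`. -/
abbrev valRing : ValuationSubring (PadicAlgCl ℓ) := (PadicAlgCl.valued ℓ).v.valuationSubring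

/-- The residue field of the algebraic closure of `ℚ_ℓ`. -/
abbrev resField : Type := IsLocalRing.ResidueField (valRing ℓ)

/-- The place of the algebraic closure of `ℚ_ℓ` with values in its residue field. -/
def resPlace : Place (PadicAlgCl ℓ) (resField ℓ) where
  ring := valRing ℓ
  res := IsLocalRing.residue (valRing ℓ)
  isUnit_of_res_ne_zero a ha := by
    by_contra h
    exact ha ((IsLocalRing.residue_eq_zero_iff a).2 h)

variable {ℓ}

lemma mem_resPlace_iff {x : PadicAlgCl ℓ} : x ∈ (resPlace ℓ).ring ↔ ‖x‖ ≤ 1 := by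
  change Valued.v x ≤ 1 ↔ _
  rw [PadicAlgCl.valuation_def, ← NNReal.coe_le_coe]
  rfl

lemma resPlace_surjective : Function.Surjective (resPlace ℓ).res := IsLocalRing.residue_surjective

lemma red_zero_iff {x : PadicAlgCl ℓ} : (resPlace ℓ).Red x 0 ↔ ‖x‖ < 1 := by
  constructor
  · rintro ⟨h, h0⟩
    refine lt_of_le_of_ne (mem_resPlace_iff.1 h) fun h1 => ?_
    have hx0 : x ≠ 0 := by rintro rfl; simp at h1
    have hi : x⁻¹ ∈ (resPlace ℓ).ring := by rw [mem_resPlace_iff, norm_inv, h1, inv_one]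
    have h2 := (show (resPlace ℓ).Red x 0 from ⟨h, h0⟩).mul (Place.exists_red hi).choose_spec
    rw [mul_inv_cancel₀ hx0, zero_mul] at h2
    exact one_ne_zero (Place.red_one.unique h2)
  · intro h
    obtain ⟨b, hb⟩ := Place.exists_red (v := resPlace ℓ) (mem_resPlace_iff.2 h.le)
    by_contra hc
    have hb0 : b ≠ 0 := by rintro rfl; exact hc hb
    have h1 := mem_resPlace_iff.1 (hb.inv hb0).mem
    have hx0 := hb.ne_zero hb0
    rw [norm_inv] at h1
    have := (inv_le_one₀ (norm_pos_iff.2 hx0)).1 h1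
    linarith

instance : CharP (resField ℓ) ℓ := by
  have h0 : ((ℓ : ℕ) : resField ℓ) = 0 := by
    have h1 := Place.red_natCast (v := resPlace ℓ) ℓ
    refine h1.unique (red_zero_iff.2 ?_)
    have h2 : ‖((ℓ : ℚ_[ℓ]) : PadicAlgCl ℓ)‖ < 1 := by
      rw [PadicAlgCl.norm_extends]; exact Padic.norm_p_lt_one
    simpa using h2
  exact (CharP.charP_iff_prime_eq_zero Fact.out).2 h0

/-- The roots of monic polynomials lift to integral elements of the algebraic closure of `ℚ_ℓ`. -/
instance : IsAlgClosed (resField ℓ) := by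
  refine IsAlgClosed.of_exists_root _ fun q hq hirr => ?_
  have hl : q ∈ Polynomial.lifts (IsLocalRing.residue (valRing ℓ)) := by
    rw [Polynomial.lifts_iff_coeff_lifts]
    exact fun n => IsLocalRing.residue_surjective _
  obtain ⟨Q, hQ, hdeg, hmonic⟩ := Polynomial.lifts_and_degree_eq_and_monic hl hq
  have hd : (Q.map (algebraMap (valRing ℓ) (PadicAlgCl ℓ))).degree ≠ 0 := by
    rw [hmonic.degree_map, hdeg]
    exact (degree_pos_of_irreducible hirr).ne'
  obtain ⟨z, hz⟩ := IsAlgClosed.exists_root _ hd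
  have hi : IsIntegral (valRing ℓ) z := ⟨Q, hmonic, by rwa [IsRoot.def, eval_map] at hz⟩
  obtain ⟨w, rfl⟩ := IsIntegrallyClosed.isIntegral_iff.1 hi
  refine ⟨IsLocalRing.residue _ w, ?_⟩
  rw [IsRoot.def, eval_map_algebraMap, aeval_algebraMap_apply] at hz
  have hw : aeval w Q = 0 := by
    apply IsFractionRing.injective (valRing ℓ) (PadicAlgCl ℓ)
    rw [hz, map_zero]
  rw [coe_aeval_eq_eval] at hw
  rw [← hQ, eval_map, eval₂_at_apply, hw, map_zero]

/-- Inertia acts trivially on residues. -/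
lemma red_inertia {σ : Gal(PadicAlgCl ℓ/ℚ_[ℓ])} (hσ : σ ∈ inertia ℓ) {a : PadicAlgCl ℓ}
    {b : resField ℓ} (h : (resPlace ℓ).Red a b) : (resPlace ℓ).Red (σ a) b := by
  obtain ⟨τ, hτ, rfl⟩ := hσ
  obtain ⟨ha, rfl⟩ := h
  have h1 : MulSemiringAction.toRingAut ((valRing ℓ).decompositionSubgroup ℚ_[ℓ])
    (IsLocalRing.ResidueField (valRing ℓ)) τ = 1 := hτ
  have h2 := RingEquiv.congr_fun h1 (IsLocalRing.residue _ ⟨a, ha⟩)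
  exact ⟨(τ • (⟨a, ha⟩ : valRing ℓ)).2, h2⟩

lemma red_inertia_iff {σ : Gal(PadicAlgCl ℓ/ℚ_[ℓ])} (hσ : σ ∈ inertia ℓ) {a : PadicAlgCl ℓ}
    {b : resField ℓ} : (resPlace ℓ).Red (σ a) b ↔ (resPlace ℓ).Red a b := by
  refine ⟨fun h => ?_, red_inertia hσ⟩
  have := red_inertia (inv_mem hσ) h
  rwa [← AlgEquiv.mul_apply, inv_mul_cancel, AlgEquiv.one_apply] at this

end Place
end EllipticLocal
end

/-! ### Automorphisms, and the reduction of changes of variables -/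

noncomputable section

namespace CurveRing
open scoped Classical
open WeierstrassCurve WeierstrassCurve.Affine WeilPairing

namespace SemilinearChange
variable {k k' k'' : Type*} [Field k] [Field k'] [Field k''] {W : Affine k} {W' : Affine k'}
  {W'' : Affine k''}

lemma hom_congr [W'.IsElliptic] {S T : SemilinearChange W W'} (hφ : S.φ = T.φ) (hC : S.C = T.C)
    (P : W.Point) : S.hom P = T.hom P := by
  cases S; cases T
  simp only at hφ hC
  subst hφ hC
  rfl

/-- The composition of semilinear changes of coordinates. -/
def comp (T : SemilinearChange W' W'') (S : SemilinearChange W W') : SemilinearChange W W'' where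
  φ := T.φ.comp S.φ
  C := S.C.map T.φ * T.C
  smul_eq := by
    rw [mul_smul, T.smul_eq, map_variableChange, S.smul_eq, WeierstrassCurve.map_map]

lemma comp_hom [W'.IsElliptic] [W''.IsElliptic] (T : SemilinearChange W' W'')
    (S : SemilinearChange W W') (P : W.Point) : (T.comp S).hom P = T.hom (S.hom P) := by
  rcases P with _ | ⟨x, y, h⟩
  · rfl
  · rw [hom_some, hom_some, hom_some, Point.some.injEq]
    simp only [X, Y, comp, VariableChange.mul_def, VariableChange.map_u, VariableChange.map_r,
      VariableChange.map_s, VariableChange.map_t, Units.val_mul, Units.coe_map, RingHom.comp_apply,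
      map_add, map_mul, map_pow, MonoidHom.coe_coe]
    constructor <;> ring

/-- An admissible change of variables, as a semilinear change of coordinates. -/
def ofSMul {W W' : Affine k} (C : VariableChange k) (h : C • (W' : WeierstrassCurve k) = W) :
    SemilinearChange W W' where
  φ := RingHom.id k
  C := C
  smul_eq := h.trans (map_id W).symm

lemma hom_surjective [W.IsElliptic] [W'.IsElliptic] (S : SemilinearChange W W')
    (hS : Function.Surjective S.φ) : Function.Surjective S.hom := by
  rintro (_ | ⟨x', y', h⟩)
  · exact ⟨0, map_zero _⟩
  have hu : (S.C.u : k') ≠ 0 := S.C.u.ne_zero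
  obtain ⟨x, hx⟩ := hS ((x' - S.C.r) / S.C.u ^ 2)
  obtain ⟨y, hy⟩ := hS ((y' - S.C.s * (x' - S.C.r) - S.C.t) / S.C.u ^ 3)
  have hX : S.X x = x' := by rw [X, hx]; field_simp; ring
  have hY : S.Y x y = y' := by rw [Y, hx, hy]; field_simp; ring
  have heq : W.Equation x y := by
    obtain ⟨h1, h2, h3, h4, h6⟩ := S.coeff_eq
    have e := (equation_iff ..).1 h.1
    rw [← hX, ← hY, X, Y] at e
    rw [equation_iff]
    apply S.φ.injective
    apply mul_left_cancel₀ (pow_ne_zero 6 hu)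
    simp only [map_add, map_mul, map_pow]
    generalize S.φ x = x₀ at *
    generalize S.φ y = y₀ at *
    generalize (S.C.u : k') = u at *
    linear_combination e - (u ^ 5 * x₀ * y₀ * (- h1) + u ^ 3 * y₀ * (- h3) +
      u ^ 4 * x₀ ^ 2 * h2 + u ^ 2 * x₀ * h4 + h6)
  refine ⟨.some x y (equation_iff_nonsingular.1 heq), ?_⟩
  rw [hom_some, Point.some.injEq]
  exact ⟨hX, hY⟩

end SemilinearChange

section Aut
variable {k : Type*} [Field k] {W : Affine k} [W.IsElliptic]

/-- The group of automorphisms of a Weierstrass curve. -/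
abbrev AutGroup (W : Affine k) : Subgroup (VariableChange k) :=
  MulAction.stabilizer (VariableChange k) (W : WeierstrassCurve k)

/-- The action of automorphisms on points; the inverse makes it a left action. -/
def autHom (A : AutGroup W) : W.Point →+ W.Point :=
  (SemilinearChange.ofSMul (W := W) (W' := W) (A⁻¹ : AutGroup W) (A⁻¹).2).hom

lemma autHom_mul (A B : AutGroup W) (P : W.Point) :
    autHom (W := W) (A * B) P = autHom A (autHom B P) := by
  rw [autHom, autHom, autHom, ← SemilinearChange.comp_hom]
  refine SemilinearChange.hom_congr ?_ ?_ P
  · rfl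
  · simp [SemilinearChange.ofSMul, SemilinearChange.comp]

lemma autHom_one (P : W.Point) : autHom (W := W) 1 P = P := by
  have h := autHom_mul (W := W) 1 1 P
  rw [mul_one] at h
  exact ((SemilinearChange.ofSMul (W := W) (W' := W) _ ((1 : AutGroup W)⁻¹).2).hom_injective
    h).symm

end Aut

section Integral
variable {K κ : Type*} [Field K] [Field κ] {v : Place K κ}

/-- The change of variables `A` is the reduction of `C`. -/
structure RedChange (v : Place K κ) (C : VariableChange K) (A : VariableChange κ) : Prop where
  u : v.Red C.u A.u
  r : v.Red C.r A.r
  s : v.Red C.s A.s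
  t : v.Red C.t A.t

lemma RedChange.mul {C C' : VariableChange K} {A A' : VariableChange κ} (h : RedChange v C A)
    (h' : RedChange v C' A') : RedChange v (C * C') (A * A') where
  u := by simpa [VariableChange.mul_def] using h.u.mul h'.u
  r := by simpa [VariableChange.mul_def] using (h.r.mul (h'.u.pow 2)).add h'.r
  s := by simpa [VariableChange.mul_def] using (h'.u.mul h.s).add h'.s
  t := by
    simpa [VariableChange.mul_def] using
      ((h.t.mul (h'.u.pow 3)).add ((h.r.mul h'.s).mul (h'.u.pow 2))).add h'.t

lemma RedChange.unique {C : VariableChange K} {A A' : VariableChange κ} (h : RedChange v C A)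
    (h' : RedChange v C A') : A = A' := by
  ext
  · exact h.u.unique h'.u
  · exact h.r.unique h'.r
  · exact h.s.unique h'.s
  · exact h.t.unique h'.t

variable {W W₂ : Affine K} {W' W₂' : Affine κ}

lemma _root_.Place.RedCurve.b₂ (hW : v.RedCurve W W') : v.Red W.b₂ W'.b₂ :=
  (hW.a₁.pow 2).add ((Place.red_ofNat 4).mul hW.a₂)

lemma _root_.Place.RedCurve.b₄ (hW : v.RedCurve W W') : v.Red W.b₄ W'.b₄ :=
  ((Place.red_ofNat 2).mul hW.a₄).add (hW.a₁.mul hW.a₃)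

lemma _root_.Place.RedCurve.b₆ (hW : v.RedCurve W W') : v.Red W.b₆ W'.b₆ :=
  (hW.a₃.pow 2).add ((Place.red_ofNat 4).mul hW.a₆)

lemma _root_.Place.RedCurve.b₈ (hW : v.RedCurve W W') : v.Red W.b₈ W'.b₈ :=
  (((((hW.a₁.pow 2).mul hW.a₆).add (((Place.red_ofNat 4).mul hW.a₂).mul hW.a₆)).sub
    ((hW.a₁.mul hW.a₃).mul hW.a₄)).add (hW.a₂.mul (hW.a₃.pow 2))).sub (hW.a₄.pow 2)

lemma _root_.Place.RedCurve.Δ (hW : v.RedCurve W W') : v.Red W.Δ W'.Δ :=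
  ((((hW.b₂.pow 2).neg.mul hW.b₈).sub ((Place.red_ofNat 8).mul (hW.b₄.pow 3))).sub
    ((Place.red_ofNat 27).mul (hW.b₆.pow 2))).add
    ((((Place.red_ofNat 9).mul hW.b₂).mul hW.b₄).mul hW.b₆)

/-- A change of variables between two curves with good reduction is integral, if `3` is a unit: `u` is
integral by the discriminants, `r` by the invariants `b₈`, where `r ^ 4` has the coefficient `3`, and
`s` and `t` by quadratic equations. -/
theorem exists_redChange [W'.IsElliptic] [W₂'.IsElliptic] (h3 : (3 : κ) ≠ 0)
    (hW : v.RedCurve W W') (hW₂ : v.RedCurve W₂ W₂') {C : VariableChange K}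
    (hC : C • (W : WeierstrassCurve K) = W₂) :
    ∃ A : VariableChange κ, RedChange v C A ∧ A • (W' : WeierstrassCurve κ) = W₂' := by
  have hu0 : (C.u : K) ≠ 0 := C.u.ne_zero
  have hΔ' : W₂'.Δ ≠ 0 := W₂'.isUnit_Δ.ne_zero
  obtain ⟨u, hu, hu'⟩ : ∃ u : κ, v.Red C.u u ∧ u ≠ 0 := by
    have h1 : (C.u : K) ^ 12 = W.Δ / W₂.Δ := by
      rw [← hC, variableChange_Δ, Units.val_inv_eq_inv_val, eq_div_iff, inv_pow]
      · have hW0 : W.Δ ≠ 0 := hW.Δ.ne_zero W'.isUnit_Δ.ne_zero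
        field_simp
      · have h2 := hW₂.Δ.ne_zero hΔ'
        rwa [← hC, variableChange_Δ, Units.val_inv_eq_inv_val] at h2
    have h2 := hW.Δ.div hW₂.Δ hΔ'
    rw [← h1] at h2
    have hne : W'.Δ / W₂'.Δ ≠ 0 := div_ne_zero W'.isUnit_Δ.ne_zero hΔ'
    have hm : (C.u : K) ∈ v.ring := by
      by_contra hm
      have h4 := ((Place.red_inv_of_notMem hm).pow 12).mul h2
      rw [← mul_pow, inv_mul_cancel₀ hu0, one_pow, zero_pow (by norm_num), zero_mul] at h4
      exact one_ne_zero (Place.red_one.unique h4)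
    obtain ⟨u, hu⟩ := Place.exists_red hm
    refine ⟨u, hu, ?_⟩
    rintro rfl
    have h5 := (hu.pow 12).unique h2
    rw [zero_pow (by norm_num)] at h5
    exact hne h5.symm
  obtain ⟨r, hr⟩ : ∃ r : κ, v.Red C.r r := by
    apply Place.exists_red
    by_contra hm
    have hr0 : C.r ≠ 0 := by intro h; rw [h] at hm; exact hm (zero_mem _)
    have hz := Place.red_inv_of_notMem hm
    have h1 := congrArg WeierstrassCurve.b₈ hC
    rw [variableChange_b₈, Units.val_inv_eq_inv_val] at h1
    have h2 : (3 : K) = C.u ^ 8 * W₂.b₈ * C.r⁻¹ ^ 4 - W.b₈ * C.r⁻¹ ^ 4 - 3 * W.b₆ * C.r⁻¹ ^ 3 -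
        3 * W.b₄ * C.r⁻¹ ^ 2 - W.b₂ * C.r⁻¹ := by
      rw [← h1]
      field_simp
      ring
    have h3' := ((((((hu.pow 8).mul hW₂.b₈).mul (hz.pow 4)).sub (hW.b₈.mul (hz.pow 4))).sub
      (((Place.red_ofNat 3).mul hW.b₆).mul (hz.pow 3))).sub
      (((Place.red_ofNat 3).mul hW.b₄).mul (hz.pow 2))).sub (hW.b₂.mul hz)
    have h4 := (Place.red_ofNat (v := v) 3).unique (a := 3) (b := OfNat.ofNat 3) (by
      rw [show (OfNat.ofNat 3 : K) = _ from h2]; exact h3')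
    apply h3
    have h5 : (3 : κ) = OfNat.ofNat 3 := rfl
    rw [h5, h4]
    simp
  obtain ⟨s, hs⟩ : ∃ s : κ, v.Red C.s s := by
    apply Place.exists_red
    have h1 := congrArg WeierstrassCurve.a₂ hC
    rw [variableChange_a₂, Units.val_inv_eq_inv_val] at h1
    refine Place.mem_of_quadratic (c := W.a₁) (d := W.a₂ + 3 * C.r - C.u ^ 2 * W₂.a₂) hW.a₁.mem
      ((hW.a₂.add ((Place.red_ofNat 3).mul hr)).sub ((hu.pow 2).mul hW₂.a₂)).mem ?_
    rw [← h1]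
    field_simp
    ring
  obtain ⟨t, ht⟩ : ∃ t : κ, v.Red C.t t := by
    apply Place.exists_red
    have h1 := congrArg WeierstrassCurve.a₆ hC
    rw [variableChange_a₆, Units.val_inv_eq_inv_val] at h1
    refine Place.mem_of_quadratic (c := W.a₃ + C.r * W.a₁)
      (d := W.a₆ + C.r * W.a₄ + C.r ^ 2 * W.a₂ + C.r ^ 3 - C.u ^ 6 * W₂.a₆)
      (hW.a₃.add (hr.mul hW.a₁)).mem
      ((((hW.a₆.add (hr.mul hW.a₄)).add ((hr.pow 2).mul hW.a₂)).add (hr.pow 3)).sub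
        ((hu.pow 6).mul hW₂.a₆)).mem ?_
    rw [← h1]
    field_simp
    ring
  refine ⟨⟨Units.mk0 u hu', r, s, t⟩, ⟨hu, hr, hs, ht⟩, ?_⟩
  have hui : v.Red (C.u⁻¹ : Kˣ) u⁻¹ := by rw [Units.val_inv_eq_inv_val]; exact hu.inv hu'
  have two := Place.red_ofNat (v := v) 2
  have three := Place.red_ofNat (v := v) 3
  have e1 := congrArg WeierstrassCurve.a₁ hC
  have e2 := congrArg WeierstrassCurve.a₂ hC
  have e3 := congrArg WeierstrassCurve.a₃ hC
  have e4 := congrArg WeierstrassCurve.a₄ hC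
  have e6 := congrArg WeierstrassCurve.a₆ hC
  rw [variableChange_a₁] at e1
  rw [variableChange_a₂] at e2
  rw [variableChange_a₃] at e3
  rw [variableChange_a₄] at e4
  rw [variableChange_a₆] at e6
  ext
  · refine Place.Red.unique ?_ (e1 ▸ hW₂.a₁)
    exact hui.mul (hW.a₁.add (two.mul hs))
  · refine Place.Red.unique ?_ (e2 ▸ hW₂.a₂)
    exact (hui.pow 2).mul (((hW.a₂.sub (hs.mul hW.a₁)).add (three.mul hr)).sub (hs.pow 2))
  · refine Place.Red.unique ?_ (e3 ▸ hW₂.a₃)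
    exact (hui.pow 3).mul ((hW.a₃.add (hr.mul hW.a₁)).add (two.mul ht))
  · refine Place.Red.unique ?_ (e4 ▸ hW₂.a₄)
    exact (hui.pow 4).mul (((((hW.a₄.sub (hs.mul hW.a₃)).add ((two.mul hr).mul hW.a₂)).sub
      ((ht.add (hr.mul hs)).mul hW.a₁)).add (three.mul (hr.pow 2))).sub ((two.mul hs).mul ht))
  · refine Place.Red.unique ?_ (e6 ▸ hW₂.a₆)
    exact (hui.pow 6).mul ((((((hW.a₆.add (hr.mul hW.a₄)).add ((hr.pow 2).mul hW.a₂)).add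
      (hr.pow 3)).sub (ht.mul hW.a₃)).sub (ht.pow 2)).sub ((hr.mul ht).mul hW.a₁))

/-- A semilinear automorphism that acts trivially on residues reduces to the automorphism given by
the reduced change of variables. -/
lemma hom_reduction [W.IsElliptic] [W'.IsElliptic] (hW : v.RedCurve W W')
    (S : SemilinearChange W W) (T : SemilinearChange W' W')
    (hφ : ∀ a b, v.Red (S.φ a) b ↔ v.Red a b) (hT : T.φ = RingHom.id κ)
    (hC : RedChange v S.C T.C) (P : W.Point) : hW.hom (S.hom P) = T.hom (hW.hom P) := by
  apply hW.hom_eq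
  have hP := hW.redPt_hom P
  generalize hW.hom P = P' at *
  have hTφ (a : κ) : T.φ a = a := by rw [hT]; rfl
  cases hP with
  | zero => rw [map_zero, map_zero]; exact .zero
  | pole h hx =>
    rename_i x y
    rw [map_zero, S.hom_some]
    refine .pole _ fun hc => hx ?_
    obtain ⟨c, hc⟩ := Place.exists_red hc
    have hu' : (T.C.u : κ) ^ 2 ≠ 0 := pow_ne_zero _ T.C.u.ne_zero
    have h1 := (hc.sub hC.r).div (hC.u.pow 2) hu'
    have e : (S.X x - S.C.r) / (S.C.u : K) ^ 2 = S.φ x := by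
      have hu : (S.C.u : K) ≠ 0 := S.C.u.ne_zero
      rw [SemilinearChange.X]
      field_simp
      ring
    rw [e, hφ] at h1
    exact h1.mem
  | some h h' hx hy =>
    rw [S.hom_some, T.hom_some]
    have hx' := (hφ _ _).2 hx
    have hy' := (hφ _ _).2 hy
    refine .some _ _ ?_ ?_
    · rw [SemilinearChange.X, SemilinearChange.X, hTφ]
      exact ((hC.u.pow 2).mul hx').add hC.r
    · rw [SemilinearChange.Y, SemilinearChange.Y, hTφ, hTφ]
      exact (((hC.u.pow 3).mul hy').add ((hC.s.mul (hC.u.pow 2)).mul hx')).add hC.t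

end Integral
end CurveRing
end

/-! ### The reduction of a curve with potentially good reduction -/

noncomputable section
namespace EllipticLocal
open scoped Classical
open LocalInertia
open WeierstrassCurve WeierstrassCurve.Affine WeilPairing CurveRing

/-- A bijective homomorphism restricts to an isomorphism of torsion subgroups. -/
lemma exists_torsionBy_equiv {A B : Type*} [AddCommGroup A] [AddCommGroup B] (f : A →+ B)
    (hf : Function.Bijective f) (n : ℕ) :
    ∃ θ : AddSubgroup.torsionBy A (n : ℤ) ≃+ AddSubgroup.torsionBy B (n : ℤ),
      ∀ P, (θ P : B) = f P := by
  set θ₀ : AddSubgroup.torsionBy A (n : ℤ) →+ AddSubgroup.torsionBy B (n : ℤ) :=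
    (f.comp (AddSubgroup.torsionBy A (n : ℤ)).subtype).codRestrict _ fun P => by
      rw [AddSubgroup.torsionBy.nsmul_iff]
      change n • f (P : A) = 0
      rw [← map_nsmul, AddSubgroup.torsionBy.nsmul_iff.1 P.2, map_zero]
    with hθ₀
  refine ⟨AddEquiv.ofBijective θ₀ ⟨fun P Q h => Subtype.ext (hf.1 (congrArg Subtype.val h)),
    fun Q => ?_⟩, fun P => rfl⟩
  obtain ⟨P, hP⟩ := hf.2 Q
  refine ⟨⟨P, ?_⟩, Subtype.ext hP⟩
  rw [AddSubgroup.torsionBy.nsmul_iff]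
  apply hf.1
  rw [map_nsmul, hP, map_zero, AddSubgroup.torsionBy.nsmul_iff.1 Q.2]

lemma smul_coe_torsionBy {A : Type*} [AddCommGroup A] {n : ℕ}
    (P : AddSubgroup.torsionBy A (n : ℤ)) : n • (P : A) = 0 :=
  AddSubgroup.torsionBy.nsmul_iff.1 P.2

/-- The curve `W'` over the residue field is a reduction of `E`, after an extension of the base
field: the odd torsion of `E` is identified with that of `W'`, inertia acts through automorphisms of
`W'`, and the Weil pairings correspond. The action `ρ` does not depend on the torsion level. -/
def HasModel (E : WeierstrassCurve ℚ_[2]) (W' : Affine (resField 2)) [W'.IsElliptic] : Prop :=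
  ∃ ρ : inertia 2 →* AutGroup W', ∀ (p : ℕ) [Fact p.Prime], p ≠ 2 →
    ∃ θ : Torsion E p ≃+ AddSubgroup.torsionBy W'.Point (p : ℤ),
      (∀ (σ : inertia 2) (P : Torsion E p),
        (θ (galTorsion E p σ P) : W'.Point) = autHom (ρ σ) (θ P)) ∧
      ∀ P Q : Torsion E p, (resPlace 2).Red (weilPairing (geom E) p P Q)
        (weilPairing W' p (θ P) (θ Q))

section Model

lemma map_geom (E : WeierstrassCurve ℚ_[2]) (σ : Gal(PadicAlgCl 2/ℚ_[2])) :
    WeierstrassCurve.map (geom E) (σ : PadicAlgCl 2 →+* PadicAlgCl 2) = geom E := by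
  rw [geom, WeierstrassCurve.baseChange, WeierstrassCurve.map_map]
  congr 1
  ext x
  exact σ.commutes x

/-- The Galois action on points, as a semilinear change of coordinates. -/
def galChange (E : WeierstrassCurve ℚ_[2]) (σ : Gal(PadicAlgCl 2/ℚ_[2])) :
    SemilinearChange (geom E) (geom E) where
  φ := (σ : PadicAlgCl 2 →+* PadicAlgCl 2)
  C := 1
  smul_eq := by rw [one_smul, map_geom]

variable {E : WeierstrassCurve ℚ_[2]} [E.IsElliptic]

instance : (geom E).IsElliptic := inferInstanceAs (E.map _).IsElliptic

lemma galPoint_eq (σ : Gal(PadicAlgCl 2/ℚ_[2])) (P : (geom E).Point) :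
    galPoint E σ P = (galChange E σ).hom P := by
  rcases P with _ | ⟨x, y, h⟩
  · rfl
  · refine (Point.some.injEq ..).mpr ?_
    constructor
    · simp [SemilinearChange.X, galChange, VariableChange.one_def]
    · simp [SemilinearChange.Y, galChange, VariableChange.one_def]

/-- A curve with good reduction after the change of variables `C` has a model. The action of `σ` on the
points of the changed curve is the semilinear map given by `σ` and the change of variables
`σ(C) C⁻¹`, which relates two curves with the same good reduction, and therefore reduces. -/
theorem hasModel_of_redCurve {C : VariableChange (PadicAlgCl 2)} {W' : Affine (resField 2)}
    [W'.IsElliptic] (hW : (resPlace 2).RedCurve (C • (geom E : WeierstrassCurve (PadicAlgCl 2))) W') :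
    HasModel E W' := by
  set W : Affine (PadicAlgCl 2) := C • (geom E : WeierstrassCurve (PadicAlgCl 2)) with hWdef
  have hWe : W.IsElliptic :=
    inferInstanceAs (C • (geom E : WeierstrassCurve (PadicAlgCl 2))).IsElliptic
  have h3 : (3 : resField 2) ≠ 0 := by
    rw [show (3 : resField 2) = ((3 : ℕ) : resField 2) by norm_num, Ne,
      CharP.cast_eq_zero_iff (resField 2) 2 3]
    norm_num
  set D : Gal(PadicAlgCl 2/ℚ_[2]) → VariableChange (PadicAlgCl 2) :=
    fun σ => C.map (σ : PadicAlgCl 2 →+* PadicAlgCl 2) * C⁻¹ with hD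
  have hDW (σ : Gal(PadicAlgCl 2/ℚ_[2])) : D σ • (W : WeierstrassCurve (PadicAlgCl 2)) =
      WeierstrassCurve.map W (σ : PadicAlgCl 2 →+* PadicAlgCl 2) := by
    rw [hD, hWdef, mul_smul, inv_smul_smul, ← map_variableChange, map_geom]
  have hWσ (σ : inertia 2) : (resPlace 2).RedCurve
      (WeierstrassCurve.map W ((σ : Gal(PadicAlgCl 2/ℚ_[2])) : PadicAlgCl 2 →+* PadicAlgCl 2)) W' :=
    ⟨red_inertia σ.2 hW.a₁, red_inertia σ.2 hW.a₂, red_inertia σ.2 hW.a₃, red_inertia σ.2 hW.a₄,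
      red_inertia σ.2 hW.a₆⟩
  choose A hA hAW using fun σ : inertia 2 => exists_redChange h3 hW (hWσ σ) (hDW σ)
  -- The changes of variables form a cocycle, and inertia acts trivially after reduction, so that
  -- they reduce to a homomorphism; the action on points is from the other side, hence the inverse
  -- in `ρ`.
  have hAmul (σ τ : inertia 2) : A (σ * τ) = A τ * A σ := by
    refine (hA (σ * τ)).unique ?_
    have e : D (σ * τ : inertia 2) =
        (D τ).map ((σ : Gal(PadicAlgCl 2/ℚ_[2])) : PadicAlgCl 2 →+* PadicAlgCl 2) * D σ := by
      have h1 : (C.map ((τ : Gal(PadicAlgCl 2/ℚ_[2])) : PadicAlgCl 2 →+* PadicAlgCl 2) * C⁻¹).map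
          ((σ : Gal(PadicAlgCl 2/ℚ_[2])) : PadicAlgCl 2 →+* PadicAlgCl 2) = _ :=
        map_mul (VariableChange.mapHom
          ((σ : Gal(PadicAlgCl 2/ℚ_[2])) : PadicAlgCl 2 →+* PadicAlgCl 2)) _ _
      have h2 : VariableChange.mapHom
          ((σ : Gal(PadicAlgCl 2/ℚ_[2])) : PadicAlgCl 2 →+* PadicAlgCl 2) C⁻¹ = _ :=
        map_inv (VariableChange.mapHom _) C
      simp only [hD]
      rw [h1, h2]
      rw [mul_assoc]
      change _ = _ * ((C.map ((σ : Gal(PadicAlgCl 2/ℚ_[2])) : PadicAlgCl 2 →+* PadicAlgCl 2))⁻¹ *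
        (C.map ((σ : Gal(PadicAlgCl 2/ℚ_[2])) : PadicAlgCl 2 →+* PadicAlgCl 2) * C⁻¹))
      rw [inv_mul_cancel_left]
      rfl
    rw [e]
    refine RedChange.mul ?_ (hA σ)
    exact ⟨red_inertia σ.2 (hA τ).u, red_inertia σ.2 (hA τ).r, red_inertia σ.2 (hA τ).s,
      red_inertia σ.2 (hA τ).t⟩
  set ρ : inertia 2 →* AutGroup W' := MonoidHom.mk' (fun σ => (⟨A σ, hAW σ⟩ : AutGroup W')⁻¹)
    fun σ τ => by
      rw [← mul_inv_rev, inv_inj]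
      exact Subtype.ext (hAmul σ τ) with hρ
  refine ⟨ρ, fun p hp hp2 => ?_⟩
  set β : SemilinearChange (geom E) W := SemilinearChange.ofSMul C⁻¹ (inv_smul_smul C _) with hβ
  obtain ⟨θ₁, hθ₁⟩ := exists_torsionBy_equiv β.hom
    ⟨β.hom_injective, β.hom_surjective Function.surjective_id⟩ p
  obtain ⟨θ₂, hθ₂⟩ := exists_torsion_equiv hW hp2
  refine ⟨θ₁.trans θ₂, fun σ P => ?_, fun P Q => ?_⟩
  · rw [AddEquiv.trans_apply, AddEquiv.trans_apply, hθ₂, hθ₂, hθ₁, hθ₁]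
    change hW.hom (β.hom (galPoint E σ P)) = _
    rw [galPoint_eq]
    set S : SemilinearChange W W := ⟨_, D σ, hDW σ⟩ with hS
    set T : SemilinearChange W' W' := SemilinearChange.ofSMul (A σ) (hAW σ) with hT
    have e1 : β.hom ((galChange E σ).hom (P : (geom E).Point)) = S.hom (β.hom P) := by
      rw [← SemilinearChange.comp_hom β (galChange E σ), ← SemilinearChange.comp_hom S β]
      refine SemilinearChange.hom_congr (S := β.comp (galChange E σ)) (T := S.comp β) rfl ?_ _
      have h2 : (C⁻¹).map ((σ : Gal(PadicAlgCl 2/ℚ_[2])) : PadicAlgCl 2 →+* PadicAlgCl 2) = _ :=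
        map_inv (VariableChange.mapHom _) C
      have h1 : (1 : VariableChange (PadicAlgCl 2)).map (RingHom.id _) = 1 := rfl
      change (1 : VariableChange (PadicAlgCl 2)).map (RingHom.id _) * C⁻¹ =
        (C⁻¹).map _ * (C.map _ * C⁻¹)
      rw [h1, h2]
      change 1 * C⁻¹ = (C.map _)⁻¹ * (C.map _ * C⁻¹)
      rw [inv_mul_cancel_left, one_mul]
    rw [e1, hom_reduction hW S T (fun a b => red_inertia_iff σ.2) rfl (hA σ)]
    rw [autHom]
    refine SemilinearChange.hom_congr (S := T)
      (T := SemilinearChange.ofSMul _ ((ρ σ)⁻¹).2) rfl ?_ _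
    change A σ = (((⟨A σ, hAW σ⟩ : AutGroup W')⁻¹)⁻¹ : AutGroup W')
    rw [inv_inv]
  · rw [AddEquiv.trans_apply, AddEquiv.trans_apply, hθ₂, hθ₂, hθ₁, hθ₁]
    have hP := smul_coe_torsionBy P
    have hQ := smul_coe_torsionBy Q
    have h1 := β.weilPairing_hom hP hQ
    have h2 : β.φ (weilPairing (geom E) p P Q) = weilPairing (geom E) p P Q := rfl
    rw [← h2, ← h1]
    have hP' : p • β.hom (P : (geom E).Point) = 0 := by rw [← map_nsmul, hP, map_zero]
    have hQ' : p • β.hom (Q : (geom E).Point) = 0 := by rw [← map_nsmul, hQ, map_zero]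
    exact red_weilPairing hW resPlace_surjective hp2 hP' hQ'
      (eq_zero_of_hom_eq_zero hW hp2 hP') (eq_zero_of_hom_eq_zero hW hp2 hQ')

/-- A curve with potentially good reduction has a model over the residue field. -/
theorem exists_hasModel (hE : PotentiallyGoodReduction E) :
    ∃ (W' : Affine (resField 2)) (_ : W'.IsElliptic), HasModel E W' := by
  obtain ⟨F, _, C, hgood⟩ := hE
  set M := integralModel (integers F) (C • E.baseChange F) with hM
  set C' : VariableChange (PadicAlgCl 2) := C.map (algebraMap F (PadicAlgCl 2)) with hC'
  have hcoe (z : integers F) : ((algebraMap (integers F) F z : F) : PadicAlgCl 2) ∈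
      (resPlace 2).ring := by
    rw [mem_resPlace_iff]
    exact (mem_integers_iff F _).1 z.2
  have hW : C' • (geom E : WeierstrassCurve (PadicAlgCl 2)) =
      (C • E.baseChange F).map (algebraMap F (PadicAlgCl 2)) := by
    rw [← map_variableChange, WeierstrassCurve.baseChange, WeierstrassCurve.map_map, ← IsScalarTower.algebraMap_eq]
    rfl
  have h1 := integralModel_a₁_eq (integers F) (C • E.baseChange F)
  have h2 := integralModel_a₂_eq (integers F) (C • E.baseChange F)
  have h3 := integralModel_a₃_eq (integers F) (C • E.baseChange F)
  have h4 := integralModel_a₄_eq (integers F) (C • E.baseChange F)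
  have h6 := integralModel_a₆_eq (integers F) (C • E.baseChange F)
  obtain ⟨a₁, ha₁⟩ := Place.exists_red (hcoe M.a₁)
  obtain ⟨a₂, ha₂⟩ := Place.exists_red (hcoe M.a₂)
  obtain ⟨a₃, ha₃⟩ := Place.exists_red (hcoe M.a₃)
  obtain ⟨a₄, ha₄⟩ := Place.exists_red (hcoe M.a₄)
  obtain ⟨a₆, ha₆⟩ := Place.exists_red (hcoe M.a₆)
  rw [hM, h1] at ha₁
  rw [hM, h2] at ha₂
  rw [hM, h3] at ha₃
  rw [hM, h4] at ha₄
  rw [hM, h6] at ha₆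
  set W' : Affine (resField 2) := ⟨a₁, a₂, a₃, a₄, a₆⟩ with hW'
  have hred : (resPlace 2).RedCurve (C' • (geom E : WeierstrassCurve (PadicAlgCl 2))) W' := by
    rw [hW]
    exact ⟨ha₁, ha₂, ha₃, ha₄, ha₆⟩
  have hΔ : W'.Δ ≠ 0 := by
    intro h0
    have h7 := hred.Δ
    rw [h0, red_zero_iff, hW, map_Δ] at h7
    have h8 := hgood.goodReduction
    rw [← integralModel_Δ_eq (integers F)] at h8 h7
    have h9 : IsUnit (integralModel (integers F) (C • E.baseChange F)).Δ := by
      by_contra hu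
      exact (ne_of_lt ((IsDedekindDomain.HeightOneSpectrum.valuation_lt_one_iff_mem _ _).2
        ((IsLocalRing.mem_maximalIdeal _).2 hu))) h8
    rw [isUnit_integers_iff] at h9
    exact h7.ne h9
  have hell : W'.IsElliptic := ⟨hΔ.isUnit⟩
  exact ⟨W', hell, hasModel_of_redCurve hred⟩

end Model
end EllipticLocal
end

/-! ### Automorphisms in characteristic two -/

noncomputable section
namespace EllipticLocal
open scoped Classical
open LocalInertia
open WeierstrassCurve WeierstrassCurve.Affine WeilPairing CurveRing

section Aut
variable {k : Type*} [Field k] {W W' : Affine k} [W.IsElliptic] [W'.IsElliptic]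

/-- An isomorphism of curves conjugates one automorphism group into the other. -/
def conjAut (C : VariableChange k) (h : C • (W : WeierstrassCurve k) = W') :
    AutGroup W →* AutGroup W' where
  toFun A := ⟨C * A * C⁻¹, by
    rw [MulAction.mem_stabilizer_iff, ← h, mul_smul, mul_smul, inv_smul_smul, A.2]⟩
  map_one' := Subtype.ext (by simp)
  map_mul' A B := Subtype.ext (by simp [mul_assoc])

lemma autHom_conjAut (C : VariableChange k) (h : C • (W : WeierstrassCurve k) = W')
    (h' : C⁻¹ • (W' : WeierstrassCurve k) = W) (A : AutGroup W) (P : W.Point) :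
    autHom (W := W') (conjAut C h A) ((SemilinearChange.ofSMul C⁻¹ h').hom P) =
      (SemilinearChange.ofSMul C⁻¹ h').hom (autHom (W := W) A P) := by
  rw [autHom, autHom, ← SemilinearChange.comp_hom, ← SemilinearChange.comp_hom]
  refine SemilinearChange.hom_congr ?_ ?_ P
  · rfl
  · change C⁻¹ * ((conjAut C h A)⁻¹ : AutGroup W') = ((A⁻¹ : AutGroup W) : VariableChange k) * C⁻¹
    rw [← map_inv]
    change C⁻¹ * (C * _ * C⁻¹) = _
    rw [mul_assoc, inv_mul_cancel_left]

/-- In characteristic two, an automorphism that fixes four points is trivial. -/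
lemma eq_one_of_autHom_eq [CharP k 2] {n : ℕ}
    (hcard : 3 < Nat.card (AddSubgroup.torsionBy W.Point (n : ℤ))) {A : AutGroup W}
    (hA : ∀ P : AddSubgroup.torsionBy W.Point (n : ℤ), autHom (W := W) A P = P) : A = 1 := by
  have : Finite (AddSubgroup.torsionBy W.Point (n : ℤ)) :=
    Nat.finite_of_card_ne_zero (by omega)
  obtain ⟨P, hP⟩ : ∃ P : AddSubgroup.torsionBy W.Point (n : ℤ), P ≠ 0 := by
    have : Nontrivial (AddSubgroup.torsionBy W.Point (n : ℤ)) :=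
      Finite.one_lt_card_iff_nontrivial.1 (by omega)
    exact exists_ne 0
  obtain ⟨Q, hQ⟩ : ∃ Q : AddSubgroup.torsionBy W.Point (n : ℤ), Q ∉ ({0, P, -P} : Finset _) := by
    have : Fintype (AddSubgroup.torsionBy W.Point (n : ℤ)) := Fintype.ofFinite _
    by_contra! h
    have h1 := Finset.card_le_card (fun Q _ => h Q :
      (Finset.univ : Finset (AddSubgroup.torsionBy W.Point (n : ℤ))) ⊆ {0, P, -P})
    rw [Finset.card_univ, ← Nat.card_eq_fintype_card] at h1
    have := Finset.card_le_three (a := (0 : AddSubgroup.torsionBy W.Point (n : ℤ))) (b := P)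
      (c := -P)
    omega
  simp only [Finset.mem_insert, Finset.mem_singleton, not_or] at hQ
  obtain ⟨hQ0, hQP, hQP'⟩ := hQ
  have hAP := hA P
  have hAQ := hA Q
  obtain ⟨P, hPt⟩ := P
  obtain ⟨Q, hQt⟩ := Q
  rcases P with _ | ⟨x, y, h⟩
  · exact absurd rfl hP
  rcases Q with _ | ⟨x', y', h'⟩
  · exact absurd rfl hQ0
  have hx : x ≠ x' := by
    rintro rfl
    rcases Y_eq_of_X_eq h'.1 h.1 rfl with e | e
    · subst e; exact hQP rfl
    · subst e; exact hQP' (Subtype.ext (by simp))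
  have h2 : (2 : k) = 0 := CharTwo.two_eq_zero
  rw [← inv_eq_one]
  rcases hB : A⁻¹ with ⟨⟨u, r, s, t⟩, hAs⟩
  simp only [autHom, hB, SemilinearChange.hom_some, Point.some.injEq, SemilinearChange.X,
    SemilinearChange.Y, SemilinearChange.ofSMul, RingHom.id_apply] at hAP hAQ
  obtain ⟨e1, e2⟩ := hAP
  obtain ⟨e3, e4⟩ := hAQ
  have hxx : x - x' ≠ 0 := sub_ne_zero.2 hx
  have hu : (u : k) = 1 := by
    -- Two points with different `x`-coordinates are fixed, so that `u ^ 2 = 1`, and then `u = 1` in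
    -- characteristic two.
    have h5 : ((u : k) - 1) ^ 2 * (x - x') = 0 := by
      linear_combination e1 - e3 + (1 - (u : k)) * (x - x') * h2
    have h6 := (mul_eq_zero.1 h5).resolve_right hxx
    exact sub_eq_zero.1 (pow_eq_zero_iff (two_ne_zero) |>.1 h6)
  have hr : r = 0 := by rw [hu] at e1; linear_combination e1
  rw [hu] at e2 e4
  have hs : s = 0 := by
    have h5 : s * (x - x') = 0 := by linear_combination e2 - e4
    exact (mul_eq_zero.1 h5).resolve_right hxx
  have ht : t = 0 := by rw [hs] at e2; linear_combination e2
  apply Subtype.ext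
  change (⟨u, r, s, t⟩ : VariableChange k) = 1
  rw [VariableChange.one_def, hr, hs, ht, show u = 1 from Units.ext hu]

/-- In characteristic two, a curve with `a₁ ≠ 0` has at most two automorphisms. -/
lemma aut_eq_or_eq_of_a₁_ne_zero [CharP k 2] (ha : W.a₁ ≠ 0) (A B C : AutGroup W) :
    A = B ∨ B = C ∨ A = C := by
  have h2 : (2 : k) = 0 := CharTwo.two_eq_zero
  have key (A : AutGroup W) : ((A : VariableChange k).u : k) = 1 ∧ (A : VariableChange k).r = 0 ∧
      ((A : VariableChange k).s = 0 ∨ (A : VariableChange k).s = -W.a₁) ∧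
      (A : VariableChange k).t * W.a₁ = -(A : VariableChange k).s * W.a₃ := by
    obtain ⟨h1, hh2, h3, h4, -⟩ :=
      (SemilinearChange.ofSMul (W := W) (W' := W) A A.2).coeff_eq
    simp only [SemilinearChange.ofSMul, RingHom.id_apply] at h1 hh2 h3 h4
    have hu : ((A : VariableChange k).u : k) = 1 := by
      apply mul_right_cancel₀ ha
      linear_combination h1 + (A : VariableChange k).s * h2
    rw [hu] at hh2 h3 h4
    have hr : (A : VariableChange k).r = 0 := by
      apply mul_right_cancel₀ ha
      linear_combination -h3 - (A : VariableChange k).t * h2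
    rw [hr] at hh2 h4
    refine ⟨hu, hr, ?_, ?_⟩
    · have : (A : VariableChange k).s * ((A : VariableChange k).s + W.a₁) = 0 := by
        linear_combination hh2
      rcases mul_eq_zero.1 this with h | h
      · exact .inl h
      · exact .inr (by linear_combination h)
    · linear_combination h4 - (A : VariableChange k).s * (A : VariableChange k).t * h2
  have hext (A B : AutGroup W) (h : (A : VariableChange k).s = (B : VariableChange k).s) :
      A = B := by
    obtain ⟨u, r, -, t⟩ := key A
    obtain ⟨u', r', -, t'⟩ := key B
    apply Subtype.ext
    ext
    · rw [u, u']
    · rw [r, r']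
    · exact h
    · apply mul_right_cancel₀ ha
      rw [t, t', h]
  rcases (key A).2.2.1 with a | a <;> rcases (key B).2.2.1 with b | b <;>
    rcases (key C).2.2.1 with c | c
  all_goals first
    | exact .inl (hext _ _ (a.trans b.symm))
    | exact .inr (.inl (hext _ _ (b.trans c.symm)))
    | exact .inr (.inr (hext _ _ (a.trans c.symm)))

end Aut

/-- A model can be replaced by an isomorphic curve. -/
theorem HasModel.smul {E : WeierstrassCurve ℚ_[2]} {W W' : Affine (resField 2)} [W.IsElliptic]
    [W'.IsElliptic] (hE : HasModel E W) {C : VariableChange (resField 2)}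
    (h : C • (W : WeierstrassCurve (resField 2)) = W') : HasModel E W' := by
  obtain ⟨ρ, hρ⟩ := hE
  have h' : C⁻¹ • (W' : WeierstrassCurve (resField 2)) = W := by rw [← h, inv_smul_smul]
  set β := SemilinearChange.ofSMul C⁻¹ h' with hβ
  refine ⟨(conjAut C h).comp ρ, fun p _ hp2 => ?_⟩
  obtain ⟨θ, hθ, hθ'⟩ := hρ p hp2
  obtain ⟨θ₁, hθ₁⟩ := exists_torsionBy_equiv β.hom
    ⟨β.hom_injective, β.hom_surjective Function.surjective_id⟩ p
  refine ⟨θ.trans θ₁, fun σ P => ?_, fun P Q => ?_⟩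
  · rw [AddEquiv.trans_apply, AddEquiv.trans_apply, hθ₁, hθ₁, hθ]
    exact (autHom_conjAut C h h' (ρ σ) _).symm
  · rw [AddEquiv.trans_apply, AddEquiv.trans_apply, hθ₁, hθ₁,
      β.weilPairing_hom (smul_coe_torsionBy _) (smul_coe_torsionBy _)]
    exact hθ' P Q

end EllipticLocal
end

/-! ### Inertia and the inertial field -/

noncomputable section
namespace EllipticLocal
open scoped Classical
open LocalInertia
open WeierstrassCurve WeierstrassCurve.Affine WeilPairing CurveRing

section Galois
variable {E : WeierstrassCurve ℚ_[2]} {q : ℕ}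

lemma inertia_le_fixingSubgroup : inertia 2 ≤ (unramified 2).fixingSubgroup :=
  (IntermediateField.le_iff_le _ _).1 le_rfl

/-- Inertia, as a group of automorphisms over the maximal unramified extension. -/
def inertiaHom : inertia 2 →* Gal(PadicAlgCl 2/unramified 2) :=
  (IntermediateField.fixingSubgroupEquiv (unramified 2)).toMonoidHom.comp
    (Subgroup.inclusion inertia_le_fixingSubgroup)

lemma inertiaHom_apply (σ : inertia 2) (x : PadicAlgCl 2) :
    inertiaHom σ x = (σ : Gal(PadicAlgCl 2/ℚ_[2])) x := rfl

lemma mem_unramified_of_inertiaHom {x : PadicAlgCl 2} (h : ∀ σ, inertiaHom σ x = x) :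
    x ∈ unramified 2 := fun σ => h σ

instance : Algebra.IsAlgebraic (unramified 2) (PadicAlgCl 2) :=
  Algebra.IsAlgebraic.tower_top (K := ℚ_[2]) _

instance : IsAlgClosure (unramified 2) (PadicAlgCl 2) := ⟨inferInstance, inferInstance⟩

instance : Normal (unramified 2) (PadicAlgCl 2) := IsAlgClosure.normal _ _

/-- Inertia surjects onto the Galois group of a finite normal extension of the maximal unramified
extension, because the fixed field of inertia is the maximal unramified extension by definition. -/
theorem exists_inertia_surjective (L : IntermediateField (unramified 2) (PadicAlgCl 2))
    [FiniteDimensional (unramified 2) L]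
    (hL : ∀ τ : Gal(PadicAlgCl 2/unramified 2), L.map (τ : PadicAlgCl 2 →ₐ[unramified 2] _) ≤ L) :
    ∃ π : inertia 2 →* Gal(L/unramified 2), Function.Surjective π ∧
      ∀ σ, π σ = 1 ↔ ∀ x ∈ L, (σ : Gal(PadicAlgCl 2/ℚ_[2])) x = x := by
  have hn : Normal (unramified 2) L := IntermediateField.normal_iff_forall_map_le'.2 hL
  have hg : IsGalois (unramified 2) L := ⟨⟩
  set π : inertia 2 →* Gal(L/unramified 2) :=
    (AlgEquiv.restrictNormalHom L).comp inertiaHom with hπ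
  have hπa (σ : inertia 2) (x : L) : (π σ x : PadicAlgCl 2) = (σ : Gal(PadicAlgCl 2/ℚ_[2])) x :=
    AlgEquiv.restrictNormal_commutes (inertiaHom σ) L x
  refine ⟨π, ?_, fun σ => ⟨fun h x hx => ?_, fun h => ?_⟩⟩
  · rw [← MonoidHom.range_eq_top, ← IntermediateField.fixingSubgroup_fixedField π.range]
    have : IntermediateField.fixedField π.range = ⊥ := by
      rw [eq_bot_iff]
      intro x hx
      have h1 : (x : PadicAlgCl 2) ∈ unramified 2 := mem_unramified_of_inertiaHom fun σ => by
        rw [inertiaHom_apply, ← hπa]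
        exact congrArg Subtype.val (hx ⟨π σ, σ, rfl⟩)
      exact IntermediateField.mem_bot.2 ⟨⟨x, h1⟩, rfl⟩
    rw [this, IntermediateField.fixingSubgroup_bot]
  · rw [← hπa σ ⟨x, hx⟩, h]; rfl
  · ext x
    rw [hπa, h x x.2]; rfl

/-- The coordinates of the `q`-torsion points. -/
def torsionCoords (E : WeierstrassCurve ℚ_[2]) (q : ℕ) : Set (PadicAlgCl 2) :=
  {z | ∃ (x y : PadicAlgCl 2) (h : (geom E).Nonsingular x y),
    .some x y h ∈ Torsion E q ∧ (z = x ∨ z = y)}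

lemma map_torsionCoords (σ : Gal(PadicAlgCl 2/ℚ_[2])) {z : PadicAlgCl 2}
    (hz : z ∈ torsionCoords E q) : σ z ∈ torsionCoords E q := by
  obtain ⟨x, y, h, ht, hz⟩ := hz
  exact ⟨σ x, σ y, _, (galTorsion E q σ ⟨_, ht⟩).2, hz.imp (congrArg σ) (congrArg σ)⟩

lemma finite_torsionCoords [Finite (Torsion E q)] : (torsionCoords E q).Finite := by
  have h : torsionCoords E q ⊆ ⋃ P : Torsion E q,
      {z | ∃ (x y : PadicAlgCl 2) (h : (geom E).Nonsingular x y),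
        .some x y h = (P : (geom E).Point) ∧ (z = x ∨ z = y)} := by
    rintro z ⟨x, y, h, ht, hz⟩
    exact Set.mem_iUnion.2 ⟨⟨_, ht⟩, x, y, h, rfl, hz⟩
  refine (Set.finite_iUnion fun P => ?_).subset h
  obtain ⟨P, hP⟩ := P
  rcases P with _ | ⟨x, y, hxy⟩
  · refine Set.finite_empty.subset ?_
    rintro z ⟨x, y, h, h0, -⟩
    cases h0
  · refine (Set.toFinite {x, y}).subset ?_
    rintro z ⟨x', y', h, h0, hz⟩
    cases h0
    exact hz

lemma finiteDimensional_inertialField [Finite (Torsion E q)] :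
    FiniteDimensional (unramified 2) (inertialField E q) := by
  have : Finite (torsionCoords E q) := finite_torsionCoords.to_subtype
  exact IntermediateField.finiteDimensional_adjoin (S := torsionCoords E q) (fun _ _ => Algebra.IsIntegral.isIntegral _)

lemma map_inertialField_le (τ : Gal(PadicAlgCl 2/unramified 2)) :
    (inertialField E q).map (τ : PadicAlgCl 2 →ₐ[unramified 2] _) ≤ inertialField E q := by
  rw [inertialField, IntermediateField.adjoin_map]
  refine IntermediateField.adjoin.mono _ _ _ ?_
  rintro _ ⟨z, hz, rfl⟩
  exact map_torsionCoords (τ.restrictScalars ℚ_[2]) hz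

/-- An element of inertia is trivial on the `q`-torsion if and only if it is trivial on the inertial
field. -/
lemma galTorsion_eq_iff (σ : inertia 2) :
    (∀ P : Torsion E q, galTorsion E q σ P = P) ↔
      ∀ x ∈ inertialField E q, (σ : Gal(PadicAlgCl 2/ℚ_[2])) x = x := by
  constructor
  · intro h
    have hle : inertialField E q ≤
        IntermediateField.fixedField (Subgroup.zpowers (inertiaHom σ)) := by
      rw [inertialField, IntermediateField.adjoin_le_iff]
      rintro z ⟨x, y, hxy, ht, hz⟩
      have h1 := congrArg Subtype.val (h ⟨_, ht⟩)
      obtain ⟨hx, hy⟩ := (Point.some.injEq ..).mp h1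
      have hz' : inertiaHom σ z = z := by
        rcases hz with rfl | rfl
        exacts [hx, hy]
      rintro ⟨g, hg⟩
      have : Subgroup.zpowers (inertiaHom σ) ≤
          MulAction.stabilizer Gal(PadicAlgCl 2/unramified 2) z := by
        rw [Subgroup.zpowers_le]; exact hz'
      exact this hg
    intro x hx
    exact hle hx ⟨_, Subgroup.mem_zpowers _⟩
  · rintro h ⟨P, hP⟩
    apply Subtype.ext
    rcases P with _ | ⟨x, y, hxy⟩
    · rfl
    · refine (Point.some.injEq ..).mpr ⟨?_, ?_⟩
      · exact h x (IntermediateField.subset_adjoin _ _ ⟨x, y, hxy, hP, .inl rfl⟩)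
      · exact h y (IntermediateField.subset_adjoin _ _ ⟨x, y, hxy, hP, .inr rfl⟩)

end Galois
end EllipticLocal
end

/-! ### The curve `y² + y = x³` -/

noncomputable section
namespace CurveRing
open scoped Classical
open WeierstrassCurve WeierstrassCurve.Affine WeilPairing

/-- The curve `y² + y = x³`, which is supersingular in characteristic two. -/
def supersingular (k : Type*) [Field k] : Affine k := ⟨0, 0, 1, 0, 0⟩

section
variable {k : Type*} [Field k] [CharP k 2]

instance : (supersingular k).IsElliptic := by
  have h2 : (2 : k) = 0 := CharTwo.two_eq_zero
  refine ⟨isUnit_iff_ne_zero.2 ?_⟩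
  have : (supersingular k).Δ = 1 := by
    simp only [supersingular, WeierstrassCurve.Δ, b₂, b₄, b₆, b₈]
    linear_combination -14 * h2
  rw [this]
  exact one_ne_zero

lemma j_supersingular : WeierstrassCurve.j (supersingular k) = 0 := by
  rw [j_eq_zero_iff_of_char_two]
  rfl

/-- In characteristic two, `a₁ = 0` means that the `j`-invariant is zero. -/
lemma exists_smul_eq_supersingular [IsAlgClosed k] {W : Affine k} [W.IsElliptic] (h : W.a₁ = 0) :
    ∃ C : VariableChange k, C • (W : WeierstrassCurve k) = supersingular k :=
  exists_variableChange_of_j_eq _ _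
    (((j_eq_zero_iff_of_char_two W).2 h).trans j_supersingular.symm)

/-- The shape of an automorphism of `y² + y = x³`. -/
lemma aut_supersingular (A : AutGroup (supersingular k)) :
    ((A : VariableChange k).u : k) ^ 3 = 1 ∧
    (A : VariableChange k).r = (A : VariableChange k).s ^ 2 ∧
    (A : VariableChange k).s ^ 4 = (A : VariableChange k).s ∧
    (A : VariableChange k).t ^ 2 + (A : VariableChange k).t = (A : VariableChange k).s ^ 3 := by
  have h2 : (2 : k) = 0 := CharTwo.two_eq_zero
  obtain ⟨-, e2, e3, e4, e6⟩ :=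
    (SemilinearChange.ofSMul (W := supersingular k) (W' := supersingular k) A A.2).coeff_eq
  simp only [SemilinearChange.ofSMul, RingHom.id_apply, supersingular] at e2 e3 e4 e6
  generalize ((A : VariableChange k).u : k) = u at *
  generalize (A : VariableChange k).r = r at *
  generalize (A : VariableChange k).s = s at *
  generalize (A : VariableChange k).t = t at *
  have hr : r = s ^ 2 := by linear_combination -e2 - r * h2
  have hs : s ^ 4 = s := by grind
  refine ⟨by linear_combination e3 + t * h2, hr, hs, ?_⟩
  grind

/-- The automorphism of `y² + y = x³` with given parameters. -/
lemma mem_aut_supersingular {u : kˣ} {s t : k} (hu : (u : k) ^ 3 = 1) (hs : s ^ 4 = s)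
    (ht : t ^ 2 + t = s ^ 3) :
    (⟨u, s ^ 2, s, t⟩ : VariableChange k) ∈ AutGroup (supersingular k) := by
  have h2 : (2 : k) = 0 := CharTwo.two_eq_zero
  have hu0 : (u : k) ≠ 0 := u.ne_zero
  have hui : (u⁻¹ : k) ^ 3 = 1 := by rw [inv_pow, hu, inv_one]
  rw [MulAction.mem_stabilizer_iff]
  ext
  · simp only [variableChange_a₁, supersingular, Units.val_inv_eq_inv_val]
    linear_combination (u⁻¹ : k) * s * h2
  · simp only [variableChange_a₂, supersingular, Units.val_inv_eq_inv_val]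
    linear_combination (u⁻¹ : k) ^ 2 * s ^ 2 * h2
  · simp only [variableChange_a₃, supersingular, Units.val_inv_eq_inv_val]
    linear_combination hui + (u⁻¹ : k) ^ 3 * t * h2
  · simp only [variableChange_a₄, supersingular, Units.val_inv_eq_inv_val]
    linear_combination (u⁻¹ : k) ^ 4 * (hs + (s ^ 4 - s * t) * h2)
  · simp only [variableChange_a₆, supersingular, Units.val_inv_eq_inv_val]
    linear_combination (u⁻¹ : k) ^ 6 * (- ht + s ^ 2 * hs)

/-- The automorphism `-1`. -/
lemma autHom_eq_neg {A : AutGroup (supersingular k)} (hu : (A : VariableChange k).u = 1)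
    (hs : (A : VariableChange k).s = 0) (hA : A ≠ 1) (P : (supersingular k).Point) :
    autHom A P = -P := by
  have h2 : (2 : k) = 0 := CharTwo.two_eq_zero
  obtain ⟨-, hr, -, ht⟩ := aut_supersingular A
  rw [hs] at hr ht
  have hr' : (A : VariableChange k).r = 0 := by rw [hr]; ring
  have ht1 : (A : VariableChange k).t = 1 := by
    have h0 : (A : VariableChange k).t ≠ 0 := by
      intro h0
      apply hA
      apply Subtype.ext
      rw [OneMemClass.coe_one, VariableChange.one_def, ← hu]
      ext
      exacts [rfl, hr', hs, h0]
    apply mul_left_cancel₀ h0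
    linear_combination ht - (A : VariableChange k).t * h2
  rcases P with _ | ⟨x, y, h⟩
  · exact map_zero _
  · have h1 : ((A⁻¹ : AutGroup (supersingular k)) : VariableChange k) = A := by
      have hA' : (A : VariableChange k) = ⟨1, 0, 0, 1⟩ := by
        ext
        · rw [hu]
        · exact hr'
        · exact hs
        · exact ht1
      rw [InvMemClass.coe_inv, inv_eq_iff_mul_eq_one, hA', VariableChange.mul_def,
        VariableChange.one_def]
      simp [CharTwo.add_self_eq_zero]
    have h3 : autHom A (.some x y h) = (SemilinearChange.ofSMul (W := supersingular k)
        (W' := supersingular k) A A.2).hom (.some x y h) :=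
      SemilinearChange.hom_congr (S := SemilinearChange.ofSMul _ (A⁻¹).2)
        (T := SemilinearChange.ofSMul _ A.2) rfl h1 _
    rw [h3, SemilinearChange.hom_some, Point.neg_some, Point.some.injEq]
    simp only [SemilinearChange.X, SemilinearChange.Y, SemilinearChange.ofSMul, hu, hr', hs,
      ht1, Units.val_one, RingHom.id_apply, Affine.negY, supersingular]
    exact ⟨by ring, by linear_combination (y + 1) * h2⟩

/-- Frobenius on `y² + y = x³`. -/
def frob (k : Type*) [Field k] [CharP k 2] :
    SemilinearChange (supersingular k) (supersingular k) where
  φ := frobenius k 2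
  C := 1
  smul_eq := by
    rw [one_smul]
    ext <;> simp [supersingular]

/-- Frobenius on the automorphisms of `y² + y = x³`. -/
def frobAut (k : Type*) [Field k] [CharP k 2] :
    AutGroup (supersingular k) →* AutGroup (supersingular k) :=
  ((VariableChange.mapHom (frobenius k 2)).comp (Subgroup.subtype _)).codRestrict _ fun A => by
    rw [MulAction.mem_stabilizer_iff]
    have h := (frob k).smul_eq
    change (1 : VariableChange k) • supersingular k =
      WeierstrassCurve.map (supersingular k) (frobenius k 2) at h
    rw [one_smul] at h
    have h' := congrArg (fun V => (A : VariableChange k).map (frobenius k 2) • V) h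
    refine h'.trans ?_
    change (A : VariableChange k).map (frobenius k 2) • WeierstrassCurve.map _ _ = _
    rw [map_variableChange, A.2, ← h]

lemma frob_autHom (A : AutGroup (supersingular k)) (P : (supersingular k).Point) :
    (frob k).hom (autHom A P) = autHom (frobAut k A) ((frob k).hom P) := by
  rw [autHom, autHom, ← SemilinearChange.comp_hom, ← SemilinearChange.comp_hom]
  refine SemilinearChange.hom_congr ?_ ?_ P
  · rfl
  · change ((A⁻¹ : AutGroup (supersingular k)) : VariableChange k).map (frobenius k 2) * 1 =
      1 * (((frobAut k A)⁻¹ : AutGroup (supersingular k)) : VariableChange k)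
    rw [one_mul, mul_one, ← map_inv]
    rfl

end
end CurveRing
end

/-! ### Embeddings of the quaternion group -/

noncomputable section
namespace CurveRing
open scoped Classical
open WeierstrassCurve WeierstrassCurve.Affine WeilPairing

section
variable {k : Type*} [Field k] [CharP k 2]

lemma aut_ext {A B : AutGroup (supersingular k)}
    (hu : ((A : VariableChange k).u : k) = (B : VariableChange k).u)
    (hs : (A : VariableChange k).s = (B : VariableChange k).s)
    (ht : (A : VariableChange k).t = (B : VariableChange k).t) : A = B := by
  apply Subtype.ext
  ext
  · exact hu
  · rw [(aut_supersingular A).2.1, (aut_supersingular B).2.1, hs]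
  · exact hs
  · exact ht

lemma u_mul (A B : AutGroup (supersingular k)) :
    (((A * B : AutGroup (supersingular k)) : VariableChange k).u : k) =
      (A : VariableChange k).u * (B : VariableChange k).u := rfl

lemma s_mul (A B : AutGroup (supersingular k)) :
    ((A * B : AutGroup (supersingular k)) : VariableChange k).s =
      (B : VariableChange k).u * (A : VariableChange k).s + (B : VariableChange k).s := rfl

lemma t_mul (A B : AutGroup (supersingular k)) :
    ((A * B : AutGroup (supersingular k)) : VariableChange k).t =
      (A : VariableChange k).t * (B : VariableChange k).u ^ 3 +
      (A : VariableChange k).r * (B : VariableChange k).s * (B : VariableChange k).u ^ 2 +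
      (B : VariableChange k).t := rfl

section Quaternion
open QuaternionGroup

variable (j : QuaternionGroup 2 →* AutGroup (supersingular k))

lemma pow_four_eq_one (g : QuaternionGroup 2) : g ^ 4 = 1 := by
  revert g; decide

/-- The elements of the quaternion group have order dividing four, while `u ^ 3 = 1`. -/
lemma u_eq_one (g : QuaternionGroup 2) : ((j g : VariableChange k).u : k) = 1 := by
  have h3 := (aut_supersingular (j g)).1
  have h4 : ((j g ^ 4 : AutGroup (supersingular k)) : VariableChange k).u = (1 : k) := by
    rw [← map_pow, pow_four_eq_one, map_one]
    rfl
  rw [pow_succ, pow_succ, pow_succ, pow_one, u_mul, u_mul, u_mul] at h4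
  linear_combination h4 - ((j g : VariableChange k).u : k) * h3

variable {j}

/-- The automorphisms with `u = 1` and `s = 0` have order at most two. -/
lemma s_ne_zero (hj : Function.Injective j) {g : QuaternionGroup 2} (hg : g * g ≠ 1) :
    (j g : VariableChange k).s ≠ 0 := by
  intro h
  apply hg
  apply hj
  have h2 : (2 : k) = 0 := CharTwo.two_eq_zero
  rw [map_mul, map_one]
  have hu := u_eq_one j g
  apply aut_ext
  · rw [u_mul, hu, mul_one]; rfl
  · rw [s_mul, h, mul_zero, add_zero]; rfl
  · rw [t_mul, hu, h]
    change _ = (0 : k)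
    linear_combination (j g : VariableChange k).t * h2

/-- The parameters of the images of two generators of the quaternion group. -/
lemma quaternion_params (hj : Function.Injective j) :
    (j (a 1) : VariableChange k).s ^ 3 = 1 ∧ (j (xa 0) : VariableChange k).s ^ 3 = 1 ∧
    (j (a 1) : VariableChange k).s ^ 2 + (j (a 1) : VariableChange k).s *
      (j (xa 0) : VariableChange k).s + (j (xa 0) : VariableChange k).s ^ 2 = 0 := by
  have h1 := s_ne_zero hj (g := a 1) (by decide)
  have h2 := s_ne_zero hj (g := xa 0) (by decide)
  have h3 := s_ne_zero hj (g := a 1 * xa 0) (by decide)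
  rw [map_mul, s_mul, u_eq_one, one_mul] at h3
  have e1 := (aut_supersingular (j (a 1))).2.2.1
  have e2 := (aut_supersingular (j (xa 0))).2.2.1
  generalize (j (a 1) : VariableChange k).s = s₁ at *
  generalize (j (xa 0) : VariableChange k).s = s₂ at *
  have htwo : (2 : k) = 0 := CharTwo.two_eq_zero
  have e1' : s₁ ^ 3 = 1 := mul_left_cancel₀ h1 (by linear_combination e1)
  have e2' : s₂ ^ 3 = 1 := mul_left_cancel₀ h2 (by linear_combination e2)
  refine ⟨e1', e2', mul_left_cancel₀ h3 ?_⟩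
  linear_combination e1' + e2' + (1 + s₁ ^ 2 * s₂ + s₁ * s₂ ^ 2) * htwo

/-- A relation between two homomorphisms holds everywhere if it holds at two generators. -/
lemma semiconjBy_of_generators {G : Type*} [Group G] {j j' : QuaternionGroup 2 →* G} {c : G}
    (h1 : SemiconjBy c (j (a 1)) (j' (a 1))) (h2 : SemiconjBy c (j (xa 0)) (j' (xa 0)))
    (g : QuaternionGroup 2) : SemiconjBy c (j g) (j' g) := by
  have key (i : ZMod (2 * 2)) : SemiconjBy c (j (a i)) (j' (a i)) := by
    have : a i = (a 1 : QuaternionGroup 2) ^ i.val := by rw [a_one_pow, ZMod.natCast_zmod_val]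
    rw [this, map_pow, map_pow]
    exact h1.pow_right _
  rcases g with i | i
  · exact key i
  · have : xa i = (xa 0 * a i : QuaternionGroup 2) := by simp
    rw [this, map_mul, map_mul]
    exact h2.mul_right (key i)

variable [IsAlgClosed k] {j' : QuaternionGroup 2 →* AutGroup (supersingular k)}

/-- Two embeddings of the quaternion group are conjugate if the parameters `s` of the images of the
two generators are proportional. -/
lemma exists_semiconjBy (hj : Function.Injective j) (hj' : Function.Injective j')
    (h : (j (a 1) : VariableChange k).s * (j' (xa 0) : VariableChange k).s =
      (j (xa 0) : VariableChange k).s * (j' (a 1) : VariableChange k).s) :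
    ∃ c : AutGroup (supersingular k), ∀ g, SemiconjBy c (j g) (j' g) := by
  have htwo : (2 : k) = 0 := CharTwo.two_eq_zero
  obtain ⟨e1, e2, e3⟩ := quaternion_params hj
  obtain ⟨e1', e2', e3'⟩ := quaternion_params hj'
  have f1 := (aut_supersingular (j (a 1))).2.2.2
  have f2 := (aut_supersingular (j (xa 0))).2.2.2
  have f1' := (aut_supersingular (j' (a 1))).2.2.2
  have f2' := (aut_supersingular (j' (xa 0))).2.2.2
  set s₁ := (j (a 1) : VariableChange k).s with hs₁
  set s₂ := (j (xa 0) : VariableChange k).s with hs₂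
  set s₁' := (j' (a 1) : VariableChange k).s with hs₁'
  set s₂' := (j' (xa 0) : VariableChange k).s with hs₂'
  set t₁ := (j (a 1) : VariableChange k).t with ht₁
  set t₂ := (j (xa 0) : VariableChange k).t with ht₂
  set t₁' := (j' (a 1) : VariableChange k).t with ht₁'
  set t₂' := (j' (xa 0) : VariableChange k).t with ht₂'
  have hs₁'0 : s₁' ≠ 0 := by
    intro h0; rw [h0] at e1'; norm_num at e1'
  have hs₁0 : s₁ ≠ 0 := by
    intro h0; rw [h0] at e1; norm_num at e1
  set u : kˣ := Units.mk0 (s₁ / s₁') (div_ne_zero hs₁0 hs₁'0) with hu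
  have hu1 : (u : k) * s₁' = s₁ := div_mul_cancel₀ _ hs₁'0
  have hu2 : (u : k) * s₂' = s₂ := by
    apply mul_right_cancel₀ hs₁'0
    linear_combination s₂' * hu1 + h
  have hu3 : (u : k) ^ 3 = 1 := by
    linear_combination (- (u : k) ^ 3) * e1' +
      ((u : k) ^ 2 * s₁' ^ 2 + u * s₁' * s₁ + s₁ ^ 2) * hu1 + e1
  -- the product of the three primitive cube roots of unity is one
  have hprod : s₁ ^ 2 * s₂ + s₁ * s₂ ^ 2 = 1 := by
    linear_combination s₁ * e3 - e1 - htwo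
  -- inner automorphisms with `u = 1` change `t₁` and `t₂` by arbitrary elements of `{0, 1}`
  have hδ₁ : (t₁ + t₁') ^ 2 = t₁ + t₁' := by
    linear_combination f1 + f1' + e1 + e1' + (t₁ * t₁' + 1 - t₁ - t₁') * htwo
  have hδ₂ : (t₂ + t₂') ^ 2 = t₂ + t₂' := by
    linear_combination f2 + f2' + e2 + e2' + (t₂ * t₂' + 1 - t₂ - t₂') * htwo
  obtain ⟨δ₁, hδ₁'⟩ : ∃ δ, δ = t₁ + t₁' := ⟨_, rfl⟩
  obtain ⟨δ₂, hδ₂'⟩ : ∃ δ, δ = t₂ + t₂' := ⟨_, rfl⟩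
  rw [← hδ₁'] at hδ₁
  rw [← hδ₂'] at hδ₂
  obtain ⟨s, hs⟩ : ∃ s, s = δ₁ * s₂ + δ₂ * s₁ := ⟨_, rfl⟩
  have hssq : s ^ 2 = δ₁ * s₂ ^ 2 + δ₂ * s₁ ^ 2 := by
    rw [hs]
    linear_combination s₂ ^ 2 * hδ₁ + s₁ ^ 2 * hδ₂ + δ₁ * δ₂ * s₁ * s₂ * htwo
  have hs4 : s ^ 4 = s := by
    have : s ^ 4 = (s ^ 2) ^ 2 := by ring
    rw [this, hssq, hs]
    linear_combination s₂ ^ 4 * hδ₁ + s₁ ^ 4 * hδ₂ + δ₁ * s₂ * e2 + δ₂ * s₁ * e1 +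
      δ₁ * δ₂ * s₁ ^ 2 * s₂ ^ 2 * htwo
  obtain ⟨t, ht⟩ : ∃ t : k, t ^ 2 + t = s ^ 3 := by
    obtain ⟨t, ht⟩ := IsAlgClosed.exists_root (X ^ 2 + X - C (s ^ 3) : k[X])
      (by rw [show (X ^ 2 + X - C (s ^ 3) : k[X]).degree = 2 by compute_degree!]; norm_num)
    refine ⟨t, ?_⟩
    simpa [sub_eq_zero] using ht
  have r₁ := (aut_supersingular (j' (a 1))).2.1
  have r₂ := (aut_supersingular (j' (xa 0))).2.1
  have hu2' : (u : k) ^ 2 * s₁' ^ 2 = s₁ ^ 2 := by rw [← hu1]; ring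
  have hu2'' : (u : k) ^ 2 * s₂' ^ 2 = s₂ ^ 2 := by rw [← hu2]; ring
  refine ⟨⟨⟨u, s ^ 2, s, t⟩, mem_aut_supersingular hu3 hs4 ht⟩, semiconjBy_of_generators ?_ ?_⟩
  · refine aut_ext ?_ ?_ ?_
    · rw [u_mul, u_mul, u_eq_one, u_eq_one, mul_comm]
    · rw [s_mul, s_mul, u_eq_one, ← hs₁, ← hs₁']
      linear_combination -hu1
    · rw [t_mul, t_mul, u_eq_one, r₁, ← hs₁, ← hs₁', ← ht₁, ← ht₁']
      dsimp only
      rw [hssq]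
      linear_combination -t₁' * hu3 - s * hu2' - s₁ ^ 2 * hs + δ₁ * hprod + hδ₁' +
        (t₁ - δ₁ * s₂ * s₁ ^ 2) * htwo
  · refine aut_ext ?_ ?_ ?_
    · rw [u_mul, u_mul, u_eq_one, u_eq_one, mul_comm]
    · rw [s_mul, s_mul, u_eq_one, ← hs₂, ← hs₂']
      linear_combination -hu2
    · rw [t_mul, t_mul, u_eq_one, r₂, ← hs₂, ← hs₂', ← ht₂, ← ht₂']
      dsimp only
      rw [hssq]
      linear_combination -t₂' * hu3 - s * hu2'' - s₂ ^ 2 * hs + δ₂ * hprod + hδ₂' +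
        (t₂ - δ₂ * s₂ ^ 2 * s₁) * htwo

lemma frobAut_injective : Function.Injective (frobAut k) := by
  intro A B h
  have hu := congrArg (fun C : AutGroup (supersingular k) => ((C : VariableChange k).u : k)) h
  have hs := congrArg (fun C : AutGroup (supersingular k) => (C : VariableChange k).s) h
  have ht := congrArg (fun C : AutGroup (supersingular k) => (C : VariableChange k).t) h
  exact aut_ext (frobenius_inj k 2 hu) (frobenius_inj k 2 hs) (frobenius_inj k 2 ht)

/-- Two embeddings of the quaternion group in the automorphism group of `y² + y = x³` are conjugate,
up to Frobenius. The parameters `s` of two generators have a primitive cube root of unity as their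
ratio; there are two such roots, and Frobenius exchanges them. -/
theorem semiconjBy_or_frob (hj : Function.Injective j) (hj' : Function.Injective j') :
    ∃ c : AutGroup (supersingular k),
      (∀ g, SemiconjBy c (j g) (j' g)) ∨ ∀ g, SemiconjBy c (frobAut k (j g)) (j' g) := by
  have htwo : (2 : k) = 0 := CharTwo.two_eq_zero
  by_cases h : (j (a 1) : VariableChange k).s * (j' (xa 0) : VariableChange k).s =
      (j (xa 0) : VariableChange k).s * (j' (a 1) : VariableChange k).s
  · obtain ⟨c, hc⟩ := exists_semiconjBy hj hj' h
    exact ⟨c, .inl hc⟩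
  · have h' : (j (a 1) : VariableChange k).s ^ 2 * (j' (xa 0) : VariableChange k).s =
        (j (xa 0) : VariableChange k).s ^ 2 * (j' (a 1) : VariableChange k).s := by
      obtain ⟨e1, e2, e3⟩ := quaternion_params hj
      obtain ⟨e1', e2', e3'⟩ := quaternion_params hj'
      generalize (j (a 1) : VariableChange k).s = s₁ at *
      generalize (j (xa 0) : VariableChange k).s = s₂ at *
      generalize (j' (a 1) : VariableChange k).s = s₁' at *
      generalize (j' (xa 0) : VariableChange k).s = s₂' at *
      apply mul_left_cancel₀ (sub_ne_zero.2 h)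
      linear_combination s₁ ^ 3 * e3' - s₁ * s₁' * s₂' * e3 + s₁' ^ 2 * (e2 - e1)
    obtain ⟨c, hc⟩ := exists_semiconjBy (j := (frobAut k).comp j) (frobAut_injective.comp hj) hj' h'
    exact ⟨c, .inr hc⟩

end Quaternion
end
end CurveRing
end

/-! ### Inertia acts through an embedding of the quaternion group -/

noncomputable section
namespace EllipticLocal
open scoped Classical
open LocalInertia
open WeierstrassCurve WeierstrassCurve.Affine WeilPairing CurveRing

section Schur

lemma two_ne_zero_zmod {p : ℕ} [Fact p.Prime] (hp2 : p ≠ 2) : (2 : ZMod p) ≠ 0 := by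
  have : ((2 : ℕ) : ZMod p) ≠ 0 := by
    rw [Ne, ZMod.natCast_eq_zero_iff, Nat.prime_dvd_prime_iff_eq Fact.out Nat.prime_two]
    exact hp2
  exact_mod_cast this

/-- Schur's lemma for the representation of the quaternion group on a plane over `ZMod p`: an
endomorphism that commutes with two anticommuting invertible endomorphisms is scalar. -/
lemma exists_eq_smul_of_commute {p : ℕ} [Fact p.Prime] (hp2 : p ≠ 2) {V : Type*} [AddCommGroup V]
    (hV : ∀ v : V, p • v = 0) (hcard : Nat.card V = p ^ 2) {A B T : V →+ V}
    (hA : ∀ v, A (A v) = -v) (hB : ∀ v, B (B v) = -v) (hAB : ∀ v, A (B v) = -B (A v))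
    (hTA : ∀ v, T (A v) = A (T v)) (hTB : ∀ v, T (B v) = B (T v)) :
    ∃ c : ℕ, ∀ v, T v = c • v := by
  have : Module (ZMod p) V := AddCommGroup.zmodModule hV
  have hp1 : 1 < p := (Fact.out : p.Prime).one_lt
  have hfin : Finite V := Nat.finite_of_card_ne_zero (by rw [hcard]; positivity)
  have hdim : Module.finrank (ZMod p) V = 2 := by
    have h := FiniteField.pow_finrank_eq_natCard p V
    rw [hcard] at h
    exact Nat.pow_right_injective hp1 h
  let f : V →ₗ[ZMod p] V := T.toZModLinearMap p
  have hscalar : ∃ c : ZMod p, f = c • 1 := by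
      refine LinearMap.exists_eq_smul_id_of_forall_notLinearIndependent (R := ZMod p) (V := V)
        fun w hw => ?_
      change LinearIndependent (ZMod p) ![w, T w] at hw
      have hspan (v : V) : ∃ x y : ZMod p, x • w + y • T w = v := by
        have h1 := hw.span_eq_top_of_card_eq_finrank (by simp [hdim])
        have h2 : v ∈ Submodule.span (ZMod p) (Set.range ![w, T w]) := h1 ▸ Submodule.mem_top
        rw [Matrix.range_cons, Matrix.range_cons, Matrix.range_empty, Set.union_empty,
          Set.singleton_union, Submodule.mem_span_pair] at h2
        exact h2
      have hAl (c : ZMod p) (v : V) : A (c • v) = c • A v := (A.toZModLinearMap p).map_smul c v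
      have hBl (c : ZMod p) (v : V) : B (c • v) = c • B v := (B.toZModLinearMap p).map_smul c v
      obtain ⟨x, y, hx⟩ := hspan (A w)
      obtain ⟨x', y', hx'⟩ := hspan (B w)
      -- `A w` and `B w` lie in the span of `w` and `T w`, so that `A` and `B` commute at `w`
      have h1 : A (B w) = B (A w) := by
        rw [← hx', ← hx]
        simp only [map_add, hAl, hBl, ← hTA, ← hTB]
        rw [← hx', ← hx]
        simp only [map_add]
        have hTl (c : ZMod p) (v : V) : T (c • v) = c • T v := (T.toZModLinearMap p).map_smul c v
        simp only [hTl]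
        module
      have h2 : (2 : ZMod p) • B (A w) = 0 := by
        rw [two_smul]
        nth_rewrite 1 [← h1]
        rw [hAB, neg_add_cancel]
      have h4 := (smul_eq_zero.1 h2).resolve_left (two_ne_zero_zmod hp2)
      have h5 : A w = 0 := by rw [← neg_eq_zero, ← hB, h4, map_zero]
      have h6 : w = 0 := by rw [← neg_eq_zero, ← hA, h5, map_zero]
      exact hw.ne_zero 0 h6
  obtain ⟨c, hc⟩ := hscalar
  refine ⟨c.val, fun v => ?_⟩
  have h1 := LinearMap.congr_fun hc v
  change T v = c • v at h1
  rw [h1]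
  nth_rewrite 1 [← ZMod.natCast_zmod_val c]
  rw [Nat.cast_smul_eq_nsmul]

end Schur

section Lift
/-- A homomorphism with the same kernel as a surjective one factors through it injectively. -/
lemma exists_injective_lift {G H N : Type*} [Group G] [Group H] [Group N] {π : G →* H}
    (hπ : Function.Surjective π) {ρ : G →* N} (h : ∀ g, π g = 1 ↔ ρ g = 1) :
    ∃ j : H →* N, Function.Injective j ∧ ∀ g, j (π g) = ρ g := by
  set j := π.liftOfSurjective hπ ⟨ρ, fun g hg => (h g).1 hg⟩ with hj
  have hjπ (g : G) : j (π g) = ρ g := MonoidHom.liftOfRightInverse_comp_apply _ _ _ _ g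
  refine ⟨j, ?_, hjπ⟩
  rw [injective_iff_map_eq_one]
  intro x hx
  obtain ⟨g, rfl⟩ := hπ x
  rw [hjπ] at hx
  exact (h g).2 hx
end Lift

section Model
variable {E : WeierstrassCurve ℚ_[2]} [E.IsElliptic]

/-- The action of inertia on the odd torsion of `E`, when it factors through the quaternion group:
it comes from an embedding of the quaternion group in the automorphism group of `y² + y = x³`. -/
theorem exists_embedding (hE : PotentiallyGoodReduction E) {q : ℕ} [Fact q.Prime] (hq : q ≠ 2)
    {π : inertia 2 →* QuaternionGroup 2} (hπ : Function.Surjective π)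
    (hπE : ∀ σ, π σ = 1 ↔ ∀ P : Torsion E q, galTorsion E q σ P = P) :
    ∃ j : QuaternionGroup 2 →* AutGroup (supersingular (resField 2)), Function.Injective j ∧
      ∀ (p : ℕ) [Fact p.Prime], p ≠ 2 →
        ∃ θ : Torsion E p ≃+ AddSubgroup.torsionBy (supersingular (resField 2)).Point (p : ℤ),
          (∀ (σ : inertia 2) (P : Torsion E p),
            (θ (galTorsion E p σ P) : (supersingular (resField 2)).Point) =
              autHom (j (π σ)) (θ P)) ∧
          ∀ P Q : Torsion E p, (resPlace 2).Red (weilPairing (geom E) p P Q)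
            (weilPairing (supersingular (resField 2)) p (θ P) (θ Q)) := by
  -- the action on the `q`-torsion has the same kernel as the action by automorphisms
  have key {W : Affine (resField 2)} [W.IsElliptic] {ρ : inertia 2 →* AutGroup W}
      {θ : Torsion E q ≃+ AddSubgroup.torsionBy W.Point (q : ℤ)}
      (hθ : ∀ (σ : inertia 2) (P : Torsion E q),
        (θ (galTorsion E q σ P) : W.Point) = autHom (ρ σ) (θ P)) (σ : inertia 2) :
      π σ = 1 ↔ ρ σ = 1 := by
    rw [hπE]
    constructor
    · intro h
      have hcard : 3 < Nat.card (AddSubgroup.torsionBy W.Point (q : ℤ)) := by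
        rw [← Nat.card_congr θ.toEquiv, TorsionCount.card_torsion (geom E) q]
        have : 2 ≤ q := (Fact.out : q.Prime).two_le
        nlinarith
      refine eq_one_of_autHom_eq hcard fun P => ?_
      obtain ⟨P, rfl⟩ := θ.surjective P
      rw [← hθ, h]
    · intro h P
      apply θ.injective
      apply Subtype.ext
      rw [hθ, h, autHom_one]
  obtain ⟨W, hW, hM⟩ := exists_hasModel hE
  -- A curve with `a₁ ≠ 0` does not have enough automorphisms.
  have ha : W.a₁ = 0 := by
    by_contra ha
    obtain ⟨ρ, hρ⟩ := hM
    obtain ⟨θ, hθ, -⟩ := hρ q hq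
    obtain ⟨j, hj, -⟩ := exists_injective_lift hπ (key hθ)
    rcases aut_eq_or_eq_of_a₁_ne_zero ha (j 1) (j (.a 1)) (j (.a 2)) with h | h | h
    · exact absurd (hj h) (by decide)
    · exact absurd (hj h) (by decide)
    · exact absurd (hj h) (by decide)
  obtain ⟨C, hC⟩ := exists_smul_eq_supersingular ha
  obtain ⟨ρ, hρ⟩ := hM.smul hC
  obtain ⟨θ, hθ, -⟩ := hρ q hq
  obtain ⟨j, hj, hjπ⟩ := exists_injective_lift hπ (key hθ)
  refine ⟨j, hj, fun p _ hp => ?_⟩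
  obtain ⟨θ, hθ, hθ'⟩ := hρ p hp
  exact ⟨θ, fun σ P => by rw [hθ, hjπ], hθ'⟩

end Model
end EllipticLocal
end

/-! ### Comparison of the torsion modules -/

noncomputable section
namespace EllipticLocal
open scoped Classical
open LocalInertia
open WeierstrassCurve WeierstrassCurve.Affine WeilPairing CurveRing

section Comparison
variable {E E' : WeierstrassCurve ℚ_[2]} [E.IsElliptic] [E'.IsElliptic]

/-- The isomorphism `φ` raises the Weil pairing to the power `n`. -/
def ScalesPairing {p : ℕ} (φ : Torsion E p ≃+ Torsion E' p) (n : ℕ) : Prop :=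
  ∀ P Q : Torsion E p,
    weilPairing (geom E') p (φ P) (φ Q) = weilPairing (geom E) p P Q ^ n

/-- A map of the reduced curves that intertwines the actions of inertia lifts to an isomorphism of
torsion modules, with the same effect on the Weil pairing. -/
lemma exists_lift_of_model {W W' : Affine (resField 2)} [W.IsElliptic] [W'.IsElliptic]
    {p : ℕ} [Fact p.Prime] (hp2 : p ≠ 2)
    {ρ : inertia 2 → W.Point →+ W.Point} {ρ' : inertia 2 → W'.Point →+ W'.Point}
    {θ : Torsion E p ≃+ AddSubgroup.torsionBy W.Point (p : ℤ)}
    (hθ : ∀ (σ : inertia 2) (P : Torsion E p), (θ (galTorsion E p σ P) : W.Point) = ρ σ (θ P))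
    (hθe : ∀ P Q : Torsion E p, (resPlace 2).Red (weilPairing (geom E) p P Q)
      (weilPairing W p (θ P) (θ Q)))
    {θ' : Torsion E' p ≃+ AddSubgroup.torsionBy W'.Point (p : ℤ)}
    (hθ' : ∀ (σ : inertia 2) (P : Torsion E' p),
      (θ' (galTorsion E' p σ P) : W'.Point) = ρ' σ (θ' P))
    (hθe' : ∀ P Q : Torsion E' p, (resPlace 2).Red (weilPairing (geom E') p P Q)
      (weilPairing W' p (θ' P) (θ' Q)))
    {f : W.Point →+ W'.Point} (hf : Function.Bijective f)
    (hfρ : ∀ σ P, f (ρ σ P) = ρ' σ (f P)) {n : ℕ}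
    (hfe : ∀ P Q : W.Point, p • P = 0 → p • Q = 0 →
      weilPairing W' p (f P) (f Q) = weilPairing W p P Q ^ n) :
    ∃ φ : Torsion E p ≃+ Torsion E' p, IsInertiaEquivariant φ ∧ ScalesPairing φ n := by
  obtain ⟨g, hg⟩ := exists_torsionBy_equiv f hf p
  refine ⟨(θ.trans g).trans θ'.symm, fun σ hσ P => ?_, fun P Q => ?_⟩
  · rw [AddEquiv.trans_apply, AddEquiv.trans_apply, AddEquiv.symm_apply_eq]
    apply Subtype.ext
    rw [hg, hθ' ⟨σ, hσ⟩]
    simp only [AddEquiv.trans_apply, AddEquiv.apply_symm_apply]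
    rw [hg, hθ ⟨σ, hσ⟩, hfρ]
  · have h1 := hθe' (((θ.trans g).trans θ'.symm) P) (((θ.trans g).trans θ'.symm) Q)
    simp only [AddEquiv.trans_apply, AddEquiv.apply_symm_apply] at h1 ⊢
    rw [hg, hg, hfe _ _ (smul_coe_torsionBy _) (smul_coe_torsionBy _)] at h1
    refine eq_of_red_rootOfUnity hp2 h1 ((hθe P Q).pow n) ?_ ?_
    · exact weilPairing_pow (smul_coe_torsionBy _) (smul_coe_torsionBy _)
    · rw [pow_right_comm, weilPairing_pow (smul_coe_torsionBy P) (smul_coe_torsionBy Q), one_pow]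

variable {p : ℕ} [hp : Fact p.Prime] {φ ψ : Torsion E p ≃+ Torsion E' p}

lemma ScalesPairing.isSymplectic (h : ScalesPairing φ 1) : IsSymplectic φ := by
  refine ⟨1, IsSquare.one, fun P Q => ?_⟩
  have : Fact (1 < p) := ⟨hp.1.one_lt⟩
  rw [h, Units.val_one, ZMod.val_one]

lemma ScalesPairing.isSymplectic_two (hp2 : p ≠ 2) (h : ScalesPairing φ 2)
    (h2 : legendreSym p 2 = 1) : IsSymplectic φ := by
  have h0 := two_ne_zero_zmod hp2
  have hsq : IsSquare (2 : ZMod p) := by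
    have := (legendreSym.eq_one_iff p (a := 2) (by exact_mod_cast h0)).1 h2
    exact_mod_cast this
  obtain ⟨s, hs⟩ := hsq
  have hs0 : s ≠ 0 := by rintro rfl; exact h0 (by rw [hs, mul_zero])
  refine ⟨Units.mk0 2 h0, ⟨Units.mk0 s hs0, Units.ext hs⟩, fun P Q => ?_⟩
  rw [h]
  congr 1
  have h3 : 2 < p := lt_of_le_of_ne hp.1.two_le hp2.symm
  change 2 = (2 : ZMod p).val
  have := ZMod.val_natCast_of_lt h3
  exact_mod_cast this.symm

/-- If an equivariant isomorphism squares the Weil pairing, and `2` is not a square modulo `p`, then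
no equivariant isomorphism is symplectic: by Schur's lemma the two differ by a scalar `c`, so that
the other one raises the pairing to the power `2 c ^ 2`. -/
lemma not_isSymplectic {π : inertia 2 →* QuaternionGroup 2} (hπ : Function.Surjective π)
    (hp2 : p ≠ 2)
    {j : QuaternionGroup 2 →* AutGroup (supersingular (resField 2))} (hj : Function.Injective j)
    {θ : Torsion E p ≃+ AddSubgroup.torsionBy (supersingular (resField 2)).Point (p : ℤ)}
    (hθ : ∀ (σ : inertia 2) (P : Torsion E p),
      (θ (galTorsion E p σ P) : (supersingular (resField 2)).Point) = autHom (j (π σ)) (θ P))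
    (hφ : IsInertiaEquivariant φ) (hφ2 : ScalesPairing φ 2) (h2 : legendreSym p 2 = -1)
    (hψ : IsInertiaEquivariant ψ) : ¬ IsSymplectic ψ := by
  rintro ⟨r, ⟨r', hr'⟩, hr⟩
  obtain ⟨σ, hσ⟩ := hπ (.a 1)
  obtain ⟨τ, hτ⟩ := hπ (.xa 0)
  have hneg (P : (supersingular (resField 2)).Point) : autHom (j (.a 2)) P = -P := by
    have e : j (.a 2) = j (.a 1) * j (.a 1) := by rw [← map_mul]; rfl
    refine autHom_eq_neg (Units.ext (u_eq_one j _)) ?_ ?_ P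
    · rw [e, s_mul, u_eq_one, one_mul, CharTwo.add_self_eq_zero]
    · rw [← map_one j]
      exact fun h => absurd (hj h) (by decide)
  have hmul (g h g' : QuaternionGroup 2) (hg : g * h = .a 2 * g')
      (P : (supersingular (resField 2)).Point) :
      autHom (j g) (autHom (j h) P) = -autHom (j g') P := by
    rw [← autHom_mul, ← map_mul, hg, map_mul, autHom_mul, hneg]
  -- The relations `i² = j² = -1` and `i j = - j i` on the torsion of `E`, as the central element of
  -- the quaternion group acts as `-1`.
  have hTor (σ τ σ' : inertia 2) (h : π σ * π τ = .a 2 * π σ') (P : Torsion E p) :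
      galTorsion E p σ (galTorsion E p τ P) = -galTorsion E p σ' P := by
    apply θ.injective
    apply Subtype.ext
    rw [hθ, hθ, hmul _ _ _ h, map_neg, AddSubgroup.coe_neg, hθ]
  have hone (P : Torsion E p) : galTorsion E p ((1 : inertia 2) : Gal(PadicAlgCl 2/ℚ_[2])) P = P := by
    apply θ.injective
    apply Subtype.ext
    rw [hθ, map_one, map_one, autHom_one]
  set T : Torsion E p ≃+ Torsion E p := ψ.trans φ.symm with hT
  have hφT (P : Torsion E p) : φ (T P) = ψ P := φ.apply_symm_apply _
  have hTgal (σ : inertia 2) (P : Torsion E p) :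
      T (galTorsion E p σ P) = galTorsion E p σ (T P) := by
    apply φ.injective
    rw [hφT, hψ σ σ.2, hφ σ σ.2, hφT]
  obtain ⟨c, hc⟩ := exists_eq_smul_of_commute hp2 (V := Torsion E p)
    (A := galTorsion E p σ) (B := galTorsion E p τ) (T := T.toAddMonoidHom)
    (fun P => Subtype.ext (smul_coe_torsionBy P)) (TorsionCount.card_torsion (geom E) p)
    (fun P => by
      rw [hTor σ σ 1 (by rw [hσ, map_one]; decide), hone])
    (fun P => by
      rw [hTor τ τ 1 (by rw [hτ, map_one]; decide), hone])
    (fun P => by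
      have h1 : π τ * π σ = .a 2 * π (σ * τ) := by rw [map_mul, hσ, hτ]; decide
      have h2 : π σ * π τ = .a 2 * π (τ * σ) := by rw [map_mul, hσ, hτ]; decide
      have h3 : π σ * π τ = π (σ * τ) := (map_mul ..).symm
      rw [hTor τ σ _ h1, neg_neg]
      apply θ.injective
      apply Subtype.ext
      rw [hθ, hθ, hθ, ← autHom_mul, ← map_mul, h3])
    (hTgal σ) (hTgal τ)
  obtain ⟨P, hP⟩ : ∃ P : Torsion E p, P ≠ 0 := by
    have hcard := TorsionCount.card_torsion (geom E) p
    have hp1 := hp.1.one_lt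
    have : Finite (Torsion E p) := Nat.finite_of_card_ne_zero (by rw [hcard]; positivity)
    have : Nontrivial (Torsion E p) := Finite.one_lt_card_iff_nontrivial.1 (by
      rw [hcard]; nlinarith)
    exact exists_ne 0
  obtain ⟨Q, hQ, hPQ⟩ := exists_weilPairing_ne_one (W := geom E) (smul_coe_torsionBy P)
    (fun h => hP (Subtype.ext h))
  set Q' : Torsion E p := ⟨Q, AddSubgroup.torsionBy.nsmul_iff.2 hQ⟩ with hQ'
  have hPt := smul_coe_torsionBy P
  have e1 := hr P Q'
  rw [← hφT, ← hφT, hφ2] at e1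
  have hc' (R : Torsion E p) : ((T R : Torsion E p) : (geom E).Point) = c • (R : (geom E).Point) :=
    congrArg Subtype.val (hc R)
  rw [hc', hc', weilPairing_nsmul_right (by rw [smul_comm, hPt, smul_zero]) hQ,
    weilPairing_nsmul_left hPt hQ] at e1
  set z := weilPairing (geom E) p P Q with hz
  have hzp : z ^ p = 1 := weilPairing_pow hPt hQ
  have hord : orderOf z = p := orderOf_eq_prime hzp hPQ
  rw [← pow_mul, ← pow_mul] at e1
  have hz0 : z ≠ 0 := by
    intro h0
    rw [h0, zero_pow hp.1.ne_zero] at hzp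
    exact zero_ne_one hzp
  have e2 := pow_eq_pow_iff_modEq (x := Units.mk0 z hz0).1 (Units.ext e1)
  rw [← orderOf_units, Units.val_mk0, hord, ← ZMod.natCast_eq_natCast_iff] at e2
  push_cast at e2
  rw [ZMod.natCast_zmod_val] at e2
  have hrr : (r : ZMod p) = r' * r' := by rw [hr']; rfl
  have hc0 : (c : ZMod p) ≠ 0 := by
    intro h0
    rw [h0, zero_mul] at e2
    exact r.ne_zero e2.symm
  refine (legendreSym.eq_neg_one_iff p).1 h2 ⟨r' / c, ?_⟩
  push_cast
  field_simp
  linear_combination e2 + hrr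

end Comparison

/-- The homomorphism from inertia onto the quaternion group, with the elements that fix the inertial
field as its kernel. -/
theorem exists_inertia_quaternion (E : WeierstrassCurve ℚ_[2]) [E.IsElliptic] {q : ℕ}
    [hq : Fact q.Prime]
    (hI : Nonempty (Gal(inertialField E q/unramified 2) ≃* QuaternionGroup 2)) :
    ∃ π : inertia 2 →* QuaternionGroup 2, Function.Surjective π ∧
      ∀ σ, π σ = 1 ↔ ∀ x ∈ inertialField E q, (σ : Gal(PadicAlgCl 2/ℚ_[2])) x = x := by
  obtain ⟨e⟩ := hI
  have : Finite (Torsion E q) := Nat.finite_of_card_ne_zero (by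
    rw [TorsionCount.card_torsion (geom E) q]; exact pow_ne_zero 2 hq.1.ne_zero)
  have := finiteDimensional_inertialField (E := E) (q := q)
  obtain ⟨π, hπ, hπ'⟩ := exists_inertia_surjective (inertialField E q) map_inertialField_le
  refine ⟨e.toMonoidHom.comp π, e.surjective.comp hπ, fun σ => ?_⟩
  rw [← hπ']
  exact map_eq_one_iff e e.injective

/-- The torsion modules are related by isomorphisms that preserve the Weil pairing at all odd primes,
or by isomorphisms that square it at all odd primes, according to whether the two embeddings of the
quaternion group are conjugate or conjugate up to Frobenius. -/
theorem exists_equivariant_scalesPairing (E E' : WeierstrassCurve ℚ_[2]) [E.IsElliptic] [E'.IsElliptic]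
    (hE : PotentiallyGoodReduction E) (hE' : PotentiallyGoodReduction E')
    (q : ℕ) (hq : q.Prime) (hq3 : 3 ≤ q) (hL : inertialField E q = inertialField E' q)
    (hI : Nonempty (Gal(inertialField E q/unramified 2) ≃* QuaternionGroup 2)) :
    (∀ (p : ℕ) [Fact p.Prime], p ≠ 2 →
      ∃ φ : Torsion E p ≃+ Torsion E' p, IsInertiaEquivariant φ ∧ ScalesPairing φ 1) ∨
    ∀ (p : ℕ) [Fact p.Prime], p ≠ 2 →
      ∃ φ : Torsion E p ≃+ Torsion E' p, IsInertiaEquivariant φ ∧ ScalesPairing φ 2 ∧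
        (legendreSym p 2 = -1 → ∀ ψ : Torsion E p ≃+ Torsion E' p, IsInertiaEquivariant ψ →
          ¬ IsSymplectic ψ) := by
  have : Fact q.Prime := ⟨hq⟩
  have hq2 : q ≠ 2 := by omega
  obtain ⟨π, hπ, hπL⟩ := exists_inertia_quaternion E hI
  obtain ⟨j, hj, hθ⟩ := exists_embedding hE hq2 hπ
    (fun σ => (hπL σ).trans (galTorsion_eq_iff σ).symm)
  obtain ⟨j', hj', hθ'⟩ := exists_embedding hE' hq2 hπ
    (fun σ => (hπL σ).trans (by rw [hL]; exact (galTorsion_eq_iff σ).symm))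
  obtain ⟨c, hc⟩ := semiconjBy_or_frob hj hj'
  have hc_bij : Function.Bijective (autHom c) :=
    ⟨SemilinearChange.hom_injective _, SemilinearChange.hom_surjective _ Function.surjective_id⟩
  have hc_e {p : ℕ} [Fact p.Prime] {P Q : (supersingular (resField 2)).Point} (hP : p • P = 0)
      (hQ : p • Q = 0) : weilPairing (supersingular (resField 2)) p (autHom c P) (autHom c Q) =
        weilPairing (supersingular (resField 2)) p P Q :=
    SemilinearChange.weilPairing_hom _ hP hQ
  refine hc.imp (fun hc p _ hp2 => ?_) fun hc p _ hp2 => ?_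
  · obtain ⟨θ, hθ, hθe⟩ := hθ p hp2
    obtain ⟨θ', hθ', hθe'⟩ := hθ' p hp2
    refine exists_lift_of_model (ρ := fun σ => autHom (j (π σ)))
      (ρ' := fun σ => autHom (j' (π σ))) hp2 hθ hθe hθ' hθe' hc_bij (fun σ P => ?_)
      (fun P Q hP hQ => ?_)
    · rw [← autHom_mul, ← autHom_mul, hc (π σ)]
    · rw [hc_e hP hQ, pow_one]
  · obtain ⟨θ, hθ, hθe⟩ := hθ p hp2
    obtain ⟨θ', hθ', hθe'⟩ := hθ' p hp2
    have hF : Function.Bijective (frob (resField 2)).hom :=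
      ⟨SemilinearChange.hom_injective _,
        SemilinearChange.hom_surjective _ (bijective_frobenius (resField 2) 2).2⟩
    obtain ⟨φ, hφ, hφ2⟩ := exists_lift_of_model (ρ := fun σ => autHom (j (π σ)))
      (ρ' := fun σ => autHom (j' (π σ))) (f := (autHom c).comp (frob (resField 2)).hom) (n := 2)
      hp2 hθ hθe hθ' hθe' (hc_bij.comp hF) (fun σ P => by
        change autHom c ((frob _).hom _) = autHom (j' (π σ)) (autHom c ((frob _).hom P))
        rw [frob_autHom, ← autHom_mul, ← autHom_mul, hc (π σ)])
      (fun P Q hP hQ => by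
        change weilPairing _ p (autHom c _) (autHom c _) = _
        rw [hc_e (by rw [← map_nsmul, hP, map_zero]) (by rw [← map_nsmul, hQ, map_zero]),
          (frob (resField 2)).weilPairing_hom hP hQ]
        rfl)
    exact ⟨φ, hφ, hφ2, fun h2 ψ hψ => not_isSymplectic hπ hp2 hj hθ hφ hφ2 h2 hψ⟩

end EllipticLocal
end
theorem theorem4p6 (p : ℕ) [Fact p.Prime] (hp : 3 ≤ p)
    (E E' : WeierstrassCurve ℚ_[2]) [E.IsElliptic] [E'.IsElliptic]
    (hE : EllipticLocal.PotentiallyGoodReduction E)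
    (hE' : EllipticLocal.PotentiallyGoodReduction E')
    (q : ℕ) (hq : q.Prime) (hq3 : 3 ≤ q)
    (hL : EllipticLocal.inertialField E q = EllipticLocal.inertialField E' q)
    (hI : Nonempty
      (Gal(EllipticLocal.inertialField E q/LocalInertia.unramified 2) ≃* QuaternionGroup 2)) :
    EllipticLocal.InertiaIsomorphic E E' p ∧
    (legendreSym p 2 = 1 → EllipticLocal.InertiaSymplecticallyIsomorphic E E' p) ∧
    (legendreSym p 2 = -1 →
      (EllipticLocal.InertiaSymplecticallyIsomorphic E E' p ↔
        EllipticLocal.InertiaSymplecticallyIsomorphic E E' 3)) := by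
  have hp2 : p ≠ 2 := by omega
  have h3 : legendreSym 3 2 = -1 := by decide
  rcases EllipticLocal.exists_equivariant_scalesPairing E E' hE hE' q hq hq3 hL hI with h | h
  · obtain ⟨φ, hφ, hφ1⟩ := h p hp2
    obtain ⟨ψ, hψ, hψ1⟩ := h 3 (by norm_num)
    exact ⟨⟨φ, hφ⟩, fun _ => ⟨φ, hφ, hφ1.isSymplectic⟩,
      fun _ => ⟨fun _ => ⟨ψ, hψ, hψ1.isSymplectic⟩, fun _ => ⟨φ, hφ, hφ1.isSymplectic⟩⟩⟩
  · obtain ⟨φ, hφ, hφ2, hn⟩ := h p hp2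
    obtain ⟨-, -, -, hn3⟩ := h 3 (by norm_num)
    refine ⟨⟨φ, hφ⟩, fun h1 => ⟨φ, hφ, hφ2.isSymplectic_two hp2 h1⟩, fun h1 => ⟨?_, ?_⟩⟩
    · rintro ⟨ψ, hψ, hs⟩
      exact absurd hs (hn h1 ψ hψ)
    · rintro ⟨ψ, hψ, hs⟩
      exact absurd hs (hn3 h3 ψ hψ)
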